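/- Let $k$ be a field of characteristic $p>0$, let $\mathcal{O}$ be a complete discrete valuation ring of characteristic $0$ with residue field $k$ and uniformizer $\pi$ (equivalently, a finite totally ramified extension of a Cohen ring of $k$), let $v_p$ be its valuation normalized by $v_p(p)=1$, and let $\sigma_0:\mathcal{O}\to\mathcal{O}$ be a ring endomorphism lifting the $p$-power Frobenius of $k$. Fix $f\ge 1$ and put $q=p^f$. Let $K$ be a perfect field that is algebraic over $k((t))$ (that is, a perfect valued field over $k$), and let $v_K$ be the valuation on $K$ extending the $t$-adic valuation of $k((t))$, with $v_K(t)=1$. Let $\Gamma=\Gamma^K$ be the complete discrete valuation ring, unramified over $\mathcal{O}$, with residue field $K$ (compatibly with $k\subset K$) and equipped with a lift $\sigma_0$ of the $p$-power Frobenius extending $\sigma_0$ on $\mathcal{O}$; since $K$ is perfect, it is unique up to unique isomorphism. Every $x\in\Gamma$ is uniquely a sum $\sum_{i\ge 0}\pi^i[\overline{x_i}]$ with $\overline{x_i}\in K$, where $[\cdot]$ is the Teichmüller lift; for $n$ in the value group of $\mathcal{O}$ put $v_n(x)=\min_{v_p(\pi^i)\le n} v_K(\overline{x_i})$. For $r>0$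 let $\Gamma_r$ be the set of $x\in\Gamma$ with $\lim_{n\to\infty}(r\,v_n(x)+n)=\infty$, and let $\Gamma_{\mathrm{con}}=\Gamma^K_{\mathrm{con}}=\bigcup_{r>0}\Gamma_r$, a subring of $\Gamma$ stable under $\sigma_0$. Put $\sigma=\sigma_0^f$. For a ring $R$ with an endomorphism $\sigma$, a $\sigma$-module over $R$ is a finite free $R$-module $M$ with a $\sigma$-linear map $F:M\to M$ acting on a basis by a matrix invertible over $R[\frac1p]$. An isogeny is an $F$-equivariant $R$-linear map that becomes an isomorphism over $R[\frac1p]$. A $\sigma$-module is standard if it is isogenous to a $\sigma$-module with a basis $\mathbf{v}_1,\dots,\mathbf{v}_n$, $n\ge 1$, such that $F\mathbf{v}_i=\mathbf{v}_{i+1}$ for $i<n$ and $F\mathbf{v}_n=\lambda\mathbf{v}_1$ with $\lambda\in R$ fixed by $\sigma$. The generic slopes of a $\sigma$-module $M$ over $\Gamma_{\mathrm{con}}$ are the valuations $v_p(\lambda_i)$, where $\Gamma_{\mathrm{con}}$ is embedded, compatibly with Frobenius lifts, into a complete discrete valuation ring $S$ with a $q$-power Frobenius lift over which $M$ acquires a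 maximal linearly independent family $\mathbf{e}_1,\dots,\mathbf{e}_{\operatorname{rank} M}$ with $F\mathbf{e}_i=\lambda_i\mathbf{e}_i$, $\lambda_i\in S$ nonzero; they do not depend on the choices. Then any $\sigma$-module $M$ over $\Gamma_{\mathrm{con}}$ admits a unique filtration $0=M_0\subset M_1\subset\cdots\subset M_m=M$, with strict inclusions, by $\sigma$-submodules such that 1. for $i=1,\dots,m$, $M_{i-1}$ is saturated in $M_i$ and $M_i/M_{i-1}$ has all generic slopes equal to some $s_i$, and 2. $s_1>\cdots>s_m$. Moreover, if $K$ is algebraically closed, each $M_i/M_{i-1}$ is isogenous to a direct sum of standard $\sigma$-modules. -/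

import Mathlib

open IsLocalRing Filter
open scoped TensorProduct

universe u w

noncomputable section

namespace SlopeFiltration

/-- `σ` lifts the `q`-power Frobenius of the residue field of the local ring `A`. -/
def IsFrobLift (q : ℕ) {A : Type u} [CommRing A] [IsLocalRing A] (σ : A →+* A) : Prop :=
  ∀ x, σ x - x ^ q ∈ maximalIdeal A

/-- The valuation `v_p` of a nonzero element of a discrete valuation ring, normalized by
`v_p(p) = 1`. -/
def vp (p : ℕ) {A : Type u} [CommRing A] [IsDomain A] [IsDiscreteValuationRing A] (x : A) : ℚ :=
  ((IsDiscreteValuationRing.addVal A x).toNat : ℚ) /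
    ((IsDiscreteValuationRing.addVal A (p : A)).toNat : ℚ)

/-- The ring `Γ^K` of a perfect valued field `K`, with its Frobenius lift and the valuation `v_K`.

Here `O` is a complete discrete valuation ring of characteristic `0` with residue field `k` of
characteristic `p`, `σ₀` is a Frobenius lift on `O`, and `K` is a perfect algebraic extension of
`k((t))`. `Γ^K` is the complete discrete valuation ring, unramified over `O` and with residue field
`K` (as an extension of `k`), which carries a `p`-power Frobenius lift extending `σ₀`. As `K` is
perfect, these properties characterize `Γ^K` with its Frobenius lift up to unique isomorphism: it
is `W(K) ⊗ O'` over `W(k^{1/p^∞})`, for `O'` the completed direct limit of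
`O → O → ⋯` along `σ₀` (so it is `W(K) ⊗ O` over `W(k)` if `k` is perfect). `val` is the
valuation `v_K`, the unique extension to `K` of the `t`-adic valuation of `k((t))`. -/
structure GammaRing (p : ℕ) {O : Type u} [CommRing O] [IsDomain O] [IsDiscreteValuationRing O]
    (σ₀ : O →+* O) (K : Type u) [Field K] [Algebra (LaurentSeries (ResidueField O)) K]
    (Γ : Type u) [CommRing Γ] [IsDomain Γ] [IsDiscreteValuationRing Γ] [Algebra O Γ] where
  /-- reduction to the residue field `K` -/
  residue : Γ →+* K
  residue_surjective : Function.Surjective residue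
  residue_algebraMap : ∀ a : O, residue (algebraMap O Γ a) =
    algebraMap (LaurentSeries (ResidueField O)) K (HahnSeries.C (IsLocalRing.residue O a))
  /-- a uniformizer of `O` is a uniformizer of `Γ` -/
  unramified : (maximalIdeal O).map (algebraMap O Γ) = maximalIdeal Γ
  complete : IsAdicComplete (maximalIdeal Γ) Γ
  /-- the Frobenius lift extending `σ₀` -/
  frob : Γ →+* Γ
  frob_algebraMap : ∀ a : O, frob (algebraMap O Γ a) = algebraMap O Γ (σ₀ a)
  residue_frob : ∀ x, residue (frob x) = residue x ^ p
  /-- the valuation `v_K`, with `v_K(t) = 1` -/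
  val : AddValuation K (WithTop ℝ)
  val_algebraMap : ∀ g : LaurentSeries (ResidueField O), g ≠ 0 →
    val (algebraMap (LaurentSeries (ResidueField O)) K g) = ((g.order : ℝ) : WithTop ℝ)

/-- `t` is a Teichmüller lift (of its residue): it has a `p^n`-th root for every `n`. When `Γ` is
complete with perfect residue field `K`, every element `x` of `K` has exactly one lift `[x]` of
this kind. -/
def IsTeichmuller (p : ℕ) {Γ : Type u} [CommRing Γ] (t : Γ) : Prop :=
  ∀ n : ℕ, ∃ y : Γ, y ^ p ^ n = t

/-- `x = ∑ ϖ ^ i * c i`, where each `c i` is a Teichmüller lift. -/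
def IsExpansion (p : ℕ) {Γ : Type u} [CommRing Γ] [IsLocalRing Γ] (ϖ x : Γ) (c : ℕ → Γ) : Prop :=
  (∀ i, IsTeichmuller p (c i)) ∧
    ∀ n : ℕ, x - ∑ i ∈ Finset.range n, ϖ ^ i * c i ∈ maximalIdeal Γ ^ n

namespace GammaRing

variable {p : ℕ} {O : Type u} [CommRing O] [IsDomain O] [IsDiscreteValuationRing O]
  {σ₀ : O →+* O} {K : Type u} [Field K] [Algebra (LaurentSeries (ResidueField O)) K]
  {Γ : Type u} [CommRing Γ] [IsDomain Γ] [IsDiscreteValuationRing Γ] [Algebra O Γ]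

/-- The partial valuation `v_n(x)` of `x = ∑ ϖ ^ i * c i` for `n = v_p(ϖ ^ j)`: the minimum of
`v_K` on the residues of `c 0, …, c j`. -/
def partialVal (G : GammaRing p σ₀ K Γ) (c : ℕ → Γ) (j : ℕ) : WithTop ℝ :=
  (Finset.range (j + 1)).inf fun i => G.val (G.residue (c i))

/-- `x` belongs to `Γ_r`: `r * v_n(x) + n → ∞` as `n → ∞` in the value group of `O`. (For `r > 0`,
`r * v_n(x) + n ≥ C` is written as `(C - n) / r ≤ v_n(x)`, because `v_n(x)` may be `∞`.) -/
def IsConvergent (G : GammaRing p σ₀ K Γ) (π : O) (r : ℝ) (x : Γ) : Prop :=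
  ∃ c : ℕ → Γ, IsExpansion p (algebraMap O Γ π) x c ∧
    ∀ C : ℝ, ∀ᶠ j : ℕ in atTop,
      (((C - (vp p (π ^ j) : ℝ)) / r : ℝ) : WithTop ℝ) ≤ G.partialVal c j

set_option linter.unusedSectionVars false

/-! The overconvergent elements form a subring stable under Frobenius. -/

section Aux

theorem mem_max_iff (G : GammaRing p σ₀ K Γ) (x : Γ) : x ∈ maximalIdeal Γ ↔ G.residue x = 0 := by
  have h : RingHom.ker G.residue = maximalIdeal Γ := by
    have := RingHom.ker_isMaximal_of_surjective G.residue G.residue_surjective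
    exact eq_maximalIdeal this
  rw [← h, RingHom.mem_ker]

theorem max_eq (G : GammaRing p σ₀ K Γ) {π : O} (hπ : Irreducible π) :
    maximalIdeal Γ = Ideal.span {algebraMap O Γ π} := by
  rw [← G.unramified, hπ.maximalIdeal_eq, Ideal.map_span, Set.image_singleton]

theorem mem_pow_iff (G : GammaRing p σ₀ K Γ) {π : O} (hπ : Irreducible π) (n : ℕ) (x : Γ) :
    x ∈ maximalIdeal Γ ^ n ↔ (algebraMap O Γ π) ^ n ∣ x := by
  rw [G.max_eq hπ, Ideal.span_singleton_pow, Ideal.mem_span_singleton]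

theorem unif_ne_zero (G : GammaRing p σ₀ K Γ) {π : O} (hπ : Irreducible π) : algebraMap O Γ π ≠ 0 := by
  intro h
  have := G.max_eq hπ
  rw [h] at this
  exact IsDiscreteValuationRing.not_a_field Γ (by simpa using this)

theorem algebraMap_injective (G : GammaRing p σ₀ K Γ) : Function.Injective (algebraMap O Γ) := by
  obtain ⟨π, hπ⟩ := IsDiscreteValuationRing.exists_irreducible O
  rw [injective_iff_map_eq_zero]
  intro a ha
  by_contra h0
  obtain ⟨n, u, rfl⟩ := IsDiscreteValuationRing.eq_unit_mul_pow_irreducible h0 hπ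
  rw [map_mul, map_pow] at ha
  rcases mul_eq_zero.1 ha with h | h
  · exact (u.isUnit.map (algebraMap O Γ)).ne_zero h
  · exact pow_ne_zero n (G.unif_ne_zero hπ) h

theorem dvd_of_mem {π : O} (hπ : Irreducible π) (a : O)
    (h : algebraMap O Γ a ∈ maximalIdeal Γ) : π ∣ a := by
  rw [← Ideal.mem_span_singleton, ← hπ.maximalIdeal_eq]
  by_contra h'
  have hu : IsUnit a := by simpa using h'
  exact (IsLocalRing.mem_maximalIdeal _ |>.1 h) (hu.map _)

variable [hp : Fact p.Prime] [CharP (ResidueField O) p]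

theorem cast_p_eq_zero (G : GammaRing p σ₀ K Γ) : (p : K) = 0 := by
  have h := G.residue_algebraMap (p : O)
  simpa using h

theorem charP_K (G : GammaRing p σ₀ K Γ) : CharP K p := (CharP.charP_iff_prime_eq_zero hp.out).2 G.cast_p_eq_zero

theorem p_mem (G : GammaRing p σ₀ K Γ) : (p : Γ) ∈ maximalIdeal Γ := by
  rw [G.mem_max_iff, map_natCast, G.cast_p_eq_zero]

theorem pow_sub_mem (G : GammaRing p σ₀ K Γ) {x y : Γ} (h : G.residue x = G.residue y) (n : ℕ) :
    x ^ p ^ n - y ^ p ^ n ∈ maximalIdeal Γ ^ (n + 1) := by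
  have h1 : x ≡ y [SMOD maximalIdeal Γ] := by
    rw [SModEq.sub_mem, G.mem_max_iff, map_sub, h, sub_self]
  exact SModEq.sub_mem.1 (h1.pow_pow_add_one G.p_mem n)

theorem haus (G : GammaRing p σ₀ K Γ) (x : Γ) (h : ∀ n, x ∈ maximalIdeal Γ ^ n) : x = 0 := by
  have := G.complete
  refine IsHausdorff.haus (I := maximalIdeal Γ) inferInstance x fun n => ?_
  rw [SModEq.sub_mem, sub_zero]
  simpa using h n

theorem teich_unique (G : GammaRing p σ₀ K Γ) {t t' : Γ} (ht : IsTeichmuller p t) (ht' : IsTeichmuller p t')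
    (h : G.residue t = G.residue t') : t = t' := by
  have := G.charP_K
  have : ExpChar K p := ExpChar.prime hp.out
  rw [← sub_eq_zero]
  refine G.haus _ fun n => ?_
  obtain ⟨y, rfl⟩ := ht n
  obtain ⟨y', rfl⟩ := ht' n
  refine Ideal.pow_le_pow_right (Nat.le_succ n) (G.pow_sub_mem ?_ n)
  rw [map_pow, map_pow] at h
  exact iterateFrobenius_inj K p n (by simpa [iterateFrobenius_def] using h)

theorem teich_mul {t t' : Γ} (ht : IsTeichmuller p t) (ht' : IsTeichmuller p t') :
    IsTeichmuller p (t * t') := fun n => by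
  obtain ⟨y, rfl⟩ := ht n
  obtain ⟨y', rfl⟩ := ht' n
  exact ⟨y * y', mul_pow _ _ _⟩

theorem teich_frob (G : GammaRing p σ₀ K Γ) {t : Γ} (ht : IsTeichmuller p t) : G.frob t = t ^ p := by
  refine G.teich_unique (fun n => ?_) (fun n => ?_) ?_
  · obtain ⟨y, rfl⟩ := ht n
    exact ⟨G.frob y, (map_pow _ _ _).symm⟩
  · obtain ⟨y, rfl⟩ := ht n
    exact ⟨y ^ p, by rw [← pow_mul, ← pow_mul, mul_comm]⟩
  · rw [G.residue_frob, map_pow]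

variable [PerfectField K]

theorem exists_teich (G : GammaRing p σ₀ K Γ) (x : K) : ∃ t : Γ, IsTeichmuller p t ∧ G.residue t = x := by
  have := G.charP_K
  have : ExpChar K p := ExpChar.prime hp.out
  have := G.complete
  -- a compatible system of `p`-power roots of `x`, lifted
  let root : ℕ → K := fun n => ((frobeniusEquiv K p).symm)^[n] x
  have hroot : ∀ n, root (n + 1) ^ p = root n := fun n => by
    simp only [root, Function.iterate_succ_apply', frobeniusEquiv_symm_pow_p]
  choose l hl using fun n => G.residue_surjective (root n)
  have hstep : ∀ k n, l (k + n + 1) ^ p ^ (n + 1) - l (k + n) ^ p ^ n ∈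
      maximalIdeal Γ ^ (n + 1) := fun k n => by
    rw [pow_succ' p n, pow_mul]
    exact G.pow_sub_mem (by rw [map_pow, hl, hl, hroot]) n
  have hlim : ∀ k, ∃ L : Γ, ∀ n, l (k + n) ^ p ^ n - L ∈ maximalIdeal Γ ^ (n + 1) := fun k => by
    have hc : ∀ {m n}, m ≤ n → l (k + m) ^ p ^ m ≡ l (k + n) ^ p ^ n
        [SMOD (maximalIdeal Γ ^ m • ⊤ : Submodule Γ Γ)] := fun {m n} hmn => by
      rw [smul_eq_mul, Ideal.mul_top]
      induction n, hmn using Nat.le_induction with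
      | base => rfl
      | succ n hn ih =>
        refine ih.trans (SModEq.symm ?_)
        rw [SModEq.sub_mem]
        exact Ideal.pow_le_pow_right (by lia) (hstep k n)
    obtain ⟨L, hL⟩ := IsPrecomplete.prec' (I := maximalIdeal Γ) _ hc
    refine ⟨L, fun n => ?_⟩
    have h1 := hL (n + 1)
    rw [smul_eq_mul, Ideal.mul_top, SModEq.sub_mem] at h1
    have := Ideal.sub_mem _ h1 (hstep k n)
    rwa [show l (k + (n + 1)) ^ p ^ (n + 1) - L - (l (k + n + 1) ^ p ^ (n + 1) - l (k + n) ^ p ^ n)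
      = l (k + n) ^ p ^ n - L by ring_nf] at this
  choose L hL using hlim
  have hres : ∀ k, G.residue (L k) = root k := fun k => by
    have h := hL k 0
    rw [zero_add, pow_one, G.mem_max_iff, map_sub, sub_eq_zero] at h
    rw [← h]; simpa using hl k
  have hpow : ∀ k n, L (k + n) ^ p ^ n = L k := fun k n => by
    rw [← sub_eq_zero]
    refine G.haus _ fun j => ?_
    have h1 : L (k + n) ^ p ^ n - (l (k + n + j) ^ p ^ j) ^ p ^ n ∈ maximalIdeal Γ ^ j := by
      have h2 := hL (k + n) j
      have h3 := Ideal.mul_mem_right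
        (∑ i ∈ Finset.range (p ^ n), (l (k + n + j) ^ p ^ j) ^ i * (L (k + n)) ^ (p ^ n - 1 - i))
        _ h2
      rw [mul_comm, Commute.geom_sum₂_mul (Commute.all _ _)] at h3
      have h4 := neg_mem (Ideal.pow_le_pow_right (Nat.le_succ j) h3)
      rwa [neg_sub] at h4
    have h5 := hL k (n + j)
    rw [← pow_mul, ← pow_add, add_comm j n] at h1
    rw [← add_assoc] at h5
    have := Ideal.add_mem _ h1 (Ideal.pow_le_pow_right (by lia : j ≤ n + j + 1) h5)
    rwa [sub_add_sub_cancel] at this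
  refine ⟨L 0, fun n => ⟨L n, by simpa using hpow 0 n⟩, ?_⟩
  simpa [root] using hres 0

theorem exists_expansion (G : GammaRing p σ₀ K Γ) {π : O} (hπ : Irreducible π) (x : Γ) :
    ∃ c : ℕ → Γ, IsExpansion p (algebraMap O Γ π) x c := by
  have key : ∀ y : Γ, ∃ ty : Γ × Γ, IsTeichmuller p ty.1 ∧
      y = ty.1 + algebraMap O Γ π * ty.2 := fun y => by
    obtain ⟨t, ht, hr⟩ := G.exists_teich (G.residue y)
    have : y - t ∈ maximalIdeal Γ ^ 1 := by
      rw [pow_one, G.mem_max_iff, map_sub, hr, sub_self]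
    rw [G.mem_pow_iff hπ, pow_one] at this
    obtain ⟨z, hz⟩ := this
    exact ⟨(t, z), ht, by rw [← hz]; ring⟩
  choose s hs1 hs2 using key
  let rem : ℕ → Γ := fun n => Nat.rec x (fun _ y => (s y).2) n
  refine ⟨fun n => (s (rem n)).1, fun i => hs1 _, fun n => ?_⟩
  have : x - ∑ i ∈ Finset.range n, (algebraMap O Γ π) ^ i * (s (rem i)).1 =
      (algebraMap O Γ π) ^ n * rem n := by
    induction n with
    | zero => simp [rem]
    | succ n ih =>
      rw [Finset.sum_range_succ, ← sub_sub, ih]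
      have h := hs2 (rem n)
      have h' : rem (n + 1) = (s (rem n)).2 := rfl
      rw [h']
      nth_rewrite 1 [h]
      ring
  rw [G.mem_pow_iff hπ, this]
  exact dvd_mul_right _ _


/-- The elements of the closure of `⋃ frob⁻ⁿ(O)` in `Γ`. -/
def IsConst (G : GammaRing p σ₀ K Γ) (b : Γ) : Prop :=
  ∀ n : ℕ, ∃ (j : ℕ) (o : O), (G.frob ^ j) b - algebraMap O Γ o ∈ maximalIdeal Γ ^ n

theorem frob_pow_mem (G : GammaRing p σ₀ K Γ) {n : ℕ} {x : Γ} (h : x ∈ maximalIdeal Γ ^ n)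
    (l : ℕ) : (G.frob ^ l) x ∈ maximalIdeal Γ ^ n := by
  have h1 : maximalIdeal Γ ≤ (maximalIdeal Γ).comap G.frob := fun y hy => by
    rw [G.mem_max_iff] at hy
    rw [Ideal.mem_comap, G.mem_max_iff, G.residue_frob, hy, zero_pow hp.out.ne_zero]
  have h2 : ∀ y ∈ maximalIdeal Γ ^ n, G.frob y ∈ maximalIdeal Γ ^ n := fun y hy =>
    (Ideal.le_comap_pow G.frob n) (Ideal.pow_right_mono h1 n hy)
  induction l with
  | zero => simpa using h
  | succ l ih => rw [pow_succ', RingHom.mul_def, RingHom.comp_apply]; exact h2 _ ih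

theorem frob_pow_algebraMap (G : GammaRing p σ₀ K Γ) (l : ℕ) (a : O) :
    (G.frob ^ l) (algebraMap O Γ a) = algebraMap O Γ ((σ₀ ^ l) a) := by
  induction l with
  | zero => simp
  | succ l ih => rw [pow_succ', RingHom.mul_def, RingHom.comp_apply, ih, G.frob_algebraMap,
      pow_succ', RingHom.mul_def, RingHom.comp_apply]

theorem const_shift (G : GammaRing p σ₀ K Γ) {b : Γ} {n j : ℕ} {o : O}
    (h : (G.frob ^ j) b - algebraMap O Γ o ∈ maximalIdeal Γ ^ n) (l : ℕ) :
    (G.frob ^ (l + j)) b - algebraMap O Γ ((σ₀ ^ l) o) ∈ maximalIdeal Γ ^ n := by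
  have := G.frob_pow_mem h l
  rwa [map_sub, G.frob_pow_algebraMap, ← RingHom.comp_apply, ← RingHom.mul_def, ← pow_add] at this

theorem const_algebraMap (G : GammaRing p σ₀ K Γ) (a : O) : G.IsConst (algebraMap O Γ a) :=
  fun n => ⟨0, a, by simp⟩

theorem const_mul (G : GammaRing p σ₀ K Γ) {b b' : Γ} (h : G.IsConst b) (h' : G.IsConst b') :
    G.IsConst (b * b') := fun n => by
  obtain ⟨j, o, hj⟩ := h n
  obtain ⟨j', o', hj'⟩ := h' n
  have h1 := G.const_shift hj j'
  have h2 := G.const_shift hj' j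
  refine ⟨j' + j, (σ₀ ^ j') o * (σ₀ ^ j) o', ?_⟩
  rw [add_comm j j'] at h2
  rw [map_mul, map_mul]
  have := Ideal.add_mem _ (Ideal.mul_mem_right ((G.frob ^ (j' + j)) b') _ h1)
    (Ideal.mul_mem_left _ (algebraMap O Γ ((σ₀ ^ j') o)) h2)
  convert this using 1
  ring

theorem const_frob (G : GammaRing p σ₀ K Γ) {b : Γ} (h : G.IsConst b) : G.IsConst (G.frob b) :=
  fun n => by
  obtain ⟨j, o, hj⟩ := h n
  refine ⟨j, σ₀ o, ?_⟩
  have := G.const_shift hj 1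
  rwa [pow_one, add_comm, pow_succ, RingHom.mul_def, RingHom.comp_apply] at this

theorem teich_frob_pow (G : GammaRing p σ₀ K Γ) {t : Γ} (ht : IsTeichmuller p t) (l : ℕ) :
    (G.frob ^ l) t = t ^ p ^ l := by
  induction l with
  | zero => simp
  | succ l ih =>
    rw [pow_succ', RingHom.mul_def, RingHom.comp_apply, ih, map_pow, G.teich_frob ht, ← pow_mul,
      pow_succ']

theorem residue_frob_pow (G : GammaRing p σ₀ K Γ) (x : Γ) (l : ℕ) :
    G.residue ((G.frob ^ l) x) = G.residue x ^ p ^ l := by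
  induction l with
  | zero => simp
  | succ l ih =>
    rw [pow_succ', RingHom.mul_def, RingHom.comp_apply, G.residue_frob, ih, ← pow_mul, pow_succ]

theorem frob_unif (G : GammaRing p σ₀ K Γ) {π : O} (hπ : Irreducible π) (l : ℕ) :
    ∃ u : O, (σ₀ ^ l) π = π * u := by
  refine dvd_of_mem (Γ := Γ) hπ _ ?_
  rw [← G.frob_pow_algebraMap, G.mem_max_iff, G.residue_frob_pow]
  have : algebraMap O Γ π ∈ maximalIdeal Γ := by
    rw [G.max_eq hπ]; exact Ideal.mem_span_singleton_self _
  rw [(G.mem_max_iff _).1 this, zero_pow (pow_ne_zero _ hp.out.ne_zero)]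

theorem frob_unif_unit (G : GammaRing p σ₀ K Γ) [CharZero O] {π : O} (hπ : Irreducible π)
    (l : ℕ) : ∃ u : Oˣ, (σ₀ ^ l) π = π * u := by
  obtain ⟨u, hu⟩ := G.frob_unif hπ l
  obtain ⟨e, w, hw⟩ := IsDiscreteValuationRing.eq_unit_mul_pow_irreducible
    (Nat.cast_ne_zero.2 hp.out.ne_zero : (p : O) ≠ 0) hπ
  have h1 : (p : O) = (σ₀ ^ l) w * (π * u) ^ e := by
    rw [← hu, ← map_pow, ← map_mul, ← hw, map_natCast]
  have he : e ≠ 0 := by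
    rintro rfl
    have h2 : IsLocalRing.residue O (p : O) = 0 := by simp
    rw [hw, pow_zero, mul_one] at h2
    exact (w.isUnit.map (IsLocalRing.residue O)).ne_zero h2
  have h2 : (w : O) = (σ₀ ^ l) w * u ^ e := by
    have h3 : (w : O) * π ^ e = ((σ₀ ^ l) w * u ^ e) * π ^ e := by
      rw [← hw]; nth_rewrite 1 [h1]; ring
    exact mul_right_cancel₀ (pow_ne_zero _ hπ.ne_zero) h3
  have h4 : IsUnit (u ^ e) := isUnit_of_mul_isUnit_right (h2 ▸ w.isUnit)
  have h5 : IsUnit u := (isUnit_pow_iff he).1 h4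
  exact ⟨h5.unit, hu⟩

theorem const_step (G : GammaRing p σ₀ K Γ) [CharZero O] {π : O} (hπ : Irreducible π)
    {b t b' : Γ} (hb : G.IsConst b) (ht : IsTeichmuller p t)
    (h : b = t + algebraMap O Γ π * b') : G.IsConst b' := fun n => by
  obtain ⟨j, o, hj⟩ := hb (n + 1)
  have hϖ : G.residue (algebraMap O Γ π) = 0 := by
    rw [← G.mem_max_iff, G.max_eq hπ]; exact Ideal.mem_span_singleton_self _
  have h1 := G.const_shift hj n
  have hro : G.residue (algebraMap O Γ o) = G.residue (t ^ p ^ j) := by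
    have h2 := Ideal.pow_le_self (Nat.succ_ne_zero n) hj
    rw [G.mem_max_iff, map_sub, sub_eq_zero, G.residue_frob_pow] at h2
    rw [← h2, h, map_add, map_mul, hϖ, zero_mul, add_zero, map_pow]
  have h3 := G.pow_sub_mem hro n
  have hd : π ∣ (σ₀ ^ n) o - o ^ p ^ n := by
    refine dvd_of_mem (Γ := Γ) hπ _ ?_
    rw [G.mem_max_iff, map_sub, map_sub, ← G.frob_pow_algebraMap, G.residue_frob_pow, map_pow,
      map_pow, sub_self]
  obtain ⟨o', ho'⟩ := hd
  obtain ⟨u, hu⟩ := G.frob_unif_unit hπ (n + j)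
  refine ⟨n + j, ↑(u⁻¹) * o', ?_⟩
  have h4 : (G.frob ^ (n + j)) b = t ^ p ^ (n + j) +
      algebraMap O Γ π * algebraMap O Γ u * (G.frob ^ (n + j)) b' := by
    rw [h, map_add, map_mul, G.frob_pow_algebraMap, hu, G.teich_frob_pow ht, map_mul]
  have h5 : algebraMap O Γ ((σ₀ ^ n) o) = algebraMap O Γ o ^ p ^ n +
      algebraMap O Γ π * algebraMap O Γ o' := by
    rw [← map_mul, ← ho', map_sub, map_pow]; ring
  have h6 : algebraMap O Γ π ^ (n + 1) ∣ algebraMap O Γ π *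
      (algebraMap O Γ u * ((G.frob ^ (n + j)) b' - algebraMap O Γ (↑(u⁻¹) * o'))) := by
    rw [← G.mem_pow_iff hπ]
    have := Ideal.add_mem _ h1 h3
    rw [h4, h5, ← pow_mul, ← pow_add, add_comm j n] at this
    convert this using 1
    have hu' : algebraMap O Γ u * algebraMap O Γ (↑(u⁻¹)) = 1 := by
      rw [← map_mul, Units.mul_inv, map_one]
    rw [map_mul]
    linear_combination (-(algebraMap O Γ π) * algebraMap O Γ o') * hu'
  rw [pow_succ', mul_dvd_mul_iff_left (G.unif_ne_zero hπ)] at h6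
  rw [G.mem_pow_iff hπ]
  exact (IsUnit.dvd_mul_left (u.isUnit.map (algebraMap O Γ))).1 h6

theorem le_of_nsmul_le {n : ℕ} (hn : 0 < n) {x : ℝ} {a : WithTop ℝ}
    (h : (x : WithTop ℝ) ≤ n • a) : ((x / n : ℝ) : WithTop ℝ) ≤ a := by
  induction a with
  | top => exact le_top
  | coe a =>
    rw [← WithTop.coe_nsmul, WithTop.coe_le_coe, nsmul_eq_mul] at h
    rw [WithTop.coe_le_coe, div_le_iff₀ (by exact_mod_cast hn)]
    linarith

theorem val_const (G : GammaRing p σ₀ K Γ) {b : Γ} (hb : G.IsConst b) :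
    ((0 : ℝ) : WithTop ℝ) ≤ G.val (G.residue b) := by
  obtain ⟨j, o, hj⟩ := hb 1
  rw [pow_one, G.mem_max_iff, map_sub, sub_eq_zero, G.residue_frob_pow, G.residue_algebraMap] at hj
  have h1 : ((0 : ℝ) : WithTop ℝ) ≤ (p ^ j) • G.val (G.residue b) := by
    rw [← G.val.map_pow, hj]
    by_cases h0 : IsLocalRing.residue O o = 0
    · simp [h0]
    · rw [G.val_algebraMap _ (by simpa using h0), HahnSeries.order_C]
      simp
  have := le_of_nsmul_le (pow_pos hp.out.pos j) h1
  simpa using this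

/-- Finite sums of terms `ϖ ^ i * b * t` with `b` constant, `t` a Teichmüller lift, and
the valuation of the residue of `t` at least `-(s + N * i)`. -/
def bdd (G : GammaRing p σ₀ K Γ) (π : O) (s N : ℝ) : AddSubgroup Γ :=
  AddSubgroup.closure {y | ∃ (i : ℕ) (b t : Γ), G.IsConst b ∧ IsTeichmuller p t ∧
    ((-(s + N * i) : ℝ) : WithTop ℝ) ≤ G.val (G.residue t) ∧ y = algebraMap O Γ π ^ i * b * t}

theorem bdd_mono (G : GammaRing p σ₀ K Γ) (π : O) {s N s' N' : ℝ} (hs : s ≤ s') (hN : N ≤ N') :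
    G.bdd π s N ≤ G.bdd π s' N' := by
  refine AddSubgroup.closure_mono ?_
  rintro y ⟨i, b, t, hb, ht, hv, rfl⟩
  refine ⟨i, b, t, hb, ht, le_trans ?_ hv, rfl⟩
  rw [WithTop.coe_le_coe]
  have : N * i ≤ N' * i := by gcongr
  linarith

theorem bdd_mul (G : GammaRing p σ₀ K Γ) (π : O) {s N s' N' : ℝ} {x x' : Γ}
    (hx : x ∈ G.bdd π s N) (hx' : x' ∈ G.bdd π s' N') (hN : 0 ≤ N) (hN' : 0 ≤ N') :
    x * x' ∈ G.bdd π (s + s') (N + N') := by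
  refine AddSubgroup.closure_induction (fun y hy => ?_) (by simp)
    (fun y y' _ _ h h' => by rw [add_mul]; exact add_mem h h')
    (fun y _ h => by rw [neg_mul]; exact neg_mem h) hx
  obtain ⟨i, b, t, hb, ht, hv, rfl⟩ := hy
  refine AddSubgroup.closure_induction (fun y hy => ?_) (by simp)
    (fun y y' _ _ h h' => by rw [mul_add]; exact add_mem h h')
    (fun y _ h => by rw [mul_neg]; exact neg_mem h) hx'
  obtain ⟨i', b', t', hb', ht', hv', rfl⟩ := hy
  refine AddSubgroup.subset_closure ⟨i + i', b * b', t * t', G.const_mul hb hb',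
    teich_mul ht ht', ?_, by ring⟩
  rw [map_mul, G.val.map_mul]
  refine le_trans ?_ (add_le_add hv hv')
  rw [← WithTop.coe_add, WithTop.coe_le_coe]
  push_cast
  have : 0 ≤ N * i' := by positivity
  have : 0 ≤ N' * i := by positivity
  nlinarith

theorem bdd_frob (G : GammaRing p σ₀ K Γ) {π : O} (hπ : Irreducible π) {s N : ℝ} {x : Γ}
    (hx : x ∈ G.bdd π s N) : G.frob x ∈ G.bdd π (p * s) (p * N) := by
  refine AddSubgroup.closure_induction (fun y hy => ?_) (by simp)
    (fun y y' _ _ h h' => by rw [map_add]; exact add_mem h h')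
    (fun y _ h => by rw [map_neg]; exact neg_mem h) hx
  obtain ⟨i, b, t, hb, ht, hv, rfl⟩ := hy
  obtain ⟨u, hu⟩ := G.frob_unif hπ 1
  rw [pow_one] at hu
  refine AddSubgroup.subset_closure ⟨i, algebraMap O Γ (u ^ i) * G.frob b, t ^ p,
    G.const_mul (G.const_algebraMap _) (G.const_frob hb), ?_, ?_, ?_⟩
  · intro n
    obtain ⟨y, rfl⟩ := ht n
    exact ⟨y ^ p, by rw [← pow_mul, ← pow_mul, mul_comm]⟩
  · rw [map_pow, G.val.map_pow]
    refine le_trans ?_ (nsmul_le_nsmul_right hv p)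
    rw [← WithTop.coe_nsmul, WithTop.coe_le_coe, nsmul_eq_mul]
    apply le_of_eq; ring
  · rw [map_mul, map_mul, map_pow, G.frob_algebraMap, hu, G.teich_frob ht]
    simp only [map_mul, map_pow]
    ring

theorem exists_teich_root (G : GammaRing p σ₀ K Γ) {t : Γ} (ht : IsTeichmuller p t) (n : ℕ) :
    ∃ y : Γ, IsTeichmuller p y ∧ y ^ p ^ n = t := by
  obtain ⟨z, hz⟩ := ht n
  obtain ⟨y, hy, hr⟩ := G.exists_teich (G.residue z)
  refine ⟨y, hy, G.teich_unique (fun m => ?_) ht ?_⟩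
  · obtain ⟨w, rfl⟩ := hy m
    exact ⟨w ^ p ^ n, by rw [← pow_mul, ← pow_mul, mul_comm]⟩
  · rw [map_pow, hr, ← map_pow, hz]

theorem teich_pow {t : Γ} (ht : IsTeichmuller p t) (i : ℕ) : IsTeichmuller p (t ^ i) := fun n => by
  obtain ⟨y, rfl⟩ := ht n
  exact ⟨y ^ i, by rw [← pow_mul, ← pow_mul, mul_comm]⟩

theorem teich_zero : IsTeichmuller p (0 : Γ) := fun _ =>
  ⟨0, zero_pow (pow_ne_zero _ hp.out.ne_zero)⟩

theorem teich_add (G : GammaRing p σ₀ K Γ) {π : O} (hπ : Irreducible π) (n : ℕ) {s N : ℝ}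
    {t₁ t₂ : Γ} (h₁ : IsTeichmuller p t₁) (h₂ : IsTeichmuller p t₂)
    (hv₁ : ((-s : ℝ) : WithTop ℝ) ≤ G.val (G.residue t₁))
    (hv₂ : ((-s : ℝ) : WithTop ℝ) ≤ G.val (G.residue t₂)) :
    ∃ t y' : Γ, IsTeichmuller p t ∧ ((-s : ℝ) : WithTop ℝ) ≤ G.val (G.residue t) ∧
      y' ∈ G.bdd π s N ∧ t₁ + t₂ - t - algebraMap O Γ π * y' ∈ maximalIdeal Γ ^ n := by
  have := G.charP_K
  have : ExpChar K p := ExpChar.prime hp.out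
  obtain ⟨t, ht, hr⟩ := G.exists_teich (G.residue (t₁ + t₂))
  obtain ⟨y₁, hy₁, e₁⟩ := G.exists_teich_root h₁ n
  obtain ⟨y₂, hy₂, e₂⟩ := G.exists_teich_root h₂ n
  obtain ⟨y, hy, e⟩ := G.exists_teich_root ht n
  have hres : G.residue (y₁ + y₂) = G.residue y := by
    refine iterateFrobenius_inj K p n ?_
    simp only [iterateFrobenius_def]
    rw [← map_pow G.residue y, e, hr, map_add, map_add, add_pow_expChar_pow, ← map_pow,
      ← map_pow, e₁, e₂]
  have hpos : 0 < p ^ n := pow_pos hp.out.pos n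
  have hb := Ideal.pow_le_pow_right (Nat.le_succ n) (G.pow_sub_mem hres n)
  have hpdvd : π ∣ (p : O) := by
    refine dvd_of_mem (Γ := Γ) hπ _ ?_
    rw [map_natCast]; exact G.p_mem
  obtain ⟨p', hp'⟩ := hpdvd
  have hterm : ∀ i ∈ Finset.range (p ^ n - 1), ∃ z ∈ G.bdd π s N,
      y₁ ^ (i + 1) * y₂ ^ (p ^ n - (i + 1)) * ((p ^ n).choose (i + 1) : Γ) =
        algebraMap O Γ π * z := by
    intro i hi
    rw [Finset.mem_range] at hi
    obtain ⟨m, hm⟩ := hp.out.dvd_choose_pow (n := n) (k := i + 1) (by lia) (by lia)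
    refine ⟨algebraMap O Γ π ^ 0 * algebraMap O Γ (p' * m) *
      (y₁ ^ (i + 1) * y₂ ^ (p ^ n - (i + 1))), AddSubgroup.subset_closure
      ⟨0, _, _, G.const_algebraMap _, teich_mul (teich_pow hy₁ _) (teich_pow hy₂ _), ?_, rfl⟩, ?_⟩
    · rw [← e₁, map_pow, G.val.map_pow] at hv₁
      rw [← e₂, map_pow, G.val.map_pow] at hv₂
      have w₁ := le_of_nsmul_le hpos hv₁
      have w₂ := le_of_nsmul_le hpos hv₂
      rw [map_mul, map_pow, map_pow, G.val.map_mul, G.val.map_pow, G.val.map_pow]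
      refine le_trans ?_ (add_le_add (nsmul_le_nsmul_right w₁ (i + 1))
        (nsmul_le_nsmul_right w₂ (p ^ n - (i + 1))))
      rw [← WithTop.coe_nsmul, ← WithTop.coe_nsmul, ← WithTop.coe_add, WithTop.coe_le_coe,
        ← add_nsmul, show i + 1 + (p ^ n - (i + 1)) = p ^ n by lia, nsmul_eq_mul,
        mul_div_cancel₀ _ (by exact_mod_cast hpos.ne')]
      simp
    · rw [hm]
      have : (p : Γ) = algebraMap O Γ π * algebraMap O Γ p' := by
        rw [← map_mul, ← hp', map_natCast]
      rw [Nat.cast_mul, this]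
      simp only [map_mul, map_natCast]
      ring
  choose! z hz1 hz2 using hterm
  refine ⟨t, -∑ i ∈ Finset.range (p ^ n - 1), z i, ht, ?_, neg_mem (sum_mem hz1), ?_⟩
  · rw [hr, map_add]
    exact le_trans (le_min hv₁ hv₂) (G.val.map_add _ _)
  · have hsum : (y₁ + y₂) ^ p ^ n = t₁ + t₂ +
        algebraMap O Γ π * ∑ i ∈ Finset.range (p ^ n - 1), z i := by
      rw [add_pow, Finset.sum_range_succ, Finset.mul_sum, ← Finset.sum_congr rfl hz2]
      obtain ⟨k, hk⟩ : ∃ k, p ^ n = k + 1 := ⟨p ^ n - 1, by lia⟩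
      rw [← e₁, ← e₂, hk, Finset.sum_range_succ']
      simp
      ring
    rw [hsum, e] at hb
    convert hb using 1
    ring

theorem key_step (G : GammaRing p σ₀ K Γ) [CharZero O] {π : O} (hπ : Irreducible π) (n : ℕ)
    {s N : ℝ} (hN : 0 ≤ N) {y : Γ} (hy : y ∈ G.bdd π s N) :
    ∃ t y' : Γ, IsTeichmuller p t ∧ ((-s : ℝ) : WithTop ℝ) ≤ G.val (G.residue t) ∧
      y' ∈ G.bdd π (s + N) N ∧ y - t - algebraMap O Γ π * y' ∈ maximalIdeal Γ ^ n := by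
  have gen : ∀ b t : Γ, G.IsConst b → IsTeichmuller p t →
      ((-s : ℝ) : WithTop ℝ) ≤ G.val (G.residue t) → ∃ t' y' : Γ, IsTeichmuller p t' ∧
        ((-s : ℝ) : WithTop ℝ) ≤ G.val (G.residue t') ∧ y' ∈ G.bdd π (s + N) N ∧
        b * t - t' - algebraMap O Γ π * y' ∈ maximalIdeal Γ ^ n := by
    intro b t hb ht hv
    obtain ⟨τ, hτ, hr⟩ := G.exists_teich (G.residue b)
    have h1 : b - τ ∈ maximalIdeal Γ ^ 1 := by
      rw [pow_one, G.mem_max_iff, map_sub, hr, sub_self]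
    rw [G.mem_pow_iff hπ, pow_one] at h1
    obtain ⟨b', hb'⟩ := h1
    have hc := G.const_step hπ hb hτ (b' := b') (by rw [← hb']; ring)
    refine ⟨τ * t, b' * t, teich_mul hτ ht, ?_, ?_, ?_⟩
    · rw [map_mul, G.val.map_mul, hr]
      have := add_le_add (G.val_const hb) hv
      rwa [← WithTop.coe_add, zero_add] at this
    · refine G.bdd_mono π (by linarith : s ≤ s + N) le_rfl (AddSubgroup.subset_closure
        ⟨0, b', t, hc, ht, by simpa using hv, by simp⟩)
    · have : b * t - τ * t - algebraMap O Γ π * (b' * t) = 0 := by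
        linear_combination t * hb'
      rw [this]; exact zero_mem _
  refine AddSubgroup.closure_induction (fun y hy => ?_) ?_ (fun y₁ y₂ _ _ h₁ h₂ => ?_)
    (fun y _ h => ?_) hy
  · obtain ⟨i, b, t, hb, ht, hv, rfl⟩ := hy
    cases i with
    | zero =>
      obtain ⟨t', y', a1, a2, a3, a4⟩ := gen b t hb ht (by simpa using hv)
      exact ⟨t', y', a1, a2, a3, by simpa using a4⟩
    | succ i =>
      refine ⟨0, algebraMap O Γ π ^ i * b * t, teich_zero, by simp,
        AddSubgroup.subset_closure ⟨i, b, t, hb, ht, le_trans ?_ hv, rfl⟩, ?_⟩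
      · rw [WithTop.coe_le_coe]; push_cast; linarith
      · have : algebraMap O Γ π ^ (i + 1) * b * t - 0 -
          algebraMap O Γ π * (algebraMap O Γ π ^ i * b * t) = 0 := by ring
        rw [this]; exact zero_mem _
  · exact ⟨0, 0, teich_zero, by simp, zero_mem _, by simp⟩
  · obtain ⟨t₁, z₁, a1, a2, a3, a4⟩ := h₁
    obtain ⟨t₂, z₂, b1, b2, b3, b4⟩ := h₂
    obtain ⟨t, z, c1, c2, c3, c4⟩ := G.teich_add hπ n (N := N) a1 b1 a2 b2
    refine ⟨t, z₁ + z₂ + z, c1, c2, add_mem (add_mem a3 b3)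
      (G.bdd_mono π (by linarith : s ≤ s + N) le_rfl c3), ?_⟩
    have := Ideal.add_mem _ (Ideal.add_mem _ a4 b4) c4
    convert this using 1
    ring
  · obtain ⟨t, z, a1, a2, a3, a4⟩ := h
    obtain ⟨t', z', b1, b2, b3, b4⟩ := gen (algebraMap O Γ (-1)) t (G.const_algebraMap _) a1 a2
    refine ⟨t', z' - z, b1, b2, sub_mem b3 a3, ?_⟩
    have := Ideal.sub_mem _ b4 a4
    convert this using 1
    rw [map_neg, map_one]
    ring

theorem coeff_bound (G : GammaRing p σ₀ K Γ) [CharZero O] {π : O} (hπ : Irreducible π)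
    {N : ℝ} (hN : 0 ≤ N) (n : ℕ) : ∀ (s : ℝ) (y : Γ) (c : ℕ → Γ), y ∈ G.bdd π s N →
      (∀ i, IsTeichmuller p (c i)) →
      y - ∑ i ∈ Finset.range n, algebraMap O Γ π ^ i * c i ∈ maximalIdeal Γ ^ n →
      ∀ i < n, ((-(s + N * i) : ℝ) : WithTop ℝ) ≤ G.val (G.residue (c i)) := by
  induction n with
  | zero => intro s y c _ _ _ i hi; exact absurd hi (Nat.not_lt_zero i)
  | succ n ih =>
    intro s y c hy hc h i hi
    obtain ⟨t, y', a1, a2, a3, a4⟩ := G.key_step hπ (n + 1) hN hy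
    have hϖ : G.residue (algebraMap O Γ π) = 0 := by
      rw [← G.mem_max_iff, G.max_eq hπ]; exact Ideal.mem_span_singleton_self _
    have hsum : ∑ i ∈ Finset.range (n + 1), algebraMap O Γ π ^ i * c i = c 0 +
        algebraMap O Γ π * ∑ i ∈ Finset.range n, algebraMap O Γ π ^ i * c (i + 1) := by
      rw [Finset.sum_range_succ', Finset.mul_sum, pow_zero, one_mul, add_comm]
      congr 1
      exact Finset.sum_congr rfl fun i _ => by ring
    rw [hsum] at h
    have hd := Ideal.sub_mem _ h a4
    have h0 : t = c 0 := by
      refine G.teich_unique a1 (hc 0) ?_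
      have := Ideal.pow_le_self (Nat.succ_ne_zero n) hd
      rw [G.mem_max_iff] at this
      simp only [map_sub, map_add, map_mul, hϖ, zero_mul] at this
      linear_combination this
    cases i with
    | zero => rw [← h0]; simpa using a2
    | succ i =>
      have h1 : y' - ∑ i ∈ Finset.range n, algebraMap O Γ π ^ i * c (i + 1) ∈
          maximalIdeal Γ ^ n := by
        rw [G.mem_pow_iff hπ, ← mul_dvd_mul_iff_left (G.unif_ne_zero hπ), ← pow_succ',
          ← G.mem_pow_iff hπ]
        convert hd using 1
        rw [h0]; ring
      have := ih (s + N) y' (fun i => c (i + 1)) a3 (fun i => hc _) h1 i (by lia)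
      refine le_trans ?_ this
      rw [WithTop.coe_le_coe]; push_cast; linarith

/-- Approximability by elements of `bdd`. -/
def IsGood (G : GammaRing p σ₀ K Γ) (π : O) (x : Γ) : Prop :=
  ∃ s N : ℝ, 0 ≤ N ∧ ∀ n : ℕ, ∃ y ∈ G.bdd π s N, x - y ∈ maximalIdeal Γ ^ n

theorem vp_pos [CharZero O] {π : O} (hπ : Irreducible π) : 0 < vp p π := by
  have h0 : (p : O) ≠ 0 := Nat.cast_ne_zero.2 hp.out.ne_zero
  have h1 : IsDiscreteValuationRing.addVal O (p : O) ≠ ⊤ := by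
    rwa [Ne, IsDiscreteValuationRing.addVal_eq_top_iff]
  have h2 : IsDiscreteValuationRing.addVal O (p : O) ≠ 0 := by
    rw [Ne, IsDiscreteValuationRing.addVal_eq_zero_iff]
    intro h
    have := (h.map (IsLocalRing.residue O)).ne_zero
    simp at this
  rw [vp, IsDiscreteValuationRing.addVal_uniformizer hπ]
  have : 0 < (IsDiscreteValuationRing.addVal O (p : O)).toNat :=
    Nat.pos_of_ne_zero fun h => (ENat.toNat_eq_zero.1 h).elim h2 h1
  simp only [ENat.toNat_one, Nat.cast_one]
  positivity

theorem vp_pow {π : O} (hπ : Irreducible π) (j : ℕ) : vp p (π ^ j) = j * vp p π := by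
  rw [vp, vp, hπ.addVal_pow, IsDiscreteValuationRing.addVal_uniformizer hπ]
  simp [div_eq_mul_inv]

theorem isGood_iff (G : GammaRing p σ₀ K Γ) [CharZero O] {π : O} (hπ : Irreducible π) (x : Γ) :
    G.IsGood π x ↔ ∃ r : ℝ, 0 < r ∧ G.IsConvergent π r x := by
  have hw : (0 : ℝ) < (vp p π : ℝ) := by exact_mod_cast vp_pos (p := p) hπ
  constructor
  · rintro ⟨s, N, hN, h⟩
    obtain ⟨c, hc⟩ := G.exists_expansion hπ x
    have hb : ∀ i : ℕ, ((-(s + N * i) : ℝ) : WithTop ℝ) ≤ G.val (G.residue (c i)) := fun i => by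
      obtain ⟨y, hy, hxy⟩ := h (i + 1)
      refine G.coeff_bound hπ hN (i + 1) s y c hy hc.1 ?_ i (Nat.lt_succ_self i)
      have := Ideal.sub_mem _ (hc.2 (i + 1)) hxy
      convert this using 1
      ring
    set w : ℝ := (vp p π : ℝ)
    have hr : 0 < w / (2 * (N + 1)) := by positivity
    refine ⟨w / (2 * (N + 1)), hr, c, hc, fun C => ?_⟩
    obtain ⟨J, hJ⟩ := exists_nat_ge ((C + w / (2 * (N + 1)) * |s|) / (w / 2))
    filter_upwards [eventually_ge_atTop J] with j hj
    refine Finset.le_inf fun i hi => le_trans ?_ (hb i)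
    rw [WithTop.coe_le_coe, vp_pow hπ, div_le_iff₀ hr]
    push_cast
    have hij : (i : ℝ) ≤ j := by exact_mod_cast Finset.mem_range_succ_iff.1 hi
    have hJ' : C + w / (2 * (N + 1)) * |s| ≤ j * (w / 2) := by
      rw [← div_le_iff₀ (by positivity)]
      exact hJ.trans (by exact_mod_cast hj)
    have h1 : w / (2 * (N + 1)) * s ≤ w / (2 * (N + 1)) * |s| := by
      gcongr; exact le_abs_self s
    have h2 : w / (2 * (N + 1)) * (N * i) ≤ j * (w / 2) := by
      have : w / (2 * (N + 1)) * (N * i) ≤ w / (2 * (N + 1)) * ((N + 1) * j) := by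
        gcongr; linarith
      refine this.trans (le_of_eq ?_)
      field_simp
    change C - j * w ≤ _
    nlinarith
  · rintro ⟨r, hr, c, hc, h⟩
    obtain ⟨J, hJ⟩ := eventually_atTop.1 (h 0)
    set w : ℝ := (vp p π : ℝ)
    -- a lower bound for the finitely many initial coefficients
    have hinit : ∃ s : ℝ, 0 ≤ s ∧ ∀ i < J, ((-s : ℝ) : WithTop ℝ) ≤ G.val (G.residue (c i)) := by
      clear hJ
      induction J with
      | zero => exact ⟨0, le_rfl, fun i hi => absurd hi (Nat.not_lt_zero i)⟩
      | succ J ih =>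
        obtain ⟨s, hs, hs'⟩ := ih
        have : ∃ s' : ℝ, ((-s' : ℝ) : WithTop ℝ) ≤ G.val (G.residue (c J)) := by
          cases hv : G.val (G.residue (c J)) with
          | top => exact ⟨0, le_top⟩
          | coe a => exact ⟨-a, by simp⟩
        obtain ⟨s', hs''⟩ := this
        refine ⟨max s s', le_max_of_le_left hs, fun i hi => ?_⟩
        rcases Nat.lt_succ_iff_lt_or_eq.1 hi with h' | rfl
        · refine le_trans ?_ (hs' i h')
          rw [WithTop.coe_le_coe]; linarith [le_max_left s s']
        · refine le_trans ?_ hs''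
          rw [WithTop.coe_le_coe]; linarith [le_max_right s s']
    obtain ⟨s, hs, hs'⟩ := hinit
    refine ⟨s, w / r, by positivity, fun n => ⟨∑ i ∈ Finset.range n, algebraMap O Γ π ^ i * c i,
      sum_mem fun i _ => AddSubgroup.subset_closure ⟨i, 1, c i, ?_, hc.1 i, ?_, by ring⟩, hc.2 n⟩⟩
    · simpa using G.const_algebraMap 1
    · have hpos : 0 ≤ w / r * i := by positivity
      by_cases hi : i < J
      · refine le_trans ?_ (hs' i hi)
        rw [WithTop.coe_le_coe]; linarith
      · have h1 := (hJ i (by lia)).trans (Finset.inf_le (Finset.self_mem_range_succ i))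
        refine le_trans ?_ h1
        rw [WithTop.coe_le_coe, vp_pow hπ]
        push_cast
        change _ ≤ (0 - i * w) / r
        have : (0 - i * w) / r = -(w / r * i) := by ring
        rw [this]; linarith

theorem good_add (G : GammaRing p σ₀ K Γ) {π : O} {x x' : Γ} (h : G.IsGood π x)
    (h' : G.IsGood π x') : G.IsGood π (x + x') := by
  obtain ⟨s, N, hN, h⟩ := h
  obtain ⟨s', N', hN', h'⟩ := h'
  refine ⟨max s s', max N N', le_max_of_le_left hN, fun n => ?_⟩
  obtain ⟨y, hy, e⟩ := h n
  obtain ⟨y', hy', e'⟩ := h' n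
  refine ⟨y + y', add_mem (G.bdd_mono π (le_max_left _ _) (le_max_left _ _) hy)
    (G.bdd_mono π (le_max_right _ _) (le_max_right _ _) hy'), ?_⟩
  have := Ideal.add_mem _ e e'
  convert this using 1
  ring

theorem good_mul (G : GammaRing p σ₀ K Γ) {π : O} {x x' : Γ} (h : G.IsGood π x)
    (h' : G.IsGood π x') : G.IsGood π (x * x') := by
  obtain ⟨s, N, hN, h⟩ := h
  obtain ⟨s', N', hN', h'⟩ := h'
  refine ⟨s + s', N + N', by positivity, fun n => ?_⟩
  obtain ⟨y, hy, e⟩ := h n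
  obtain ⟨y', hy', e'⟩ := h' n
  refine ⟨y * y', G.bdd_mul π hy hy' hN hN', ?_⟩
  have := Ideal.add_mem _ (Ideal.mul_mem_right x' _ e) (Ideal.mul_mem_left _ y e')
  convert this using 1
  ring

theorem good_neg (G : GammaRing p σ₀ K Γ) {π : O} {x : Γ} (h : G.IsGood π x) :
    G.IsGood π (-x) := by
  obtain ⟨s, N, hN, h⟩ := h
  refine ⟨s, N, hN, fun n => ?_⟩
  obtain ⟨y, hy, e⟩ := h n
  refine ⟨-y, neg_mem hy, ?_⟩
  have := neg_mem e
  convert this using 1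
  ring

theorem good_one (G : GammaRing p σ₀ K Γ) {π : O} : G.IsGood π 1 :=
  ⟨0, 0, le_rfl, fun n => ⟨1, AddSubgroup.subset_closure
    ⟨0, 1, 1, by simpa using G.const_algebraMap 1, fun _ => ⟨1, one_pow _⟩, by simp, by simp⟩,
    by simp⟩⟩

theorem good_zero (G : GammaRing p σ₀ K Γ) {π : O} : G.IsGood π 0 :=
  ⟨0, 0, le_rfl, fun n => ⟨0, zero_mem _, by simp⟩⟩

theorem good_frob (G : GammaRing p σ₀ K Γ) {π : O} (hπ : Irreducible π) {x : Γ}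
    (h : G.IsGood π x) : G.IsGood π (G.frob x) := by
  obtain ⟨s, N, hN, h⟩ := h
  refine ⟨p * s, p * N, by positivity, fun n => ?_⟩
  obtain ⟨y, hy, e⟩ := h n
  refine ⟨G.frob y, G.bdd_frob hπ hy, ?_⟩
  have := G.frob_pow_mem e 1
  rwa [pow_one, map_sub] at this

end Aux

variable [Fact p.Prime] [CharP (ResidueField O) p] [CharZero O] [PerfectField K]

/-- The ring `Γ_con` of overconvergent elements, the union of the `Γ_r` for `r > 0`. -/
def con (G : GammaRing p σ₀ K Γ) {π : O} (hπ : Irreducible π) : Subring Γ where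
  carrier := {x | ∃ r : ℝ, 0 < r ∧ G.IsConvergent π r x}
  zero_mem' := (G.isGood_iff hπ _).1 G.good_zero
  one_mem' := (G.isGood_iff hπ _).1 G.good_one
  add_mem' h h' := (G.isGood_iff hπ _).1
    (G.good_add ((G.isGood_iff hπ _).2 h) ((G.isGood_iff hπ _).2 h'))
  mul_mem' h h' := (G.isGood_iff hπ _).1
    (G.good_mul ((G.isGood_iff hπ _).2 h) ((G.isGood_iff hπ _).2 h'))
  neg_mem' h := (G.isGood_iff hπ _).1 (G.good_neg ((G.isGood_iff hπ _).2 h))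

/-- The Frobenius lift `σ₀` on `Γ_con`. -/
def conFrob (G : GammaRing p σ₀ K Γ) {π : O} (hπ : Irreducible π) : G.con hπ →+* G.con hπ :=
  G.frob.restrict (G.con hπ) (G.con hπ) fun x hx =>
    (G.isGood_iff hπ _).1 (G.good_frob hπ ((G.isGood_iff hπ x).2 hx))

end GammaRing

/-! ### σ-modules -/

section SigmaModules

variable (p : ℕ) {R : Type u} [CommRing R] {σ : R →+* R}
  {M : Type w} [AddCommGroup M] [Module R M]

/-- `(M, F)` is a `σ`-module over `R`: `M` is finite free and the `σ`-linear map `F` acts on a basis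
by a matrix that is invertible over `R[1/p]`. -/
def IsSigmaModule (F : M →ₛₗ[σ] M) : Prop :=
  ∃ (n : ℕ) (b : Module.Basis (Fin n) R M),
    IsUnit ((Matrix.of fun i j => b.repr (F (b j)) i).map
      (algebraMap R (Localization.Away (p : R))))

/-- An isogeny: a linear map compatible with `F` that becomes an isomorphism over `R[1/p]`. -/
def IsIsogeny {N : Type*} [AddCommGroup N] [Module R N] (F : M →ₛₗ[σ] M) (F' : N →ₛₗ[σ] N)
    (g : M →ₗ[R] N) : Prop :=
  (∀ m, g (F m) = F' (g m)) ∧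
    Function.Bijective (IsLocalizedModule.map (Submonoid.powers (p : R))
      (LocalizedModule.mkLinearMap (Submonoid.powers (p : R)) M)
      (LocalizedModule.mkLinearMap (Submonoid.powers (p : R)) N) g)

/-- `(M, F)` and `(N, F')` are isogenous. -/
def Isogenous {N : Type*} [AddCommGroup N] [Module R N] (F : M →ₛₗ[σ] M)
    (F' : N →ₛₗ[σ] N) : Prop :=
  ∃ g : M →ₗ[R] N, IsIsogeny p F F' g

/-- `(M, F)` is standard: it is isogenous to a `σ`-module with a basis `v_0, …, v_n` such that
`F v_i = v_{i+1}` for `i < n` and `F v_n = a • v_0`, with `a` fixed by `σ`. -/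
def IsStandard (F : M →ₛₗ[σ] M) : Prop :=
  ∃ (N : Type u) (_ : AddCommGroup N) (_ : Module R N) (F' : N →ₛₗ[σ] N) (n : ℕ)
    (b : Module.Basis (Fin (n + 1)) R N) (a : R),
    IsSigmaModule p F' ∧ σ a = a ∧ (∀ i : Fin n, F' (b i.castSucc) = b i.succ) ∧
      F' (b (Fin.last n)) = a • b 0 ∧ Isogenous p F F'

/-- The direct sum of finitely many `σ`-linear maps. -/
def sumFrob {l : ℕ} {N : Fin l → Type*} [∀ j, AddCommGroup (N j)] [∀ j, Module R (N j)]
    (F : ∀ j, N j →ₛₗ[σ] N j) : (∀ j, N j) →ₛₗ[σ] (∀ j, N j) where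
  toFun x j := F j (x j)
  map_add' _ _ := funext fun j => map_add (F j) _ _
  map_smul' _ _ := funext fun j => map_smulₛₗ (F j) _ _

/-- `(M, F)` is isogenous to a direct sum of standard `σ`-modules. -/
def IsogenousToSumOfStandard (F : M →ₛₗ[σ] M) : Prop :=
  ∃ (l : ℕ) (N : Fin l → Type u) (_ : ∀ j, AddCommGroup (N j)) (_ : ∀ j, Module R (N j))
    (F' : ∀ j, N j →ₛₗ[σ] N j),
    (∀ j, IsSigmaModule p (F' j) ∧ IsStandard p (F' j)) ∧ Isogenous p F (sumFrob F')

/-- `s` is the list of generic slopes of `(M, F)`, where `σ` is a `q`-power Frobenius lift: there is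
an embedding of `R`, compatible with Frobenius lifts, into a complete discrete valuation ring `S` of
residue characteristic `p` such that `S ⊗ M` has a basis up to isogeny (a maximal linearly
independent family) of eigenvectors whose eigenvalues have the valuations `s i`. The slopes do not
depend, up to permutation, on the choice of `S` or of the eigenvectors. -/
def HasGenericSlopes (q : ℕ) (F : M →ₛₗ[σ] M) {n : ℕ} (s : Fin n → ℚ) : Prop :=
  n = Module.finrank R M ∧
  ∃ (S : Type u) (_ : CommRing S) (_ : IsDomain S) (_ : IsDiscreteValuationRing S)
    (_ : Algebra R S) (τ : S →+* S) (FS : S ⊗[R] M →ₛₗ[τ] S ⊗[R] M),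
    IsAdicComplete (maximalIdeal S) S ∧ (p : S) ∈ maximalIdeal S ∧
    Function.Injective (algebraMap R S) ∧
    IsFrobLift q τ ∧ (∀ a, τ (algebraMap R S a) = algebraMap R S (σ a)) ∧
    (∀ m : M, FS (1 ⊗ₜ[R] m) = 1 ⊗ₜ[R] F m) ∧
    ∃ (e : Fin n → S ⊗[R] M) (a : Fin n → S), LinearIndependent S e ∧
      ∀ i, FS (e i) = a i • e i ∧ a i ≠ 0 ∧ vp p (a i) = s i

/-- A finite family of `F`-stable submodules `step 0, …, step length` of `M`, with a rational number
`slope i` attached to the `i`-th graded piece. -/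
structure SigmaFiltration (F : M →ₛₗ[σ] M) where
  length : ℕ
  step : Fin (length + 1) → Submodule R M
  slope : Fin length → ℚ
  stable : ∀ i, ∀ x ∈ step i, F x ∈ step i

namespace SigmaFiltration

variable {F : M →ₛₗ[σ] M} (D : SigmaFiltration F)

/-- The quotient of `step (i + 1)` by `step i`. -/
abbrev Gr (i : Fin D.length) : Type w :=
  D.step i.succ ⧸ (D.step i.castSucc).submoduleOf (D.step i.succ)

/-- The `σ`-linear map on `step i` induced by `F`. -/
def stepFrob (i : Fin (D.length + 1)) : D.step i →ₛₗ[σ] D.step i :=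
  F.restrict (D.stable i)

/-- The `σ`-linear map on the quotient of `step (i + 1)` by `step i` induced by `F`. -/
def grFrob (i : Fin D.length) : D.Gr i →ₛₗ[σ] D.Gr i :=
  Submodule.mapQ _ _ (D.stepFrob i.succ) fun x hx => D.stable i.castSucc x hx

/-- `D` is a filtration `0 = M_0 ⊂ M_1 ⊂ ⋯ ⊂ M_m = M` (with strict inclusions) by `σ`-submodules,
each saturated in the next, such that all generic slopes of the quotient of `M_i` by `M_{i-1}` are
equal to `s_i`, with `s_1 > ⋯ > s_m`. -/
structure IsDescendingGeneric (q : ℕ) : Prop where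
  sigma_submodule : ∀ i, IsSigmaModule p (D.stepFrob i)
  bot : D.step 0 = ⊥
  top : D.step (Fin.last D.length) = ⊤
  lt : ∀ i : Fin D.length, D.step i.castSucc < D.step i.succ
  saturated : ∀ (i : Fin D.length) (a : R) (x : M), a ≠ 0 → x ∈ D.step i.succ →
    a • x ∈ D.step i.castSucc → x ∈ D.step i.castSucc
  slopes : ∀ i : Fin D.length, HasGenericSlopes p q (D.grFrob i)
    (fun _ : Fin (Module.finrank R (D.Gr i)) => D.slope i)
  strictAnti : StrictAnti D.slope

end SigmaFiltration

end SigmaModules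

end SlopeFiltration

end

/-! `Γ_con` is a discrete valuation ring, not complete, on which Frobenius is bijective because `K`
is perfect. Put `|x| = 2^(-v_p(x))`, give a finite free module the sup norm of a basis, and write
`rho s = 2^(-s)`. Call `M` pure of slope `s` if `|F^k x|` equals `rho s ^ k * |x|` up to a constant
independent of `k` and `x`. The theorem splits in two: filtrations with pure quotients of decreasing
slopes exist and are unique, and being pure of slope `s` is the same as having all generic slopes
equal to `s`.

Existence. The vectors with `|F^k x| = O(rho s ^ k)` form a saturated stable submodule `slopeSub`.
For a suitable `s`, the largest slope, it is nonzero and pure (`exists_slopeSub_pure`); divide by it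
and induct on the rank (`exists_isPureFiltration`). The difficulty is to find it over `Γ_con` and
not only over `Γ`. Over the fraction field, `B = F⁻¹` has an exact growth rate, read off from Newton
polygons of companion matrices (`exists_growth`). A power of `B`, divided by a scalar, is then
integral in a suitable lattice and not nilpotent modulo `π`. Fitting's decomposition splits its
reduction, and lifting the invariant part amounts to a contracting fixed-point equation
(`exists_riccati`) that involves only `σ⁻¹`. Inverse Frobenius improves the bounds on Teichmüller
coefficients that define overconvergence, so `Γ_con` is a union of subrings, complete and stable
under `σ⁻¹`, in which the iteration converges (`con_hasClosedSubrings`). With `σ` the bounds would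
get worse, which is why the largest slope comes first.

Uniqueness. In any filtration with pure quotients of decreasing slopes, the `i`-th step is the
`slopeSub` of its slope, and the slopes are the jumps of `slopeSub` (`step_succ`, `range_slope`).

Generic slopes. A maximal family of eigenvectors of slope `s` forces purity by Cramer's rule, and
purity descends from the extension `S` since norms are preserved. Conversely, after extending to a
complete ring with algebraically closed residue field and a fixed uniformizer of the right
ramification, a pure module contains a lattice on which `F` is a fixed scalar times a unit matrix
(`exists_unit_lattice`). Lang's theorem makes this matrix the identity.

Standard modules. If `K` is algebraically closed, the same argument applies to `F^b`, with `b` the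
denominator of the slope measured by the uniformizer. Lang's equation is solved over `Γ`, and its
solutions are automatically overconvergent (`mem_con_of_frob_eq`). The eigenvectors of `F^b`
generate cyclic modules of rank `b`; they are independent because the rank of every pure submodule
of that slope is a multiple of `b`. -/

noncomputable section

namespace SlopeFiltration

set_option linter.unusedSectionVars false

/-! ### The normalized absolute value of a discrete valuation ring of mixed characteristic -/

section AbsoluteValue

/-- `A` has mixed characteristic `(0, p)`, in the sense that `p` is a nonzero nonunit. -/
structure IsMixed (p : ℕ) (A : Type*) [CommRing A] [IsLocalRing A] : Prop where
  ne_zero : (p : A) ≠ 0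
  mem : (p : A) ∈ maximalIdeal A

variable (p : ℕ) {A : Type u} [CommRing A] [IsDomain A] [IsDiscreteValuationRing A]

/-- The absolute value `2 ^ (-v_p(x))`. -/
def av (x : A) : ℝ :=
  open Classical in if x = 0 then 0 else (2 : ℝ) ^ (-(vp p x : ℝ))

theorem av_zero : av p (0 : A) = 0 := by simp [av]

theorem av_pos {x : A} (h : x ≠ 0) : 0 < av p x := by
  rw [av, if_neg h]; positivity

theorem av_nonneg (x : A) : 0 ≤ av p x := by
  by_cases h : x = 0
  · rw [h, av_zero]
  · exact (av_pos p h).le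

theorem av_eq_zero {x : A} : av p x = 0 ↔ x = 0 :=
  ⟨fun h => by_contra fun h0 => (av_pos p h0).ne' h, fun h => by rw [h, av_zero]⟩

theorem vp_nonneg (x : A) : 0 ≤ vp p x := by unfold vp; positivity

theorem av_le_one (x : A) : av p x ≤ 1 := by
  by_cases h : x = 0
  · rw [h, av_zero]; exact zero_le_one
  · rw [av, if_neg h]
    refine Real.rpow_le_one_of_one_le_of_nonpos one_le_two ?_
    have : (0 : ℝ) ≤ vp p x := by exact_mod_cast vp_nonneg p x
    linarith

theorem addVal_ne_top {x : A} (h : x ≠ 0) : IsDiscreteValuationRing.addVal A x ≠ ⊤ := by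
  rwa [Ne, IsDiscreteValuationRing.addVal_eq_top_iff]

theorem vp_mul {x y : A} (hx : x ≠ 0) (hy : y ≠ 0) : vp p (x * y) = vp p x + vp p y := by
  unfold vp
  rw [IsDiscreteValuationRing.addVal_mul, ENat.toNat_add (addVal_ne_top hx) (addVal_ne_top hy)]
  push_cast
  ring

theorem av_mul (x y : A) : av p (x * y) = av p x * av p y := by
  by_cases hx : x = 0
  · simp [hx, av_zero]
  by_cases hy : y = 0
  · simp [hy, av_zero]
  rw [av, av, av, if_neg hx, if_neg hy, if_neg (mul_ne_zero hx hy), vp_mul p hx hy,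
    ← Real.rpow_add two_pos]
  push_cast
  ring_nf

theorem av_isUnit {x : A} (h : IsUnit x) : av p x = 1 := by
  rw [av, if_neg h.ne_zero, vp, IsDiscreteValuationRing.addVal_eq_zero_iff.2 h]
  simp

theorem av_one : av p (1 : A) = 1 := av_isUnit p isUnit_one

theorem av_neg (x : A) : av p (-x) = av p x := by
  rw [← neg_one_mul, av_mul, av_isUnit p isUnit_one.neg, one_mul]

theorem av_pow (x : A) (n : ℕ) : av p (x ^ n) = av p x ^ n := by
  induction n with
  | zero => simp [av_one]
  | succ n ih => rw [pow_succ, av_mul, ih, pow_succ]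

theorem av_le_of_dvd {x y : A} (h : x ∣ y) : av p y ≤ av p x := by
  obtain ⟨z, rfl⟩ := h
  rw [av_mul]
  exact mul_le_of_le_one_right (av_nonneg p x) (av_le_one p z)

theorem av_add_le (x y : A) : av p (x + y) ≤ max (av p x) (av p y) := by
  rcases ValuationRing.dvd_total x y with h | h
  · exact le_max_of_le_left (av_le_of_dvd p (dvd_add dvd_rfl h))
  · exact le_max_of_le_right (av_le_of_dvd p (dvd_add h dvd_rfl))

theorem av_sum_le {ι : Type*} (s : Finset ι) (f : ι → A) {C : ℝ} (hC : 0 ≤ C)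
    (h : ∀ i ∈ s, av p (f i) ≤ C) : av p (∑ i ∈ s, f i) ≤ C := by
  classical
  induction s using Finset.induction_on with
  | empty => simpa [av_zero]
  | insert a s ha ih =>
    rw [Finset.sum_insert ha]
    refine (av_add_le p _ _).trans (max_le (h _ (Finset.mem_insert_self _ _)) (ih fun i hi => ?_))
    exact h _ (Finset.mem_insert_of_mem hi)

variable {p}

theorem av_lt_one (hA : IsMixed p A) {x : A} (h : ¬ IsUnit x) : av p x < 1 := by
  by_cases hx : x = 0
  · rw [hx, av_zero]; exact one_pos
  rw [av, if_neg hx]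
  refine Real.rpow_lt_one_of_one_lt_of_neg one_lt_two ?_
  have h1 : 0 < (IsDiscreteValuationRing.addVal A x).toNat :=
    Nat.pos_of_ne_zero fun h0 => (ENat.toNat_eq_zero.1 h0).elim
      (fun h' => h (IsDiscreteValuationRing.addVal_eq_zero_iff.1 h')) (addVal_ne_top hx)
  have h2 : 0 < (IsDiscreteValuationRing.addVal A (p : A)).toNat :=
    Nat.pos_of_ne_zero fun h0 => (ENat.toNat_eq_zero.1 h0).elim
      (fun h' => hA.mem (IsDiscreteValuationRing.addVal_eq_zero_iff.1 h')) (addVal_ne_top hA.ne_zero)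
  have h3 : (0 : ℚ) < vp p x := by unfold vp; positivity
  have : (0 : ℝ) < vp p x := by exact_mod_cast h3
  linarith

theorem isUnit_of_av_eq_one (hA : IsMixed p A) {x : A} (h : av p x = 1) : IsUnit x :=
  by_contra fun h' => (av_lt_one hA h').ne h

theorem dvd_of_av_le (hA : IsMixed p A) {x y : A} (h : av p y ≤ av p x) : x ∣ y := by
  rcases ValuationRing.dvd_total x y with h' | h'
  · exact h'
  obtain ⟨z, rfl⟩ := h'
  by_cases hy : y = 0
  · simp [hy]
  rw [av_mul] at h
  have h1 : 1 ≤ av p z := by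
    by_contra h2
    exact absurd h (not_le.2 (mul_lt_of_lt_one_right (av_pos p hy) (not_le.1 h2)))
  have := isUnit_of_av_eq_one hA (le_antisymm (av_le_one p z) h1)
  exact (associated_mul_unit_left _ _ this).dvd

theorem av_le_iff (hA : IsMixed p A) {x y : A} : av p y ≤ av p x ↔ x ∣ y :=
  ⟨dvd_of_av_le hA, av_le_of_dvd p⟩

theorem av_natCast (hA : IsMixed p A) : av p (p : A) = 1 / 2 := by
  have h2 : (IsDiscreteValuationRing.addVal A (p : A)).toNat ≠ 0 :=
    fun h0 => (ENat.toNat_eq_zero.1 h0).elim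
      (fun h' => hA.mem (IsDiscreteValuationRing.addVal_eq_zero_iff.1 h')) (addVal_ne_top hA.ne_zero)
  rw [av, if_neg hA.ne_zero, vp, div_self (by exact_mod_cast h2)]
  norm_num

theorem av_irreducible_lt_one (hA : IsMixed p A) {π : A} (hπ : Irreducible π) : av p π < 1 :=
  av_lt_one hA hπ.not_isUnit

/-- Ring homomorphisms between rings of mixed characteristic are isometries. -/
theorem av_map (hA : IsMixed p A) {B : Type*} [CommRing B] [IsDomain B]
    [IsDiscreteValuationRing B] (hB : IsMixed p B) (f : A →+* B) (x : A) :
    av p (f x) = av p x := by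
  obtain ⟨π, hπ⟩ := IsDiscreteValuationRing.exists_irreducible A
  obtain ⟨e, w, hw⟩ := IsDiscreteValuationRing.eq_unit_mul_pow_irreducible hA.ne_zero hπ
  have he : e ≠ 0 := by
    rintro rfl
    rw [pow_zero, mul_one] at hw
    exact hA.mem (hw ▸ w.isUnit)
  -- Compare both sides on `p`, which is a unit times `π ^ e` with `e ≠ 0`, and extract an `e`-th
  -- root.
  have hπ' : av p (f π) = av p π := by
    have h1 : av p (f (p : A)) = av p (p : A) := by
      rw [map_natCast, av_natCast hA, av_natCast hB]
    rw [hw, map_mul, map_pow, av_mul, av_mul, av_pow, av_pow, av_isUnit p w.isUnit,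
      av_isUnit p (w.isUnit.map f), one_mul, one_mul] at h1
    exact (pow_left_inj₀ (av_nonneg p _) (av_nonneg p _) he).1 h1
  by_cases hx : x = 0
  · rw [hx, map_zero, av_zero, av_zero]
  obtain ⟨n, u, rfl⟩ := IsDiscreteValuationRing.eq_unit_mul_pow_irreducible hx hπ
  rw [map_mul, map_pow, av_mul, av_mul, av_pow, av_pow, hπ', av_isUnit p u.isUnit,
      av_isUnit p (u.isUnit.map f)]

theorem map_injective_of_isMixed (hA : IsMixed p A) {B : Type*} [CommRing B] [IsDomain B]
    [IsDiscreteValuationRing B] (hB : IsMixed p B) (f : A →+* B) : Function.Injective f := by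
  rw [injective_iff_map_eq_zero]
  intro x hx
  rw [← av_eq_zero p, ← av_map hA hB f, hx, av_zero]

end AbsoluteValue

/-! ### The norm of a finite free module -/

section Norm

variable (p : ℕ) {A : Type u} [CommRing A] [IsDomain A] [IsDiscreteValuationRing A]
  {M : Type*} [AddCommGroup M] [Module A M]

/-- The norm of `x` with respect to a basis. -/
def bnorm {ι : Type*} (b : Module.Basis ι A M) (x : M) : ℝ := ⨆ i, av p (b.repr x i)

variable {p} {ι : Type*} [Finite ι] (b : Module.Basis ι A M)

theorem av_repr_le_bnorm (x : M) (i : ι) : av p (b.repr x i) ≤ bnorm p b x :=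
  le_ciSup (f := fun i => av p (b.repr x i)) (Set.finite_range _).bddAbove i

theorem bnorm_le {x : M} {C : ℝ} (hC : 0 ≤ C) (h : ∀ i, av p (b.repr x i) ≤ C) : bnorm p b x ≤ C :=
  Real.iSup_le h hC

theorem bnorm_nonneg (x : M) : 0 ≤ bnorm p b x := Real.iSup_nonneg fun _ => av_nonneg p _

/-- Norms are values of elements of `A`, so this determines the norm by divisibility in `M` alone.
Independence of the basis, and the behaviour under linear and semilinear maps, are read off from it.
-/
theorem bnorm_le_iff (hA : IsMixed p A) {x : M} (r : A) :
    bnorm p b x ≤ av p r ↔ ∃ y, x = r • y := by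
  constructor
  · intro h
    have h1 : ∀ i, r ∣ b.repr x i := fun i => dvd_of_av_le hA ((av_repr_le_bnorm b x i).trans h)
    choose y hy using h1
    cases nonempty_fintype ι
    refine ⟨∑ i, y i • b i, ?_⟩
    rw [Finset.smul_sum]
    simp_rw [smul_smul, ← hy]
    exact (b.sum_repr x).symm
  · rintro ⟨y, rfl⟩
    refine bnorm_le b (av_nonneg p r) fun i => ?_
    rw [map_smul, Finsupp.smul_apply, smul_eq_mul, av_mul]
    exact mul_le_of_le_one_right (av_nonneg p r) (av_le_one p _)

theorem exists_bnorm_eq (x : M) : ∃ r : A, bnorm p b x = av p r := by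
  rcases isEmpty_or_nonempty ι with h | h
  · exact ⟨0, by rw [bnorm, Real.iSup_of_isEmpty, av_zero]⟩
  · obtain ⟨i, hi⟩ := exists_eq_ciSup_of_finite (f := fun i => av p (b.repr x i))
    exact ⟨_, hi.symm⟩

theorem bnorm_eq_bnorm (hA : IsMixed p A) {κ : Type*} [Finite κ] (b' : Module.Basis κ A M) (x : M) :
    bnorm p b x = bnorm p b' x := by
  obtain ⟨r, hr⟩ := exists_bnorm_eq (p := p) b x
  obtain ⟨r', hr'⟩ := exists_bnorm_eq (p := p) b' x
  apply le_antisymm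
  · rw [hr', bnorm_le_iff b hA, ← bnorm_le_iff b' hA, hr']
  · rw [hr, bnorm_le_iff b' hA, ← bnorm_le_iff b hA, hr]

variable (p) in
/-- The norm of an element of a finite free module. -/
def nm [Module.Free A M] (x : M) : ℝ := bnorm p (Module.Free.chooseBasis A M) x

variable [Module.Free A M] [Module.Finite A M]

theorem nm_eq_bnorm (hA : IsMixed p A) (x : M) : nm (A := A) p x = bnorm p b x :=
  bnorm_eq_bnorm _ hA b x

theorem nm_nonneg (x : M) : 0 ≤ nm (A := A) p x := bnorm_nonneg _ x

theorem nm_le_iff (hA : IsMixed p A) {x : M} (r : A) :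
    nm (A := A) p x ≤ av p r ↔ ∃ y, x = r • y := bnorm_le_iff _ hA r

theorem exists_nm_eq (x : M) : ∃ r : A, nm (A := A) p x = av p r := exists_bnorm_eq _ x

theorem nm_le_one (hA : IsMixed p A) (x : M) : nm (A := A) p x ≤ 1 := by
  rw [← av_one p (A := A), nm_le_iff hA]
  exact ⟨x, (one_smul _ _).symm⟩

theorem nm_eq_zero (hA : IsMixed p A) {x : M} : nm (A := A) p x = 0 ↔ x = 0 := by
  have h := nm_le_iff hA (x := x) (0 : A)
  rw [av_zero] at h
  constructor
  · intro h0
    obtain ⟨y, hy⟩ := h.1 h0.le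
    rw [hy, zero_smul]
  · rintro rfl
    exact le_antisymm (h.2 ⟨0, (smul_zero _).symm⟩) (nm_nonneg _)

theorem nm_smul (c : A) (x : M) : nm (A := A) p (c • x) = av p c * nm (A := A) p x := by
  simp only [nm, bnorm, map_smul, Finsupp.smul_apply, smul_eq_mul, av_mul]
  rw [Real.mul_iSup_of_nonneg (av_nonneg p c)]

theorem nm_add_le (x y : M) :
    nm (A := A) p (x + y) ≤ max (nm (A := A) p x) (nm (A := A) p y) := by
  refine bnorm_le _ (le_max_of_le_left (nm_nonneg x)) fun i => ?_
  rw [map_add, Finsupp.add_apply]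
  exact (av_add_le p _ _).trans (max_le_max (av_repr_le_bnorm _ _ _) (av_repr_le_bnorm _ _ _))

theorem nm_neg (x : M) : nm (A := A) p (-x) = nm (A := A) p x := by
  simp only [nm, bnorm, map_neg, Finsupp.neg_apply, av_neg]

theorem nm_sum_le {κ : Type*} (s : Finset κ) (f : κ → M) {C : ℝ} (hC : 0 ≤ C)
    (h : ∀ i ∈ s, nm (A := A) p (f i) ≤ C) : nm (A := A) p (∑ i ∈ s, f i) ≤ C := by
  refine bnorm_le _ hC fun i => ?_
  rw [map_sum, Finsupp.finsetSum_apply]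
  exact av_sum_le p _ _ hC fun j hj => (av_repr_le_bnorm _ _ _).trans (h j hj)

theorem nm_map_le (hA : IsMixed p A) {N : Type*} [AddCommGroup N] [Module A N] [Module.Free A N]
    [Module.Finite A N] (g : M →ₗ[A] N) (x : M) : nm (A := A) p (g x) ≤ nm (A := A) p x := by
  obtain ⟨r, hr⟩ := exists_nm_eq (p := p) (A := A) x
  obtain ⟨y, hy⟩ := (nm_le_iff hA r).1 hr.le
  rw [hr, nm_le_iff hA]
  exact ⟨g y, by rw [hy, map_smul]⟩

theorem nm_equiv (hA : IsMixed p A) {N : Type*} [AddCommGroup N] [Module A N] [Module.Free A N]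
    [Module.Finite A N] (g : M ≃ₗ[A] N) (x : M) : nm (A := A) p (g x) = nm (A := A) p x :=
  le_antisymm (nm_map_le hA g.toLinearMap x)
    (by simpa using nm_map_le hA g.symm.toLinearMap (g x))

/-- A semilinear map does not increase the norm. -/
theorem nm_semilinear_le (hA : IsMixed p A) {σ : A →+* A} (F : M →ₛₗ[σ] M) (x : M) :
    nm (A := A) p (F x) ≤ nm (A := A) p x := by
  obtain ⟨r, hr⟩ := exists_nm_eq (p := p) (A := A) x
  obtain ⟨y, hy⟩ := (nm_le_iff hA r).1 hr.le
  rw [hr, ← av_map hA hA σ, nm_le_iff hA]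
  exact ⟨F y, by rw [hy, map_smulₛₗ]⟩

/-- A submodule is saturated if it contains every element with a nonzero multiple in it. -/
def IsSaturated (N : Submodule A M) : Prop := ∀ (a : A) (x : M), a ≠ 0 → a • x ∈ N → x ∈ N

/-- A scalar `r` that realizes the norm in `M` divides `x` in `M`; saturation puts the quotient back
in `N`. -/
theorem nm_coe (hA : IsMixed p A) {N : Submodule A M} [Module.Free A N] [Module.Finite A N]
    (hN : IsSaturated N) (x : N) : nm (A := A) p (x : M) = nm (A := A) p x := by
  refine le_antisymm (nm_map_le hA N.subtype x) ?_
  obtain ⟨r, hr⟩ := exists_nm_eq (p := p) (A := A) (x : M)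
  obtain ⟨y, hy⟩ := (nm_le_iff hA r).1 hr.le
  by_cases h0 : r = 0
  · rw [h0, zero_smul] at hy
    rw [(nm_eq_zero hA).2 (Subtype.ext hy)]
    exact nm_nonneg _
  rw [hr, nm_le_iff hA]
  exact ⟨⟨y, hN r y h0 (hy ▸ x.2)⟩, Subtype.ext hy⟩

theorem exists_lift_nm_eq (hA : IsMixed p A) {N : Type*} [AddCommGroup N] [Module A N]
    [Module.Free A N] [Module.Finite A N] {g : M →ₗ[A] N} (hg : Function.Surjective g) (y : N) :
    ∃ x, g x = y ∧ nm (A := A) p x = nm (A := A) p y := by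
  obtain ⟨r, hr⟩ := exists_nm_eq (p := p) (A := A) y
  obtain ⟨z, hz⟩ := (nm_le_iff hA r).1 hr.le
  obtain ⟨x, rfl⟩ := hg z
  refine ⟨r • x, by rw [map_smul, hz], le_antisymm ?_ ?_⟩
  · rw [hr, nm_le_iff hA]; exact ⟨x, rfl⟩
  · rw [hz, ← map_smul]; exact nm_map_le hA g _

end Norm

/-! ### Overconvergent elements -/

namespace GammaRing

variable {p : ℕ} {O : Type u} [CommRing O] [IsDomain O] [IsDiscreteValuationRing O]
  {σ₀ : O →+* O} {K : Type u} [Field K] [Algebra (LaurentSeries (ResidueField O)) K]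
  {Γ : Type u} [CommRing Γ] [IsDomain Γ] [IsDiscreteValuationRing Γ] [Algebra O Γ]
  [hp : Fact p.Prime] [CharP (ResidueField O) p] [PerfectField K] [CharZero O]

theorem isMixed (G : GammaRing p σ₀ K Γ) : IsMixed p Γ where
  ne_zero h := by
    have : algebraMap O Γ (p : O) = algebraMap O Γ 0 := by rw [map_natCast, h, map_zero]
    exact Nat.cast_ne_zero.2 hp.out.ne_zero (G.algebraMap_injective this)
  mem := G.p_mem

theorem unif_irreducible (G : GammaRing p σ₀ K Γ) {π : O} (hπ : Irreducible π) :
    Irreducible (algebraMap O Γ π) :=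
  (IsDiscreteValuationRing.irreducible_iff_uniformizer _).2 (G.max_eq hπ)

theorem residue_unif (G : GammaRing p σ₀ K Γ) {π : O} (hπ : Irreducible π) :
    G.residue (algebraMap O Γ π) = 0 := by
  rw [← G.mem_max_iff, G.max_eq hπ]; exact Ideal.mem_span_singleton_self _

/-- Perfectness of `K` makes Frobenius surjective modulo the maximal ideal, and it sends the
uniformizer to a unit multiple of itself; completeness turns this into surjectivity. -/
theorem frob_bijective (G : GammaRing p σ₀ K Γ) : Function.Bijective G.frob := by
  obtain ⟨π, hπ⟩ := IsDiscreteValuationRing.exists_irreducible O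
  have := G.complete
  have := G.charP_K
  have : ExpChar K p := ExpChar.prime hp.out
  refine ⟨map_injective_of_isMixed G.isMixed G.isMixed _, ?_⟩
  have hI : (maximalIdeal Γ).map G.frob = maximalIdeal Γ := by
    obtain ⟨u, hu⟩ := G.frob_unif_unit hπ 1
    rw [pow_one] at hu
    rw [G.max_eq hπ, Ideal.map_span, Set.image_singleton, G.frob_algebraMap, hu, map_mul]
    exact Ideal.span_singleton_mul_right_unit (u.isUnit.map _) _
  have : IsHausdorff ((maximalIdeal Γ).map G.frob) Γ := by rw [hI]; infer_instance
  refine surjective_of_mk_map_comp_surjective (I := maximalIdeal Γ) G.frob fun y => ?_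
  obtain ⟨y, rfl⟩ := Ideal.Quotient.mk_surjective y
  obtain ⟨x, hx⟩ := G.residue_surjective ((frobeniusEquiv K p).symm (G.residue y))
  refine ⟨x, ?_⟩
  rw [RingHom.comp_apply, Ideal.Quotient.eq, hI, G.mem_max_iff, map_sub, G.residue_frob, hx,
    frobeniusEquiv_symm_pow_p, sub_self]

/-- The inverse of the Frobenius lift. -/
def frobInv (G : GammaRing p σ₀ K Γ) : Γ →+* Γ :=
  (RingEquiv.ofBijective G.frob G.frob_bijective).symm.toRingHom

theorem frob_frobInv (G : GammaRing p σ₀ K Γ) (x : Γ) : G.frob (G.frobInv x) = x :=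
  (RingEquiv.ofBijective G.frob G.frob_bijective).apply_symm_apply x

theorem frobInv_frob (G : GammaRing p σ₀ K Γ) (x : Γ) : G.frobInv (G.frob x) = x :=
  (RingEquiv.ofBijective G.frob G.frob_bijective).symm_apply_apply x

theorem residue_frobInv_pow (G : GammaRing p σ₀ K Γ) (x : Γ) :
    G.residue (G.frobInv x) ^ p = G.residue x := by
  rw [← G.residue_frob, G.frob_frobInv]

/-- Taking as constants the closure of all `frob⁻ⁿ(O)` makes this possible; `O` itself need not be
stable under inverse Frobenius when its residue field is imperfect. -/
theorem const_frobInv (G : GammaRing p σ₀ K Γ) {b : Γ} (h : G.IsConst b) :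
    G.IsConst (G.frobInv b) := fun n => by
  obtain ⟨j, o, hj⟩ := h n
  refine ⟨j + 1, o, ?_⟩
  rwa [pow_succ, RingHom.mul_def, RingHom.comp_apply, G.frob_frobInv]

theorem frobInv_unif (G : GammaRing p σ₀ K Γ) {π : O} (hπ : Irreducible π) :
    ∃ u : Γ, G.IsConst u ∧ G.frobInv (algebraMap O Γ π) = algebraMap O Γ π * u := by
  obtain ⟨u, hu⟩ := G.frob_unif_unit hπ 1
  rw [pow_one] at hu
  refine ⟨G.frobInv (algebraMap O Γ ↑u⁻¹), G.const_frobInv (G.const_algebraMap _), ?_⟩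
  have : algebraMap O Γ π = G.frob (algebraMap O Γ π) * algebraMap O Γ ↑u⁻¹ := by
    rw [G.frob_algebraMap, hu, ← map_mul, mul_assoc, Units.mul_inv, mul_one]
  nth_rewrite 1 [this]
  rw [map_mul, G.frobInv_frob]

theorem frobInv_mem (G : GammaRing p σ₀ K Γ) {n : ℕ} {x : Γ} (h : x ∈ maximalIdeal Γ ^ n) :
    G.frobInv x ∈ maximalIdeal Γ ^ n := by
  obtain ⟨π, hπ⟩ := IsDiscreteValuationRing.exists_irreducible O
  rw [G.mem_pow_iff hπ] at h ⊢
  obtain ⟨y, rfl⟩ := h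
  obtain ⟨u, -, hu⟩ := G.frobInv_unif hπ
  rw [map_mul, map_pow, hu, mul_pow, mul_assoc]
  exact dvd_mul_right _ _

theorem teich_frobInv (G : GammaRing p σ₀ K Γ) {t : Γ} (ht : IsTeichmuller p t) :
    IsTeichmuller p (G.frobInv t) := fun n => by
  obtain ⟨y, rfl⟩ := ht n
  exact ⟨G.frobInv y, (map_pow _ _ _).symm⟩

/-- Exponents of `π` add under multiplication, so the linear part `N * i` of the bound takes care of
itself and only the constants have to be summed. For `s = 0` and fixed `N` this gives a ring. -/
theorem bdd_mul_same (G : GammaRing p σ₀ K Γ) (π : O) {s N s' : ℝ} {x x' : Γ}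
    (hx : x ∈ G.bdd π s N) (hx' : x' ∈ G.bdd π s' N) : x * x' ∈ G.bdd π (s + s') N := by
  refine AddSubgroup.closure_induction (fun y hy => ?_) (by simp)
    (fun y y' _ _ h h' => by rw [add_mul]; exact add_mem h h')
    (fun y _ h => by rw [neg_mul]; exact neg_mem h) hx
  obtain ⟨i, b, t, hb, ht, hv, rfl⟩ := hy
  refine AddSubgroup.closure_induction (fun y hy => ?_) (by simp)
    (fun y y' _ _ h h' => by rw [mul_add]; exact add_mem h h')
    (fun y _ h => by rw [mul_neg]; exact neg_mem h) hx'
  obtain ⟨i', b', t', hb', ht', hv', rfl⟩ := hy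
  refine AddSubgroup.subset_closure ⟨i + i', b * b', t * t', G.const_mul hb hb',
    teich_mul ht ht', ?_, by ring⟩
  rw [map_mul, G.val.map_mul]
  refine le_trans ?_ (add_le_add hv hv')
  rw [← WithTop.coe_add, WithTop.coe_le_coe]
  push_cast
  nlinarith

theorem const_pow (G : GammaRing p σ₀ K Γ) {b : Γ} (h : G.IsConst b) (n : ℕ) :
    G.IsConst (b ^ n) := by
  induction n with
  | zero => simpa using G.const_algebraMap 1
  | succ n ih => rw [pow_succ]; exact G.const_mul ih h

theorem le_val_frobInv (G : GammaRing p σ₀ K Γ) {x : ℝ} {t : Γ}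
    (h : ((-x : ℝ) : WithTop ℝ) ≤ G.val (G.residue t)) :
    ((-x / p : ℝ) : WithTop ℝ) ≤ G.val (G.residue (G.frobInv t)) := by
  rw [← G.residue_frobInv_pow, G.val.map_pow] at h
  exact le_of_nsmul_le hp.out.pos h

theorem neg_le_neg_div {x : ℝ} (hx : 0 ≤ x) {n : ℕ} (hn : 0 < n) : -x ≤ -x / n := by
  rw [neg_div]
  have : x / n ≤ x := div_le_self hx (by exact_mod_cast hn)
  linarith

/-- Inverse Frobenius divides the valuation of a residue by `p`, which can only help a bound of the
form `-(s + N * i) ≤ 0`. Frobenius would multiply `s` and `N` by `p`. This asymmetry is why the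
inverse of `F` is iterated later on. -/
theorem bdd_frobInv (G : GammaRing p σ₀ K Γ) {π : O} (hπ : Irreducible π) {s N : ℝ} (hs : 0 ≤ s)
    (hN : 0 ≤ N) {x : Γ} (hx : x ∈ G.bdd π s N) : G.frobInv x ∈ G.bdd π s N := by
  refine AddSubgroup.closure_induction (fun y hy => ?_) (by simp)
    (fun y y' _ _ h h' => by rw [map_add]; exact add_mem h h')
    (fun y _ h => by rw [map_neg]; exact neg_mem h) hx
  obtain ⟨i, b, t, hb, ht, hv, rfl⟩ := hy
  obtain ⟨u, huc, hu⟩ := G.frobInv_unif hπ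
  have h0 : 0 ≤ s + N * i := by positivity
  refine AddSubgroup.subset_closure ⟨i, u ^ i * G.frobInv b, G.frobInv t,
    G.const_mul (G.const_pow huc i) (G.const_frobInv hb), G.teich_frobInv ht,
    le_trans ?_ (G.le_val_frobInv hv), ?_⟩
  · rw [WithTop.coe_le_coe]
    exact neg_le_neg_div h0 hp.out.pos
  · rw [map_mul, map_mul, map_pow, hu]; ring

/-- The elements `∑ π ^ i * c i` of `Γ` such that the valuation of the residue of `c i` is at least
`-(s + N * i)`. -/
def clos (G : GammaRing p σ₀ K Γ) (π : O) (s N : ℝ) : AddSubgroup Γ where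
  carrier := {x | ∀ n : ℕ, ∃ y ∈ G.bdd π s N, x - y ∈ maximalIdeal Γ ^ n}
  zero_mem' n := ⟨0, zero_mem _, by simp⟩
  add_mem' {x x'} h h' n := by
    obtain ⟨y, hy, e⟩ := h n
    obtain ⟨y', hy', e'⟩ := h' n
    refine ⟨y + y', add_mem hy hy', ?_⟩
    rw [add_sub_add_comm]
    exact add_mem e e'
  neg_mem' {x} h n := by
    obtain ⟨y, hy, e⟩ := h n
    refine ⟨-y, neg_mem hy, ?_⟩
    rw [neg_sub_neg, ← neg_sub]
    exact neg_mem e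

theorem bdd_le_clos (G : GammaRing p σ₀ K Γ) (π : O) (s N : ℝ) : G.bdd π s N ≤ G.clos π s N :=
  fun x hx _ => ⟨x, hx, by simp⟩

theorem clos_mono (G : GammaRing p σ₀ K Γ) (π : O) {s N s' N' : ℝ} (hs : s ≤ s') (hN : N ≤ N') :
    G.clos π s N ≤ G.clos π s' N' := fun x hx n => by
  obtain ⟨y, hy, e⟩ := hx n
  exact ⟨y, G.bdd_mono π hs hN hy, e⟩

theorem clos_mul (G : GammaRing p σ₀ K Γ) (π : O) {s N s' : ℝ} {x x' : Γ}
    (hx : x ∈ G.clos π s N) (hx' : x' ∈ G.clos π s' N) : x * x' ∈ G.clos π (s + s') N := fun n => by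
  obtain ⟨y, hy, e⟩ := hx n
  obtain ⟨y', hy', e'⟩ := hx' n
  refine ⟨y * y', G.bdd_mul_same π hy hy', ?_⟩
  have := Ideal.add_mem _ (Ideal.mul_mem_right x' _ e) (Ideal.mul_mem_left _ y e')
  convert this using 1
  ring

theorem clos_of_forall (G : GammaRing p σ₀ K Γ) (π : O) {s N : ℝ} {x : Γ}
    (h : ∀ n : ℕ, ∃ y ∈ G.clos π s N, x - y ∈ maximalIdeal Γ ^ n) : x ∈ G.clos π s N := fun n => by
  obtain ⟨y, hy, e⟩ := h n
  obtain ⟨y', hy', e'⟩ := hy n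
  refine ⟨y', hy', ?_⟩
  rw [← sub_add_sub_cancel x y y']
  exact add_mem e e'

theorem clos_frobInv (G : GammaRing p σ₀ K Γ) {π : O} (hπ : Irreducible π) {s N : ℝ} (hs : 0 ≤ s)
    (hN : 0 ≤ N) {x : Γ} (hx : x ∈ G.clos π s N) : G.frobInv x ∈ G.clos π s N := fun n => by
  obtain ⟨y, hy, e⟩ := hx n
  refine ⟨G.frobInv y, G.bdd_frobInv hπ hs hN hy, ?_⟩
  rw [← map_sub]
  exact G.frobInv_mem e

theorem const_mem_clos (G : GammaRing p σ₀ K Γ) (π : O) {N : ℝ} {b : Γ} (hb : G.IsConst b) :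
    b ∈ G.clos π 0 N :=
  G.bdd_le_clos π _ _ (AddSubgroup.subset_closure ⟨0, b, 1, hb, fun _ => ⟨1, one_pow _⟩,
    by simp, by simp⟩)

theorem teich_mem_clos (G : GammaRing p σ₀ K Γ) (π : O) {s N : ℝ} (i : ℕ) {t : Γ}
    (ht : IsTeichmuller p t) (h : ((-(s + N * i) : ℝ) : WithTop ℝ) ≤ G.val (G.residue t)) :
    algebraMap O Γ π ^ i * t ∈ G.clos π s N :=
  G.bdd_le_clos π _ _ (AddSubgroup.subset_closure
    ⟨i, 1, t, by simpa using G.const_algebraMap 1, ht, h, by ring⟩)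

/-- By `coeff_bound`, a bound on the terms of an approximation modulo `π ^ (i + 1)` passes to the
Teichmüller coefficients, which are unique. -/
theorem val_of_expansion (G : GammaRing p σ₀ K Γ) {π : O} (hπ : Irreducible π) {s N : ℝ}
    (hN : 0 ≤ N) {x : Γ} (hx : x ∈ G.clos π s N) {c : ℕ → Γ}
    (hc : IsExpansion p (algebraMap O Γ π) x c) (i : ℕ) :
    ((-(s + N * i) : ℝ) : WithTop ℝ) ≤ G.val (G.residue (c i)) := by
  obtain ⟨y, hy, hxy⟩ := hx (i + 1)
  refine G.coeff_bound hπ hN (i + 1) s y c hy hc.1 ?_ i (Nat.lt_succ_self i)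
  have := Ideal.sub_mem _ (hc.2 (i + 1)) hxy
  convert this using 1
  ring

theorem clos_of_expansion (G : GammaRing p σ₀ K Γ) {π : O} {s N : ℝ} {x : Γ} {c : ℕ → Γ}
    (hc : IsExpansion p (algebraMap O Γ π) x c)
    (h : ∀ i : ℕ, ((-(s + N * i) : ℝ) : WithTop ℝ) ≤ G.val (G.residue (c i))) :
    x ∈ G.clos π s N :=
  G.clos_of_forall π fun n => ⟨_, sum_mem fun i _ => G.teich_mem_clos π i (hc.1 i) (h i), hc.2 n⟩

theorem expansion_unif_mul (G : GammaRing p σ₀ K Γ) {π : O} (hπ : Irreducible π) {x : Γ} {c : ℕ → Γ}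
    (hc : IsExpansion p (algebraMap O Γ π) x c) :
    IsExpansion p (algebraMap O Γ π) (algebraMap O Γ π * x) (fun n => Nat.casesOn n 0 c) := by
  refine ⟨fun i => ?_, fun n => ?_⟩
  · cases i with
    | zero => exact teich_zero
    | succ i => exact hc.1 i
  · cases n with
    | zero => simp
    | succ n =>
      rw [Finset.sum_range_succ']
      have h := hc.2 n
      rw [G.mem_pow_iff hπ] at h ⊢
      obtain ⟨z, hz⟩ := h
      refine ⟨z, ?_⟩
      have : ∑ i ∈ Finset.range n, algebraMap O Γ π ^ (i + 1) * c i =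
          algebraMap O Γ π * ∑ i ∈ Finset.range n, algebraMap O Γ π ^ i * c i := by
        rw [Finset.mul_sum]
        exact Finset.sum_congr rfl fun i _ => by ring
      change algebraMap O Γ π * x - (∑ i ∈ Finset.range n, algebraMap O Γ π ^ (i + 1) * c i +
        algebraMap O Γ π ^ 0 * 0) = _
      rw [this, mul_zero, add_zero, ← mul_sub, hz]; ring

/-- Dividing by `π` shifts the coefficients by one index, at the price of one `N` in the constant.
-/
theorem clos_of_unif_mul (G : GammaRing p σ₀ K Γ) {π : O} (hπ : Irreducible π) {s N : ℝ}
    (hN : 0 ≤ N) {x : Γ} (h : algebraMap O Γ π * x ∈ G.clos π s N) : x ∈ G.clos π (s + N) N := by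
  obtain ⟨c, hc⟩ := G.exists_expansion hπ x
  refine G.clos_of_expansion hc fun i => ?_
  refine le_trans ?_ (G.val_of_expansion hπ hN h (G.expansion_unif_mul hπ hc) (i + 1))
  rw [WithTop.coe_le_coe]; push_cast; linarith

/-- A multiple of `π` has no coefficient of index `0`, and for `i ≥ 1` the constant `s` is absorbed
in the slope: `s + N * i ≤ (s + N) * i`. This is how elements are brought into one of the rings
`closRing`. -/
theorem unif_mul_clos (G : GammaRing p σ₀ K Γ) {π : O} (hπ : Irreducible π) {s N : ℝ} (hs : 0 ≤ s)
    (hN : 0 ≤ N) {x : Γ} (h : algebraMap O Γ π * x ∈ G.clos π s N) :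
    algebraMap O Γ π * x ∈ G.clos π 0 (s + N) := by
  obtain ⟨c, hc⟩ := G.exists_expansion hπ x
  have hc' := G.expansion_unif_mul hπ hc
  refine G.clos_of_expansion hc' fun i => ?_
  cases i with
  | zero => simp
  | succ i =>
    refine le_trans ?_ (G.val_of_expansion hπ hN h hc' (i + 1))
    rw [WithTop.coe_le_coe]
    push_cast
    nlinarith

theorem val_of_unif_pow_mul (G : GammaRing p σ₀ K Γ) {π : O} (hπ : Irreducible π) {N : ℝ}
    (hN : 0 ≤ N) (k : ℕ) : ∀ {s : ℝ} {x : Γ}, algebraMap O Γ π ^ k * x ∈ G.clos π s N →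
    ((-(s + N * k) : ℝ) : WithTop ℝ) ≤ G.val (G.residue x) := by
  induction k with
  | zero =>
    intro s x h
    obtain ⟨c, hc⟩ := G.exists_expansion hπ x
    have h1 := G.val_of_expansion hπ hN (by simpa using h) hc 0
    have h2 := hc.2 1
    rw [Finset.sum_range_one, pow_zero, one_mul, pow_one, G.mem_max_iff, map_sub, sub_eq_zero] at h2
    rw [h2]
    simpa using h1
  | succ k ih =>
    intro s x h
    rw [pow_succ', mul_assoc] at h
    refine le_trans ?_ (ih (G.clos_of_unif_mul hπ hN h))
    rw [WithTop.coe_le_coe]; push_cast; linarith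

theorem mem_con_iff (G : GammaRing p σ₀ K Γ) {π : O} (hπ : Irreducible π) {x : Γ} :
    x ∈ G.con hπ ↔ ∃ s N : ℝ, 0 ≤ s ∧ 0 ≤ N ∧ x ∈ G.clos π s N := by
  have : x ∈ G.con hπ ↔ G.IsGood π x := (G.isGood_iff hπ x).symm
  rw [this]
  constructor
  · rintro ⟨s, N, hN, h⟩
    exact ⟨max s 0, N, le_max_right _ _, hN, G.clos_mono π (le_max_left s 0) le_rfl h⟩
  · rintro ⟨s, N, -, hN, h⟩
    exact ⟨s, N, hN, h⟩

/-- The subring of the elements `∑ π ^ i * c i` of `Γ` such that the valuation of the residue of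
`c i` is at least `-(N * i)`. -/
def closRing (G : GammaRing p σ₀ K Γ) (π : O) (N : ℝ) : Subring Γ where
  __ := G.clos π 0 N
  one_mem' := G.const_mem_clos π (by simpa using G.const_algebraMap 1)
  mul_mem' h h' := by simpa using G.clos_mul π h h'

theorem closRing_le_con (G : GammaRing p σ₀ K Γ) {π : O} (hπ : Irreducible π) {N : ℝ} (hN : 0 ≤ N) :
    G.closRing π N ≤ G.con hπ := fun _ hx => (G.mem_con_iff hπ).2 ⟨0, N, le_rfl, hN, hx⟩

/-- Finitely many overconvergent elements lie in a common `clos`. -/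
theorem exists_clos (G : GammaRing p σ₀ K Γ) {π : O} (hπ : Irreducible π) {ι : Type*}
    (T : Finset ι) (x : ι → Γ) (h : ∀ i ∈ T, x i ∈ G.con hπ) :
    ∃ s N : ℝ, 0 ≤ s ∧ 0 ≤ N ∧ ∀ i ∈ T, x i ∈ G.clos π s N := by
  classical
  induction T using Finset.induction_on with
  | empty => exact ⟨0, 0, le_rfl, le_rfl, by simp⟩
  | insert a T ha ih =>
    obtain ⟨s, N, hs, hN, h1⟩ := ih fun i hi => h i (Finset.mem_insert_of_mem hi)
    obtain ⟨s', N', hs', hN', h2⟩ := (G.mem_con_iff hπ).1 (h a (Finset.mem_insert_self _ _))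
    refine ⟨max s s', max N N', le_max_of_le_left hs, le_max_of_le_left hN, fun i hi => ?_⟩
    rcases Finset.mem_insert.1 hi with rfl | hi
    · exact G.clos_mono π (le_max_right _ _) (le_max_right _ _) h2
    · exact G.clos_mono π (le_max_left _ _) (le_max_left _ _) (h1 i hi)

theorem exists_closRing (G : GammaRing p σ₀ K Γ) {π : O} (hπ : Irreducible π) {ι : Type*}
    (T : Finset ι) (x : ι → Γ) (h : ∀ i ∈ T, algebraMap O Γ π * x i ∈ G.con hπ) :
    ∃ N : ℝ, 0 ≤ N ∧ ∀ i ∈ T, algebraMap O Γ π * x i ∈ G.closRing π N := by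
  obtain ⟨s, N, hs, hN, h1⟩ := G.exists_clos hπ T _ h
  exact ⟨s + N, by positivity, fun i hi => G.unif_mul_clos hπ hs hN (h1 i hi)⟩

theorem mem_con_of_unif_mul (G : GammaRing p σ₀ K Γ) {π : O} (hπ : Irreducible π) {x : Γ}
    (h : algebraMap O Γ π * x ∈ G.con hπ) : x ∈ G.con hπ := by
  obtain ⟨s, N, hs, hN, h⟩ := (G.mem_con_iff hπ).1 h
  exact (G.mem_con_iff hπ).2 ⟨s + N, N, by positivity, hN, G.clos_of_unif_mul hπ hN h⟩

theorem algebraMap_mem_con (G : GammaRing p σ₀ K Γ) {π : O} (hπ : Irreducible π) (a : O) :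
    algebraMap O Γ a ∈ G.con hπ :=
  (G.mem_con_iff hπ).2 ⟨0, 0, le_rfl, le_rfl, G.const_mem_clos π (G.const_algebraMap a)⟩

theorem teich_mem_con (G : GammaRing p σ₀ K Γ) {π : O} (hπ : Irreducible π) {t : Γ}
    (ht : IsTeichmuller p t) : t ∈ G.con hπ := by
  have : ∃ s : ℝ, 0 ≤ s ∧ ((-s : ℝ) : WithTop ℝ) ≤ G.val (G.residue t) := by
    cases hv : G.val (G.residue t) with
    | top => exact ⟨0, le_rfl, le_top⟩
    | coe a => exact ⟨|a|, abs_nonneg a, WithTop.coe_le_coe.2 (neg_abs_le a)⟩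
  obtain ⟨s, hs, h⟩ := this
  refine (G.mem_con_iff hπ).2 ⟨s, 0, hs, le_rfl, ?_⟩
  simpa using G.teich_mem_clos π (N := 0) 0 ht (by simpa using h)

theorem frobInv_mem_con (G : GammaRing p σ₀ K Γ) {π : O} (hπ : Irreducible π) {x : Γ}
    (h : x ∈ G.con hπ) : G.frobInv x ∈ G.con hπ := by
  obtain ⟨s, N, hs, hN, h⟩ := (G.mem_con_iff hπ).1 h
  exact (G.mem_con_iff hπ).2 ⟨s, N, hs, hN, G.clos_frobInv hπ hs hN h⟩

/-- An element of `Γ_con` which is a unit in `Γ` is a unit in `Γ_con`. -/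
theorem inv_mem_con (G : GammaRing p σ₀ K Γ) {π : O} (hπ : Irreducible π) {x y : Γ}
    (hx : x ∈ G.con hπ) (hxy : x * y = 1) : y ∈ G.con hπ := by
  have hx0 : G.residue x ≠ 0 := fun h => by
    have := congrArg G.residue hxy
    rw [map_mul, h, zero_mul, map_one] at this
    exact zero_ne_one this
  -- Scaling by this Teichmüller lift makes `x` congruent to `1` modulo `π`; then `1 - t * x` is a
  -- multiple of `π` and lies in some `closRing`.
  obtain ⟨t, ht, hrt⟩ := G.exists_teich (G.residue x)⁻¹
  have h1 : 1 - t * x ∈ maximalIdeal Γ ^ 1 := by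
    rw [pow_one, G.mem_max_iff, map_sub, map_one, map_mul, hrt, inv_mul_cancel₀ hx0, sub_self]
  rw [G.mem_pow_iff hπ, pow_one] at h1
  obtain ⟨z, hz⟩ := h1
  obtain ⟨N, hN, hzN⟩ := G.exists_closRing hπ {()} (fun _ => z) (fun i _ => by
    rw [← hz]
    exact sub_mem (one_mem _) (mul_mem (G.teich_mem_con hπ ht) hx))
  have hzN := hzN () (Finset.mem_singleton_self _)
  rw [← hz] at hzN
  obtain ⟨t', ht', hrt'⟩ := G.exists_teich (G.residue x)
  have htt : t * t' = 1 := G.teich_unique (teich_mul ht ht') (fun _ => ⟨1, one_pow _⟩) (by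
    rw [map_mul, hrt, hrt', inv_mul_cancel₀ hx0, map_one])
  set w := y * t' with hw
  have hyw : y = t * w := by rw [hw]; linear_combination (-y) * htt
  have hwx : w * (t * x) = 1 := by rw [hw]; linear_combination x * y * htt + hxy
  -- `w` is the inverse of `t * x`, the sum of the geometric series of `1 - t * x`, and `closRing`
  -- is closed under such limits.
  have hwN : w ∈ G.closRing π N := by
    refine G.clos_of_forall π fun n => ⟨∑ k ∈ Finset.range n, (1 - t * x) ^ k,
      sum_mem fun k _ => (G.closRing π N).pow_mem hzN k, ?_⟩
    have h1 : w - ∑ k ∈ Finset.range n, (1 - t * x) ^ k = w * (1 - t * x) ^ n := by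
      have := geom_sum_mul (1 - t * x) n
      linear_combination (∑ k ∈ Finset.range n, (1 - t * x) ^ k) * hwx + w * this
    rw [h1, G.mem_pow_iff hπ, hz, mul_pow]
    exact Dvd.intro_left (w * z ^ n) (by ring)
  rw [hyw]
  exact mul_mem (G.teich_mem_con hπ ht) (G.closRing_le_con hπ hN hwN)

/-- The uniformizer of `Γ_con`. -/
def conUnif (G : GammaRing p σ₀ K Γ) {π : O} (hπ : Irreducible π) : G.con hπ :=
  ⟨algebraMap O Γ π, G.algebraMap_mem_con hπ π⟩

theorem con_isUnit_iff (G : GammaRing p σ₀ K Γ) {π : O} (hπ : Irreducible π) (x : G.con hπ) :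
    IsUnit x ↔ IsUnit (x : Γ) := by
  refine ⟨fun h => h.map (G.con hπ).subtype, fun h => ?_⟩
  obtain ⟨y, hy⟩ := h.exists_right_inv
  exact IsUnit.of_mul_eq_one ⟨y, G.inv_mem_con hπ x.2 hy⟩ (Subtype.ext hy)

/-- Division by `π` preserves overconvergence, so the `π`-adic filtration of `Γ_con` is induced by
that of `Γ`. This makes `Γ_con` a discrete valuation ring with the same uniformizer. -/
theorem con_dvd_iff (G : GammaRing p σ₀ K Γ) {π : O} (hπ : Irreducible π) (n : ℕ) (x : G.con hπ) :
    G.conUnif hπ ^ n ∣ x ↔ algebraMap O Γ π ^ n ∣ (x : Γ) := by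
  constructor
  · rintro ⟨y, rfl⟩
    exact ⟨y, rfl⟩
  · rintro ⟨y, hy⟩
    have : ∀ n : ℕ, ∀ y : Γ, algebraMap O Γ π ^ n * y ∈ G.con hπ → y ∈ G.con hπ := by
      intro n
      induction n with
      | zero => intro y hy; simpa using hy
      | succ n ih =>
        intro y hy
        rw [pow_succ, mul_assoc] at hy
        exact G.mem_con_of_unif_mul hπ (ih _ hy)
    exact ⟨⟨y, this n y (hy ▸ x.2)⟩, Subtype.ext hy⟩

theorem con_hasUnitMulPow (G : GammaRing p σ₀ K Γ) {π : O} (hπ : Irreducible π) :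
    IsDiscreteValuationRing.HasUnitMulPowIrreducibleFactorization (G.con hπ) := by
  refine ⟨G.conUnif hπ, ⟨?_, ?_⟩, fun {x} hx => ?_⟩
  · rw [G.con_isUnit_iff hπ]
    exact (G.unif_irreducible hπ).not_isUnit
  · intro a b hab
    rw [G.con_isUnit_iff hπ, G.con_isUnit_iff hπ]
    exact (G.unif_irreducible hπ).isUnit_or_isUnit (congrArg Subtype.val hab)
  · have hx' : (x : Γ) ≠ 0 := fun h => hx (Subtype.ext h)
    obtain ⟨n, u, hu⟩ := IsDiscreteValuationRing.eq_unit_mul_pow_irreducible hx'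
      (G.unif_irreducible hπ)
    obtain ⟨y, hy⟩ := (G.con_dvd_iff hπ n x).2 ⟨u, by rw [hu, mul_comm]⟩
    have hyu : (y : Γ) = u := by
      have h1 : algebraMap O Γ π ^ n * (y : Γ) = algebraMap O Γ π ^ n * u := by
        rw [mul_comm _ (u : Γ), ← hu, hy]; rfl
      exact mul_left_cancel₀ (pow_ne_zero _ (G.unif_ne_zero hπ)) h1
    have hy' : IsUnit y := by rw [G.con_isUnit_iff hπ, hyu]; exact u.isUnit
    exact ⟨n, hy'.unit, by rw [hy]; rfl⟩

instance con_dvr (G : GammaRing p σ₀ K Γ) {π : O} (hπ : Irreducible π) :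
    IsDiscreteValuationRing (G.con hπ) :=
  IsDiscreteValuationRing.ofHasUnitMulPowIrreducibleFactorization (G.con_hasUnitMulPow hπ)

theorem con_isMixed (G : GammaRing p σ₀ K Γ) {π : O} (hπ : Irreducible π) :
    IsMixed p (G.con hπ) where
  ne_zero h := G.isMixed.ne_zero (by simpa using congrArg Subtype.val h)
  mem := by
    rw [mem_maximalIdeal, mem_nonunits_iff, G.con_isUnit_iff hπ]
    simpa using G.isMixed.mem

theorem conUnif_irreducible (G : GammaRing p σ₀ K Γ) {π : O} (hπ : Irreducible π) :
    Irreducible (G.conUnif hπ) := by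
  refine ⟨?_, fun a b hab => ?_⟩
  · rw [G.con_isUnit_iff hπ]
    exact (G.unif_irreducible hπ).not_isUnit
  · rw [G.con_isUnit_iff hπ, G.con_isUnit_iff hπ]
    exact (G.unif_irreducible hπ).isUnit_or_isUnit (congrArg Subtype.val hab)

theorem coe_conFrob (G : GammaRing p σ₀ K Γ) {π : O} (hπ : Irreducible π) (x : G.con hπ) :
    (G.conFrob hπ x : Γ) = G.frob x := rfl

theorem coe_conFrob_pow (G : GammaRing p σ₀ K Γ) {π : O} (hπ : Irreducible π) (n : ℕ)
    (x : G.con hπ) : ((G.conFrob hπ ^ n) x : Γ) = (G.frob ^ n) x := by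
  induction n with
  | zero => rfl
  | succ n ih =>
    rw [pow_succ', RingHom.mul_def, RingHom.comp_apply, coe_conFrob, ih, pow_succ',
      RingHom.mul_def, RingHom.comp_apply]

theorem conFrob_bijective (G : GammaRing p σ₀ K Γ) {π : O} (hπ : Irreducible π) :
    Function.Bijective (G.conFrob hπ) := by
  refine ⟨fun x y h => Subtype.ext (G.frob_bijective.1 (congrArg Subtype.val h)), fun y => ?_⟩
  exact ⟨⟨G.frobInv y, G.frobInv_mem_con hπ y.2⟩, Subtype.ext (G.frob_frobInv y)⟩

theorem bijective_ringHom_pow {A : Type*} [CommRing A] {σ : A →+* A} (h : Function.Bijective σ)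
    (n : ℕ) : Function.Bijective (σ ^ n) := by
  rw [RingHom.coe_pow]
  exact h.iterate n

end GammaRing

/-- Every finite set of multiples of `π` in `R` is contained in a subring which is complete for the
`π`-adic topology of `R` and stable under the inverse of `σ`. -/
def HasClosedSubrings {R : Type*} [CommRing R] (σ : R →+* R) (π : R) : Prop :=
  ∀ T : Finset R, ∃ A : Subring R, (∀ x ∈ T, π * x ∈ A) ∧ (∀ x, σ x ∈ A → x ∈ A) ∧
    ∀ x : ℕ → R, (∀ n, x n ∈ A) → (∀ n, π ^ n ∣ x (n + 1) - x n) → ∃ y ∈ A, ∀ n, π ^ n ∣ y - x n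

namespace GammaRing

variable {p : ℕ} {O : Type u} [CommRing O] [IsDomain O] [IsDiscreteValuationRing O]
  {σ₀ : O →+* O} {K : Type u} [Field K] [Algebra (LaurentSeries (ResidueField O)) K]
  {Γ : Type u} [CommRing Γ] [IsDomain Γ] [IsDiscreteValuationRing Γ] [Algebra O Γ]
  [hp : Fact p.Prime] [CharP (ResidueField O) p] [PerfectField K] [CharZero O]

/-- The subring is `closRing` for an `N` that serves all elements `π * x` at once. It is closed
because it is defined by approximation, and stable under inverse Frobenius by `clos_frobInv`. -/
theorem con_hasClosedSubrings (G : GammaRing p σ₀ K Γ) {π : O} (hπ : Irreducible π) :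
    HasClosedSubrings (G.conFrob hπ) (G.conUnif hπ) := by
  intro T
  have := G.complete
  obtain ⟨N, hN, hT⟩ := G.exists_closRing hπ T (fun x => (x : Γ))
    (fun x _ => mul_mem (G.algebraMap_mem_con hπ π) x.2)
  refine ⟨(G.closRing π N).comap (G.con hπ).subtype, hT, fun x hx => ?_, fun x hx hc => ?_⟩
  · have := G.clos_frobInv hπ le_rfl hN hx
    rwa [Subring.subtype_apply, coe_conFrob, G.frobInv_frob] at this
  · have hc' : ∀ {m n}, m ≤ n → (x m : Γ) ≡ x n
        [SMOD (maximalIdeal Γ ^ m • ⊤ : Submodule Γ Γ)] := fun {m n} hmn => by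
      rw [smul_eq_mul, Ideal.mul_top]
      induction n, hmn using Nat.le_induction with
      | base => rfl
      | succ n hn ih =>
        refine ih.trans (SModEq.symm ?_)
        rw [SModEq.sub_mem]
        refine Ideal.pow_le_pow_right hn ?_
        rw [G.mem_pow_iff hπ]
        exact (G.con_dvd_iff hπ n _).1 (hc n)
    obtain ⟨y, hy⟩ := IsPrecomplete.prec' (I := maximalIdeal Γ) _ hc'
    have hy' : ∀ n, y - x n ∈ maximalIdeal Γ ^ n := fun n => by
      have := (hy n).symm
      rwa [smul_eq_mul, Ideal.mul_top, SModEq.sub_mem] at this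
    have hyN : y ∈ G.closRing π N := G.clos_of_forall π fun n => ⟨x n, hx n, hy' n⟩
    refine ⟨⟨y, G.closRing_le_con hπ hN hyN⟩, hyN, fun n => ?_⟩
    rw [G.con_dvd_iff hπ, ← G.mem_pow_iff hπ]
    exact hy' n

end GammaRing

/-! ### Overconvergence of solutions of Frobenius equations -/

namespace GammaRing

variable {p : ℕ} {O : Type u} [CommRing O] [IsDomain O] [IsDiscreteValuationRing O]
  {σ₀ : O →+* O} {K : Type u} [Field K] [Algebra (LaurentSeries (ResidueField O)) K]
  {Γ : Type u} [CommRing Γ] [IsDomain Γ] [IsDiscreteValuationRing Γ] [Algebra O Γ]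
  [hp : Fact p.Prime] [CharP (ResidueField O) p] [PerfectField K] [CharZero O]

theorem frobInv_pow_frob_pow (G : GammaRing p σ₀ K Γ) (m : ℕ) (x : Γ) :
    (G.frobInv ^ m) ((G.frob ^ m) x) = x := by
  rw [RingHom.coe_pow, RingHom.coe_pow]
  exact Function.LeftInverse.iterate G.frobInv_frob m x

theorem frob_pow_frobInv_pow (G : GammaRing p σ₀ K Γ) (m : ℕ) (x : Γ) :
    (G.frob ^ m) ((G.frobInv ^ m) x) = x := by
  rw [RingHom.coe_pow, RingHom.coe_pow]
  exact Function.LeftInverse.iterate G.frob_frobInv m x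

theorem frobInv_pow_induction {P : Γ → Prop} (G : GammaRing p σ₀ K Γ)
    (h : ∀ x, P x → P (G.frobInv x)) (m : ℕ) {x : Γ} (hx : P x) : P ((G.frobInv ^ m) x) := by
  induction m with
  | zero => exact hx
  | succ m ih => rw [pow_succ', RingHom.mul_def, RingHom.comp_apply]; exact h _ ih

theorem frobInv_pow_unif (G : GammaRing p σ₀ K Γ) {π : O} (hπ : Irreducible π) (m : ℕ) :
    ∃ u : Γ, G.IsConst u ∧ (G.frobInv ^ m) (algebraMap O Γ π) = algebraMap O Γ π * u := by
  obtain ⟨u, hu, hu'⟩ := G.frobInv_unif hπ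
  refine G.frobInv_pow_induction (P := fun x => ∃ u : Γ, G.IsConst u ∧ x = algebraMap O Γ π * u)
    ?_ m ⟨1, by simpa using G.const_algebraMap 1, (mul_one _).symm⟩
  rintro x ⟨v, hv, rfl⟩
  exact ⟨u * G.frobInv v, G.const_mul hu (G.const_frobInv hv), by rw [map_mul, hu', mul_assoc]⟩

theorem residue_frobInv_pow_pow (G : GammaRing p σ₀ K Γ) (x : Γ) (m : ℕ) :
    G.residue ((G.frobInv ^ m) x) ^ p ^ m = G.residue x := by
  rw [← G.residue_frob_pow, G.frob_pow_frobInv_pow]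

theorem exists_teich_val (G : GammaRing p σ₀ K Γ) (j : ℕ) :
    ∃ t t' : Γ, IsTeichmuller p t ∧ IsTeichmuller p t' ∧ t * t' = 1 ∧
      G.val (G.residue t) = ((j : ℝ) : WithTop ℝ) := by
  have hT : (HahnSeries.single (1 : ℤ) (1 : ResidueField O)) ≠ 0 := by simp
  set T : K := algebraMap (LaurentSeries (ResidueField O)) K (HahnSeries.single (1 : ℤ) 1) with hTd
  have hT0 : T ≠ 0 := by rw [hTd]; simp [hT]
  have hv : G.val T = ((1 : ℝ) : WithTop ℝ) := by
    rw [hTd, G.val_algebraMap _ hT, HahnSeries.order_single (by simp)]; simp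
  obtain ⟨t, ht, hr⟩ := G.exists_teich (T ^ j)
  obtain ⟨t', ht', hr'⟩ := G.exists_teich (T ^ j)⁻¹
  refine ⟨t, t', ht, ht', G.teich_unique (teich_mul ht ht') (fun _ => ⟨1, one_pow _⟩) ?_, ?_⟩
  · rw [map_mul, hr, hr', mul_inv_cancel₀ (pow_ne_zero _ hT0), map_one]
  · rw [hr, G.val.map_pow, hv, ← WithTop.coe_nsmul, nsmul_eq_mul, mul_one]

theorem le_val_sum (G : GammaRing p σ₀ K Γ) {ι : Type*} (s : Finset ι) (f : ι → K) {c : WithTop ℝ}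
    (h : ∀ i ∈ s, c ≤ G.val (f i)) : c ≤ G.val (∑ i ∈ s, f i) := by
  classical
  induction s using Finset.induction_on with
  | empty => simp
  | insert a s ha ih =>
    rw [Finset.sum_insert ha]
    exact (le_min (h _ (Finset.mem_insert_self _ _))
      (ih fun i hi => h i (Finset.mem_insert_of_mem hi))).trans (G.val.map_add _ _)

/-- The valuations of a solution of `z = r + B * z ^ (1 / q)` with `B` integral. -/
theorem le_val_of_root_eq (G : GammaRing p σ₀ K Γ) {ι : Type*} [Fintype ι] {q : ℕ} (hq : 2 ≤ q)
    {C : ℝ} (hC : 0 ≤ C) (B : ι → ι → K) (z y r : ι → K) (hy : ∀ i, y i ^ q = z i)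
    (hB : ∀ i j, ((0 : ℝ) : WithTop ℝ) ≤ G.val (B i j))
    (hr : ∀ i, ((-C : ℝ) : WithTop ℝ) ≤ G.val (r i))
    (h : ∀ i, z i = r i + ∑ j, B i j * y j) (i : ι) : ((-C : ℝ) : WithTop ℝ) ≤ G.val (z i) := by
  -- Let `m` be the minimal valuation and suppose `m < -C ≤ 0`. The `q`-th roots have valuation at
  -- least `m / q > m`, so both terms on the right-hand side have valuation greater than `m`, which
  -- is impossible at `i₀`.
  obtain ⟨i₀, -, hi₀⟩ := Finset.exists_min_image Finset.univ (fun i => G.val (z i))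
    ⟨i, Finset.mem_univ i⟩
  refine le_trans ?_ (hi₀ i (Finset.mem_univ i))
  by_contra hlt
  rw [not_le] at hlt
  obtain ⟨m, hm⟩ := WithTop.ne_top_iff_exists.1 hlt.ne_top
  rw [← hm, WithTop.coe_lt_coe] at hlt
  have hq0 : (0 : ℝ) < q := by exact_mod_cast (by lia : 0 < q)
  have hmq : m < m / q := by
    rw [lt_div_iff₀ hq0]
    have : (2 : ℝ) ≤ q := by exact_mod_cast hq
    nlinarith
  have h1 : ((min (-C) (m / q) : ℝ) : WithTop ℝ) ≤ G.val (z i₀) := by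
    rw [h i₀]
    refine le_trans (le_min ?_ ?_) (G.val.map_add _ _)
    · exact le_trans (WithTop.coe_le_coe.2 (min_le_left _ _)) (hr _)
    · refine G.le_val_sum _ _ fun j _ => ?_
      rw [G.val.map_mul]
      have h2 : ((m / q : ℝ) : WithTop ℝ) ≤ G.val (y j) := by
        refine le_of_nsmul_le (by lia) ?_
        rw [← G.val.map_pow, hy, hm]
        exact hi₀ j (Finset.mem_univ j)
      refine le_trans ?_ (add_le_add (hB i₀ j) h2)
      rw [← WithTop.coe_add, zero_add, WithTop.coe_le_coe]
      exact min_le_right _ _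
  rw [← hm, WithTop.coe_le_coe] at h1
  exact absurd h1 (not_le.2 (lt_min hlt hmq))

/-- The expansion of `v` is built one Teichmüller term at a time. Write `v = α + π ^ k * ω` with `α`
in the ring. The residue `z` of `ω` satisfies `z = r + B z ^ (1 / q)`, where `π ^ k` times a lift of
`r` is a combination of elements of the ring, so `r` has valuation at least `-(N * k)`. By
`le_val_of_root_eq` so has `z`, which is the bound required for the next term. -/
theorem mem_clos_of_eq_frobInv (G : GammaRing p σ₀ K Γ) {π : O} (hπ : Irreducible π) {ι : Type*}
    [Fintype ι] {m : ℕ} (hm : 0 < m) {N : ℝ} (hN : 0 ≤ N) (B : ι → ι → Γ)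
    (hB : ∀ i j, B i j ∈ G.closRing π N) (v : ι → Γ)
    (hv : ∀ i, v i = ∑ j, B i j * (G.frobInv ^ m) (v j)) (i : ι) : v i ∈ G.closRing π N := by
  have hq : 2 ≤ p ^ m := hp.out.two_le.trans (Nat.le_self_pow hm.ne' p)
  obtain ⟨u, huc, hu⟩ := G.frobInv_pow_unif hπ m
  have key : ∀ k : ℕ, ∀ i, ∃ α ∈ G.closRing π N, ∃ ω, v i = α + algebraMap O Γ π ^ k * ω := by
    intro k
    induction k with
    | zero => exact fun i => ⟨0, zero_mem _, v i, by simp⟩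
    | succ k ih =>
      choose α hα ω hω using ih
      have hz := G.le_val_of_root_eq hq (C := N * k) (by positivity)
        (fun i j => G.residue (u ^ k * B i j)) (fun i => G.residue (ω i))
        (fun j => G.residue ((G.frobInv ^ m) (ω j)))
        (fun i => G.residue (ω i - ∑ j, u ^ k * B i j * (G.frobInv ^ m) (ω j)))
        (fun i => G.residue_frobInv_pow_pow _ _) (fun i j => ?_) (fun i => ?_) (fun i => ?_)
      · intro i
        obtain ⟨t, ht, hrt⟩ := G.exists_teich (G.residue (ω i))
        have h1 : ω i - t ∈ maximalIdeal Γ ^ 1 := by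
          rw [pow_one, G.mem_max_iff, map_sub, hrt, sub_self]
        rw [G.mem_pow_iff hπ, pow_one] at h1
        obtain ⟨ω', hω'⟩ := h1
        refine ⟨α i + algebraMap O Γ π ^ k * t, add_mem (hα i) ?_, ω', ?_⟩
        · refine G.teich_mem_clos π k ht ?_
          rw [zero_add, hrt]
          exact hz i
        · rw [hω i]; linear_combination algebraMap O Γ π ^ k * hω'
      · have h1 : u ^ k * B i j ∈ G.closRing π N :=
          mul_mem (G.const_mem_clos π (G.const_pow huc k)) (hB i j)
        simpa using G.val_of_unif_pow_mul hπ hN 0 (s := 0) (x := u ^ k * B i j)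
          (by rw [pow_zero, one_mul]; exact h1)
      · have h1 := G.val_of_unif_pow_mul hπ hN k (s := 0)
          (x := ω i - ∑ j, u ^ k * B i j * (G.frobInv ^ m) (ω j)) ?_
        · simpa using h1
        · have h2 : algebraMap O Γ π ^ k * (ω i - ∑ j, u ^ k * B i j * (G.frobInv ^ m) (ω j)) =
              ∑ j, B i j * (G.frobInv ^ m) (α j) - α i := by
            have h3 := hv i
            have h4 : ∀ j, B i j * (G.frobInv ^ m) (v j) = B i j * (G.frobInv ^ m) (α j) +
                algebraMap O Γ π ^ k * (u ^ k * B i j * (G.frobInv ^ m) (ω j)) := fun j => by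
              rw [hω j, map_add, map_mul, map_pow, hu]; ring
            simp_rw [h4] at h3
            rw [hω i, Finset.sum_add_distrib, ← Finset.mul_sum] at h3
            linear_combination h3
          rw [h2]
          exact sub_mem (sum_mem fun j _ => mul_mem (S := Subring Γ) (hB i j)
            (G.frobInv_pow_induction (P := fun x => x ∈ G.closRing π N)
              (fun x hx => G.clos_frobInv hπ le_rfl hN hx) m (hα j))) (hα i)
      · simp only [map_sub, map_sum, map_mul]
        ring
  refine G.clos_of_forall π fun n => ?_
  obtain ⟨α, hα, ω, hω⟩ := key n i
  refine ⟨α, hα, ?_⟩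
  rw [G.mem_pow_iff hπ, hω, add_sub_cancel_left]
  exact dvd_mul_right _ _

/-- Solutions in `Γ` of `frob ^ m (v) = B * v` with `B` overconvergent are overconvergent. -/
theorem mem_con_of_frob_eq (G : GammaRing p σ₀ K Γ) {π : O} (hπ : Irreducible π) {ι : Type*}
    [Fintype ι] {m : ℕ} (hm : 0 < m) (B : ι → ι → Γ) (hB : ∀ i j, B i j ∈ G.con hπ) (v : ι → Γ)
    (hv : ∀ i, (G.frob ^ m) (v i) = ∑ j, B i j * v j) (i : ι) : v i ∈ G.con hπ := by
  obtain ⟨s, N, hs, hN, h⟩ := G.exists_clos hπ (Finset.univ (α := ι × ι))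
    (fun x => (G.frobInv ^ m) (B x.1 x.2)) (fun x _ =>
      G.frobInv_pow_induction (P := fun x => x ∈ G.con hπ) (fun x => G.frobInv_mem_con hπ) m
        (hB x.1 x.2))
  -- With `q = p ^ m` and `t` a Teichmüller lift of valuation `J ≥ s`, the vector `t ^ q * v`
  -- satisfies an equation with matrix `t ^ (q - 1) * frobInv ^ m (B)`. As `q - 1 ≥ 1`, the factor
  -- compensates the constant `s`, and the matrix has entries in `closRing`.
  obtain ⟨J, hJ⟩ := exists_nat_ge s
  obtain ⟨t, t', ht, ht', htt, hval⟩ := G.exists_teich_val J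
  have hq : 1 ≤ p ^ m - 1 := by
    have := hp.out.two_le.trans (Nat.le_self_pow hm.ne' p)
    lia
  have hqs : t ^ p ^ m = t ^ (p ^ m - 1) * t := by
    rw [← pow_succ, Nat.sub_add_cancel (Nat.one_le_pow _ _ hp.out.pos)]
  have hw := G.mem_clos_of_eq_frobInv hπ hm hN
    (fun i j => t ^ (p ^ m - 1) * (G.frobInv ^ m) (B i j)) (fun i j => ?_)
    (fun i => t ^ p ^ m * v i) (fun i => ?_) i
  · have h1 := G.closRing_le_con hπ hN hw
    have h2 : v i = t' ^ p ^ m * (t ^ p ^ m * v i) := by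
      rw [← mul_assoc, ← mul_pow, mul_comm t', htt, one_pow, one_mul]
    rw [h2]
    exact mul_mem (G.teich_mem_con hπ (teich_pow ht' _)) h1
  · have h1 : t ^ (p ^ m - 1) ∈ G.clos π (-s) N := by
      have := G.teich_mem_clos π (s := -s) (N := N) 0 (teich_pow ht (p ^ m - 1)) ?_
      · simpa using this
      · rw [map_pow, G.val.map_pow, hval, ← WithTop.coe_nsmul, WithTop.coe_le_coe, nsmul_eq_mul]
        have : (1 : ℝ) ≤ ((p ^ m - 1 : ℕ) : ℝ) := by exact_mod_cast hq
        have hJ0 : (0 : ℝ) ≤ J := by positivity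
        simp only [Nat.cast_zero, mul_zero, add_zero, neg_neg]
        nlinarith
    have := G.clos_mul π h1 (h (i, j) (Finset.mem_univ _))
    rwa [neg_add_cancel] at this
  · have h1 : v i = ∑ j, (G.frobInv ^ m) (B i j) * (G.frobInv ^ m) (v j) := by
      rw [← G.frobInv_pow_frob_pow m (v i), hv, map_sum]
      simp_rw [map_mul]
    have h2 : (G.frobInv ^ m) (t ^ p ^ m) = t := by
      rw [← G.teich_frob_pow ht, G.frobInv_pow_frob_pow]
    rw [h1, Finset.mul_sum]
    refine Finset.sum_congr rfl fun j _ => ?_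
    rw [map_mul, h2, hqs]; ring

end GammaRing

/-! ### Growth of semilinear maps over a valued field -/

section Growth

variable {E : Type*} [Field E] (v : AbsoluteValue E ℝ)
  {V : Type*} [AddCommGroup V] [Module E V]

/-- The norm on `V` for which `e` is an orthogonal basis with norms `c`. -/
def wnorm {ι : Type*} (e : Module.Basis ι E V) (c : ι → ℝ) (x : V) : ℝ := ⨆ i, v (e.repr x i) * c i

variable {v} {ι : Type*} [Finite ι] (e : Module.Basis ι E V) {c : ι → ℝ}

theorem le_wnorm (x : V) (i : ι) : v (e.repr x i) * c i ≤ wnorm v e c x :=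
  le_ciSup (f := fun i => v (e.repr x i) * c i) (Set.finite_range _).bddAbove i

theorem wnorm_le {x : V} {C : ℝ} (hC : 0 ≤ C) (h : ∀ i, v (e.repr x i) * c i ≤ C) :
    wnorm v e c x ≤ C := Real.iSup_le h hC

theorem wnorm_nonneg (hc : ∀ i, 0 < c i) (x : V) : 0 ≤ wnorm v e c x :=
  Real.iSup_nonneg fun i => mul_nonneg (v.nonneg _) (hc i).le

theorem wnorm_smul (a : E) (x : V) : wnorm v e c (a • x) = v a * wnorm v e c x := by
  simp only [wnorm, map_smul, Finsupp.smul_apply, smul_eq_mul, map_mul, mul_assoc]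
  rw [Real.mul_iSup_of_nonneg (v.nonneg a)]

theorem wnorm_basis (hc : ∀ i, 0 < c i) (j : ι) : wnorm v e c (e j) = c j := by
  classical
  refine le_antisymm (wnorm_le e (hc j).le fun i => ?_) ?_
  · rw [e.repr_self, Finsupp.single_apply]
    split_ifs with h
    · rw [map_one, one_mul, h]
    · rw [map_zero, zero_mul]; exact (hc j).le
  · simpa using le_wnorm (v := v) (c := c) e (e j) j

theorem wnorm_add_le (hna : IsNonarchimedean v) (hc : ∀ i, 0 < c i) (x y : V) :
    wnorm v e c (x + y) ≤ max (wnorm v e c x) (wnorm v e c y) := by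
  refine wnorm_le e (le_max_of_le_left (wnorm_nonneg e hc x)) fun i => ?_
  rw [map_add, Finsupp.add_apply]
  refine (mul_le_mul_of_nonneg_right (hna _ _) (hc i).le).trans ?_
  rw [max_mul_of_nonneg _ _ (hc i).le]
  exact max_le_max (le_wnorm e _ _) (le_wnorm e _ _)

theorem wnorm_sum_le (hna : IsNonarchimedean v) (hc : ∀ i, 0 < c i) {κ : Type*} (s : Finset κ)
    (f : κ → V) {C : ℝ} (hC : 0 ≤ C) (h : ∀ i ∈ s, wnorm v e c (f i) ≤ C) :
    wnorm v e c (∑ i ∈ s, f i) ≤ C := by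
  classical
  induction s using Finset.induction_on with
  | empty => exact wnorm_le e hC fun i => by simpa using hC
  | insert a s ha ih =>
    rw [Finset.sum_insert ha]
    exact (wnorm_add_le e hna hc _ _).trans (max_le (h _ (Finset.mem_insert_self _ _))
      (ih fun i hi => h _ (Finset.mem_insert_of_mem hi)))

variable {V' : Type*} [AddCommGroup V'] [Module E V']

theorem wnorm_map_le (hna : IsNonarchimedean v) {σ : E →+* E} (hσ : ∀ x, v (σ x) = v x)
    (hc : ∀ i, 0 < c i) {κ : Type*} [Finite κ] (e' : Module.Basis κ E V') {c' : κ → ℝ}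
    (hc' : ∀ i, 0 < c' i) (B : V →ₛₗ[σ] V') {C : ℝ} (hC : 0 ≤ C)
    (h : ∀ j, wnorm v e' c' (B (e j)) ≤ C * c j) (x : V) :
    wnorm v e' c' (B x) ≤ C * wnorm v e c x := by
  cases nonempty_fintype ι
  rw [← e.sum_repr x, map_sum]
  refine wnorm_sum_le e' hna hc' _ _ (mul_nonneg hC (wnorm_nonneg e hc _)) fun j _ => ?_
  rw [map_smulₛₗ, wnorm_smul, hσ, e.sum_repr]
  calc v (e.repr x j) * wnorm v e' c' (B (e j)) ≤ v (e.repr x j) * (C * c j) :=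
        mul_le_mul_of_nonneg_left (h j) (v.nonneg _)
    _ = C * (v (e.repr x j) * c j) := by ring
    _ ≤ _ := mul_le_mul_of_nonneg_left (le_wnorm e x j) hC

theorem exists_wnorm_map_le (hna : IsNonarchimedean v) {σ : E →+* E} (hσ : ∀ x, v (σ x) = v x)
    (hc : ∀ i, 0 < c i) {κ : Type*} [Finite κ] (e' : Module.Basis κ E V') {c' : κ → ℝ}
    (hc' : ∀ i, 0 < c' i) (B : V →ₛₗ[σ] V') :
    ∃ C : ℝ, 0 < C ∧ ∀ x, wnorm v e' c' (B x) ≤ C * wnorm v e c x := by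
  cases nonempty_fintype ι
  have hn : ∀ j, 0 ≤ wnorm v e' c' (B (e j)) / c j := fun j =>
    div_nonneg (wnorm_nonneg e' hc' _) (hc j).le
  have h0 : 0 ≤ ∑ j, wnorm v e' c' (B (e j)) / c j := Finset.sum_nonneg fun j _ => hn j
  refine ⟨∑ j, wnorm v e' c' (B (e j)) / c j + 1, by positivity,
    wnorm_map_le e hna hσ hc e' hc' B (by positivity) fun j => ?_⟩
  rw [← div_le_iff₀ (hc j)]
  have := Finset.single_le_sum (fun j _ => hn j) (Finset.mem_univ j)
  linarith

variable (v) in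
/-- Some norm is scaled by at most `ρ` under `B`. -/
def GrowthLE {σ : E →+* E} (B : V →ₛₗ[σ] V) (ρ : ℝ) : Prop :=
  ∃ (n : ℕ) (e : Module.Basis (Fin n) E V) (c : Fin n → ℝ), (∀ i, 0 < c i) ∧
    ∀ x, wnorm v e c (B x) ≤ ρ * wnorm v e c x

variable (v) in
/-- Some vector grows at least at the rate `ρ` under the iterates of `B`. -/
def GrowthGE {σ : E →+* E} (B : V →ₛₗ[σ] V) (ρ : ℝ) : Prop :=
  ∃ (n : ℕ) (e : Module.Basis (Fin n) E V) (c : Fin n → ℝ) (y : V) (δ : ℝ), (∀ i, 0 < c i) ∧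
    0 < δ ∧ ∀ m : ℕ, δ * ρ ^ m ≤ wnorm v e c (B^[m] y)

/-- Linear maps between finite-dimensional spaces are bounded, so a lower bound on the orbit of an
image vector is, up to a constant, a lower bound on the orbit upstairs. -/
theorem GrowthGE.of_linearMap (hna : IsNonarchimedean v) {σ : E →+* E} {B : V →ₛₗ[σ] V}
    {B' : V' →ₛₗ[σ] V'} [FiniteDimensional E V] (g : V →ₗ[E] V')
    (hg : ∀ y' : V', ∃ y : V, ∀ m, g (B^[m] y) = B'^[m] y') {ρ : ℝ} (h : GrowthGE v B' ρ) :
    GrowthGE v B ρ := by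
  obtain ⟨n, e', c', y', δ, hc', hδ, h⟩ := h
  obtain ⟨y, hy⟩ := hg y'
  let e := Module.finBasis E V
  obtain ⟨C, hC, hCle⟩ := exists_wnorm_map_le (v := v) e (c := fun _ => 1) hna (fun _ => rfl)
    (fun _ => one_pos) e' hc' g
  refine ⟨_, e, fun _ => 1, y, δ / C, fun _ => one_pos, by positivity, fun m => ?_⟩
  have h1 := (h m).trans ((congrArg _ (hy m)).symm.le.trans (hCle (B^[m] y)))
  rw [div_mul_eq_mul_div, div_le_iff₀ hC]
  linarith

theorem GrowthLE.mono {σ : E →+* E} {B : V →ₛₗ[σ] V} {ρ ρ' : ℝ} (h : GrowthLE v B ρ)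
    (hρ : ρ ≤ ρ') : GrowthLE v B ρ' := by
  obtain ⟨n, e, c, hc, h⟩ := h
  exact ⟨n, e, c, hc, fun x =>
    (h x).trans (mul_le_mul_of_nonneg_right hρ (wnorm_nonneg e hc x))⟩

theorem GrowthLE.of_fintype {σ : E →+* E} {B : V →ₛₗ[σ] V} {ρ : ℝ} {κ : Type*} [Fintype κ]
    (e : Module.Basis κ E V) {c : κ → ℝ} (hc : ∀ i, 0 < c i)
    (h : ∀ x, wnorm v e c (B x) ≤ ρ * wnorm v e c x) : GrowthLE v B ρ := by
  let φ := Fintype.equivFin κ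
  have : ∀ x, wnorm v (e.reindex φ) (c ∘ φ.symm) x = wnorm v e c x := fun x => by
    rw [wnorm, wnorm, ← φ.symm.iSup_comp]
    simp
  exact ⟨_, e.reindex φ, c ∘ φ.symm, fun i => hc _, fun x => by rw [this, this]; exact h x⟩

/-- In a basis adapted to `W` the map is block triangular. Multiplying the norm of the quotient part
by a large factor `k` makes the off-diagonal block harmless, so that the rate stays exactly `ρ`. -/
theorem GrowthLE.extension (hna : IsNonarchimedean v) {σ : E →+* E} (hσ : ∀ x, v (σ x) = v x)
    {B : V →ₛₗ[σ] V} {W : Submodule E V} (hW : ∀ x ∈ W, B x ∈ W) {ρ : ℝ} (hρ : 0 < ρ)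
    (h₁ : GrowthLE v (B.restrict hW) ρ) (h₂ : GrowthLE v (W.mapQ W B hW) ρ) : GrowthLE v B ρ := by
  obtain ⟨n₁, e₁, c₁, hc₁, h₁⟩ := h₁
  obtain ⟨n₂, e₂, c₂, hc₂, h₂⟩ := h₂
  set e := e₁.sumQuot e₂ with he
  have hn : ∀ x : Fin n₁ × Fin n₂, 0 ≤
      v (e.repr (B (e (Sum.inr x.2))) (Sum.inl x.1)) * c₁ x.1 / (ρ * c₂ x.2) := fun x =>
    div_nonneg (mul_nonneg (v.nonneg _) (hc₁ _).le) (mul_pos hρ (hc₂ _)).le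
  set k : ℝ := ∑ x : Fin n₁ × Fin n₂,
    v (e.repr (B (e (Sum.inr x.2))) (Sum.inl x.1)) * c₁ x.1 / (ρ * c₂ x.2) + 1 with hk
  have hk0 : 0 < k := by
    have := Finset.sum_nonneg fun x (_ : x ∈ Finset.univ) => hn x
    positivity
  have hc : ∀ i, 0 < Sum.elim c₁ (fun j => k * c₂ j) i := by
    rintro (i | j)
    · exact hc₁ i
    · exact mul_pos hk0 (hc₂ j)
  refine GrowthLE.of_fintype e (c := Sum.elim c₁ (fun j => k * c₂ j)) hc
    (wnorm_map_le e hna hσ hc e hc B hρ.le ?_)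
  rintro (j | j)
  · refine wnorm_le e (mul_nonneg hρ.le (hc _).le) ?_
    have hm : B (e (Sum.inl j)) ∈ W := by
      rw [he, Module.Basis.sumQuot_inl]; exact hW _ (e₁ j).2
    rintro (i | i)
    · rw [he, Module.Basis.sumQuot_repr_inl_of_mem _ _ _ hm]
      have h3 := (le_wnorm (v := v) (c := c₁) e₁ (B.restrict hW (e₁ j)) i).trans (h₁ (e₁ j))
      rw [wnorm_basis e₁ hc₁] at h3
      have h4 : (⟨B (e (Sum.inl j)), hm⟩ : W) = B.restrict hW (e₁ j) :=
        Subtype.ext (congrArg B (Module.Basis.sumQuot_inl e₁ e₂ j))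
      simp only [Sum.elim_inl]
      rw [h4]
      exact h3
    · rw [he, Module.Basis.sumQuot_repr_inr_of_mem _ _ _ hm]
      simpa using mul_nonneg hρ.le (hc₁ j).le
  · refine wnorm_le e (mul_nonneg hρ.le (hc _).le) ?_
    rintro (i | i)
    · have h3 := Finset.single_le_sum (fun x (_ : x ∈ Finset.univ) => hn x)
        (Finset.mem_univ (i, j))
      have h4 : v (e.repr (B (e (Sum.inr j))) (Sum.inl i)) * c₁ i / (ρ * c₂ j) ≤ k := by
        rw [hk]; exact h3.trans (by linarith)
      rw [div_le_iff₀ (mul_pos hρ (hc₂ j))] at h4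
      simp only [Sum.elim_inl, Sum.elim_inr]
      linarith
    · have h3 := (le_wnorm (v := v) (c := c₂) e₂ (W.mapQ W B hW (e₂ j)) i).trans (h₂ (e₂ j))
      rw [wnorm_basis e₂ hc₂] at h3
      have h4 : W.mapQ W B hW (e₂ j) = W.mkQ (B (e (Sum.inr j))) := by
        rw [← Module.Basis.sumQuot_inr e₁ e₂ j]; rfl
      rw [h4] at h3
      simp only [Sum.elim_inr]
      rw [he, Module.Basis.sumQuot_repr_inr, ← he]
      nlinarith

end Growth

/-! ### Cyclic vectors of semilinear maps -/

section Cyclic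

variable {E : Type*} [Field E] {V : Type*} [AddCommGroup V] [Module E V]

/-- The subspace generated by the iterates of a vector. -/
theorem exists_cyclic [FiniteDimensional E V] {σ : E →+* E} (B : V →ₛₗ[σ] V) {x : V} (hx : x ≠ 0) :
    ∃ (d : ℕ) (a : Fin (d + 1) → E), LinearIndependent E (fun i : Fin (d + 1) => B^[i] x) ∧
      B^[d + 1] x = ∑ i, a i • B^[i] x := by
  classical
  have hex : ∃ d, ¬ LinearIndependent E (fun i : Fin d => B^[i] x) := by
    refine ⟨Module.finrank E V + 1, fun h => ?_⟩
    have := h.fintype_card_le_finrank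
    simp at this
  have h1 := Nat.find_spec hex
  have hmin := fun m => Nat.find_min hex (m := m)
  set D := Nat.find hex
  have hD0 : D ≠ 0 := by
    intro h0
    rw [h0] at h1
    exact h1 (linearIndependent_empty_type)
  have hD1 : D ≠ 1 := by
    intro h0
    rw [h0] at h1
    refine h1 ?_
    rw [linearIndependent_unique_iff]
    simpa using hx
  obtain ⟨d, hd⟩ : ∃ d, D = d + 1 + 1 := ⟨D - 2, by lia⟩
  rw [hd] at h1 hmin
  have h2 := not_not.1 (hmin (d + 1) (Nat.lt_succ_self _))
  rw [linearIndependent_finSucc'] at h1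
  have h3 : B^[d + 1] x ∈ Submodule.span E (Set.range fun i : Fin (d + 1) => B^[i] x) := by
    by_contra h4
    exact h1 ⟨h2, h4⟩
  obtain ⟨a, ha⟩ := (Submodule.mem_span_range_iff_exists_fun E).1 h3
  exact ⟨d, a, h2, ha.symm⟩

theorem surjective_of_injective_semilinear [FiniteDimensional E V] {σ : E →+* E}
    (hσ : Function.Bijective σ) (B : V →ₛₗ[σ] V) (hB : Function.Injective B) :
    Function.Surjective B := by
  let e := Module.finBasis E V
  have hli : LinearIndependent E (fun i => B (e i)) := by
    rw [Fintype.linearIndependent_iff]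
    intro g hg
    choose g' hg' using fun i => hσ.2 (g i)
    have h1 : B (∑ i, g' i • e i) = 0 := by
      rw [map_sum, ← hg]
      exact Finset.sum_congr rfl fun i _ => by rw [map_smulₛₗ, hg']
    have h2 := hB (h1.trans (map_zero B).symm)
    intro i
    rw [← hg' i, Fintype.linearIndependent_iff.1 e.linearIndependent g' h2 i, map_zero]
  intro y
  have hy : y ∈ Submodule.span E (Set.range fun i => B (e i)) := by
    rw [hli.span_eq_top_of_card_eq_finrank' (by simp)]
    trivial
  obtain ⟨a, rfl⟩ := (Submodule.mem_span_range_iff_exists_fun E).1 hy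
  choose a' ha' using fun i => hσ.2 (a i)
  exact ⟨∑ i, a' i • e i, by
    rw [map_sum]; exact Finset.sum_congr rfl fun i _ => by rw [map_smulₛₗ, ha']⟩

end Cyclic

/-! ### Newton polygons and growth rates -/

section CyclicGrowth

variable {E : Type*} [Field E] {v : AbsoluteValue E ℝ} (hna : IsNonarchimedean v)
  {σ : E →+* E} (hσ : ∀ x, v (σ x) = v x) {V : Type*} [AddCommGroup V] [Module E V]
include hna hσ

/-- The rate of growth of a companion matrix is given by its Newton polygon. -/
theorem exists_growth_companion (B : V →ₛₗ[σ] V) {d : ℕ} (e : Module.Basis (Fin (d + 1)) E V)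
    (a : Fin (d + 1) → E) (hB : ∀ i : Fin d, B (e i.castSucc) = e i.succ)
    (hB' : B (e (Fin.last d)) = ∑ i, a i • e i) (ha : ∃ i, a i ≠ 0) :
    ∃ ρ : ℝ, 0 < ρ ∧ GrowthLE v B ρ ∧ GrowthGE v B ρ ∧ ∃ (x : E) (k : ℕ), x ≠ 0 ∧ 0 < k ∧
      ρ ^ k = v x := by
  classical
  set k : Fin (d + 1) → ℕ := fun i => d + 1 - i with hk
  have hk0 : ∀ i, k i ≠ 0 := fun i => by have := i.2; simp only [hk]; lia
  have hki : ∀ i, k i + i = d + 1 := fun i => by have := i.2; simp only [hk]; lia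
  -- `ρ` is the largest of the numbers `|a i| ^ (1 / (d + 1 - i))`, an extremal slope of the Newton
  -- polygon. With the weight `ρ ^ i` on `e i`, the map multiplies norms by at most `ρ`.
  obtain ⟨i₁, -, hi₁⟩ := Finset.exists_max_image Finset.univ
    (fun i => (v (a i)) ^ ((k i : ℝ)⁻¹)) ⟨0, Finset.mem_univ _⟩
  set ρ := (v (a i₁)) ^ ((k i₁ : ℝ)⁻¹) with hρd
  have hle : ∀ i, v (a i) ≤ ρ ^ k i := fun i => by
    rw [← Real.rpow_inv_natCast_pow (v.nonneg (a i)) (hk0 i)]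
    exact pow_le_pow_left₀ (Real.rpow_nonneg (v.nonneg _) _) (hi₁ i (Finset.mem_univ i)) _
  have heq₁ : v (a i₁) = ρ ^ k i₁ := (Real.rpow_inv_natCast_pow (v.nonneg _) (hk0 i₁)).symm
  have hρ : 0 < ρ := by
    obtain ⟨i, hi⟩ := ha
    exact (Real.rpow_pos_of_pos (v.pos hi) _).trans_le (hi₁ i (Finset.mem_univ i))
  -- The first index at which the maximum is attained; before it, `|a i| < ρ ^ k i` strictly. This
  -- is what excludes cancellation below.
  obtain ⟨i₀, hi₀, hmin⟩ := Finset.exists_min_image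
    (Finset.univ.filter fun i => v (a i) = ρ ^ k i) id ⟨i₁, by simpa using heq₁⟩
  simp only [Finset.mem_filter, Finset.mem_univ, true_and, id] at hi₀ hmin
  have hlt : ∀ i < i₀, v (a i) < ρ ^ k i := fun i hi =>
    lt_of_le_of_ne (hle i) fun h => absurd (hmin i h) (not_le.2 hi)
  have hc : ∀ i : Fin (d + 1), 0 < ρ ^ (i : ℕ) := fun i => pow_pos hρ _
  have hpow : ∀ i : Fin (d + 1), ρ ^ k i * ρ ^ (i : ℕ) = ρ * ρ ^ d := fun i => by
    rw [← pow_add, hki, pow_succ']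
  have hrepr0 : ∀ y, e.repr (B y) 0 = σ (e.repr y (Fin.last d)) * a 0 := fun y => by
    nth_rewrite 1 [← e.sum_repr y]
    rw [map_sum, map_sum, Finsupp.finsetSum_apply, Fin.sum_univ_castSucc]
    simp only [map_smulₛₗ, hB, hB', map_sum, e.repr_self, Finsupp.smul_apply,
      Finsupp.finsetSum_apply, Finsupp.single_apply, RingHom.id_apply, smul_eq_mul]
    simp
  have hreprs : ∀ y (j : Fin d), e.repr (B y) j.succ =
      σ (e.repr y j.castSucc) + σ (e.repr y (Fin.last d)) * a j.succ := fun y j => by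
    nth_rewrite 1 [← e.sum_repr y]
    rw [map_sum, map_sum, Finsupp.finsetSum_apply, Fin.sum_univ_castSucc]
    simp only [map_smulₛₗ, hB, hB', map_sum, e.repr_self, Finsupp.smul_apply,
      Finsupp.finsetSum_apply, Finsupp.single_apply, RingHom.id_apply, smul_eq_mul]
    simp
  have hlast : ∀ (y : V) (i : Fin (d + 1)) (C : ℝ), v (e.repr y (Fin.last d)) * ρ ^ d ≤ C →
      v (σ (e.repr y (Fin.last d)) * a i) * ρ ^ (i : ℕ) ≤ ρ * C := fun y i C h => by
    rw [map_mul, hσ]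
    calc v (e.repr y (Fin.last d)) * v (a i) * ρ ^ (i : ℕ)
        ≤ v (e.repr y (Fin.last d)) * ρ ^ k i * ρ ^ (i : ℕ) := by
          gcongr
          exact hle i
      _ = ρ * (v (e.repr y (Fin.last d)) * ρ ^ d) := by rw [mul_assoc, hpow]; ring
      _ ≤ ρ * C := by gcongr
  have hfirst : ∀ (y : V) (j : Fin d), v (σ (e.repr y j.castSucc)) * ρ ^ (j.succ : ℕ) =
      ρ * (v (e.repr y j.castSucc) * ρ ^ (j.castSucc : ℕ)) := fun y j => by
    rw [hσ, Fin.val_succ, Fin.val_castSucc, pow_succ]; ring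
  -- An invariant of vectors that `B` preserves with `N` replaced by `ρ * N`: all weighted
  -- coordinates are at most `N`, those before `i₀` are less than `N`, and some coordinate from `i₀`
  -- on equals `N`.
  have hstep : ∀ (y : V) (N : ℝ), 0 < N → (∀ j, v (e.repr y j) * ρ ^ (j : ℕ) ≤ N) →
      (∀ j < i₀, v (e.repr y j) * ρ ^ (j : ℕ) < N) →
      (∃ j, i₀ ≤ j ∧ v (e.repr y j) * ρ ^ (j : ℕ) = N) →
      (∀ j, v (e.repr (B y) j) * ρ ^ (j : ℕ) ≤ ρ * N) ∧
      (∀ j < i₀, v (e.repr (B y) j) * ρ ^ (j : ℕ) < ρ * N) ∧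
      ∃ j, i₀ ≤ j ∧ v (e.repr (B y) j) * ρ ^ (j : ℕ) = ρ * N := by
    intro y N hN h1 h2 h3
    have hll := h1 (Fin.last d)
    rw [Fin.val_last] at hll
    refine ⟨fun j => ?_, fun j hj => ?_, ?_⟩
    · induction j using Fin.cases with
      | zero => rw [hrepr0]; exact hlast y 0 N hll
      | succ j =>
        rw [hreprs]
        refine (mul_le_mul_of_nonneg_right (hna _ _) (hc _).le).trans ?_
        rw [max_mul_of_nonneg _ _ (hc _).le]
        refine max_le ?_ (hlast y _ N hll)
        rw [hfirst]
        exact mul_le_mul_of_nonneg_left (h1 _) hρ.le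
    · have hstrict : v (σ (e.repr y (Fin.last d)) * a j) * ρ ^ (j : ℕ) < ρ * N := by
        by_cases h0 : e.repr y (Fin.last d) = 0
        · rw [h0]; simpa using mul_pos hρ hN
        · rw [map_mul, hσ]
          calc v (e.repr y (Fin.last d)) * v (a j) * ρ ^ (j : ℕ)
              < v (e.repr y (Fin.last d)) * ρ ^ k j * ρ ^ (j : ℕ) := by
                gcongr
                · exact v.pos h0
                · exact hlt j hj
            _ = ρ * (v (e.repr y (Fin.last d)) * ρ ^ d) := by rw [mul_assoc, hpow]; ring
            _ ≤ ρ * N := by gcongr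
      induction j using Fin.cases with
      | zero => rw [hrepr0]; exact hstrict
      | succ j =>
        rw [hreprs]
        refine (mul_le_mul_of_nonneg_right (hna _ _) (hc _).le).trans_lt ?_
        rw [max_mul_of_nonneg _ _ (hc _).le]
        refine max_lt ?_ hstrict
        rw [hfirst]
        exact mul_lt_mul_of_pos_left (h2 _ (lt_trans (Fin.castSucc_lt_succ) hj)) hρ
    -- If the last coordinate is not maximal, a maximal coordinate is shifted by one place and
    -- dominates the contribution of the `a i`. If it is maximal, its contribution at `i₀` has exact
    -- size `ρ * N` and dominates whatever is shifted into that place.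
    · rcases hll.lt_or_eq with hlt' | heq'
      · obtain ⟨j, hj, hjN⟩ := h3
        induction j using Fin.lastCases with
        | last => rw [Fin.val_last] at hjN; exact absurd hjN hlt'.ne
        | cast j =>
          refine ⟨j.succ, hj.trans (Fin.castSucc_lt_succ).le, ?_⟩
          have hf := hfirst y j
          rw [hjN] at hf
          have hl := hlast y j.succ _ le_rfl
          have hl' : v (σ (e.repr y (Fin.last d)) * a j.succ) * ρ ^ (j.succ : ℕ) < ρ * N :=
            hl.trans_lt (mul_lt_mul_of_pos_left hlt' hρ)
          have hcmp : v (σ (e.repr y (Fin.last d)) * a j.succ) < v (σ (e.repr y j.castSucc)) :=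
            lt_of_mul_lt_mul_right (hl'.trans_eq hf.symm) (hc _).le
          rw [hreprs, hna.add_eq_max_of_ne hcmp.ne', max_eq_left hcmp.le, hf]
      · refine ⟨i₀, le_rfl, ?_⟩
        have hl : v (σ (e.repr y (Fin.last d)) * a i₀) * ρ ^ (i₀ : ℕ) = ρ * N := by
          rw [map_mul, hσ, hi₀, mul_assoc, hpow, ← heq']; ring
        clear hlt hi₀ hmin h3
        induction i₀ using Fin.cases with
        | zero => rw [hrepr0]; exact hl
        | succ j =>
          have hf : v (σ (e.repr y j.castSucc)) * ρ ^ (j.succ : ℕ) < ρ * N := by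
            rw [hfirst]
            exact mul_lt_mul_of_pos_left (h2 _ (Fin.castSucc_lt_succ)) hρ
          have hcmp : v (σ (e.repr y j.castSucc)) < v (σ (e.repr y (Fin.last d)) * a j.succ) :=
            lt_of_mul_lt_mul_right (hf.trans_eq hl.symm) (hc _).le
          rw [hreprs, hna.add_eq_max_of_ne hcmp.ne, max_eq_right hcmp.le, hl]
  refine ⟨ρ, hρ, ⟨_, e, fun i => ρ ^ (i : ℕ), hc, ?_⟩,
    ⟨_, e, fun i => ρ ^ (i : ℕ), e i₀, ρ ^ (i₀ : ℕ), hc, hc i₀, fun m => ?_⟩,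
    a i₁, k i₁, fun h => ?_, Nat.pos_of_ne_zero (hk0 i₁), heq₁.symm⟩
  · refine wnorm_map_le e hna hσ hc e hc B hρ.le fun j => ?_
    induction j using Fin.lastCases with
    | last =>
      refine wnorm_le e (mul_pos hρ (hc _)).le fun i => ?_
      rw [hB', e.repr_sum_self, Fin.val_last]
      calc v (a i) * ρ ^ (i : ℕ) ≤ ρ ^ k i * ρ ^ (i : ℕ) := by gcongr; exact hle i
        _ = _ := hpow i
    | cast j =>
      rw [hB, wnorm_basis e hc, Fin.val_succ, Fin.val_castSucc, pow_succ']
  · have key : ∀ m : ℕ, (∀ j, v (e.repr (B^[m] (e i₀)) j) * ρ ^ (j : ℕ) ≤ ρ ^ m * ρ ^ (i₀ : ℕ)) ∧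
        (∀ j < i₀, v (e.repr (B^[m] (e i₀)) j) * ρ ^ (j : ℕ) < ρ ^ m * ρ ^ (i₀ : ℕ)) ∧
        ∃ j, i₀ ≤ j ∧ v (e.repr (B^[m] (e i₀)) j) * ρ ^ (j : ℕ) = ρ ^ m * ρ ^ (i₀ : ℕ) := by
      intro m
      induction m with
      | zero =>
        simp only [Function.iterate_zero, id, e.repr_self, Finsupp.single_apply, pow_zero, one_mul]
        refine ⟨fun j => ?_, fun j hj => ?_, i₀, le_rfl, by simp⟩
        · split_ifs with h
          · simp [h]
          · simpa using (hc i₀).le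
        · rw [if_neg hj.ne']
          simpa using hc i₀
      | succ m ih =>
        rw [Function.iterate_succ_apply', pow_succ', mul_assoc]
        exact hstep _ _ (mul_pos (pow_pos hρ m) (hc i₀)) ih.1 ih.2.1 ih.2.2
    obtain ⟨j, -, hj⟩ := (key m).2.2
    rw [mul_comm, ← hj]
    exact le_wnorm (c := fun i : Fin (d + 1) => ρ ^ (i : ℕ)) e _ j
  · rw [h, map_zero] at heq₁
    exact (pow_pos hρ (k i₁)).ne heq₁

/-- Induct on the dimension, splitting off the cyclic subspace `W` of a vector. The rate is the
larger of those of `W` and of the quotient: the upper bound passes to the extension, and the lower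
bound is pulled back along a linear retraction onto `W` or along the quotient map. That one `ρ`
serves as upper and lower rate, and that a power of it is a value of `v`, is what later allows `B`
to be normalized to rate `1`. -/
theorem exists_growth (hσb : Function.Bijective σ) (n : ℕ) :
    ∀ (V : Type w) [AddCommGroup V] [Module E V] [FiniteDimensional E V] (B : V →ₛₗ[σ] V),
      Function.Injective B → Module.finrank E V = n → 0 < n →
      ∃ ρ : ℝ, 0 < ρ ∧ GrowthLE v B ρ ∧ GrowthGE v B ρ ∧ ∃ (x : E) (k : ℕ), x ≠ 0 ∧ 0 < k ∧
        ρ ^ k = v x := by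
  induction n using Nat.strong_induction_on with
  | _ n ih =>
  intro V _ _ _ B hB hn hn0
  have : Nontrivial V := Module.nontrivial_of_finrank_pos (hn ▸ hn0)
  obtain ⟨x, hx⟩ := exists_ne (0 : V)
  obtain ⟨d, a, hli, hrel⟩ := exists_cyclic B hx
  set W := Submodule.span E (Set.range fun i : Fin (d + 1) => B^[i] x) with hWd
  let e := Module.Basis.span hli
  have hei : ∀ i, (e i : V) = B^[i] x := fun i =>
    congrArg Subtype.val (Module.Basis.span_apply hli i)
  have hmem : ∀ i : Fin (d + 1), B^[i] x ∈ W := fun i => Submodule.subset_span ⟨i, rfl⟩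
  have hW : ∀ y ∈ W, B y ∈ W := by
    intro y hy
    have : W ≤ W.comap B := by
      rw [hWd, Submodule.span_le]
      rintro _ ⟨i, rfl⟩
      change B (B^[i] x) ∈ W
      rw [← Function.iterate_succ_apply' B i x]
      by_cases h : (i : ℕ) + 1 < d + 1
      · exact hmem ⟨i + 1, h⟩
      · have h' : (i : ℕ) + 1 = d + 1 := by have := i.2; lia
        rw [Nat.succ_eq_add_one, h', hrel]
        exact sum_mem fun j _ => W.smul_mem _ (hmem j)
    exact this hy
  have hBW : Function.Injective (B.restrict hW) := fun y z h =>
    Subtype.ext (hB (congrArg Subtype.val h))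
  have hsurj := surjective_of_injective_semilinear hσb _ hBW
  have hBQ : Function.Injective (W.mapQ W B hW) := by
    rw [injective_iff_map_eq_zero]
    intro y hy
    obtain ⟨y, rfl⟩ := W.mkQ_surjective y
    rw [Submodule.mkQ_apply, Submodule.mapQ_apply, Submodule.Quotient.mk_eq_zero] at hy
    obtain ⟨z, hz⟩ := hsurj ⟨B y, hy⟩
    have : (z : V) = y := hB (congrArg Subtype.val hz)
    rw [Submodule.mkQ_apply, Submodule.Quotient.mk_eq_zero, ← this]
    exact z.2
  have h₁ : ∀ i : Fin d, B.restrict hW (e i.castSucc) = e i.succ := fun i => Subtype.ext (by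
    change B (e i.castSucc) = e i.succ
    rw [hei, hei, ← Function.iterate_succ_apply' B]; rfl)
  have h₂ : B.restrict hW (e (Fin.last d)) = ∑ i, a i • e i := Subtype.ext (by
    change B (e (Fin.last d)) = ((∑ i, a i • e i : W) : V)
    rw [hei, ← Function.iterate_succ_apply' B, Fin.val_last, Nat.succ_eq_add_one, hrel]
    simp [hei])
  have h₃ : ∃ i, a i ≠ 0 := by
    by_contra! h
    simp only [h, zero_smul, Finset.sum_const_zero] at hrel
    have h1 : ∀ m, B^[m] x = 0 → x = 0 := by
      intro m
      induction m with
      | zero => exact id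
      | succ m ih =>
        intro h2
        rw [Function.iterate_succ_apply'] at h2
        exact ih (hB (h2.trans (map_zero B).symm))
    exact hx (h1 _ hrel)
  obtain ⟨ρ₁, hρ₁, hle₁, hge₁, x₁, k₁, hx₁, hk₁, heq₁⟩ :=
    exists_growth_companion hna hσ (B.restrict hW) e a h₁ h₂ h₃
  have hge₁' : GrowthGE v B ρ₁ := by
    obtain ⟨g, hg⟩ := W.subtype.exists_leftInverse_of_injective W.ker_subtype
    refine GrowthGE.of_linearMap hna g (fun y' => ⟨y', fun m => ?_⟩) hge₁
    have : B^[m] (y' : V) = ((B.restrict hW)^[m] y' : W) := by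
      induction m with
      | zero => rfl
      | succ m ih => rw [Function.iterate_succ_apply', Function.iterate_succ_apply', ih]; rfl
    rw [this]
    exact LinearMap.congr_fun hg _
  have hWpos : 0 < Module.finrank E W := by
    rw [Module.finrank_eq_card_basis e]; simp
  have hsum := W.finrank_quotient_add_finrank
  rcases Nat.eq_zero_or_pos (Module.finrank E (V ⧸ W)) with h0 | hpos
  · refine ⟨ρ₁, hρ₁, GrowthLE.extension hna hσ hW hρ₁ hle₁ ⟨0, ?_⟩, hge₁', x₁, k₁, hx₁, hk₁, heq₁⟩
    refine ⟨Module.finBasisOfFinrankEq E (V ⧸ W) h0, fun _ => 1, fun _ => one_pos, fun y => ?_⟩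
    simp [wnorm]
  · obtain ⟨ρ₂, hρ₂, hle₂, hge₂, x₂, k₂, hx₂, hk₂, heq₂⟩ :=
      ih (Module.finrank E (V ⧸ W)) (by lia) (V ⧸ W) (W.mapQ W B hW) hBQ rfl hpos
    rcases le_total ρ₂ ρ₁ with h | h
    · exact ⟨ρ₁, hρ₁, GrowthLE.extension hna hσ hW hρ₁ hle₁ (hle₂.mono h), hge₁', x₁, k₁, hx₁, hk₁,
        heq₁⟩
    · refine ⟨ρ₂, hρ₂, GrowthLE.extension hna hσ hW hρ₂ (hle₁.mono h) hle₂,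
        GrowthGE.of_linearMap hna W.mkQ (fun y' => ?_) hge₂, x₂, k₂, hx₂, hk₂, heq₂⟩
      obtain ⟨y, rfl⟩ := W.mkQ_surjective y'
      refine ⟨y, fun m => ?_⟩
      induction m with
      | zero => rfl
      | succ m ih => rw [Function.iterate_succ_apply', Function.iterate_succ_apply', ← ih]; rfl

end CyclicGrowth

/-! ### Fitting decomposition of semilinear maps -/

section Fitting

/-- The iterates of a semilinear map. -/
def siter {R M : Type*} [CommRing R] [AddCommGroup M] [Module R M] {σ : R →+* R} (F : M →ₛₗ[σ] M)
    (n : ℕ) : M →ₛₗ[σ ^ n] M where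
  toFun := F^[n]
  map_add' x y := iterate_map_add F n x y
  map_smul' c x := by
    induction n with
    | zero => rfl
    | succ n ih =>
      rw [Function.iterate_succ_apply', ih, map_smulₛₗ, Function.iterate_succ_apply', pow_succ',
        RingHom.mul_def, RingHom.comp_apply]

@[simp]
theorem siter_apply {R M : Type*} [CommRing R] [AddCommGroup M] [Module R M] {σ : R →+* R}
    (F : M →ₛₗ[σ] M) (n : ℕ) (x : M) : siter F n x = F^[n] x := rfl

variable {κ : Type*} [Field κ] {U : Type*} [AddCommGroup U] [Module κ U] [FiniteDimensional κ U]

theorem injective_of_surjective_semilinear {s : κ →+* κ} (T : U →ₛₗ[s] U)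
    (hT : Function.Surjective T) : Function.Injective T := by
  let e := Module.finBasis κ U
  choose f hf using fun i => hT (e i)
  have hsum : ∀ g : Fin (Module.finrank κ U) → κ, T (∑ i, g i • f i) = ∑ i, s (g i) • e i :=
    fun g => by
      rw [map_sum]; exact Finset.sum_congr rfl fun i _ => by rw [map_smulₛₗ, hf]
  have hzero : ∀ g : Fin (Module.finrank κ U) → κ, T (∑ i, g i • f i) = 0 → ∀ i, g i = 0 := by
    intro g hg i
    rw [hsum] at hg
    exact (map_eq_zero s).1 (Fintype.linearIndependent_iff.1 e.linearIndependent _ hg i)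
  have hli : LinearIndependent κ f := by
    rw [Fintype.linearIndependent_iff]
    intro g hg
    exact hzero g (by rw [hg, map_zero])
  rw [injective_iff_map_eq_zero]
  intro x hx
  have hmem : x ∈ Submodule.span κ (Set.range f) := by
    rw [hli.span_eq_top_of_card_eq_finrank' (by simp)]
    trivial
  obtain ⟨g, rfl⟩ := (Submodule.mem_span_range_iff_exists_fun κ).1 hmem
  simp [hzero g hx]

/-- The image of a semilinear map over a bijective endomorphism. -/
def rangeSub {R M : Type*} [CommRing R] [AddCommGroup M] [Module R M] {σ : R →+* R}
    (hσ : Function.Bijective σ) (F : M →ₛₗ[σ] M) : Submodule R M where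
  carrier := Set.range F
  zero_mem' := ⟨0, map_zero F⟩
  add_mem' := by
    rintro _ _ ⟨x, rfl⟩ ⟨y, rfl⟩
    exact ⟨x + y, map_add F x y⟩
  smul_mem' := by
    rintro c _ ⟨x, rfl⟩
    obtain ⟨c, rfl⟩ := hσ.2 c
    exact ⟨c • x, map_smulₛₗ F c x⟩

/-- Some power of a semilinear map which is not nilpotent is the direct sum of a bijective map on a
nonzero space and of zero. -/
theorem exists_fitting {s : κ →+* κ} (hs : Function.Bijective s) (T : U →ₛₗ[s] U)
    (hT : ∀ m, ∃ x, T^[m] x ≠ 0) :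
    ∃ (m d d' : ℕ) (b : Module.Basis (Fin d ⊕ Fin d') κ U), 0 < m ∧ 0 < d ∧
      (∀ j, T^[m] (b (Sum.inr j)) = 0) ∧
      (∀ i j, b.repr (T^[m] (b (Sum.inl i))) (Sum.inr j) = 0) ∧
      LinearIndependent κ (fun i => T^[m] (b (Sum.inl i))) := by
  have hsm : ∀ m : ℕ, Function.Bijective (s ^ m) := GammaRing.bijective_ringHom_pow hs
  -- The images of the powers are subspaces, because the powers of `s` are surjective; they
  -- decrease, hence stabilize. Once `T^[m]` and `T^[m + m]` have the same image, `T^[m]` is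
  -- bijective on it and its kernel is a complement. Taking `m = n + 1` ensures `m > 0`.
  let R : ℕ →o (Submodule κ U)ᵒᵈ :=
    ⟨fun m => OrderDual.toDual (rangeSub (hsm m) (siter T m)), by
      refine monotone_nat_of_le_succ fun m => ?_
      rintro _ ⟨x, rfl⟩
      exact ⟨T x, (Function.iterate_succ_apply T m x).symm⟩⟩
  obtain ⟨n, hn⟩ := IsArtinian.monotone_stabilizes R
  have hn' : ∀ m, n ≤ m → rangeSub (hsm n) (siter T n) = rangeSub (hsm m) (siter T m) :=
    fun m hm => hn m hm
  set m := n + 1 with hm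
  have h2m : rangeSub (hsm m) (siter T m) = rangeSub (hsm (m + m)) (siter T (m + m)) :=
    (hn' m (by lia)).symm.trans (hn' (m + m) (by lia))
  set I := rangeSub (hsm m) (siter T m) with hI
  let Z : Submodule κ U := LinearMap.ker (siter T m)
  have hstable : ∀ x ∈ I, siter T m x ∈ I := fun x _ => ⟨x, rfl⟩
  have hsurj : Function.Surjective ((siter T m).restrict hstable) := by
    rintro ⟨y, hy⟩
    have hy' := hy
    rw [h2m] at hy'
    obtain ⟨x, hx⟩ := hy'
    refine ⟨⟨siter T m x, ⟨x, rfl⟩⟩, Subtype.ext ?_⟩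
    exact (Function.iterate_add_apply T m m x).symm.trans hx
  have hinj := injective_of_surjective_semilinear _ hsurj
  have hdisj : Disjoint I Z := by
    rw [Submodule.disjoint_def]
    intro x hxI hxZ
    have h1 : (siter T m).restrict hstable ⟨x, hxI⟩ = (siter T m).restrict hstable 0 := by
      rw [map_zero]
      exact Subtype.ext hxZ
    exact congrArg Subtype.val (hinj h1)
  have hcodisj : Codisjoint I Z := by
    rw [codisjoint_iff, eq_top_iff]
    intro x _
    obtain ⟨⟨_, z, rfl⟩, hz⟩ := hsurj ⟨siter T m x, ⟨x, rfl⟩⟩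
    have hz' : siter T m (siter T m z) = siter T m x := congrArg Subtype.val hz
    rw [Submodule.mem_sup]
    refine ⟨siter T m z, ⟨z, rfl⟩, x - siter T m z, ?_, by abel⟩
    rw [LinearMap.mem_ker, map_sub, hz', sub_self]
  have hc : IsCompl I Z := ⟨hdisj, hcodisj⟩
  let b := ((Module.finBasis κ I).prod (Module.finBasis κ Z)).map
    (Submodule.prodEquivOfIsCompl I Z hc)
  have hbl : ∀ i, b (Sum.inl i) = Module.finBasis κ I i := fun i => by simp [b]
  have hbr : ∀ j, b (Sum.inr j) = Module.finBasis κ Z j := fun j => by simp [b]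
  refine ⟨m, _, _, b, Nat.succ_pos n, ?_, fun j => ?_, fun i j => ?_, ?_⟩
  · obtain ⟨x, hx⟩ := hT m
    have : Nontrivial I := ⟨⟨⟨T^[m] x, ⟨x, rfl⟩⟩, 0, fun h => hx (congrArg Subtype.val h)⟩⟩
    exact Module.finrank_pos
  · rw [hbr]
    exact (Module.finBasis κ Z j).2
  · have h1 : (Submodule.prodEquivOfIsCompl I Z hc).symm (T^[m] (b (Sum.inl i))) =
        (⟨T^[m] (b (Sum.inl i)), ⟨_, rfl⟩⟩, 0) := by
      rw [LinearEquiv.symm_apply_eq]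
      simp
    simp only [b] at h1 ⊢
    rw [Module.Basis.map_repr, LinearEquiv.trans_apply, h1]
    simp
  · rw [Fintype.linearIndependent_iff]
    intro g hg i
    choose g' hg' using fun i => (hsm m).2 (g i)
    have h1 : (siter T m).restrict hstable (∑ i, g' i • Module.finBasis κ I i) =
        (siter T m).restrict hstable 0 := by
      rw [map_zero]
      refine Subtype.ext ?_
      rw [ZeroMemClass.coe_zero, ← hg, map_sum, AddSubmonoidClass.coe_finsetSum]
      refine Finset.sum_congr rfl fun i _ => ?_
      rw [map_smulₛₗ, hg', hbl]
      rfl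
    have h2 := Fintype.linearIndependent_iff.1 (Module.finBasis κ I).linearIndependent g' (hinj h1) i
    rw [← hg', h2, map_zero]

end Fitting

/-! ### The invariant subspace of a semilinear map which is invertible modulo the uniformizer -/

section Riccati

theorem eq_zero_of_forall_pow_dvd {R : Type*} [CommRing R] [IsDomain R] [IsDiscreteValuationRing R]
    {π : R} (hπ : Irreducible π) {x : R} (h : ∀ n : ℕ, π ^ n ∣ x) : x = 0 := by
  by_contra hx
  obtain ⟨n, u, rfl⟩ := IsDiscreteValuationRing.eq_unit_mul_pow_irreducible hx hπ
  have h1 := h (n + 1)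
  rw [pow_succ', mul_comm (u : R), mul_comm π] at h1
  exact hπ.not_isUnit (isUnit_of_dvd_unit ((mul_dvd_mul_iff_left (pow_ne_zero n hπ.ne_zero)).1 h1)
    u.isUnit)

variable {R : Type*} [CommRing R] {ι₁ ι₂ : Type*} [Fintype ι₁] [Fintype ι₂]

theorem dvd_matrix_mul_left {l m n : Type*} [Fintype m] {π : R} (A : Matrix l m R) {B : Matrix m n R}
    (h : ∀ i j, π ∣ B i j) (i : l) (j : n) : π ∣ (A * B) i j := by
  rw [Matrix.mul_apply]
  exact Finset.dvd_sum fun k _ => (h k j).mul_left _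

theorem dvd_matrix_mul_right {l m n : Type*} [Fintype m] {π : R} {A : Matrix l m R}
    (B : Matrix m n R) (h : ∀ i j, π ∣ A i j) (i : l) (j : n) : π ∣ (A * B) i j := by
  rw [Matrix.mul_apply]
  exact Finset.dvd_sum fun k _ => (h i k).mul_right _

/-- The Riccati equation `X a = c + d s(X) - X b s(X)`, with `a` invertible and `b`, `c`, `d`
divisible by `π`, can be solved in a ring which is the union of `π`-adically closed subrings stable
under `s`. -/
theorem exists_riccati [IsDomain R] [IsDiscreteValuationRing R] {π : R} (hπ : Irreducible π)
    (s : R →+* R) (hs : π ∣ s π)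
    (hA : ∀ T : Finset R, ∃ A : Subring R, (∀ x ∈ T, π * x ∈ A) ∧ (∀ x ∈ A, s x ∈ A) ∧
      ∀ x : ℕ → R, (∀ n, x n ∈ A) → (∀ n, π ^ n ∣ x (n + 1) - x n) →
        ∃ y ∈ A, ∀ n, π ^ n ∣ y - x n)
    [DecidableEq ι₁] (a a' : Matrix ι₁ ι₁ R) (b : Matrix ι₁ ι₂ R) (c : Matrix ι₂ ι₁ R)
    (d : Matrix ι₂ ι₂ R) (ha : a' * a = 1) (hb : ∀ i j, π ∣ b i j) (hc : ∀ i j, π ∣ c i j)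
    (hd : ∀ i j, π ∣ d i j) :
    ∃ X : Matrix ι₂ ι₁ R, c + d * X.map s = X * (a + b * X.map s) := by
  classical
  have hs' : ∀ n x, π ^ n ∣ x → π ^ n ∣ s x := fun n x hx => by
    have h1 := map_dvd s hx
    rw [map_pow] at h1
    exact (pow_dvd_pow_of_dvd hs n).trans h1
  choose b₀ hb₀ using hb
  choose c₀ hc₀ using hc
  choose d₀ hd₀ using hd
  -- Only multiples of `π` are sure to lie in a closed subring. After multiplication by `a'`, all
  -- coefficients of the equation are of this kind.
  obtain ⟨A, hAT, hAs, hAc⟩ := hA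
    ((Finset.univ.image fun x : ι₂ × ι₁ × ι₁ => c₀ x.1 x.2.1 * a' x.2.1 x.2.2) ∪
      (Finset.univ.image fun x : ι₂ × ι₂ × ι₁ × ι₁ => d₀ x.1 x.2.1 * a' x.2.2.1 x.2.2.2) ∪
      (Finset.univ.image fun x : ι₁ × ι₂ × ι₁ × ι₁ => b₀ x.1 x.2.1 * a' x.2.2.1 x.2.2.2))
  have hcA : ∀ l i j, c l i * a' i j ∈ A := fun l i j => by
    rw [hc₀, mul_assoc]
    refine hAT _ (Finset.mem_union_left _ (Finset.mem_union_left _ ?_))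
    exact Finset.mem_image.2 ⟨(l, i, j), Finset.mem_univ _, rfl⟩
  have hdA : ∀ l k i j, d l k * a' i j ∈ A := fun l k i j => by
    rw [hd₀, mul_assoc]
    refine hAT _ (Finset.mem_union_left _ (Finset.mem_union_right _ ?_))
    exact Finset.mem_image.2 ⟨(l, k, i, j), Finset.mem_univ _, rfl⟩
  have hbA : ∀ m k i j, b m k * a' i j ∈ A := fun m k i j => by
    rw [hb₀, mul_assoc]
    refine hAT _ (Finset.mem_union_right _ ?_)
    exact Finset.mem_image.2 ⟨(m, k, i, j), Finset.mem_univ _, rfl⟩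
  -- Multiplying by the inverse of `a` turns the equation into a fixed-point problem. `Ψ` preserves
  -- the matrices with entries in `A`, and it is contracting for the `π`-adic topology since `b` and
  -- `d` are divisible by `π`.
  let Ψ : Matrix ι₂ ι₁ R → Matrix ι₂ ι₁ R := fun X =>
    (c + d * X.map s - X * (b * X.map s)) * a'
  have hΨA : ∀ X, (∀ i j, X i j ∈ A) → ∀ i j, Ψ X i j ∈ A := by
    intro X hX l j
    have e : Ψ X l j = ∑ i, (c l i * a' i j + ∑ k, s (X k i) * (d l k * a' i j) -
        ∑ m, X l m * ∑ k, s (X k i) * (b m k * a' i j)) := by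
      simp only [Ψ, Matrix.mul_apply, Matrix.sub_apply, Matrix.add_apply, Matrix.map_apply]
      refine Finset.sum_congr rfl fun i _ => ?_
      rw [sub_mul, add_mul, Finset.sum_mul, Finset.sum_mul]
      congr 1
      · congr 1
        exact Finset.sum_congr rfl fun k _ => by ring
      · refine Finset.sum_congr rfl fun m _ => ?_
        rw [mul_assoc, Finset.sum_mul]
        congr 1
        exact Finset.sum_congr rfl fun k _ => by ring
    rw [e]
    refine sum_mem fun i _ => sub_mem (add_mem (hcA _ _ _) (sum_mem fun k _ => ?_))
      (sum_mem fun m _ => mul_mem (hX _ _) (sum_mem fun k _ => ?_))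
    · exact mul_mem (hAs _ (hX _ _)) (hdA _ _ _ _)
    · exact mul_mem (hAs _ (hX _ _)) (hbA _ _ _ _)
  have hΨc : ∀ (n : ℕ) (X Y : Matrix ι₂ ι₁ R), (∀ i j, π ^ n ∣ (X - Y) i j) →
      ∀ i j, π ^ (n + 1) ∣ (Ψ X - Ψ Y) i j := by
    intro n X Y h
    have e : Ψ X - Ψ Y = (d * (X - Y).map s - ((X - Y) * (b * X.map s) +
        Y * (b * (X - Y).map s))) * a' := by
      have e1 : (X - Y).map s = X.map s - Y.map s := by
        ext; simp
      simp only [Ψ, e1]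
      simp only [Matrix.mul_sub, Matrix.sub_mul, Matrix.add_mul, Matrix.mul_assoc]
      abel
    rw [e]
    have h' : ∀ i j, π ^ n ∣ ((X - Y).map s) i j := fun i j => hs' _ _ (h i j)
    have hbX : ∀ (Z : Matrix ι₂ ι₁ R), (∀ i j, π ^ n ∣ Z i j) → ∀ i j, π ^ (n + 1) ∣ (b * Z) i j := by
      intro Z hZ i j
      rw [Matrix.mul_apply]
      refine Finset.dvd_sum fun k _ => ?_
      rw [pow_succ']
      exact mul_dvd_mul (hb₀ i k ▸ dvd_mul_right _ _) (hZ _ _)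
    refine dvd_matrix_mul_right _ fun i j => ?_
    rw [Matrix.sub_apply, Matrix.add_apply]
    refine dvd_sub ?_ (dvd_add ?_ ?_)
    · rw [Matrix.mul_apply]
      refine Finset.dvd_sum fun k _ => ?_
      rw [pow_succ']
      exact mul_dvd_mul (hd₀ i k ▸ dvd_mul_right _ _) (h' _ _)
    · rw [Matrix.mul_apply]
      refine Finset.dvd_sum fun k _ => ?_
      rw [pow_succ]
      refine mul_dvd_mul (h _ _) ?_
      exact dvd_matrix_mul_right _ (fun i j => hb₀ i j ▸ dvd_mul_right _ _) _ _
    · exact dvd_matrix_mul_left _ (hbX _ h') _ _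
  let x : ℕ → Matrix ι₂ ι₁ R := fun n => Ψ^[n] 0
  have hx1 : ∀ n, x (n + 1) = Ψ (x n) := fun n => Function.iterate_succ_apply' Ψ n 0
  have hxA : ∀ n i j, x n i j ∈ A := by
    intro n
    induction n with
    | zero => intro i j; exact zero_mem A
    | succ n ih => rw [hx1]; exact hΨA _ ih
  have hxc : ∀ n i j, π ^ n ∣ x (n + 1) i j - x n i j := by
    intro n
    induction n with
    | zero => intro i j; simp
    | succ n ih =>
      intro i j
      rw [hx1 (n + 1)]
      nth_rewrite 2 [hx1 n]
      exact hΨc n _ _ ih i j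
  choose X₀ hXA hX using fun i j => hAc (fun n => x n i j) (fun n => hxA n i j) fun n => hxc n i j
  let X : Matrix ι₂ ι₁ R := X₀
  have hfix : Ψ X = X := by
    ext i j
    rw [← sub_eq_zero]
    refine eq_zero_of_forall_pow_dvd hπ fun n => ?_
    have h1 := hΨc n X (x n) (fun i j => hX i j n) i j
    have h2 := hX i j (n + 1)
    rw [Matrix.sub_apply, ← hx1] at h1
    have h3 := dvd_sub h1 h2
    rw [sub_sub_sub_cancel_right] at h3
    exact (pow_dvd_pow π (Nat.le_succ n)).trans h3
  refine ⟨X, ?_⟩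
  have h1 : (c + d * X.map s - X * (b * X.map s)) * a' * a = X * a := congrArg (· * a) hfix
  rw [Matrix.mul_assoc, ha, Matrix.mul_one] at h1
  rw [Matrix.mul_add, ← h1]
  abel

end Riccati

/-! ### Lifting the Fitting decomposition from the residue field -/

section UnitPart

/-- The semilinear map with given values on a basis. -/
def semiConstr {ι R M N : Type*} [Fintype ι] [CommRing R] [AddCommGroup M] [Module R M]
    {S : Type*} [CommRing S] [AddCommGroup N] [Module S N] (b : Module.Basis ι R M) (σ : R →+* S)
    (c : ι → N) : M →ₛₗ[σ] N where
  toFun x := ∑ i, σ (b.repr x i) • c i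
  map_add' x y := by simp [add_smul, Finset.sum_add_distrib]
  map_smul' a x := by simp [Finset.smul_sum, mul_smul]

theorem semiConstr_basis {ι R M N : Type*} [Fintype ι] [CommRing R] [AddCommGroup M] [Module R M]
    {S : Type*} [CommRing S] [AddCommGroup N] [Module S N] (b : Module.Basis ι R M) (σ : R →+* S)
    (c : ι → N) (i : ι) : semiConstr b σ c (b i) = c i := by
  classical
  change ∑ j, σ (b.repr (b i) j) • c j = c i
  rw [Finset.sum_eq_single i]
  · simp
  · intro j _ hj
    simp [Finsupp.single_eq_of_ne hj]
  · simp

theorem semilinear_apply {ι R M N : Type*} [Fintype ι] [CommRing R] [AddCommGroup M] [Module R M]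
    {S : Type*} [CommRing S] [AddCommGroup N] [Module S N] (b : Module.Basis ι R M) {σ : R →+* S}
    (F : M →ₛₗ[σ] N) (x : M) : F x = ∑ i, σ (b.repr x i) • F (b i) := by
  conv_lhs => rw [← b.sum_repr x]
  rw [map_sum]
  exact Finset.sum_congr rfl fun i _ => map_smulₛₗ F _ _

theorem semilinear_ext {ι R M N : Type*} [Finite ι] [CommRing R] [AddCommGroup M] [Module R M]
    {S : Type*} [CommRing S] [AddCommGroup N] [Module S N] (b : Module.Basis ι R M) {σ : R →+* S}
    {F F' : M →ₛₗ[σ] N} (h : ∀ i, F (b i) = F' (b i)) (x : M) : F x = F' x := by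
  have := Fintype.ofFinite ι
  rw [semilinear_apply b F, semilinear_apply b F']
  exact Finset.sum_congr rfl fun i _ => by rw [h]

variable {R : Type*} [CommRing R] [IsDomain R] [IsDiscreteValuationRing R] {π : R}

/-- A family with invertible determinant is a basis. -/
def basisOfDet {ι R M : Type*} [Fintype ι] [DecidableEq ι] [CommRing R] [AddCommGroup M]
    [Module R M] (e : Module.Basis ι R M) (g : ι → M) (h : IsUnit (e.det g)) : Module.Basis ι R M :=
  Module.Basis.mk ((e.is_basis_iff_det).2 h).1 ((e.is_basis_iff_det).2 h).2.ge

theorem basisOfDet_apply {ι R M : Type*} [Fintype ι] [DecidableEq ι] [CommRing R] [AddCommGroup M]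
    [Module R M] (e : Module.Basis ι R M) (g : ι → M) (h : IsUnit (e.det g)) (i : ι) :
    basisOfDet e g h i = g i := Module.Basis.mk_apply _ _ _

set_option maxHeartbeats 1000000 in
/-- A semilinear map which is not nilpotent modulo `π` has, up to a power, an invariant submodule on
which it is invertible, while it vanishes modulo `π` on the quotient. -/
theorem exists_unitPart (hπ : Irreducible π) (s : R →+* R) (hsb : Function.Bijective s)
    (hA : ∀ T : Finset R, ∃ A : Subring R, (∀ x ∈ T, π * x ∈ A) ∧ (∀ x ∈ A, s x ∈ A) ∧
      ∀ x : ℕ → R, (∀ n, x n ∈ A) → (∀ n, π ^ n ∣ x (n + 1) - x n) →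
        ∃ y ∈ A, ∀ n, π ^ n ∣ y - x n) {n : ℕ} (T : (Fin n → R) →ₛₗ[s] (Fin n → R))
    (hT : ∀ m, ∃ x, ¬ ∃ y, T^[m] x = π • y) :
    ∃ (m d d' : ℕ) (f : Module.Basis (Fin d ⊕ Fin d') R (Fin n → R)), 0 < m ∧ 0 < d ∧
      (∀ i j, f.repr (T^[m] (f (Sum.inl i))) (Sum.inr j) = 0) ∧
      IsUnit (Matrix.of fun i j => f.repr (T^[m] (f (Sum.inl j))) (Sum.inl i)).det ∧
      ∀ i j, π ∣ f.repr (T^[m] (f (Sum.inr j))) (Sum.inr i) := by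
  classical
  let κ := ResidueField R
  have hdvd : ∀ x : R, residue R x = 0 ↔ π ∣ x := fun x => by
    rw [residue_eq_zero_iff, hπ.maximalIdeal_eq, Ideal.mem_span_singleton]
  have hunit : ∀ x : R, residue R x ≠ 0 → IsUnit x := fun x h => by
    rwa [residue_ne_zero_iff_isUnit] at h
  have hloc : IsLocalHom s := ⟨fun x hx => by
    obtain ⟨y, hy⟩ := hsb.2 ((hx.unit⁻¹ : Rˣ) : R)
    refine IsUnit.of_mul_eq_one y (hsb.1 ?_)
    rw [map_mul, hy, map_one]
    exact hx.mul_val_inv⟩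
  let s' : κ →+* κ := ResidueField.map s
  have hs' : ∀ x, s' (residue R x) = residue R (s x) := fun x => ResidueField.map_residue s x
  have hs'b : Function.Bijective s' := by
    refine ⟨s'.injective, fun y => ?_⟩
    obtain ⟨y, rfl⟩ := residue_surjective y
    obtain ⟨x, rfl⟩ := hsb.2 y
    exact ⟨residue R x, hs' x⟩
  have hsm : ∀ m x, π ∣ x → π ∣ (s ^ m) x := fun m x hx => by
    induction m with
    | zero => simpa using hx
    | succ m ih =>
      rw [pow_succ', RingHom.mul_def, RingHom.comp_apply, ← hdvd, ← hs', (hdvd _).2 ih, map_zero]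
  have hAm : ∀ A : Subring R, (∀ x ∈ A, s x ∈ A) → ∀ m, ∀ x ∈ A, (s ^ m) x ∈ A := by
    intro A hA m x hx
    rw [RingHom.coe_pow]
    induction m with
    | zero => exact hx
    | succ m ih => rw [Function.iterate_succ_apply']; exact hA _ ih
  let E := Pi.basisFun R (Fin n)
  let E' := Pi.basisFun κ (Fin n)
  let r : (Fin n → R) →ₛₗ[residue R] (Fin n → κ) :=
    { toFun := fun x i => residue R (x i)
      map_add' := fun x y => funext fun i => map_add _ _ _
      map_smul' := fun a x => funext fun i => map_mul _ _ _ }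
  have hr0 : ∀ x, r x = 0 ↔ ∃ y, x = π • y := fun x => by
    constructor
    · intro h
      choose y hy using fun i => (hdvd (x i)).1 (congrFun h i)
      exact ⟨y, funext hy⟩
    · rintro ⟨y, rfl⟩
      rw [map_smulₛₗ, (hdvd π).2 dvd_rfl, zero_smul]
  let T' : (Fin n → κ) →ₛₗ[s'] (Fin n → κ) := semiConstr E' s' fun j => r (T (E j))
  have hrT : ∀ x, r (T x) = T' (r x) := fun x => by
    rw [semilinear_apply E T, map_sum]
    refine Finset.sum_congr rfl fun j _ => ?_
    rw [map_smulₛₗ]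
    exact congrArg (· • r (T (E j))) (hs' _).symm
  have hrTm : ∀ m x, r (T^[m] x) = T'^[m] (r x) := fun m => by
    induction m with
    | zero => intro x; rfl
    | succ m ih => intro x; rw [Function.iterate_succ_apply', Function.iterate_succ_apply', hrT, ih]
  obtain ⟨m, d, d', b', hm, hd, h1, h2, h3⟩ := exists_fitting hs'b T' fun m => by
    obtain ⟨x, hx⟩ := hT m
    refine ⟨r x, fun h => hx ?_⟩
    rw [← hrTm] at h
    exact (hr0 _).1 h
  have hrsurj : Function.Surjective r := fun y => by
    choose x hx using fun i => residue_surjective (y i)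
    exact ⟨x, funext hx⟩
  -- Any lift of a basis of the reduction is a basis, its determinant being a unit modulo `π`.
  choose g hg using fun i => hrsurj (b' i)
  let φ := E'.indexEquiv b'
  let f₀ := basisOfDet (E.reindex φ) g (by
    refine hunit _ ?_
    have : residue R ((E.reindex φ).det g) = (E'.reindex φ).det b' := by
      rw [Module.Basis.det_apply, Module.Basis.det_apply, RingHom.map_det]
      congr 1
      ext i j
      simp only [RingHom.mapMatrix_apply, Matrix.map_apply, Module.Basis.toMatrix_apply,
        Module.Basis.repr_reindex, Finsupp.mapDomain_equiv_apply, E, E', Pi.basisFun_repr]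
      rw [← hg]
      rfl
    rw [this]
    exact ((E'.reindex φ).isUnit_det b').ne_zero)
  have hf₀ : ∀ i, r (f₀ i) = b' i := fun i => by rw [← hg, basisOfDet_apply]
  have hrepr : ∀ x i, residue R (f₀.repr x i) = b'.repr (r x) i := fun x i => by
    have : r x = ∑ j, residue R (f₀.repr x j) • b' j := by
      rw [semilinear_apply f₀ r]
      exact Finset.sum_congr rfl fun j _ => by rw [hf₀]
    rw [this, Module.Basis.repr_sum_self]
  let a : Matrix (Fin d) (Fin d) R := Matrix.of fun i j =>
    f₀.repr (T^[m] (f₀ (Sum.inl j))) (Sum.inl i)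
  let b : Matrix (Fin d) (Fin d') R := Matrix.of fun i j =>
    f₀.repr (T^[m] (f₀ (Sum.inr j))) (Sum.inl i)
  let c : Matrix (Fin d') (Fin d) R := Matrix.of fun i j =>
    f₀.repr (T^[m] (f₀ (Sum.inl j))) (Sum.inr i)
  let e : Matrix (Fin d') (Fin d') R := Matrix.of fun i j =>
    f₀.repr (T^[m] (f₀ (Sum.inr j))) (Sum.inr i)
  have hb : ∀ i j, π ∣ b i j := fun i j => by
    rw [← hdvd]
    simp only [b, Matrix.of_apply, hrepr, hrTm, hf₀, h1, map_zero, Finsupp.coe_zero, Pi.zero_apply]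
  have he : ∀ i j, π ∣ e i j := fun i j => by
    rw [← hdvd]
    simp only [e, Matrix.of_apply, hrepr, hrTm, hf₀, h1, map_zero, Finsupp.coe_zero, Pi.zero_apply]
  have hc : ∀ i j, π ∣ c i j := fun i j => by
    rw [← hdvd]
    simp only [c, Matrix.of_apply, hrepr, hrTm, hf₀, h2]
  have ha : residue R a.det ≠ 0 := by
    rw [RingHom.map_det]
    intro h0
    obtain ⟨v, hv, hv0⟩ := Matrix.exists_mulVec_eq_zero_iff.2 h0
    refine hv (funext fun i => Fintype.linearIndependent_iff.1 h3 v ?_ i)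
    apply b'.repr.injective
    ext i
    rw [map_zero, Finsupp.coe_zero, Pi.zero_apply, map_sum, Finsupp.finsetSum_apply]
    cases i with
    | inl i =>
      have := congrFun hv0 i
      rw [Matrix.mulVec, dotProduct] at this
      rw [Pi.zero_apply] at this
      rw [← this]
      refine Finset.sum_congr rfl fun j _ => ?_
      rw [map_smul, Finsupp.smul_apply, smul_eq_mul, mul_comm]
      simp only [RingHom.mapMatrix_apply, Matrix.map_apply, a, Matrix.of_apply, hrepr, hrTm, hf₀]
    | inr i =>
      exact Finset.sum_eq_zero fun j _ => by rw [map_smul, Finsupp.smul_apply, h2, smul_zero]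
  have hau : IsUnit a.det := hunit _ ha
  -- In the lifted basis `T^[m]` has blocks `a`, `b`, `c`, `e`, with `a` invertible and the others
  -- divisible by `π`. The graph of `X` over the first block is stable precisely when `X` solves
  -- this equation; the new basis below consists of this graph and the old second block.
  obtain ⟨X, hX⟩ := exists_riccati hπ (s ^ m) (hsm m π dvd_rfl) (fun t => by
    obtain ⟨A, hA1, hA2, hA3⟩ := hA t
    exact ⟨A, hA1, fun x hx => hAm A hA2 m x hx, hA3⟩) a a⁻¹ b c e
    (Matrix.nonsing_inv_mul a hau) hb hc he
  let g' : Fin d ⊕ Fin d' → (Fin n → R) :=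
    Sum.elim (fun i => f₀ (Sum.inl i) + ∑ k, X k i • f₀ (Sum.inr k)) fun k => f₀ (Sum.inr k)
  let f := basisOfDet f₀ g' (by
    have : f₀.toMatrix g' = Matrix.fromBlocks 1 0 X 1 := by
      ext i j
      rw [Module.Basis.toMatrix_apply]
      cases j with
      | inl j =>
        cases i with
        | inl i => simp [g', Finsupp.single_apply, Matrix.one_apply, eq_comm]
        | inr i => simp [g', Finsupp.single_apply]
      | inr j =>
        cases i with
        | inl i => simp [g']
        | inr i => simp [g', Finsupp.single_apply, Matrix.one_apply, eq_comm]
    rw [Module.Basis.det_apply, this, Matrix.det_fromBlocks_zero₁₂]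
    simp)
  have hfl : ∀ i, f (Sum.inl i) = f₀ (Sum.inl i) + ∑ k, X k i • f₀ (Sum.inr k) := fun i =>
    basisOfDet_apply _ _ _ _
  have hfr : ∀ k, f (Sum.inr k) = f₀ (Sum.inr k) := fun k => basisOfDet_apply _ _ _ _
  have hf : ∀ x, f₀.repr x = f₀.repr (∑ i, f.repr x (Sum.inl i) • f (Sum.inl i) +
      ∑ k, f.repr x (Sum.inr k) • f (Sum.inr k)) := fun x => by
    conv_lhs => rw [← f.sum_repr x, Fintype.sum_sum_type]
  have hfreprl : ∀ x i, f.repr x (Sum.inl i) = f₀.repr x (Sum.inl i) := fun x i => by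
    rw [hf x]
    simp [hfl, hfr, Finsupp.single_apply]
  have hfreprr : ∀ x k, f.repr x (Sum.inr k) = f₀.repr x (Sum.inr k) -
      ∑ i, X k i * f₀.repr x (Sum.inl i) := fun x k => by
    rw [eq_sub_iff_add_eq]
    conv_rhs => rw [hf x]
    simp only [← hfreprl]
    simp only [hfl, hfr, map_add, map_sum, map_smul, Finsupp.add_apply, Finsupp.finsetSum_apply,
      Finsupp.smul_apply, smul_eq_mul, Module.Basis.repr_self, Finsupp.single_apply, reduceCtorEq,
      if_false, zero_add, mul_ite, mul_one, mul_zero, Sum.inr.injEq, Finset.sum_ite_eq',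
      Finset.mem_univ, if_true]
    rw [add_comm]
    congr 1
    exact Finset.sum_congr rfl fun i _ => mul_comm _ _
  have hTl : ∀ j, T^[m] (f (Sum.inl j)) = T^[m] (f₀ (Sum.inl j)) +
      ∑ k, (s ^ m) (X k j) • T^[m] (f₀ (Sum.inr k)) := fun j => by
    rw [hfl]
    simp only [← siter_apply]
    rw [map_add, map_sum]
    congr 1
    exact Finset.sum_congr rfl fun k _ => map_smulₛₗ _ _ _
  have hTll : ∀ i j, f₀.repr (T^[m] (f (Sum.inl j))) (Sum.inl i) =
      (a + b * X.map (s ^ m)) i j := fun i j => by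
    rw [hTl]
    simp [a, b, Matrix.mul_apply, mul_comm]
  have hTlr : ∀ i j, f₀.repr (T^[m] (f (Sum.inl j))) (Sum.inr i) =
      (c + e * X.map (s ^ m)) i j := fun i j => by
    rw [hTl]
    simp [c, e, Matrix.mul_apply, mul_comm]
  refine ⟨m, d, d', f, hm, hd, fun i j => ?_, ?_, fun i j => ?_⟩
  · rw [hfreprr, hTlr, hX, sub_eq_zero, Matrix.mul_apply]
    exact Finset.sum_congr rfl fun k _ => by rw [hTll]
  · refine hunit _ ?_
    have : (residue R).mapMatrix (Matrix.of fun i j => f.repr (T^[m] (f (Sum.inl j))) (Sum.inl i)) =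
        (residue R).mapMatrix a := by
      ext i j
      rw [RingHom.mapMatrix_apply, RingHom.mapMatrix_apply, Matrix.map_apply, Matrix.map_apply,
        Matrix.of_apply, hfreprl, hTll, Matrix.add_apply, map_add,
        (hdvd _).2 (dvd_matrix_mul_right _ hb i j), add_zero]
    rw [RingHom.map_det, this, ← RingHom.map_det]
    exact ha
  · rw [hfreprr, hfr]
    exact dvd_sub (he i j) (Finset.dvd_sum fun k _ => (hb k j).mul_left _)

end UnitPart

/-! ### The absolute value on the field of fractions -/

section FractionField

variable (p : ℕ) {R : Type u} [CommRing R] [IsDomain R] [IsDiscreteValuationRing R]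

theorem av_div_eq {a b c d : R} (hb : b ≠ 0) (hd : d ≠ 0)
    (h : algebraMap R (FractionRing R) a / algebraMap R (FractionRing R) b =
      algebraMap R (FractionRing R) c / algebraMap R (FractionRing R) d) :
    av p a / av p b = av p c / av p d := by
  have hinj := IsFractionRing.injective R (FractionRing R)
  rw [div_eq_div_iff (by simpa using hb) (by simpa using hd), ← map_mul, ← map_mul] at h
  rw [div_eq_div_iff (av_pos p hb).ne' (av_pos p hd).ne', ← av_mul, ← av_mul, hinj h]

/-- The value of the absolute value at an element of the field of fractions. -/
def avFracFun (x : FractionRing R) : ℝ :=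
  av p (IsLocalization.sec (nonZeroDivisors R) x).1 /
    av p ((IsLocalization.sec (nonZeroDivisors R) x).2 : R)

theorem avFracFun_div (a : R) {b : R} (hb : b ≠ 0) :
    avFracFun p (algebraMap R (FractionRing R) a / algebraMap R (FractionRing R) b) =
      av p a / av p b := by
  refine av_div_eq p (nonZeroDivisors.ne_zero (IsLocalization.sec (nonZeroDivisors R) _).2.2) hb ?_
  rw [← IsFractionRing.mk'_eq_div, IsLocalization.mk'_sec]

theorem exists_eq_div (x : FractionRing R) : ∃ a b : R, b ≠ 0 ∧
    x = algebraMap R (FractionRing R) a / algebraMap R (FractionRing R) b := by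
  obtain ⟨a, b, hb, rfl⟩ := IsFractionRing.div_surjective (A := R) x
  exact ⟨a, b, nonZeroDivisors.ne_zero hb, rfl⟩

theorem avFracFun_add_le (x y : FractionRing R) :
    avFracFun p (x + y) ≤ max (avFracFun p x) (avFracFun p y) := by
  obtain ⟨a, b, hb, rfl⟩ := exists_eq_div x
  obtain ⟨c, d, hd, rfl⟩ := exists_eq_div y
  rw [div_add_div _ _ (by simpa using hb) (by simpa using hd), ← map_mul, ← map_mul, ← map_mul,
    ← map_add, avFracFun_div p _ (mul_ne_zero hb hd), avFracFun_div p _ hb, avFracFun_div p _ hd,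
    av_mul]
  have h1 := av_pos p hb
  have h2 := av_pos p hd
  rw [div_le_iff₀ (mul_pos h1 h2)]
  refine (av_add_le p _ _).trans (max_le ?_ ?_)
  · rw [av_mul]
    calc av p a * av p d = av p a / av p b * (av p b * av p d) := by field_simp
      _ ≤ _ := by gcongr; exact le_max_left _ _
  · rw [av_mul]
    calc av p b * av p c = av p c / av p d * (av p b * av p d) := by field_simp
      _ ≤ _ := by gcongr; exact le_max_right _ _

variable (R) in
/-- The absolute value on the field of fractions. -/
def avFrac : AbsoluteValue (FractionRing R) ℝ where
  toFun := avFracFun p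
  map_mul' x y := by
    obtain ⟨a, b, hb, rfl⟩ := exists_eq_div x
    obtain ⟨c, d, hd, rfl⟩ := exists_eq_div y
    rw [div_mul_div_comm, ← map_mul, ← map_mul, avFracFun_div p _ (mul_ne_zero hb hd),
      avFracFun_div p _ hb, avFracFun_div p _ hd, av_mul, av_mul, div_mul_div_comm]
  nonneg' x := div_nonneg (av_nonneg p _) (av_nonneg p _)
  eq_zero' x := by
    obtain ⟨a, b, hb, rfl⟩ := exists_eq_div x
    rw [avFracFun_div p _ hb, div_eq_zero_iff, or_iff_left (av_pos p hb).ne', av_eq_zero,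
      div_eq_zero_iff, or_iff_left (by simpa using hb)]
    simp
  add_le' x y := by
    have h0 : ∀ x : FractionRing R, 0 ≤ avFracFun p x := fun x =>
      div_nonneg (av_nonneg p _) (av_nonneg p _)
    exact (avFracFun_add_le p x y).trans (max_le_add_of_nonneg (h0 x) (h0 y))

theorem avFrac_div (a : R) {b : R} (hb : b ≠ 0) :
    avFrac p R (algebraMap R (FractionRing R) a / algebraMap R (FractionRing R) b) =
      av p a / av p b := avFracFun_div p a hb

theorem avFrac_algebraMap (a : R) : avFrac p R (algebraMap R (FractionRing R) a) = av p a := by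
  have := avFrac_div p a (one_ne_zero (α := R))
  rwa [map_one, div_one, av_one, div_one] at this

theorem avFrac_isNonarchimedean : IsNonarchimedean (avFrac p R) := avFracFun_add_le p

theorem avFrac_le_one_iff (hR : IsMixed p R) (x : FractionRing R) :
    avFrac p R x ≤ 1 ↔ ∃ a, algebraMap R (FractionRing R) a = x := by
  constructor
  · obtain ⟨a, b, hb, rfl⟩ := exists_eq_div x
    rw [avFrac_div p _ hb, div_le_one (av_pos p hb), av_le_iff hR]
    rintro ⟨c, rfl⟩
    refine ⟨c, ?_⟩
    rw [map_mul, mul_div_cancel_left₀ _ (by simpa using hb)]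
  · rintro ⟨a, rfl⟩
    rw [avFrac_algebraMap]
    exact av_le_one p a

theorem avFrac_lt_one_iff (hR : IsMixed p R) {π : R} (hπ : Irreducible π) (x : FractionRing R) :
    avFrac p R x < 1 ↔ avFrac p R x ≤ av p π := by
  constructor
  · intro h
    obtain ⟨a, rfl⟩ := (avFrac_le_one_iff p hR x).1 h.le
    rw [avFrac_algebraMap] at h ⊢
    refine av_le_of_dvd p ?_
    rw [← Ideal.mem_span_singleton, ← hπ.maximalIdeal_eq, mem_maximalIdeal]
    exact fun hu => h.ne (av_isUnit p hu)
  · exact fun h => h.trans_lt (av_irreducible_lt_one hR hπ)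

/-- The value group is discrete and generated by `|π|`, so anything smaller than `|π|⁻¹` is
integral. This absorbs the rounding of weights in `exists_avFrac_mul_mem`. -/
theorem avFrac_le_one_of_lt (hR : IsMixed p R) {π : R} (hπ : Irreducible π) (x : FractionRing R)
    (h : avFrac p R x * av p π < 1) : avFrac p R x ≤ 1 := by
  rw [← avFrac_algebraMap, ← map_mul, avFrac_lt_one_iff p hR hπ, map_mul, avFrac_algebraMap] at h
  exact le_of_mul_le_mul_right (by rwa [one_mul]) (av_pos p hπ.ne_zero)

theorem avFrac_map (hR : IsMixed p R) {σ : R →+* R} (σ' : FractionRing R →+* FractionRing R)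
    (h : ∀ x, σ' (algebraMap R (FractionRing R) x) = algebraMap R (FractionRing R) (σ x))
    (x : FractionRing R) : avFrac p R (σ' x) = avFrac p R x := by
  obtain ⟨a, b, hb, rfl⟩ := exists_eq_div x
  have hb' : σ b ≠ 0 := by
    rw [Ne, ← av_eq_zero p, av_map hR hR]
    exact (av_pos p hb).ne'
  rw [map_div₀, h, h, avFrac_div p _ hb', avFrac_div p _ hb, av_map hR hR, av_map hR hR]

/-- The values of the powers of `π` are spaced by the factor `|π|`, so exactly one of them brings
`c` into the interval from `|π|` (excluded) to `1`. -/
theorem exists_avFrac_mul_mem (hR : IsMixed p R) {π : R} (hπ : Irreducible π) {c : ℝ}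
    (hc : 0 < c) : ∃ g : FractionRing R, g ≠ 0 ∧ av p π < avFrac p R g * c ∧
      avFrac p R g * c ≤ 1 := by
  have h0 := av_pos p hπ.ne_zero
  have hπ' : algebraMap R (FractionRing R) π ≠ 0 := by simpa using hπ.ne_zero
  obtain ⟨n, hn1, hn2⟩ := exists_mem_Ioc_zpow hc
    ((one_lt_inv₀ h0).2 (av_irreducible_lt_one hR hπ))
  refine ⟨algebraMap R (FractionRing R) π ^ (n + 1), zpow_ne_zero _ hπ', ?_, ?_⟩
  all_goals rw [map_zpow₀, avFrac_algebraMap]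
  · rw [inv_zpow, inv_lt_iff_one_lt_mul₀ (by positivity)] at hn1
    calc av p π = av p π * 1 := (mul_one _).symm
      _ < av p π * (c * av p π ^ n) := by gcongr
      _ = _ := by rw [zpow_add₀ h0.ne', zpow_one]; ring
  · rw [inv_zpow] at hn2
    calc _ ≤ av p π ^ (n + 1) * (av p π ^ (n + 1))⁻¹ := by gcongr
      _ = 1 := mul_inv_cancel₀ (by positivity)

end FractionField

/-! ### Separating the unit part from the topologically nilpotent part -/

section Splitting

variable {E : Type*} [Field E] {v : AbsoluteValue E ℝ} (hna : IsNonarchimedean v)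
  {τ : E →+* E} (hτ : ∀ x, v (τ x) = v x) {V : Type*} [AddCommGroup V] [Module E V]
  {ι₁ ι₂ : Type*} [Fintype ι₁] [Fintype ι₂] (f : Module.Basis (ι₁ ⊕ ι₂) E V)

/-- The subspace generated by the first part of a basis. -/
def leftSpan : Submodule E V where
  carrier := {x | ∀ j, f.repr x (Sum.inr j) = 0}
  zero_mem' := by simp
  add_mem' {x y} hx hy j := by
    rw [map_add, Finsupp.add_apply, hx j, hy j, add_zero]
  smul_mem' c x hx j := by
    rw [map_smul, Finsupp.smul_apply, hx j, smul_zero]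

theorem AbsoluteValue.sum_le (hna : IsNonarchimedean v) {ι : Type*} (s : Finset ι) (g : ι → E)
    {C : ℝ} (hC : 0 ≤ C) (h : ∀ i ∈ s, v (g i) ≤ C) : v (∑ i ∈ s, g i) ≤ C := by
  classical
  induction s using Finset.induction_on with
  | empty => simpa using hC
  | insert a s ha ih =>
    rw [Finset.sum_insert ha]
    exact (hna _ _).trans (max_le (h _ (Finset.mem_insert_self _ _))
      (ih fun i hi => h _ (Finset.mem_insert_of_mem hi)))

include hna hτ in
/-- If `T` is unramified on the first part of a basis and topologically nilpotent on the rest, then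
the inverse of `T` (up to a scalar) scales the norm on the span of the first part, and grows faster
outside of it. -/
theorem leftSpan_growth (hτb : Function.Bijective τ) (T : V →ₛₗ[τ] V) {θ : ℝ} (hθ0 : 0 < θ)
    (hθ : θ < 1) (h0 : ∀ i j, f.repr (T (f (Sum.inl i))) (Sum.inr j) = 0) [DecidableEq ι₁]
    (a' : Matrix ι₁ ι₁ E)
    (ha : a' * (Matrix.of fun i j => f.repr (T (f (Sum.inl j))) (Sum.inl i)) = 1)
    (ha1 : ∀ i j, v (f.repr (T (f (Sum.inl j))) (Sum.inl i)) ≤ 1) (ha2 : ∀ i j, v (a' i j) ≤ 1)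
    (hd : ∀ i j, v (f.repr (T (f (Sum.inr j))) (Sum.inr i)) ≤ θ)
    (Φ : V → V) (w w' : E) (hΦT : ∀ x, Φ (T x) = w • x) (hTΦ : ∀ x, T (Φ x) = w' • x)
    {r : ℝ} (hr : 0 < r) (hw : v w = r) (hw' : v w' = r) :
    (∀ x ∈ leftSpan f, ∀ j : ℕ, wnorm v f (fun _ => 1) (Φ^[j] x) =
      r ^ j * wnorm v f (fun _ => 1) x) ∧
    ∀ x C, (∀ j : ℕ, wnorm v f (fun _ => 1) (Φ^[j] x) ≤ C * r ^ j) → x ∈ leftSpan f := by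
  classical
  have hTr : ∀ x i, f.repr (T x) i = ∑ j, τ (f.repr x (Sum.inl j)) * f.repr (T (f (Sum.inl j))) i +
      ∑ j, τ (f.repr x (Sum.inr j)) * f.repr (T (f (Sum.inr j))) i := fun x i => by
    rw [semilinear_apply f T x, Fintype.sum_sum_type]
    simp
  have hTl : ∀ x ∈ leftSpan f, ∀ i, f.repr (T x) i =
      ∑ j, τ (f.repr x (Sum.inl j)) * f.repr (T (f (Sum.inl j))) i := fun x hx i => by
    rw [hTr, add_eq_left]
    exact Finset.sum_eq_zero fun j _ => by rw [hx j, map_zero, zero_mul]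
  have hTW : ∀ x ∈ leftSpan f, T x ∈ leftSpan f := fun x hx j => by
    rw [hTl x hx]
    exact Finset.sum_eq_zero fun i _ => by rw [h0, mul_zero]
  have hone : ∀ i : ι₁ ⊕ ι₂, (0 : ℝ) < (fun _ => 1 : ι₁ ⊕ ι₂ → ℝ) i := fun _ => one_pos
  have hle : ∀ x i, v (f.repr x i) ≤ wnorm v f (fun _ => 1) x := fun x i => by
    simpa using le_wnorm (v := v) (c := fun _ => 1) f x i
  -- On the first block, `T` and its inverse have integral matrices, so `T` is an isometry there.
  have hN : ∀ x ∈ leftSpan f, wnorm v f (fun _ => 1) (T x) = wnorm v f (fun _ => 1) x := by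
    intro x hx
    refine le_antisymm (wnorm_le f (wnorm_nonneg f hone _) fun i => ?_)
      (wnorm_le f (wnorm_nonneg f hone _) fun i => ?_)
    · rw [mul_one]
      cases i with
      | inl i =>
        rw [hTl x hx]
        refine AbsoluteValue.sum_le hna _ _ (wnorm_nonneg f hone _) fun j _ => ?_
        rw [map_mul, hτ]
        calc _ ≤ wnorm v f (fun _ => 1) x * 1 :=
              mul_le_mul (hle _ _) (ha1 _ _) (v.nonneg _) (wnorm_nonneg f hone _)
          _ = _ := mul_one _
      | inr i => rw [hTW x hx i, map_zero]; exact wnorm_nonneg f hone _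
    · rw [mul_one]
      cases i with
      | inl i =>
        have e : τ (f.repr x (Sum.inl i)) = ∑ j, a' i j * f.repr (T x) (Sum.inl j) := by
          simp_rw [hTl x hx, Finset.mul_sum]
          rw [Finset.sum_comm]
          have h1 : ∀ k, ∑ j, a' i j * f.repr (T (f (Sum.inl k))) (Sum.inl j) =
              (1 : Matrix ι₁ ι₁ E) i k := fun k => by
            rw [← ha, Matrix.mul_apply]; rfl
          calc τ (f.repr x (Sum.inl i)) = ∑ k, τ (f.repr x (Sum.inl k)) *
                (1 : Matrix ι₁ ι₁ E) i k := by simp [Matrix.one_apply]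
            _ = _ := Finset.sum_congr rfl fun k _ => by
                rw [← h1, Finset.mul_sum]
                exact Finset.sum_congr rfl fun j _ => by ring
        rw [← hτ, e]
        refine AbsoluteValue.sum_le hna _ _ (wnorm_nonneg f hone _) fun j _ => ?_
        rw [map_mul]
        calc _ ≤ 1 * wnorm v f (fun _ => 1) (T x) :=
              mul_le_mul (ha2 _ _) (hle _ _) (v.nonneg _) zero_le_one
          _ = _ := one_mul _
      | inr i => rw [hx i, map_zero]; exact wnorm_nonneg f hone _
  have hN0 : ∀ x, wnorm v f (fun _ => 1) x = 0 → x = 0 := fun x hx => by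
    apply f.repr.injective
    ext i
    rw [map_zero, Finsupp.coe_zero, Pi.zero_apply]
    exact v.eq_zero.1 (le_antisymm ((hle x i).trans_eq hx) (v.nonneg _))
  have : FiniteDimensional E V := Module.Finite.of_basis f
  have hsurj : Function.Surjective (T.restrict hTW) := by
    refine surjective_of_injective_semilinear hτb _ ?_
    rw [injective_iff_map_eq_zero]
    rintro ⟨x, hx⟩ h
    refine Subtype.ext (hN0 x ?_)
    rw [← hN x hx, show T x = 0 from congrArg Subtype.val h]
    simp [wnorm]
  have hΦ : ∀ x ∈ leftSpan f, Φ x ∈ leftSpan f ∧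
      wnorm v f (fun _ => 1) (Φ x) = r * wnorm v f (fun _ => 1) x := by
    intro x hx
    obtain ⟨⟨y, hy⟩, hyx⟩ := hsurj ⟨x, hx⟩
    have hyx' : T y = x := congrArg Subtype.val hyx
    rw [← hyx', hΦT]
    refine ⟨Submodule.smul_mem _ _ hy, ?_⟩
    rw [wnorm_smul, hw, hN y hy]
  refine ⟨fun x hx j => ?_, fun x C h => ?_⟩
  · suffices Φ^[j] x ∈ leftSpan f ∧ wnorm v f (fun _ => 1) (Φ^[j] x) =
        r ^ j * wnorm v f (fun _ => 1) x from this.2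
    induction j with
    | zero => simpa using hx
    | succ j ih =>
      rw [Function.iterate_succ_apply']
      refine ⟨(hΦ _ ih.1).1, ?_⟩
      rw [(hΦ _ ih.1).2, ih.2, pow_succ']
      ring
  -- Since `T (Φ x) = w' • x`, the second component of `x` is recovered from that of `Φ x` by a map
  -- that contracts by `θ`, up to the scalar of size `r`.
  · have hstep : ∀ x D, 0 ≤ D → (∀ i, v (f.repr (Φ x) (Sum.inr i)) ≤ D) →
        ∀ i, v (f.repr x (Sum.inr i)) ≤ θ * D / r := by
      intro x D hD h i
      have h1 : v (f.repr (T (Φ x)) (Sum.inr i)) ≤ θ * D := by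
        rw [hTr]
        refine (hna _ _).trans (max_le ?_ ?_)
        · rw [Finset.sum_eq_zero fun j _ => by rw [h0, mul_zero], map_zero]
          positivity
        · refine AbsoluteValue.sum_le hna _ _ (by positivity) fun j _ => ?_
          rw [map_mul, hτ, mul_comm θ]
          exact mul_le_mul (h j) (hd i j) (v.nonneg _) hD
      rw [hTΦ, map_smul, Finsupp.smul_apply, smul_eq_mul, map_mul, hw'] at h1
      rw [le_div_iff₀ hr, mul_comm]
      exact h1
    have hC : 0 ≤ C := by simpa using (wnorm_nonneg f hone _).trans (h 0)
    -- Tracing the orbit back from time `k + j` gains `θ ^ j` for every `j`, so an orbit bounded by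
    -- `C * r ^ k` has zero second component.
    have hall : ∀ j k i, v (f.repr (Φ^[k] x) (Sum.inr i)) ≤ θ ^ j * (C * r ^ k) := by
      intro j
      induction j with
      | zero => intro k i; rw [pow_zero, one_mul]; exact (hle _ _).trans (h k)
      | succ j ih =>
        intro k i
        refine (hstep _ (θ ^ j * (C * r ^ (k + 1))) (by positivity) (fun i => ?_) i).trans_eq ?_
        · have := ih (k + 1) i
          rwa [Function.iterate_succ_apply'] at this
        · rw [pow_succ, pow_succ]; field_simp
    intro i
    refine v.eq_zero.1 (le_antisymm ?_ (v.nonneg _))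
    refine ge_of_tendsto' (f := fun j : ℕ => θ ^ j * C) (x := atTop) ?_ fun j => ?_
    · simpa using (tendsto_pow_atTop_nhds_zero_of_lt_one hθ0.le hθ).mul_const C
    · simpa using hall j 0 i

end Splitting

/-! ### The extremal slope -/

section ExtremalSlope

/-- The inverse of a bijective semilinear map. -/
def semiInv {R V : Type*} [CommRing R] [AddCommGroup V] [Module R V] {σ σ' : R →+* R}
    (F : V →ₛₗ[σ] V) (hF : Function.Bijective F) (h : ∀ x, σ (σ' x) = x) : V →ₛₗ[σ'] V where
  toFun := (Equiv.ofBijective F hF).symm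
  map_add' x y := hF.1 <| by
    refine .trans ?_ (map_add F _ _).symm
    simp only [Equiv.ofBijective_apply_symm_apply]
  map_smul' c x := hF.1 <| by
    refine .trans ?_ (map_smulₛₗ F _ _).symm
    simp only [Equiv.ofBijective_apply_symm_apply, h]

theorem apply_semiInv {R V : Type*} [CommRing R] [AddCommGroup V] [Module R V] {σ σ' : R →+* R}
    (F : V →ₛₗ[σ] V) (hF : Function.Bijective F) (h : ∀ x, σ (σ' x) = x) (x : V) :
    F (semiInv F hF h x) = x := Equiv.ofBijective_apply_symm_apply F hF x

theorem semiInv_apply {R V : Type*} [CommRing R] [AddCommGroup V] [Module R V] {σ σ' : R →+* R}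
    (F : V →ₛₗ[σ] V) (hF : Function.Bijective F) (h : ∀ x, σ (σ' x) = x) (x : V) :
    semiInv F hF h (F x) = x := Equiv.ofBijective_symm_apply_apply F hF x

theorem map_ringHom_pow_eq {E : Type*} [CommRing E] {v : E → ℝ} {τ : E →+* E}
    (h : ∀ x, v (τ x) = v x) (k : ℕ) (x : E) : v ((τ ^ k) x) = v x := by
  induction k with
  | zero => rfl
  | succ k ih => rw [pow_succ', RingHom.mul_def, RingHom.comp_apply, h, ih]

variable {p : ℕ} {R : Type u} [CommRing R] [IsDomain R] [IsDiscreteValuationRing R]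

/-- A semilinear map with integral matrix in a basis of the vector space `V` which is not
topologically nilpotent splits, up to a power, into a unit part and a topologically nilpotent
part. -/
theorem exists_basis_unitPart (hR : IsMixed p R) {π : R} (hπ : Irreducible π) {s : R →+* R}
    (hsb : Function.Bijective s)
    (hA : ∀ T : Finset R, ∃ A : Subring R, (∀ x ∈ T, π * x ∈ A) ∧ (∀ x ∈ A, s x ∈ A) ∧
      ∀ x : ℕ → R, (∀ n, x n ∈ A) → (∀ n, π ^ n ∣ x (n + 1) - x n) →
        ∃ y ∈ A, ∀ n, π ^ n ∣ y - x n)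
    {s' : FractionRing R →+* FractionRing R}
    (hs' : ∀ x, s' (algebraMap R (FractionRing R) x) = algebraMap R (FractionRing R) (s x))
    {V : Type*} [AddCommGroup V] [Module (FractionRing R) V] {n : ℕ}
    (e : Module.Basis (Fin n) (FractionRing R) V) (B : V →ₛₗ[s'] V)
    (hB : ∀ i j, avFrac p R (e.repr (B (e j)) i) ≤ 1) (y : V) {δ : ℝ} (hδ : 0 < δ)
    (hy : ∀ m : ℕ, δ ≤ wnorm (avFrac p R) e (fun _ => 1) (B^[m] y)) :
    ∃ (m d d' : ℕ) (f : Module.Basis (Fin d ⊕ Fin d') (FractionRing R) V), 0 < m ∧ 0 < d ∧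
      (∀ i j, f.repr (B^[m] (f (Sum.inl i))) (Sum.inr j) = 0) ∧
      (∃ a' : Matrix (Fin d) (Fin d) (FractionRing R),
        a' * (Matrix.of fun i j => f.repr (B^[m] (f (Sum.inl j))) (Sum.inl i)) = 1 ∧
        ∀ i j, avFrac p R (a' i j) ≤ 1) ∧
      (∀ i j, avFrac p R (f.repr (B^[m] (f (Sum.inl j))) (Sum.inl i)) ≤ 1) ∧
      ∀ i j, avFrac p R (f.repr (B^[m] (f (Sum.inr j))) (Sum.inr i)) ≤ av p π := by
  classical
  set v := avFrac p R
  have hna : IsNonarchimedean v := avFrac_isNonarchimedean p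
  have hvs : ∀ x, v (s' x) = v x := avFrac_map p hR s' hs'
  let al := algebraMap R (FractionRing R)
  choose C hC using fun i j => (avFrac_le_one_iff p hR _).1 (hB i j)
  let E := Pi.basisFun R (Fin n)
  let T : (Fin n → R) →ₛₗ[s] (Fin n → R) := semiConstr E s fun j i => C i j
  let Φ : (Fin n → R) →ₛₗ[al] V := semiConstr E al e
  have hΦ : ∀ x, Φ x = ∑ j, al (x j) • e j := fun x => rfl
  have hTapp : ∀ x, T x = ∑ j, s (x j) • fun i => C i j := fun x => rfl
  have hΦrepr : ∀ x i, e.repr (Φ x) i = al (x i) := fun x i => by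
    rw [hΦ, Module.Basis.repr_sum_self]
  have hΦT : ∀ x, Φ (T x) = B (Φ x) := fun x => by
    rw [hTapp, map_sum, hΦ x, map_sum]
    refine Finset.sum_congr rfl fun j _ => ?_
    rw [map_smulₛₗ, map_smulₛₗ, hs']
    congr 1
    apply e.repr.injective
    ext i
    rw [hΦrepr]
    exact hC i j
  have hΦTm : ∀ m x, Φ (T^[m] x) = B^[m] (Φ x) := fun m => by
    induction m with
    | zero => intro x; rfl
    | succ m ih => intro x; rw [Function.iterate_succ_apply', Function.iterate_succ_apply', hΦT, ih]
  have hone : ∀ i : Fin n, (0 : ℝ) < (fun _ => 1 : Fin n → ℝ) i := fun _ => one_pos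
  have hT : ∀ m, ∃ x, ¬ ∃ y, T^[m] x = π • y := by
    intro m
    -- Otherwise `B^[m]` would multiply norms by at most `|π| < 1`, and the orbit of `y` would tend
    -- to zero.
    by_contra! hcon
    have h1 : ∀ x, wnorm v e (fun _ => 1) (B^[m] x) ≤ av p π * wnorm v e (fun _ => 1) x := by
      intro x
      refine wnorm_map_le (σ := s' ^ m) e hna (map_ringHom_pow_eq hvs m) hone e hone (siter B m)
        (av_nonneg p π) (fun j => ?_) x
      obtain ⟨y, hy⟩ := hcon (E j)
      have h2 : e j = Φ (E j) := (semiConstr_basis E al e j).symm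
      rw [siter_apply, h2, ← hΦTm, hy, map_smulₛₗ, wnorm_smul, avFrac_algebraMap]
      refine mul_le_mul_of_nonneg_left (wnorm_le e zero_le_one fun i => ?_) (av_nonneg p π)
      rw [hΦrepr, avFrac_algebraMap, mul_one]
      exact av_le_one p _
    have h2 : ∀ j, wnorm v e (fun _ => 1) ((B^[m])^[j] y) ≤
        av p π ^ j * wnorm v e (fun _ => 1) y := by
      intro j
      induction j with
      | zero => simp
      | succ j ih =>
        rw [Function.iterate_succ_apply']
        refine (h1 _).trans ?_
        rw [pow_succ', mul_assoc]
        exact mul_le_mul_of_nonneg_left ih (av_nonneg p π)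
    have h3 : δ ≤ 0 := by
      refine ge_of_tendsto' (f := fun j : ℕ => av p π ^ j * wnorm v e (fun _ => 1) y) (x := atTop)
        ?_ fun j => ?_
      · simpa using (tendsto_pow_atTop_nhds_zero_of_lt_one (av_nonneg p π)
          (av_irreducible_lt_one hR hπ)).mul_const (wnorm v e (fun _ => 1) y)
      · refine (hy (m * j)).trans ?_
        rw [Function.iterate_mul]
        exact h2 j
    exact h3.not_gt hδ
  obtain ⟨m, d, d', f, hm, hd, h1, h2, h3⟩ := exists_unitPart hπ s hsb hA T hT
  let φ := E.indexEquiv f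
  let f' := basisOfDet (e.reindex φ) (fun i => Φ (f i)) (by
    have : (e.reindex φ).det (fun i => Φ (f i)) = al ((E.reindex φ).det f) := by
      rw [Module.Basis.det_apply, Module.Basis.det_apply, RingHom.map_det]
      congr 1
      ext i j
      simp only [RingHom.mapMatrix_apply, Matrix.map_apply, Module.Basis.toMatrix_apply,
        Module.Basis.repr_reindex, Finsupp.mapDomain_equiv_apply, hΦrepr, E, Pi.basisFun_repr]
    rw [this]
    exact ((E.reindex φ).isUnit_det f).map al)
  have hf' : ∀ i, f' i = Φ (f i) := fun i => basisOfDet_apply _ _ _ i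
  have hrepr : ∀ x i, f'.repr (Φ x) i = al (f.repr x i) := fun x i => by
    have : Φ x = ∑ j, al (f.repr x j) • f' j := by
      rw [semilinear_apply f Φ]
      exact Finset.sum_congr rfl fun j _ => by rw [hf']
    rw [this, Module.Basis.repr_sum_self]
  have hmat : ∀ i j, f'.repr (B^[m] (f' j)) i = al (f.repr (T^[m] (f j)) i) := fun i j => by
    rw [hf', ← hΦTm, hrepr]
  refine ⟨m, d, d', f', hm, hd, fun i j => ?_, ⟨(Matrix.of fun i j =>
    f.repr (T^[m] (f (Sum.inl j))) (Sum.inl i))⁻¹.map al, ?_, fun i j => ?_⟩,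
    fun i j => ?_, fun i j => ?_⟩
  · rw [hmat, h1, map_zero]
  · simp only [hmat]
    have := congrArg (al.mapMatrix) (Matrix.nonsing_inv_mul _ h2)
    rw [map_mul, map_one] at this
    exact this
  · rw [Matrix.map_apply, avFrac_algebraMap]
    exact av_le_one p _
  · rw [hmat, avFrac_algebraMap]
    exact av_le_one p _
  · rw [hmat, avFrac_algebraMap]
    exact av_le_of_dvd p (h3 i j)

set_option maxHeartbeats 1000000 in
/-- The subspace on which a semilinear map has its largest slope. -/
theorem exists_slope_subspace (hR : IsMixed p R) {π : R} (hπ : Irreducible π) {σ : R →+* R}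
    (hσ : Function.Bijective σ) (hcl : HasClosedSubrings σ π)
    (σ' : FractionRing R ≃+* FractionRing R)
    (hσ' : ∀ x, σ' (algebraMap R (FractionRing R) x) = algebraMap R (FractionRing R) (σ x))
    {V : Type w} [AddCommGroup V] [Module (FractionRing R) V] {n : ℕ} (hn : 0 < n)
    (e₀ : Module.Basis (Fin n) (FractionRing R) V)
    (F : V →ₛₗ[(σ' : FractionRing R →+* FractionRing R)] V) (hF : Function.Injective F) :
    ∃ (ρ : ℝ) (K : ℕ) (z : FractionRing R) (C : ℝ) (W : Submodule (FractionRing R) V),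
      0 < ρ ∧ 0 < K ∧ z ≠ 0 ∧ ρ ^ K = avFrac p R z ∧ 0 < C ∧ W ≠ ⊥ ∧
      (∀ x ∈ W, ∀ j : ℕ,
        wnorm (avFrac p R) e₀ (fun _ => 1) ((F^[K])^[j] x) ≤
          C * (ρ ^ K) ^ j * wnorm (avFrac p R) e₀ (fun _ => 1) x ∧
        (ρ ^ K) ^ j * wnorm (avFrac p R) e₀ (fun _ => 1) x ≤
          C * wnorm (avFrac p R) e₀ (fun _ => 1) ((F^[K])^[j] x)) ∧
      ∀ x C', (∀ j : ℕ, wnorm (avFrac p R) e₀ (fun _ => 1) ((F^[K])^[j] x) ≤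
        C' * (ρ ^ K) ^ j) → x ∈ W := by
  classical
  set v := avFrac p R
  have hna : IsNonarchimedean v := avFrac_isNonarchimedean p
  have hvσ : ∀ x, v ((σ' : FractionRing R →+* FractionRing R) x) = v x := avFrac_map p hR _ hσ'
  let τ : FractionRing R →+* FractionRing R := (σ'.symm : FractionRing R →+* FractionRing R)
  have hτσ : ∀ x, (σ' : FractionRing R →+* FractionRing R) (τ x) = x := σ'.apply_symm_apply
  have hvτ : ∀ x, v (τ x) = v x := fun x => by rw [← hvσ, hτσ]
  have hτb : Function.Bijective τ := σ'.symm.bijective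
  have : FiniteDimensional (FractionRing R) V := Module.Finite.of_basis e₀
  have hFb : Function.Bijective F :=
    ⟨hF, surjective_of_injective_semilinear σ'.bijective F hF⟩
  -- The inverse is used because the closed subrings are stable under `σ⁻¹`. The part where `B`
  -- grows fastest is the part where `F` has its largest slope.
  let B : V →ₛₗ[τ] V := semiInv F hFb hτσ
  have hFB : ∀ x, F (B x) = x := apply_semiInv F hFb hτσ
  have hBF : ∀ x, B (F x) = x := semiInv_apply F hFb hτσ
  obtain ⟨ρ, hρ, ⟨n₁, e, c, hc, hle⟩, ⟨n₂, e₂, c₂, y, δ, hc₂, hδ, hge⟩, x₀, k, hx₀, hk, hρk⟩ :=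
    exists_growth hna hvτ hτb n V B (Function.LeftInverse.injective hFB)
      (by rw [Module.finrank_eq_card_basis e₀, Fintype.card_fin]) hn
  -- As `|x₀| = ρ ^ k`, this normalized power has rate `1`: it does not increase the norm given by
  -- `e` and `c`, and some orbit stays bounded away from zero.
  let B' : V →ₛₗ[τ ^ k] V := x₀⁻¹ • siter B k
  have hB' : ∀ x, B' x = x₀⁻¹ • B^[k] x := fun x => rfl
  have hvτk : ∀ x, v ((τ ^ k) x) = v x := map_ringHom_pow_eq hvτ k
  have hB'm : ∀ m, ∃ w, v w = (v x₀)⁻¹ ^ m ∧ ∀ x, B'^[m] x = w • (B^[k])^[m] x := by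
    intro m
    induction m with
    | zero => exact ⟨1, by simp, fun x => by simp⟩
    | succ m ih =>
      obtain ⟨w, hw, h⟩ := ih
      refine ⟨x₀⁻¹ * (τ ^ k) w, by rw [map_mul, hvτk, hw, map_inv₀, pow_succ'], fun x => ?_⟩
      rw [Function.iterate_succ_apply', h, map_smulₛₗ, hB', Function.iterate_succ_apply', smul_smul,
        mul_comm]
  have hlek : ∀ x, wnorm v e c (B' x) ≤ wnorm v e c x := fun x => by
    have h1 : ∀ j, wnorm v e c (B^[j] x) ≤ ρ ^ j * wnorm v e c x := fun j => by
      induction j with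
      | zero => simp
      | succ j ih =>
        rw [Function.iterate_succ_apply', pow_succ', mul_assoc]
        exact (hle _).trans (mul_le_mul_of_nonneg_left ih hρ.le)
    rw [hB', wnorm_smul, map_inv₀, ← hρk]
    rw [inv_mul_le_iff₀ (by positivity)]
    exact h1 k
  -- Rescale the orthogonal basis so that its weights lie between `|π|` and `1`. By discreteness the
  -- unit ball of the norm is then contained in the lattice spanned by `e'`, so `B'` has an integral
  -- matrix.
  choose g hg0 hg1 hg2 using fun i => exists_avFrac_mul_mem p hR hπ (hc i)
  let e' := e.isUnitSMul fun i => (hg0 i).isUnit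
  have he' : ∀ i, e' i = g i • e i := fun i => Module.Basis.isUnitSMul_apply _ i
  have he'r : ∀ x i, g i * e'.repr x i = e.repr x i := fun x i => by
    have h1 : x = ∑ j, e'.repr x j • e' j := (e'.sum_repr x).symm
    conv_rhs => rw [h1]
    simp only [he', smul_smul]
    rw [Module.Basis.repr_sum_self, mul_comm]
  have hint_le : ∀ x, wnorm v e c x ≤ 1 → ∀ i, v (e'.repr x i) ≤ 1 := fun x hx i => by
    refine avFrac_le_one_of_lt p hR hπ _ ?_
    have h1 := (le_wnorm (v := v) (c := c) e x i).trans hx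
    rw [← he'r, map_mul] at h1
    by_cases h0 : e'.repr x i = 0
    · rw [h0, map_zero, zero_mul]; exact one_pos
    · calc v (e'.repr x i) * av p π < v (e'.repr x i) * (v (g i) * c i) := by
            have := v.pos h0
            gcongr
            exact hg1 i
        _ = v (g i) * v (e'.repr x i) * c i := by ring
        _ ≤ 1 := h1
  have hone : ∀ {N : ℕ} (i : Fin N), (0 : ℝ) < (fun _ => 1 : Fin N → ℝ) i := fun _ => one_pos
  have hid : ∀ x, v (RingHom.id _ x) = v x := fun _ => rfl
  obtain ⟨D, hD, hDle⟩ := exists_wnorm_map_le e' hna hid hone e₂ hc₂ LinearMap.id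
  let s : R →+* R := ((RingEquiv.ofBijective σ hσ).symm : R →+* R)
  have hσs : ∀ x, σ (s x) = x := (RingEquiv.ofBijective σ hσ).apply_symm_apply
  have hsb : Function.Bijective s := (RingEquiv.ofBijective σ hσ).symm.bijective
  have hsτ : ∀ x, τ (algebraMap R (FractionRing R) x) = algebraMap R (FractionRing R) (s x) := by
    intro x
    apply σ'.injective
    rw [hσ', hσs]
    exact hτσ _
  have hsτk : ∀ k x, (τ ^ k) (algebraMap R (FractionRing R) x) =
      algebraMap R (FractionRing R) ((s ^ k) x) := by
    intro k
    induction k with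
    | zero => intro x; rfl
    | succ k ih =>
      intro x
      rw [pow_succ', pow_succ', RingHom.mul_def, RingHom.mul_def, RingHom.comp_apply,
        RingHom.comp_apply, ih, hsτ]
  have hAs : ∀ A : Subring R, (∀ x, σ x ∈ A → x ∈ A) → ∀ k, ∀ x ∈ A, (s ^ k) x ∈ A := by
    intro A hA k x hx
    rw [RingHom.coe_pow]
    induction k with
    | zero => exact hx
    | succ k ih =>
      rw [Function.iterate_succ_apply']
      exact hA _ (by rw [hσs]; exact ih)
  obtain ⟨m, d, d', f, hm, hd, h1, ⟨a', h2, h3⟩, h4, h5⟩ := exists_basis_unitPart hR hπ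
    (GammaRing.bijective_ringHom_pow hsb k) (fun t => by
      obtain ⟨A, hA1, hA2, hA3⟩ := hcl t
      exact ⟨A, hA1, hAs A hA2 k, hA3⟩) (hsτk k) e' B' (fun i j => by
      refine hint_le _ ((hlek _).trans ?_) i
      rw [he', wnorm_smul, wnorm_basis e hc]
      exact hg2 j) y (div_pos hδ hD) (fun m => by
        rw [div_le_iff₀ hD, mul_comm]
        refine le_trans ?_ (hDle _)
        obtain ⟨w, hw, h⟩ := hB'm m
        rw [LinearMap.id_apply, h, wnorm_smul, hw, ← Function.iterate_mul]
        have := hge (k * m)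
        calc δ = (v x₀)⁻¹ ^ m * (δ * ρ ^ (k * m)) := by
              rw [pow_mul, hρk, inv_pow]
              have := (v.pos hx₀).ne'
              field_simp
          _ ≤ _ := by gcongr)
  obtain ⟨w, hw, hw'⟩ := hB'm m
  have hFBk : ∀ j x, F^[j] (B^[j] x) = x := fun j => (Function.LeftInverse.iterate hFB j)
  have hBFk : ∀ j x, B^[j] (F^[j] x) = x := fun j => (Function.LeftInverse.iterate hBF j)
  have hρ' : (ρ⁻¹) ^ (k * m) = (v x₀)⁻¹ ^ m := by rw [pow_mul, inv_pow, hρk]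
  -- Up to scalars, `F^[k * m]` is the inverse of `B'^[m]`. Hence on the unit part of `B'^[m]` it
  -- multiplies norms by `ρ⁻¹ ^ (k * m)`, and every vector whose orbit is no larger than that lies
  -- in this part.
  have key := leftSpan_growth hna (map_ringHom_pow_eq hvτk m) f
    (GammaRing.bijective_ringHom_pow (GammaRing.bijective_ringHom_pow hτb k) m) (siter B' m)
    (av_pos p hπ.ne_zero) (av_irreducible_lt_one hR hπ) h1 a' h2 h4 h3 h5 (F^[k * m])
    (((σ' : FractionRing R →+* FractionRing R) ^ (k * m)) w) w (fun x => by
      rw [siter_apply, hw', ← Function.iterate_mul, ← siter_apply F, map_smulₛₗ, siter_apply, hFBk])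
    (fun x => by rw [siter_apply, hw', ← Function.iterate_mul, hBFk])
    (r := (ρ⁻¹) ^ (k * m)) (by positivity) (by
      rw [map_ringHom_pow_eq hvσ, hw, hρ']) (by rw [hw, hρ'])
  obtain ⟨C₁, hC₁, hC₁'⟩ := exists_wnorm_map_le f hna hid (fun _ => one_pos) e₀
    (c' := fun _ => 1) hone LinearMap.id
  obtain ⟨C₂, hC₂, hC₂'⟩ := exists_wnorm_map_le e₀ hna hid hone f
    (c' := fun _ => 1) (fun _ => one_pos) LinearMap.id
  refine ⟨ρ⁻¹, k * m, x₀⁻¹ ^ m, C₁ * C₂, leftSpan f, by positivity, by positivity,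
    pow_ne_zero _ (inv_ne_zero hx₀), by rw [hρ', map_pow, map_inv₀], by positivity, ?_,
    fun x hx j => ⟨?_, ?_⟩, fun x C' hx => key.2 x (C₂ * C') fun j => ?_⟩
  · intro h
    have h1 : f (Sum.inl ⟨0, hd⟩) ∈ leftSpan f := fun j => by
      rw [f.repr_self, Finsupp.single_eq_of_ne (by simp)]
    rw [h, Submodule.mem_bot] at h1
    exact f.ne_zero _ h1
  · refine (hC₁' _).trans ?_
    rw [key.1 x hx j]
    calc _ ≤ C₁ * ((ρ⁻¹ ^ (k * m)) ^ j * (C₂ * wnorm v e₀ (fun _ => 1) x)) := by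
          gcongr; exact hC₂' x
      _ = _ := by ring
  · calc _ ≤ (ρ⁻¹ ^ (k * m)) ^ j * (C₁ * wnorm v f (fun _ => 1) x) := by
          gcongr; exact hC₁' x
      _ = C₁ * wnorm v f (fun _ => 1) ((F^[k * m])^[j] x) := by rw [key.1 x hx j]; ring
      _ ≤ C₁ * (C₂ * wnorm v e₀ (fun _ => 1) ((F^[k * m])^[j] x)) := by
          gcongr; exact hC₂' _
      _ = _ := by ring
  · refine (hC₂' _).trans ?_
    rw [mul_assoc]
    exact mul_le_mul_of_nonneg_left (hx j) hC₂.le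

end ExtremalSlope

/-! ### The submodules of a given slope -/

section Slopes

/-- The absolute value of an element of valuation `s`. -/
def rho (s : ℚ) : ℝ := (2 : ℝ) ^ (-(s : ℝ))

theorem rho_pos (s : ℚ) : 0 < rho s := Real.rpow_pos_of_pos two_pos _

theorem rho_lt_rho {s t : ℚ} : rho s < rho t ↔ t < s := by
  rw [rho, rho, Real.rpow_lt_rpow_left_iff one_lt_two, neg_lt_neg_iff, Rat.cast_lt]

theorem rho_le_rho {s t : ℚ} : rho s ≤ rho t ↔ t ≤ s := by
  rw [← not_lt, rho_lt_rho, not_lt]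

theorem rho_injective : Function.Injective rho := fun _ _ h =>
  le_antisymm (rho_le_rho.1 h.ge) (rho_le_rho.1 h.le)

theorem rho_nsmul (n : ℕ) (s : ℚ) : rho (n * s) = rho s ^ n := by
  rw [rho, rho, ← Real.rpow_natCast, ← Real.rpow_mul zero_le_two]
  congr 1
  push_cast
  ring

theorem av_eq_rho (p : ℕ) {A : Type u} [CommRing A] [IsDomain A] [IsDiscreteValuationRing A]
    {x : A} (hx : x ≠ 0) : av p x = rho (vp p x) := by rw [av, if_neg hx, rho]

variable {p : ℕ} {R : Type u} [CommRing R] [IsDomain R] [IsDiscreteValuationRing R]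
  (hR : IsMixed p R) {σ : R →+* R} {M : Type*} [AddCommGroup M] [Module R M] [Module.Free R M]
  [Module.Finite R M] (F : M →ₛₗ[σ] M)

include hR in
theorem nm_iterate_smul (k : ℕ) (a : R) (x : M) :
    nm (A := R) p (F^[k] (a • x)) = av p a * nm (A := R) p (F^[k] x) := by
  rw [← siter_apply, map_smulₛₗ, nm_smul, av_map hR hR, siter_apply]

/-- The elements of `M` on which `F` has slope at least `s`. -/
def slopeSub (s : ℚ) : Submodule R M where
  carrier := {x | ∃ C : ℝ, ∀ k : ℕ, nm (A := R) p (F^[k] x) ≤ C * rho s ^ k}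
  zero_mem' := ⟨0, fun k => by
    rw [← siter_apply, map_zero, zero_mul]
    exact ((nm_eq_zero hR).2 rfl).le⟩
  add_mem' := by
    rintro x y ⟨C, hC⟩ ⟨D, hD⟩
    refine ⟨max C D, fun k => ?_⟩
    have h0 : 0 ≤ rho s ^ k := pow_nonneg (rho_pos s).le k
    rw [iterate_map_add]
    refine (nm_add_le _ _).trans (max_le ((hC k).trans ?_) ((hD k).trans ?_))
    · exact mul_le_mul_of_nonneg_right (le_max_left _ _) h0
    · exact mul_le_mul_of_nonneg_right (le_max_right _ _) h0
  smul_mem' := by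
    rintro c x ⟨C, hC⟩
    refine ⟨av p c * C, fun k => ?_⟩
    rw [nm_iterate_smul hR, mul_assoc]
    exact mul_le_mul_of_nonneg_left (hC k) (av_nonneg p c)

theorem slopeSub_saturated (s : ℚ) : IsSaturated (slopeSub hR F s) := by
  rintro a x ha ⟨C, hC⟩
  refine ⟨C / av p a, fun k => ?_⟩
  have h := hC k
  rw [nm_iterate_smul hR] at h
  rw [div_mul_eq_mul_div, le_div_iff₀ (av_pos p ha), mul_comm]
  exact h

theorem slopeSub_stable (s : ℚ) : ∀ x ∈ slopeSub hR F s, F x ∈ slopeSub hR F s := by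
  rintro x ⟨C, hC⟩
  refine ⟨C * rho s, fun k => ?_⟩
  rw [← Function.iterate_succ_apply, mul_assoc, ← pow_succ']
  exact hC _

theorem slopeSub_anti {s t : ℚ} (h : s ≤ t) : slopeSub hR F t ≤ slopeSub hR F s := by
  rintro x ⟨C, hC⟩
  have h0 : 0 ≤ C := by simpa using (nm_nonneg _).trans (hC 0)
  refine ⟨C, fun k => (hC k).trans (mul_le_mul_of_nonneg_left ?_ h0)⟩
  exact pow_le_pow_left₀ (rho_pos t).le (rho_le_rho.2 h) k

include hR in
theorem nm_iterate_anti {k l : ℕ} (h : k ≤ l) (x : M) :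
    nm (A := R) p (F^[l] x) ≤ nm (A := R) p (F^[k] x) := by
  induction l, h using Nat.le_induction with
  | base => rfl
  | succ l _ ih =>
    rw [Function.iterate_succ_apply']
    exact (nm_semilinear_le hR F _).trans ih

include hR in
/-- The part of largest slope of a nonzero module is nonzero, and pure. -/
theorem exists_slopeSub_pure {π : R} (hπ : Irreducible π) (hσ : Function.Bijective σ)
    (hcl : HasClosedSubrings σ π) [Nontrivial M] (hF : Function.Injective F) :
    ∃ s : ℚ, slopeSub hR F s ≠ ⊥ ∧ ∃ C : ℝ, 0 < C ∧ ∀ x ∈ slopeSub hR F s, ∀ k : ℕ,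
      nm (A := R) p (F^[k] x) ≤ C * rho s ^ k * nm (A := R) p x ∧
      rho s ^ k * nm (A := R) p x ≤ C * nm (A := R) p (F^[k] x) := by
  classical
  let b := Module.finBasis R M
  set n := Module.finrank R M
  let al := algebraMap R (FractionRing R)
  let V := Fin n → FractionRing R
  let e₀ := Pi.basisFun (FractionRing R) (Fin n)
  let σ' : FractionRing R ≃+* FractionRing R :=
    IsFractionRing.ringEquivOfRingEquiv (RingEquiv.ofBijective σ hσ)
  have hσ' : ∀ x, σ' (al x) = al (σ x) := fun x =>
    IsFractionRing.ringEquivOfRingEquiv_algebraMap (RingEquiv.ofBijective σ hσ) x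
  let ι : M →ₛₗ[al] V := semiConstr b al e₀
  have hιrepr : ∀ x i, e₀.repr (ι x) i = al (b.repr x i) := fun x i => by
    change e₀.repr (∑ j, al (b.repr x j) • e₀ j) i = _
    rw [Module.Basis.repr_sum_self]
  have hnm : ∀ x, wnorm (avFrac p R) e₀ (fun _ => 1) (ι x) = nm (A := R) p x := fun x => by
    rw [nm_eq_bnorm b hR, wnorm, bnorm]
    simp only [hιrepr, avFrac_algebraMap, mul_one, al]
  let FV : V →ₛₗ[(σ' : FractionRing R →+* FractionRing R)] V :=
    semiConstr e₀ (σ' : FractionRing R →+* FractionRing R) fun j => ι (F (b j))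
  have hFV : ∀ x, FV (ι x) = ι (F x) := fun x => by
    rw [semilinear_apply e₀ FV, semilinear_apply b F x, map_sum]
    refine Finset.sum_congr rfl fun j _ => ?_
    rw [map_smulₛₗ, hιrepr]
    exact congrArg₂ _ (hσ' _) (semiConstr_basis _ _ _ _)
  have hFVk : ∀ k x, FV^[k] (ι x) = ι (F^[k] x) := fun k => by
    induction k with
    | zero => intro x; rfl
    | succ k ih => intro x; rw [Function.iterate_succ_apply', Function.iterate_succ_apply', ih, hFV]
  have hclear : ∀ y : V, ∃ (a : R) (x : M), a ≠ 0 ∧ al a • y = ι x := fun y => by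
    obtain ⟨a, ha⟩ := IsLocalization.exist_integer_multiples_of_finite (nonZeroDivisors R) y
    choose c hc using ha
    refine ⟨a, ∑ i, c i • b i, nonZeroDivisors.ne_zero a.2, ?_⟩
    apply e₀.repr.injective
    ext i
    rw [hιrepr, Module.Basis.repr_sum_self]
    change al a * y i = al (c i)
    rw [hc, Algebra.smul_def]
  have hι0 : ∀ x, ι x = 0 ↔ x = 0 := fun x => by
    refine ⟨fun h => (nm_eq_zero (p := p) (A := R) hR).1 ?_, fun h => by rw [h, map_zero]⟩
    rw [← hnm, h]
    simp [wnorm]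
  have hal : ∀ a, a ≠ 0 → al a ≠ 0 := fun a ha => by simpa [al] using ha
  have hFVinj : Function.Injective FV := by
    rw [injective_iff_map_eq_zero]
    intro y hy
    obtain ⟨a, x, ha, hx⟩ := hclear y
    have h1 : ι (F x) = 0 := by rw [← hFV, ← hx, map_smulₛₗ, hy, smul_zero]
    rw [hι0, ← map_zero F] at h1
    rw [hF h1, map_zero] at hx
    exact (smul_eq_zero.1 hx).resolve_left (hal a ha)
  obtain ⟨ρ, K, z, C, W, hρ, hK, hz, hρz, hC, hW, h1, h2⟩ := exists_slope_subspace hR hπ hσ hcl σ' hσ'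
    (Module.finrank_pos (R := R) (M := M)) e₀ FV hFVinj
  -- A power of `ρ` is the absolute value of a fraction, so `ρ` is `2` to a rational exponent.
  obtain ⟨s, rfl⟩ : ∃ s, rho s = ρ := by
    obtain ⟨c, d, hd, rfl⟩ := exists_eq_div z
    have hc : c ≠ 0 := fun h => hz (by rw [h, map_zero, zero_div])
    refine ⟨(vp p c - vp p d) / K, ?_⟩
    refine (pow_left_inj₀ (rho_pos _).le hρ.le hK.ne').1 ?_
    rw [hρz, avFrac_div p _ hd, ← rho_nsmul, av_eq_rho p hc, av_eq_rho p hd]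
    rw [rho, rho, rho, ← Real.rpow_sub two_pos]
    congr 1
    have : (K : ℝ) ≠ 0 := by exact_mod_cast hK.ne'
    push_cast
    field_simp
    ring
  have hmem : ∀ x, x ∈ slopeSub hR F s → ι x ∈ W := fun x ⟨D, hD⟩ => by
    refine h2 _ D fun j => ?_
    rw [← Function.iterate_mul, hFVk, hnm, ← pow_mul]
    exact hD _
  have hρ1 : 0 < max 1 (rho s)⁻¹ := lt_max_of_lt_left one_pos
  -- So far only the iterates of `F^[K]` are controlled. As `F` does not increase norms, an
  -- arbitrary iterate is squeezed between the neighbouring multiples of `K`, at the price of the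
  -- constant `D`.
  have hD : ∀ k : ℕ, k ≤ K → (rho s)⁻¹ ^ k ≤ max 1 (rho s)⁻¹ ^ K := fun k hk =>
    (pow_le_pow_left₀ (by positivity) (le_max_right _ _) k).trans
      (pow_le_pow_right₀ (le_max_left _ _) hk)
  set D := max 1 (rho s)⁻¹ ^ K
  have hD0 : 0 < D := pow_pos hρ1 K
  have hbd : ∀ x, ι x ∈ W → ∀ k : ℕ, nm (A := R) p (F^[k] x) ≤
      (C * D) * rho s ^ k * nm (A := R) p x ∧
      rho s ^ k * nm (A := R) p x ≤ (C * D) * nm (A := R) p (F^[k] x) := by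
    intro x hx k
    have hb : ∀ j : ℕ, nm (A := R) p (F^[K * j] x) ≤ C * (rho s ^ (K * j)) * nm (A := R) p x ∧
        rho s ^ (K * j) * nm (A := R) p x ≤ C * nm (A := R) p (F^[K * j] x) := fun j => by
      have := h1 _ hx j
      rwa [← Function.iterate_mul, hFVk, hnm, hnm, ← pow_mul] at this
    have hk := Nat.div_add_mod k K
    have hk' := Nat.mod_lt k hK
    have hn0 := nm_nonneg (A := R) (p := p) x
    constructor
    · refine (nm_iterate_anti hR F (by lia : K * (k / K) ≤ k) x).trans ((hb (k / K)).1.trans ?_)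
      have e : rho s ^ (K * (k / K)) = (rho s)⁻¹ ^ (k % K) * rho s ^ k := by
        conv_rhs => rw [← hk, pow_add, Nat.mul_add_mod, Nat.mod_mod]
        rw [inv_pow]
        have := (rho_pos s).ne'
        field_simp
      rw [e]
      have := hD _ hk'.le
      calc _ ≤ C * (D * rho s ^ k) * nm (A := R) p x := by gcongr
        _ = _ := by ring
    · have e : rho s ^ k = (rho s)⁻¹ ^ (K - k % K) * rho s ^ (K * (k / K + 1)) := by
        have : K * (k / K + 1) = k + (K - k % K) := by
          rw [Nat.mul_add, mul_one]; lia
        rw [this, pow_add, inv_pow]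
        have := (rho_pos s).ne'
        field_simp
      rw [e, mul_assoc]
      have h3 := hD (K - k % K) (Nat.sub_le _ _)
      have h4 := (hb (k / K + 1)).2
      have h5 := nm_iterate_anti hR F (by
        rw [Nat.mul_add, mul_one]; lia : k ≤ K * (k / K + 1)) x
      calc _ ≤ D * (C * nm (A := R) p (F^[k] x)) :=
            mul_le_mul h3 (h4.trans (mul_le_mul_of_nonneg_left h5 hC.le))
              (mul_nonneg (pow_nonneg (rho_pos s).le _) hn0) hD0.le
        _ = _ := by ring
  refine ⟨s, ?_, C * D, by positivity, fun x hx => hbd x (hmem x hx)⟩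
  obtain ⟨y, hy, hy0⟩ := Submodule.exists_mem_ne_zero_of_ne_bot hW
  obtain ⟨a, x, ha, hx⟩ := hclear y
  intro h
  have hxW : ι x ∈ W := hx ▸ W.smul_mem _ hy
  have hxs : x ∈ slopeSub hR F s := ⟨C * D * nm (A := R) p x, fun k => by
    rw [mul_right_comm]; exact (hbd x hxW k).1⟩
  rw [h, Submodule.mem_bot] at hxs
  rw [hxs, map_zero] at hx
  exact hy0 ((smul_eq_zero.1 hx).resolve_left (hal a ha))

end Slopes

/-! ### Pure modules and extensions -/

section Purity

/-- `F` scales norms by powers of `rho s`, up to a constant. -/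
def IsPure (p : ℕ) {R : Type u} [CommRing R] [IsDomain R] [IsDiscreteValuationRing R]
    {σ : R →+* R} {M : Type*} [AddCommGroup M] [Module R M] (F : M →ₛₗ[σ] M) (s : ℚ) : Prop :=
  ∃ (_ : Module.Free R M) (_ : Module.Finite R M) (C : ℝ), 0 < C ∧ ∀ (k : ℕ) (x : M),
    nm (A := R) p (F^[k] x) ≤ C * rho s ^ k * nm (A := R) p x ∧
    rho s ^ k * nm (A := R) p x ≤ C * nm (A := R) p (F^[k] x)

variable {p : ℕ} {R : Type u} [CommRing R] [IsDomain R] [IsDiscreteValuationRing R]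
  (hR : IsMixed p R) {σ : R →+* R} {M : Type*} [AddCommGroup M] [Module R M] (F : M →ₛₗ[σ] M)

theorem iterate_comm {α β : Type*} {f : α → α} {g : β → β} {e : α → β} (h : ∀ x, e (f x) = g (e x))
    (k : ℕ) (x : α) : e (f^[k] x) = g^[k] (e x) := by
  induction k generalizing x with
  | zero => rfl
  | succ k ih => rw [Function.iterate_succ_apply, ih, h, Function.iterate_succ_apply]

include hR in
theorem IsPure.of_equiv {N : Type*} [AddCommGroup N] [Module R N] {F : M →ₛₗ[σ] M}
    {F' : N →ₛₗ[σ] N} {s : ℚ} (h : IsPure p F s) (e : M ≃ₗ[R] N) (he : ∀ x, e (F x) = F' (e x)) :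
    IsPure p F' s := by
  obtain ⟨_, _, C, hC, h⟩ := h
  have hfr : Module.Free R N := Module.Free.of_equiv e
  have hfi : Module.Finite R N := Module.Finite.equiv e
  refine ⟨hfr, hfi, C, hC, fun k x => ?_⟩
  have h1 := h k (e.symm x)
  rwa [← nm_equiv hR e, ← nm_equiv hR e, iterate_comm he, e.apply_symm_apply] at h1

variable [Module.Free R M] [Module.Finite R M]

include hR in
/-- The submodules `slopeSub` are closed under extensions. -/
theorem mem_slopeSub_of_extension {s : ℚ} (B : Submodule R M) (hB : ∀ x ∈ B, F x ∈ B)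
    {Q : Type*} [AddCommGroup Q] [Module R Q] [Module.Free R Q] [Module.Finite R Q]
    (g : B →ₗ[R] Q) (hg : Function.Surjective g) (F' : Q →ₛₗ[σ] Q)
    (hF' : ∀ x : B, g ⟨F x, hB x x.2⟩ = F' (g x))
    (hker : ∀ x : B, g x = 0 → (x : M) ∈ slopeSub hR F s) (x : B)
    (hx : ∃ C : ℝ, ∀ k : ℕ, nm (A := R) p (F'^[k] (g x)) ≤ C * rho s ^ k) :
    (x : M) ∈ slopeSub hR F s := by
  obtain ⟨C, hC⟩ := hx
  have hC0 : 0 ≤ C := by simpa using (nm_nonneg _).trans (hC 0)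
  have hρ := rho_pos s
  let FB : B →ₛₗ[σ] B := F.restrict hB
  have hFB : ∀ y : B, ((FB y : B) : M) = F y := fun y => rfl
  have hgFB : ∀ y : B, g (FB y) = F' (g y) := hF'
  let N := LinearMap.ker g
  have hN : IsSaturated N := fun a y ha h => by
    rw [LinearMap.mem_ker, map_smul, smul_eq_zero] at h
    exact h.resolve_left ha
  -- Each kernel element comes with its own constant; a finite basis of the kernel provides a
  -- uniform one, relative to the norm.
  obtain ⟨D, hD0, hD⟩ : ∃ D : ℝ, 0 < D ∧ ∀ (n : N) (k : ℕ),
      nm (A := R) p (F^[k] ((n : B) : M)) ≤ D * rho s ^ k * nm (A := R) p (n : B) := by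
    let b := Module.finBasis R N
    choose D hD using fun i => hker (b i : B) (b i).2
    refine ⟨∑ i, |D i| + 1, by positivity, fun n k => ?_⟩
    have e : F^[k] ((n : B) : M) = siter F k (∑ i, b.repr n i • ((b i : B) : M)) := by
      rw [siter_apply]
      congr 1
      have h := congrArg (B.subtype ∘ₗ N.subtype) (b.sum_repr n)
      rw [map_sum] at h
      simp only [map_smul] at h
      exact h.symm
    rw [e, map_sum]
    refine nm_sum_le _ _ (by have := nm_nonneg (A := R) (p := p) (n : B); positivity) fun i _ => ?_
    rw [siter_apply, nm_iterate_smul hR, nm_coe hR hN, nm_eq_bnorm b hR]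
    have h1 := av_repr_le_bnorm (p := p) b n i
    have h2 : D i ≤ ∑ i, |D i| + 1 := by
      have := Finset.single_le_sum (f := fun i => |D i|) (fun i _ => abs_nonneg _)
        (Finset.mem_univ i)
      have := le_abs_self (D i)
      linarith
    calc _ ≤ bnorm p b n * ((∑ i, |D i| + 1) * rho s ^ k) :=
          mul_le_mul h1 ((hD i k).trans (mul_le_mul_of_nonneg_right h2 (by positivity)))
            (nm_nonneg _) (bnorm_nonneg _ _)
      _ = _ := by ring
  -- Lift the orbit of `g x` term by term without increasing norms. The lifts need not form an
  -- orbit, but the errors `FB (y k) - y (k + 1)` lie in the kernel and have size `O(rho s ^ k)`.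
  choose y hy hynm using fun k : ℕ => exists_lift_nm_eq hR hg (F'^[k] (g x))
  have hy' : ∀ k, nm (A := R) p (y k) ≤ C * rho s ^ k := fun k => (hynm k).trans_le (hC k)
  let C' := C * max 1 (rho s)
  have hC' : 0 ≤ C' := by positivity
  have hz : ∀ k, FB (y k) - y (k + 1) ∈ N := fun k => by
    rw [LinearMap.mem_ker, map_sub, hgFB, hy, hy, Function.iterate_succ_apply', sub_self]
  have hznm : ∀ k, nm (A := R) p (FB (y k) - y (k + 1)) ≤ C' * rho s ^ k := fun k => by
    rw [sub_eq_add_neg]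
    refine (nm_add_le _ _).trans (max_le ?_ ?_)
    · refine (nm_semilinear_le hR FB _).trans ((hy' k).trans ?_)
      refine mul_le_mul_of_nonneg_right ?_ (by positivity)
      exact le_mul_of_one_le_right hC0 (le_max_left _ _)
    · rw [nm_neg]
      refine (hy' _).trans ?_
      rw [pow_succ', ← mul_assoc]
      exact mul_le_mul_of_nonneg_right (mul_le_mul_of_nonneg_left (le_max_right _ _) hC0)
        (by positivity)
  have h0 : (y 0 : M) ∈ slopeSub hR F s := by
    refine ⟨max C (D * C' / rho s), fun k => ?_⟩
    -- By telescoping, the orbit of `y 0` is `y k` plus iterates of the errors. Each of these is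
    -- `O(rho s ^ (k - 1 - i) * rho s ^ i)`, and the ultrametric inequality avoids a factor `k`.
    have hsum : F^[k] (y 0 : M) = y k + ∑ i ∈ Finset.range k,
        F^[k - 1 - i] ((FB (y i) - y (i + 1) : B) : M) := by
      induction k with
      | zero => simp
      | succ k ih =>
        rw [Function.iterate_succ_apply', ih, map_add, map_sum, Finset.sum_range_succ]
        have e1 : F (y k) = (y (k + 1) : M) + ((FB (y k) - y (k + 1) : B) : M) := by
          rw [AddSubgroupClass.coe_sub, hFB]; abel
        rw [e1]
        have e2 : ∀ i ∈ Finset.range k, F (F^[k - 1 - i] ((FB (y i) - y (i + 1) : B) : M)) =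
            F^[k + 1 - 1 - i] ((FB (y i) - y (i + 1) : B) : M) := fun i hi => by
          refine (Function.iterate_succ_apply' F _ _).symm.trans ?_
          congr 2
          have := Finset.mem_range.1 hi
          lia
        rw [Finset.sum_congr rfl e2]
        have e3 : k + 1 - 1 - k = 0 := by lia
        rw [e3, Function.iterate_zero, id]
        abel
    rw [hsum]
    refine (nm_add_le _ _).trans (max_le ?_ ?_)
    · refine (nm_map_le hR B.subtype (y k)).trans ((hy' k).trans ?_)
      exact mul_le_mul_of_nonneg_right (le_max_left _ _) (by positivity)
    · refine nm_sum_le _ _ (by positivity) fun i hi => ?_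
      have hi' := Finset.mem_range.1 hi
      refine (hD ⟨_, hz i⟩ _).trans ?_
      calc D * rho s ^ (k - 1 - i) * nm (A := R) p (FB (y i) - y (i + 1))
          ≤ D * rho s ^ (k - 1 - i) * (C' * rho s ^ i) := by gcongr; exact hznm i
        _ = D * C' / rho s * rho s ^ (k - 1 - i + i + 1) := by
            rw [pow_succ, pow_add]; field_simp
        _ = D * C' / rho s * rho s ^ k := by congr 2; lia
        _ ≤ _ := mul_le_mul_of_nonneg_right (le_max_right _ _) (by positivity)
  have h1 : ((x - y 0 : B) : M) ∈ slopeSub hR F s := hker _ (by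
    rw [map_sub, hy]; exact sub_self _)
  have := add_mem h1 h0
  rwa [AddSubgroupClass.coe_sub, sub_add_cancel] at this

include hR in
/-- An element of slope greater than that of a pure quotient vanishes in the quotient. -/
theorem eq_zero_of_mem_slopeSub {s t : ℚ} (hst : t < s) (B : Submodule R M) (hBs : IsSaturated B)
    (hB : ∀ x ∈ B, F x ∈ B) {Q : Type*} [AddCommGroup Q] [Module R Q]
    (g : B →ₗ[R] Q) {F' : Q →ₛₗ[σ] Q} (hF' : ∀ x : B, g ⟨F x, hB x x.2⟩ = F' (g x))
    (hQ : IsPure p F' t) (x : B) (hx : (x : M) ∈ slopeSub hR F s) : g x = 0 := by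
  obtain ⟨_, _, C, hC, h⟩ := hQ
  obtain ⟨D, hD⟩ := hx
  let FB : B →ₛₗ[σ] B := F.restrict hB
  have hgk : ∀ k, g (FB^[k] x) = F'^[k] (g x) := fun k => iterate_comm (f := FB) hF' k x
  have hck : ∀ k, ((FB^[k] x : B) : M) = F^[k] x := fun k =>
    iterate_comm (f := FB) (e := Subtype.val) (fun _ => rfl) k x
  -- The lower bound of purity in the quotient, against the decay of the orbit of `x`, bounds `g x`
  -- by a quantity that tends to zero because `rho s < rho t`.
  have h1 : ∀ k : ℕ, nm (A := R) p (g x) ≤ C * D * (rho s / rho t) ^ k := fun k => by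
    have h2 := (h k (g x)).2
    have h3 : nm (A := R) p (F'^[k] (g x)) ≤ D * rho s ^ k := by
      rw [← hgk]
      refine (nm_map_le hR g _).trans ?_
      rw [← nm_coe hR hBs, hck]
      exact hD k
    rw [div_pow, ← mul_div_assoc, le_div_iff₀ (pow_pos (rho_pos t) k), mul_comm]
    refine h2.trans ?_
    rw [mul_assoc]
    exact mul_le_mul_of_nonneg_left h3 hC.le
  rw [← nm_eq_zero (p := p) (A := R) hR]
  refine le_antisymm (ge_of_tendsto' (x := atTop) ?_ h1) (nm_nonneg _)
  have := tendsto_pow_atTop_nhds_zero_of_lt_one (div_pos (rho_pos s) (rho_pos t)).le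
    ((div_lt_one (rho_pos t)).2 (rho_lt_rho.2 hst))
  simpa using this.const_mul (C * D)

end Purity

/-! ### Filtrations with pure quotients -/

section Filtrations

variable {p : ℕ} {R : Type u} [CommRing R] [IsDomain R] [IsDiscreteValuationRing R]
  (hR : IsMixed p R) {σ : R →+* R}

/-- Saturation makes the quotient torsion-free, and finite torsion-free modules over a principal
ideal domain are free. -/
theorem free_quotient_of_isSaturated {M : Type*} [AddCommGroup M] [Module R M] [Module.Finite R M]
    {N : Submodule R M} (hN : IsSaturated N) : Module.Free R (M ⧸ N) := by
  have : Module.IsTorsionFree R (M ⧸ N) := by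
    rw [Module.isTorsionFree_iff_smul_eq_zero]
    intro r m h
    obtain ⟨m, rfl⟩ := N.mkQ_surjective m
    rw [or_iff_not_imp_left]
    intro hr
    rw [← map_smul, Submodule.mkQ_apply, Submodule.Quotient.mk_eq_zero] at h
    rw [Submodule.mkQ_apply, Submodule.Quotient.mk_eq_zero]
    exact hN r m hr h
  infer_instance

section

variable {M : Type w} [AddCommGroup M] [Module R M] {F : M →ₛₗ[σ] M}

variable (p) in
/-- A strictly increasing filtration by saturated submodules with pure quotients of strictly
decreasing slopes. -/
structure SigmaFiltration.IsPureFiltration (D : SigmaFiltration F) : Prop where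
  bot : D.step 0 = ⊥
  top : D.step (Fin.last D.length) = ⊤
  lt : ∀ i : Fin D.length, D.step i.castSucc < D.step i.succ
  saturated : ∀ (i : Fin D.length) (a : R) (x : M), a ≠ 0 → x ∈ D.step i.succ →
    a • x ∈ D.step i.castSucc → x ∈ D.step i.castSucc
  isPure : ∀ i, IsPure p (D.grFrob i) (D.slope i)
  strictAnti : StrictAnti D.slope

namespace SigmaFiltration.IsPureFiltration

variable {D : SigmaFiltration F} (h : D.IsPureFiltration p)
include h

theorem step_isSaturated (i : Fin (D.length + 1)) : IsSaturated (D.step i) := by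
  induction i using Fin.reverseInduction with
  | last => rw [h.top]; exact fun _ _ _ _ => trivial
  | cast i ih =>
    intro a x ha hx
    exact h.saturated i a x ha (ih a x ha ((h.lt i).le hx)) hx

variable [Module.Free R M] [Module.Finite R M]

include hR in
theorem step_le_slopeSub (j : Fin (D.length + 1)) (s : ℚ)
    (hs : ∀ i : Fin D.length, i.succ ≤ j → s ≤ D.slope i) : D.step j ≤ slopeSub hR F s := by
  induction j using Fin.induction with
  | zero => rw [h.bot]; exact bot_le
  | succ i ih =>
    intro x hx
    obtain ⟨_, _, C, hC, hp⟩ := h.isPure i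
    refine mem_slopeSub_of_extension hR F (D.step i.succ) (D.stable i.succ)
      (Submodule.mkQ ((D.step i.castSucc).submoduleOf (D.step i.succ))) (Submodule.mkQ_surjective _)
      (D.grFrob i) (fun _ => rfl) (fun y hy => ?_) ⟨x, hx⟩ ?_
    · rw [Submodule.mkQ_apply, Submodule.Quotient.mk_eq_zero] at hy
      exact ih (fun k hk => hs k (hk.trans (Fin.castSucc_lt_succ).le)) hy
    · set y := (Submodule.mkQ ((D.step i.castSucc).submoduleOf (D.step i.succ))) ⟨x, hx⟩
      refine ⟨C * nm (A := R) p y, fun k => (hp k y).1.trans ?_⟩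
      have h0 := nm_nonneg (A := R) (p := p) y
      have h1 := pow_le_pow_left₀ (rho_pos _).le (rho_le_rho.2 (hs i le_rfl)) k
      calc _ ≤ C * rho s ^ k * nm (A := R) p y := by gcongr
        _ = _ := by ring

include hR in
theorem mem_step_castSucc {i : Fin D.length} {s : ℚ} (hs : D.slope i < s) {x : M}
    (hx : x ∈ D.step i.succ) (hxs : x ∈ slopeSub hR F s) : x ∈ D.step i.castSucc := by
  have h1 := eq_zero_of_mem_slopeSub hR F hs (D.step i.succ) (h.step_isSaturated _)
    (D.stable i.succ) (Submodule.mkQ ((D.step i.castSucc).submoduleOf (D.step i.succ)))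
    (F' := D.grFrob i) (fun _ => rfl) (h.isPure i) ⟨x, hx⟩ hxs
  rw [Submodule.mkQ_apply, Submodule.Quotient.mk_eq_zero] at h1
  exact h1

include hR in
theorem slopeSub_le_step (j : Fin (D.length + 1)) (s : ℚ)
    (hs : ∀ i : Fin D.length, j ≤ i.castSucc → D.slope i < s) : slopeSub hR F s ≤ D.step j := by
  induction j using Fin.reverseInduction with
  | last => rw [h.top]; exact le_top
  | cast i ih =>
    intro x hx
    exact h.mem_step_castSucc hR (hs i le_rfl)
      (ih (fun k hk => hs k ((Fin.castSucc_lt_succ).le.trans hk)) hx) hx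

include hR in
-- Going up, an extension of pure pieces of slope at least `s` stays inside `slopeSub`; going down,
-- a pure piece of smaller slope receives nothing from it. So the step depends only on its slope and
-- not on the filtration.
theorem step_succ (i : Fin D.length) : D.step i.succ = slopeSub hR F (D.slope i) := by
  refine le_antisymm (h.step_le_slopeSub hR _ _ fun j hj => ?_)
    (h.slopeSub_le_step hR _ _ fun j hj => h.strictAnti ?_)
  · exact h.strictAnti.antitone (Fin.succ_le_succ_iff.1 hj)
  · rwa [Fin.succ_le_castSucc_iff] at hj

include hR in
-- The right-hand side is the set of jumps of the decreasing family `slopeSub`, which makes no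
-- reference to `D`.
theorem range_slope : Set.range D.slope =
    {s | ∃ x ∈ slopeSub hR F s, ∀ s', s < s' → x ∉ slopeSub hR F s'} := by
  ext s
  constructor
  · rintro ⟨i, rfl⟩
    obtain ⟨x, hx, hx'⟩ := SetLike.exists_of_lt (h.lt i)
    exact ⟨x, h.step_succ hR i ▸ hx, fun s' hs' hxs => hx' (h.mem_step_castSucc hR hs' hx hxs)⟩
  · rintro ⟨x, hx, hx'⟩
    obtain ⟨i, hi, hi'⟩ : ∃ i : Fin D.length, x ∈ D.step i.succ ∧ x ∉ D.step i.castSucc := by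
      by_contra! hcon
      have : ∀ j, x ∈ D.step j := fun j => by
        induction j using Fin.reverseInduction with
        | last => rw [h.top]; trivial
        | cast i ih => exact hcon i ih
      have h0 := this 0
      rw [h.bot, Submodule.mem_bot] at h0
      exact hx' (s + 1) (lt_add_one s) (h0 ▸ zero_mem _)
    refine ⟨i, ?_⟩
    rcases lt_trichotomy (D.slope i) s with h1 | h1 | h1
    · exact absurd (h.mem_step_castSucc hR h1 hi hx) hi'
    · exact h1
    · exact absurd (h.step_succ hR i ▸ hi) (hx' _ h1)

end SigmaFiltration.IsPureFiltration

include hR in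
-- Strictly decreasing enumerations of the same finite set of slopes agree, and `step_succ` recovers
-- the steps from the slopes.
theorem SigmaFiltration.IsPureFiltration.unique [Module.Free R M] [Module.Finite R M]
    {D D' : SigmaFiltration F} (h : D.IsPureFiltration p) (h' : D'.IsPureFiltration p) : D = D' := by
  have hr : Set.range D.slope = Set.range D'.slope := (h.range_slope hR).trans (h'.range_slope hR).symm
  have h1 := h.step_succ hR
  have h1' := h'.step_succ hR
  have h2 := h.bot.trans h'.bot.symm
  have h3 := h.strictAnti
  have h3' := h'.strictAnti
  clear h h'
  obtain ⟨n, step, slope, st⟩ := D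
  obtain ⟨n', step', slope', st'⟩ := D'
  simp only at *
  obtain rfl : n = n' := by
    have e := congrArg Set.ncard hr
    rwa [← Set.image_univ, ← Set.image_univ, Set.ncard_image_of_injective _ h3.injective,
      Set.ncard_image_of_injective _ h3'.injective, Set.ncard_univ, Set.ncard_univ, Nat.card_fin,
      Nat.card_fin] at e
  obtain rfl : slope = slope' := by
    have e : Set.range (OrderDual.toDual ∘ slope) = Set.range (OrderDual.toDual ∘ slope') := by
      rw [Set.range_comp, Set.range_comp, hr]
    have := (StrictMono.range_inj (f := OrderDual.toDual ∘ slope) (g := OrderDual.toDual ∘ slope')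
      (fun _ _ hab => h3 hab) fun _ _ hab => h3' hab).1 e
    exact this
  obtain rfl : step = step' := by
    funext i
    cases i using Fin.cases with
    | zero => exact h2
    | succ i => rw [h1, h1']
  rfl

/-- The semilinear map induced on a quotient of stable submodules. -/
def grMap (F : M →ₛₗ[σ] M) {A B : Submodule R M} (hA : ∀ x ∈ A, F x ∈ A) (hB : ∀ x ∈ B, F x ∈ B) :
    (B ⧸ A.submoduleOf B) →ₛₗ[σ] (B ⧸ A.submoduleOf B) :=
  Submodule.mapQ _ _ (F.restrict hB) fun x hx => hA x hx

include hR in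
theorem isPure_grMap_bot {A B : Submodule R M} (hA : ∀ x ∈ A, F x ∈ A) (hB : ∀ x ∈ B, F x ∈ B)
    (h0 : A = ⊥) {s : ℚ} (h : IsPure p (F.restrict hB) s) : IsPure p (grMap F hA hB) s := by
  have e0 : A.submoduleOf B = ⊥ := by
    rw [h0]
    ext x
    exact ZeroMemClass.coe_eq_zero
  exact h.of_equiv hR (Submodule.quotEquivOfEqBot _ e0).symm fun x => rfl

/-- Quotients of submodules pull back along surjective maps. -/
def grComapEquiv {M' : Type*} [AddCommGroup M'] [Module R M'] (g : M →ₗ[R] M')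
    (hg : Function.Surjective g) (A B : Submodule R M') :
    (B.comap g ⧸ (A.comap g).submoduleOf (B.comap g)) ≃ₗ[R] (B ⧸ A.submoduleOf B) :=
  let φ : B.comap g →ₗ[R] (B ⧸ A.submoduleOf B) :=
    Submodule.mkQ (A.submoduleOf B) ∘ₗ g.restrict fun _ hx => hx
  (Submodule.quotEquivOfEq _ (LinearMap.ker φ) (by
    ext x
    rw [LinearMap.mem_ker, LinearMap.comp_apply, Submodule.mkQ_apply,
      Submodule.Quotient.mk_eq_zero]
    rfl)).trans (φ.quotKerEquivOfSurjective (by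
      intro y
      obtain ⟨⟨y, hy⟩, rfl⟩ := Submodule.mkQ_surjective _ y
      obtain ⟨x, rfl⟩ := hg y
      exact ⟨⟨x, hy⟩, rfl⟩))

include hR in
theorem isPure_grMap_comap {M' : Type*} [AddCommGroup M'] [Module R M'] {F' : M' →ₛₗ[σ] M'}
    (g : M →ₗ[R] M') (hg : Function.Surjective g) (hgF : ∀ x, g (F x) = F' (g x))
    {A B : Submodule R M'} (hA : ∀ x ∈ A, F' x ∈ A) (hB : ∀ x ∈ B, F' x ∈ B)
    (hA' : ∀ x ∈ A.comap g, F x ∈ A.comap g) (hB' : ∀ x ∈ B.comap g, F x ∈ B.comap g) {s : ℚ}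
    (h : IsPure p (grMap F' hA hB) s) : IsPure p (grMap F hA' hB') s := by
  refine h.of_equiv hR (grComapEquiv g hg A B).symm fun y => ?_
  obtain ⟨x, rfl⟩ := (grComapEquiv g hg A B).surjective y
  apply (grComapEquiv g hg A B).injective
  rw [LinearEquiv.apply_symm_apply, LinearEquiv.symm_apply_apply]
  obtain ⟨x, rfl⟩ := Submodule.mkQ_surjective _ x
  change Submodule.mkQ (A.submoduleOf B) ⟨F' (g x), _⟩ = Submodule.mkQ (A.submoduleOf B) ⟨g (F x), _⟩
  simp only [hgF]

end

include hR in
-- Induct on the rank. The part `N` of largest slope is nonzero, saturated and pure, so `M ⧸ N` is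
-- free of smaller rank; its filtration is pulled back and `⊥` is put in front.
theorem exists_isPureFiltration {π : R} (hπ : Irreducible π) (hσ : Function.Bijective σ)
    (hcl : HasClosedSubrings σ π) (n : ℕ) : ∀ (M : Type w) [AddCommGroup M] [Module R M]
    [Module.Free R M] [Module.Finite R M] (F : M →ₛₗ[σ] M), Function.Injective F →
    Module.finrank R M = n → ∃ D : SigmaFiltration F, D.IsPureFiltration p := by
  induction n using Nat.strong_induction_on with
  | _ n ih =>
  intro M _ _ _ _ F hF hn
  cases subsingleton_or_nontrivial M with
  | inl hM =>
    refine ⟨⟨0, fun _ => ⊥, Fin.elim0, fun _ x hx => ?_⟩, rfl, Subsingleton.elim _ _, fun i => i.elim0,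
      fun i => i.elim0, fun i => i.elim0, fun i => i.elim0⟩
    rw [Submodule.mem_bot] at hx ⊢
    rw [hx, map_zero]
  | inr hM =>
  obtain ⟨s, hs, C, hC, hpure⟩ := exists_slopeSub_pure hR F hπ hσ hcl hF
  set N := slopeSub hR F s with hNdef
  have hNsat : IsSaturated N := slopeSub_saturated hR F s
  have hNst : ∀ x ∈ N, F x ∈ N := slopeSub_stable hR F s
  have hfree := free_quotient_of_isSaturated hNsat
  let F' : (M ⧸ N) →ₛₗ[σ] (M ⧸ N) := Submodule.mapQ _ _ F hNst
  have hF' : ∀ x, N.mkQ (F x) = F' (N.mkQ x) := fun x => rfl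
  -- A bound `O(rho s ^ k)` on the orbit of `F x` is one on the orbit of `x`, after changing the
  -- constant; thus `F x ∈ N` implies `x ∈ N`.
  have hF'inj : Function.Injective F' := by
    rw [injective_iff_map_eq_zero]
    intro y hy
    obtain ⟨x, rfl⟩ := N.mkQ_surjective y
    rw [← hF', Submodule.mkQ_apply, Submodule.Quotient.mk_eq_zero] at hy
    rw [Submodule.mkQ_apply, Submodule.Quotient.mk_eq_zero]
    obtain ⟨D, hD⟩ := hy
    have hρ := rho_pos s
    refine ⟨max (nm (A := R) p x) (D / rho s), fun k => ?_⟩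
    cases k with
    | zero => simp
    | succ k =>
      refine (hD k).trans ?_
      calc D * rho s ^ k = D / rho s * rho s ^ (k + 1) := by rw [pow_succ]; field_simp
        _ ≤ _ := mul_le_mul_of_nonneg_right (le_max_right _ _) (by positivity)
  have hNpure : IsPure p (F.restrict hNst) s := by
    refine ⟨inferInstance, inferInstance, C, hC, fun k x => ?_⟩
    have h1 := hpure x x.2 k
    have h2 : (((F.restrict hNst)^[k] x : N) : M) = F^[k] x :=
      iterate_comm (f := F.restrict hNst) (e := Subtype.val) (fun _ => rfl) k x
    rwa [← h2, nm_coe hR hNsat, nm_coe hR hNsat] at h1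
  have hrank : Module.finrank R (M ⧸ N) < n := by
    have h1 := N.finrank_quotient_add_finrank
    have : Nontrivial N := (Submodule.nontrivial_iff_ne_bot).2 hs
    have h2 := Module.finrank_pos (R := R) (M := N)
    lia
  obtain ⟨D, hD⟩ := ih _ hrank (M ⧸ N) F' hF'inj rfl
  have hcomap0 : (D.step 0).comap N.mkQ = N := by
    rw [hD.bot, Submodule.comap_bot, Submodule.ker_mkQ]
  let step : Fin (D.length + 1 + 1) → Submodule R M :=
    Fin.cons ⊥ fun i => (D.step i).comap N.mkQ
  have hst : ∀ i, ∀ x ∈ step i, F x ∈ step i := by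
    intro i
    cases i using Fin.cases with
    | zero =>
      intro x hx
      have hx' : x = 0 := hx
      rw [hx', map_zero]
      exact zero_mem _
    | succ i => exact fun x hx => D.stable i _ hx
  -- If the first slope of the quotient were at least `s`, the extension lemma would place lifts of
  -- its first step in `N`, and that step would vanish.
  have hslope : ∀ h0 : 0 < D.length, D.slope ⟨0, h0⟩ < s := by
    intro h0
    by_contra! hcon
    obtain ⟨y, hy, hy'⟩ := SetLike.exists_of_lt (hD.lt ⟨0, h0⟩)
    rw [hD.step_succ hR] at hy
    have hy2 := slopeSub_anti hR F' hcon hy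
    obtain ⟨x, rfl⟩ := N.mkQ_surjective y
    have hxN : x ∈ N := by
      refine mem_slopeSub_of_extension hR F ⊤ (fun _ _ => trivial) (N.mkQ ∘ₗ Submodule.subtype ⊤)
        (fun y => ?_) F' (fun _ => rfl) (fun z hz => ?_) ⟨x, trivial⟩ hy2
      · obtain ⟨x, rfl⟩ := N.mkQ_surjective y
        exact ⟨⟨x, trivial⟩, rfl⟩
      · rw [LinearMap.comp_apply, Submodule.mkQ_apply, Submodule.Quotient.mk_eq_zero] at hz
        exact hz
    rw [← Submodule.ker_mkQ N, LinearMap.mem_ker] at hxN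
    rw [hxN] at hy'
    exact hy' (zero_mem _)
  refine ⟨⟨D.length + 1, step, Fin.cons s D.slope, hst⟩, rfl, ?_, fun i => ?_, fun i => ?_,
    fun i => ?_, ?_⟩
  · change (D.step (Fin.last D.length)).comap N.mkQ = ⊤
    rw [hD.top, Submodule.comap_top]
  · cases i using Fin.cases with
    | zero =>
      change ⊥ < (D.step 0).comap N.mkQ
      rw [hcomap0]
      exact bot_lt_iff_ne_bot.2 hs
    | succ i =>
      change (D.step i.castSucc).comap N.mkQ < (D.step i.succ).comap N.mkQ
      have := Submodule.comap_injective_of_surjective N.mkQ_surjective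
      exact lt_of_le_of_ne (Submodule.comap_mono (hD.lt i).le) fun h => (hD.lt i).ne (this h)
  · cases i using Fin.cases with
    | zero =>
      intro a x ha _ hx
      have hx' : a • x = 0 := hx
      exact (smul_eq_zero.1 hx').resolve_left ha
    | succ i =>
      intro a x ha h1 h2
      have h2' : a • N.mkQ x ∈ D.step i.castSucc := by
        rw [← map_smul]; exact h2
      exact hD.saturated i a _ ha h1 h2'
  · cases i using Fin.cases with
    | zero =>
      have key : ∀ B, B = N → ∀ hB : ∀ x ∈ B, F x ∈ B, IsPure p (F.restrict hB) s := by
        rintro _ rfl _; exact hNpure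
      exact isPure_grMap_bot hR (hst 0) (hst 1) rfl (key _ hcomap0 (hst 1))
    | succ i =>
      exact isPure_grMap_comap hR N.mkQ N.mkQ_surjective hF' (D.stable _) (D.stable _)
        (hst i.castSucc.succ) (hst i.succ.succ) (hD.isPure i)
  · intro i j hij
    cases j using Fin.cases with
    | zero => exact absurd hij (Fin.not_lt_zero i)
    | succ j =>
      cases i using Fin.cases with
      | zero =>
        refine lt_of_le_of_lt ?_ (hslope j.pos)
        exact hD.strictAnti.antitone (Nat.zero_le _)
      | succ i => exact hD.strictAnti (Fin.succ_lt_succ_iff.1 hij)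

end Filtrations

/-! ### σ-modules and generic slopes -/

section SigmaModule

variable {p : ℕ} {R : Type u} [CommRing R] [IsDomain R] [IsDiscreteValuationRing R]
  (hR : IsMixed p R) {σ : R →+* R} {M : Type*} [AddCommGroup M] [Module R M] {F : M →ₛₗ[σ] M}

theorem repr_semilinear {n : ℕ} (b : Module.Basis (Fin n) R M) (x : M) (i : Fin n) :
    b.repr (F x) i = ((Matrix.of fun i j => b.repr (F (b j)) i).mulVec fun j => σ (b.repr x j)) i := by
  rw [semilinear_apply b F x, map_sum, Finsupp.finsetSum_apply, Matrix.mulVec, dotProduct]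
  exact Finset.sum_congr rfl fun j _ => by
    rw [map_smul, Finsupp.smul_apply, smul_eq_mul, mul_comm, Matrix.of_apply]

theorem injective_iff_det_ne_zero (hσ : Function.Bijective σ) {n : ℕ}
    (b : Module.Basis (Fin n) R M) :
    Function.Injective F ↔ (Matrix.of fun i j => b.repr (F (b j)) i).det ≠ 0 := by
  rw [Ne, ← Matrix.exists_mulVec_eq_zero_iff, injective_iff_map_eq_zero]
  push Not
  constructor
  · intro h v hv h0
    choose w hw using fun i => hσ.2 (v i)
    have h1 : F (∑ i, w i • b i) = 0 := by
      apply b.repr.injective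
      ext i
      rw [repr_semilinear, map_zero, Finsupp.coe_zero]
      simp only [Module.Basis.repr_sum_self, hw]
      exact congrFun h0 i
    refine hv (funext fun i => ?_)
    have h2 := congrArg (fun x => b.repr x i) (h _ h1)
    simp only [Module.Basis.repr_sum_self, map_zero, Finsupp.coe_zero, Pi.zero_apply] at h2
    rw [← hw, h2, map_zero, Pi.zero_apply]
  · intro h x hx
    by_contra hx0
    refine h (fun j => σ (b.repr x j)) (fun h0 => hx0 ?_) ?_
    · apply b.repr.injective
      ext i
      rw [map_zero, Finsupp.coe_zero, Pi.zero_apply]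
      exact hσ.1 (by rw [map_zero]; exact congrFun h0 i)
    · ext i
      rw [← repr_semilinear, hx, map_zero, Finsupp.coe_zero]

include hR in
theorem exists_dvd_natCast_pow {x : R} (hx : x ≠ 0) : ∃ n : ℕ, x ∣ (p : R) ^ n := by
  obtain ⟨n, hn⟩ := exists_pow_lt_of_lt_one (av_pos p hx) (one_half_lt_one (α := ℝ))
  refine ⟨n, (av_le_iff hR).1 ?_⟩
  rw [av_pow, av_natCast hR]
  exact hn.le

include hR in
-- Every nonzero element of `R` divides a power of `p`, so a matrix is invertible over `R[1/p]` as
-- soon as its determinant is nonzero, that is, when `F` is injective.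
theorem isSigmaModule_iff (hσ : Function.Bijective σ) :
    IsSigmaModule p F ↔ Module.Free R M ∧ Module.Finite R M ∧ Function.Injective F := by
  have hle : Submonoid.powers (p : R) ≤ nonZeroDivisors R :=
    powers_le_nonZeroDivisors_of_noZeroDivisors hR.ne_zero
  have hinj : Function.Injective (algebraMap R (Localization.Away (p : R))) :=
    IsLocalization.injective _ hle
  constructor
  · rintro ⟨n, b, hb⟩
    refine ⟨Module.Free.of_basis b, Module.Finite.of_basis b,
      (injective_iff_det_ne_zero hσ b).2 fun h0 => ?_⟩
    have := (Matrix.isUnit_iff_isUnit_det _).1 hb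
    rw [← RingHom.mapMatrix_apply, ← RingHom.map_det, h0, map_zero] at this
    have : Nontrivial (Localization.Away (p : R)) := hinj.nontrivial
    exact not_isUnit_zero ‹IsUnit (0 : Localization.Away (p : R))›
  · rintro ⟨_, _, hF⟩
    refine ⟨_, Module.finBasis R M, ?_⟩
    rw [Matrix.isUnit_iff_isUnit_det, ← RingHom.mapMatrix_apply, ← RingHom.map_det]
    obtain ⟨n, hn⟩ := exists_dvd_natCast_pow hR
      ((injective_iff_det_ne_zero hσ (Module.finBasis R M)).1 hF)
    refine isUnit_of_dvd_unit (map_dvd _ hn) ?_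
    rw [map_pow]
    exact (IsLocalization.map_units (Localization.Away (p : R))
      (⟨p, Submonoid.mem_powers _⟩ : Submonoid.powers (p : R))).pow n

end SigmaModule

/-! ### From generic slopes to purity -/

section GenericSlopes

variable {p : ℕ}

/-- A module with an independent family of eigenvectors, maximal and of a given slope, is pure. -/
theorem isPure_of_eigenvectors {S : Type u} [CommRing S] [IsDomain S] [IsDiscreteValuationRing S]
    (hS : IsMixed p S) {τ : S →+* S} {N : Type*} [AddCommGroup N] [Module S N] {n : ℕ}
    (b : Module.Basis (Fin n) S N) (F : N →ₛₗ[τ] N) {e : Fin n → N} (he : LinearIndependent S e)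
    {a : Fin n → S} {s : ℚ} (h : ∀ i, F (e i) = a i • e i ∧ a i ≠ 0 ∧ vp p (a i) = s) :
    IsPure p F s := by
  classical
  have hfree : Module.Free S N := Module.Free.of_basis b
  have hfin : Module.Finite S N := Module.Finite.of_basis b
  have hav : ∀ i, av p (a i) = rho s := fun i => by rw [av_eq_rho p (h i).2.1, (h i).2.2]
  let P : Matrix (Fin n) (Fin n) S := Matrix.of fun i j => b.repr (e j) i
  have hP : ∀ (y : Fin n → S) i, b.repr (∑ j, y j • e j) i = P.mulVec y i := fun y i => by
    rw [map_sum, Finsupp.finsetSum_apply, Matrix.mulVec, dotProduct]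
    exact Finset.sum_congr rfl fun j _ => by
      rw [map_smul, Finsupp.smul_apply, smul_eq_mul, mul_comm]; rfl
  have hdet : P.det ≠ 0 := by
    intro h0
    obtain ⟨y, hy, hy0⟩ := Matrix.exists_mulVec_eq_zero_iff.2 h0
    refine hy (funext fun i => Fintype.linearIndependent_iff.1 he y ?_ i)
    apply b.repr.injective
    ext i
    rw [hP, hy0, map_zero]
    rfl
  -- By Cramer's rule `c • x` is an integral combination of the eigenvectors, on which `F` acts
  -- exactly. Passing from the norm to the coordinates along `e` and back costs at most `|c|`
  -- squared.
  set c := P.det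
  have hc : 0 < av p c := av_pos p hdet
  have hnm : ∀ x i, av p (b.repr x i) ≤ nm (A := S) p x := fun x i => by
    rw [nm_eq_bnorm b hS]; exact av_repr_le_bnorm b x i
  have hlow : ∀ (y : Fin n → S) i, av p c * av p (y i) ≤ nm (A := S) p (∑ j, y j • e j) := by
    intro y i
    have h1 : P.adjugate.mulVec (P.mulVec y) = c • y := by
      rw [Matrix.mulVec_mulVec, Matrix.adjugate_mul, Matrix.smul_mulVec, Matrix.one_mulVec]
    have h2 := congrFun h1 i
    rw [Pi.smul_apply, smul_eq_mul] at h2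
    rw [← av_mul, ← h2, Matrix.mulVec, dotProduct]
    refine av_sum_le _ _ _ (nm_nonneg _) fun j _ => ?_
    rw [av_mul, ← hP]
    exact (mul_le_of_le_one_left (av_nonneg p _) (av_le_one p _)).trans (hnm _ _)
  have hup : ∀ (y : Fin n → S) (D : ℝ), 0 ≤ D → (∀ i, av p (y i) ≤ D) →
      nm (A := S) p (∑ j, y j • e j) ≤ D := fun y D hD hy => by
    refine nm_sum_le _ _ hD fun i _ => ?_
    rw [nm_smul]
    exact (mul_le_of_le_one_right (av_nonneg p _) (nm_le_one hS _)).trans (hy i)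
  have hexp : ∀ x, ∃ y : Fin n → S, c • x = ∑ j, y j • e j ∧ ∀ i, av p (y i) ≤ nm (A := S) p x := by
    intro x
    refine ⟨P.adjugate.mulVec (b.repr x), ?_, fun i => ?_⟩
    · apply b.repr.injective
      ext i
      rw [hP, Matrix.mulVec_mulVec, Matrix.mul_adjugate, Matrix.smul_mulVec, Matrix.one_mulVec,
        map_smul]
      rfl
    · rw [Matrix.mulVec, dotProduct]
      refine av_sum_le _ _ _ (nm_nonneg _) fun j _ => ?_
      rw [av_mul]
      exact (mul_le_of_le_one_left (av_nonneg p _) (av_le_one p _)).trans (hnm _ _)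
  have hFk : ∀ k (y : Fin n → S), ∃ z : Fin n → S, F^[k] (∑ j, y j • e j) = ∑ j, z j • e j ∧
      ∀ i, av p (z i) = rho s ^ k * av p (y i) := by
    intro k y
    induction k with
    | zero => exact ⟨y, rfl, fun i => by simp⟩
    | succ k ih =>
      obtain ⟨z, hz, hz'⟩ := ih
      refine ⟨fun i => τ (z i) * a i, ?_, fun i => ?_⟩
      · rw [Function.iterate_succ_apply', hz, map_sum]
        exact Finset.sum_congr rfl fun j _ => by rw [map_smulₛₗ, (h j).1, smul_smul]
      · rw [av_mul, av_map hS hS, hz', hav, pow_succ]; ring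
  refine ⟨hfree, hfin, (av p c * av p c)⁻¹, by positivity, fun k x => ?_⟩
  obtain ⟨y, hy, hy'⟩ := hexp x
  obtain ⟨z, hz, hz'⟩ := hFk k y
  have hρ : 0 < rho s ^ k := pow_pos (rho_pos s) k
  have e1 : av p c * nm (A := S) p (F^[k] x) = nm (A := S) p (∑ j, z j • e j) := by
    rw [← hz, ← hy, nm_iterate_smul hS]
  have hn0 := nm_nonneg (A := S) (p := p) x
  have hc1 := av_le_one p c
  constructor
  · have h1 : av p c * nm (A := S) p (F^[k] x) ≤ rho s ^ k * nm (A := S) p x := by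
      rw [e1]
      refine hup z _ (by positivity) fun i => ?_
      rw [hz']
      exact mul_le_mul_of_nonneg_left (hy' i) hρ.le
    rw [mul_assoc, ← div_eq_inv_mul, le_div_iff₀ (by positivity)]
    calc _ = av p c * (av p c * nm (A := S) p (F^[k] x)) := by ring
      _ ≤ 1 * (av p c * nm (A := S) p (F^[k] x)) := mul_le_mul_of_nonneg_right hc1
          (mul_nonneg hc.le (nm_nonneg _))
      _ ≤ _ := by rw [one_mul]; exact h1
  · rw [← div_eq_inv_mul, le_div_iff₀ (by positivity)]
    have h1 : nm (A := S) p (c • x) ≤ nm (A := S) p (F^[k] x) / rho s ^ k := by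
      rw [hy]
      refine hup y _ (div_nonneg (nm_nonneg _) hρ.le) fun i => ?_
      rw [le_div_iff₀ hρ, mul_comm, ← hz']
      refine le_of_mul_le_mul_left ?_ hc
      rw [e1]
      exact hlow z i
    rw [nm_smul, le_div_iff₀ hρ] at h1
    calc _ = av p c * (av p c * nm (A := S) p x * rho s ^ k) := by ring
      _ ≤ 1 * (av p c * nm (A := S) p x * rho s ^ k) :=
        mul_le_mul_of_nonneg_right hc1 (by positivity)
      _ ≤ _ := by rw [one_mul]; exact h1

variable {R : Type u} [CommRing R] [IsDomain R] [IsDiscreteValuationRing R] (hR : IsMixed p R)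
  {σ : R →+* R} {M : Type*} [AddCommGroup M] [Module R M] [Module.Free R M] [Module.Finite R M]
  {F : M →ₛₗ[σ] M}

include hR in
theorem nm_one_tmul {S : Type u} [CommRing S] [IsDomain S] [IsDiscreteValuationRing S]
    (hS : IsMixed p S) [Algebra R S] (x : M) :
    nm (A := S) p ((1 : S) ⊗ₜ[R] x) = nm (A := R) p x := by
  rw [nm_eq_bnorm (Algebra.TensorProduct.basis S (Module.finBasis R M)) hS,
    nm_eq_bnorm (Module.finBasis R M) hR, bnorm, bnorm]
  congr 1
  funext i
  rw [Algebra.TensorProduct.basis_repr_tmul]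
  simp only [one_smul, Finsupp.mapRange_apply]
  exact av_map hR hS (algebraMap R S) _

include hR in
-- Purity holds over `S` by the family of eigenvectors, and it descends because `x ↦ 1 ⊗ x`
-- preserves norms and commutes with Frobenius.
theorem isPure_of_hasGenericSlopes {q n : ℕ} {s : ℚ}
    (h : HasGenericSlopes p q F (fun _ : Fin n => s)) : IsPure p F s := by
  obtain ⟨hn, S, _, _, _, _, τ, FS, -, hpS, hinj, -, hτ, hFS, e, a, he, ha⟩ := h
  have hS : IsMixed p S := ⟨fun h0 => hR.ne_zero (hinj (by rw [map_natCast, h0, map_zero])), hpS⟩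
  subst hn
  obtain ⟨_, _, C, hC, hp⟩ := isPure_of_eigenvectors hS
    (Algebra.TensorProduct.basis S (Module.finBasis R M)) FS he ha
  refine ⟨inferInstance, inferInstance, C, hC, fun k x => ?_⟩
  have h1 := hp k ((1 : S) ⊗ₜ[R] x)
  rwa [← iterate_comm (f := F) (e := fun m => (1 : S) ⊗ₜ[R] m) (fun m => (hFS m).symm),
    nm_one_tmul hR hS, nm_one_tmul hR hS] at h1

end GenericSlopes

/-! ### Frobenius-semilinear maps over algebraically closed fields -/

section LangField

open Polynomial

variable {κ : Type*} [Field κ]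

/-- The coefficients of a fixed vector in a cyclic module, as polynomials in the last of them. -/
def fixedPoly (q : ℕ) (a : ℕ → κ) : ℕ → κ[X]
  | 0 => C (a 0) * X ^ q
  | i + 1 => fixedPoly q a i ^ q + C (a (i + 1)) * X ^ q

theorem fixedPoly_eq_zero {q : ℕ} (hq : 1 < q) {a : ℕ → κ} {i : ℕ} (h : ∀ j ≤ i, a j = 0) :
    fixedPoly q a i = 0 := by
  induction i with
  | zero => simp [fixedPoly, h 0 le_rfl]
  | succ i ih =>
    rw [fixedPoly, ih fun j hj => h j (hj.trans (Nat.le_succ i)), h _ le_rfl, map_zero, zero_mul,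
      zero_pow (by lia), add_zero]

theorem le_natDegree_fixedPoly {q : ℕ} (hq : 1 < q) {a : ℕ → κ} {i : ℕ} (h : ∃ j ≤ i, a j ≠ 0) :
    q ≤ (fixedPoly q a i).natDegree := by
  induction i with
  | zero =>
    obtain ⟨j, hj, hj'⟩ := h
    obtain rfl : j = 0 := by lia
    rw [fixedPoly, natDegree_C_mul_X_pow _ _ hj']
  | succ i ih =>
    rw [fixedPoly]
    by_cases h' : ∃ j ≤ i, a j ≠ 0
    · have h1 := ih h'
      have h2 : (C (a (i + 1)) * X ^ q).natDegree < (fixedPoly q a i ^ q).natDegree := by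
        refine (natDegree_C_mul_X_pow_le _ _).trans_lt ?_
        rw [natDegree_pow]
        nlinarith
      rw [natDegree_add_eq_left_of_natDegree_lt h2, natDegree_pow]
      nlinarith
    · push Not at h'
      obtain ⟨j, hj, hj'⟩ := h
      obtain rfl : j = i + 1 := by
        by_contra hne
        exact hj' (h' j (by lia))
      rw [fixedPoly_eq_zero hq h', zero_pow (by lia), zero_add, natDegree_C_mul_X_pow _ _ hj']

theorem X_sq_dvd_fixedPoly {q : ℕ} (hq : 1 < q) (a : ℕ → κ) (i : ℕ) : X ^ 2 ∣ fixedPoly q a i := by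
  have h0 : (X ^ 2 : κ[X]) ∣ X ^ q := pow_dvd_pow _ hq
  induction i with
  | zero => exact h0.mul_left _
  | succ i ih => exact dvd_add (dvd_pow ih (by lia)) (h0.mul_left _)

variable [IsAlgClosed κ] {φ : κ →+* κ} {q : ℕ} (hq : 1 < q) (hφ : ∀ x, φ x = x ^ q)
include hq hφ

/-- In a cyclic subspace with relation coefficients `a`, the vector with coordinates `y` is fixed
when `y 0 = a 0 * t ^ q` and `y (i + 1) = y i ^ q + a (i + 1) * t ^ q`, where `t` is the last
coordinate. All coordinates are thus polynomials in `t`, and what remains is one equation `fixedPoly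
q a d = X` in `t`, for which a nonzero root is needed. -/
theorem exists_fixed_vector {U : Type*} [AddCommGroup U] [Module κ U] [FiniteDimensional κ U]
    [Nontrivial U] (F : U →ₛₗ[φ] U) (hF : Function.Injective F) : ∃ v, v ≠ 0 ∧ F v = v := by
  obtain ⟨x, hx⟩ := exists_ne (0 : U)
  obtain ⟨d, a, hli, hrel⟩ := exists_cyclic F hx
  let a' : ℕ → κ := fun i => if h : i < d + 1 then a ⟨i, h⟩ else 0
  have ha' : ∀ i : Fin (d + 1), a' i = a i := fun i => dif_pos i.2
  have hrel' : F^[d + 1] x = ∑ i ∈ Finset.range (d + 1), a' i • F^[i] x := by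
    rw [hrel, Finset.sum_range]
    exact Finset.sum_congr rfl fun i _ => by rw [ha']
  have hex : ∃ j ≤ d, a' j ≠ 0 := by
    by_contra! hcon
    have h1 : F^[d + 1] x = F^[d + 1] 0 := by
      rw [hrel', ← siter_apply, map_zero]
      refine Finset.sum_eq_zero fun i hi => ?_
      rw [hcon i (by have := Finset.mem_range.1 hi; lia), zero_smul]
    exact hx (hF.iterate (d + 1) h1)
  obtain ⟨Z, hZ⟩ := X_sq_dvd_fixedPoly hq a' d
  have hZ0 : Z ≠ 0 := by
    rintro rfl
    have := le_natDegree_fixedPoly hq hex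
    rw [hZ, mul_zero, natDegree_zero] at this
    lia
  -- With `fixedPoly q a' d = X ^ 2 * Z`, the roots of `X * Z - 1` are the nonzero solutions of
  -- `fixedPoly q a' d = X`.
  obtain ⟨t, ht⟩ := IsAlgClosed.exists_root (X * Z - C 1) (by
    rw [degree_sub_eq_left_of_degree_lt]
    · rw [degree_mul, degree_X, degree_eq_natDegree hZ0]
      norm_cast
      lia
    · rw [degree_C one_ne_zero, degree_mul, degree_X, degree_eq_natDegree hZ0]
      norm_cast
      lia)
  have ht1 : t * Z.eval t = 1 := by
    simpa [sub_eq_zero] using ht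
  have ht0 : t ≠ 0 := by
    rintro rfl
    simp at ht1
  let y : ℕ → κ := fun i => (fixedPoly q a' i).eval t
  have hyd : y d = t := by
    simp only [y, hZ, eval_mul, eval_pow, eval_X]
    rw [sq, mul_assoc, ht1, mul_one]
  have hy0 : y 0 = a' 0 * t ^ q := by simp [y, fixedPoly]
  have hy1 : ∀ i, y (i + 1) = y i ^ q + a' (i + 1) * t ^ q := fun i => by simp [y, fixedPoly]
  refine ⟨∑ i ∈ Finset.range (d + 1), y i • F^[i] x, fun h0 => ?_, ?_⟩
  · rw [Finset.sum_range] at h0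
    have := Fintype.linearIndependent_iff.1 hli (fun i => y i) h0 (Fin.last d)
    simp only [Fin.val_last, hyd] at this
    exact ht0 this
  · rw [map_sum]
    simp only [map_smulₛₗ, hφ, ← Function.iterate_succ_apply' F]
    rw [Finset.sum_range_succ, hyd, hrel', Finset.smul_sum, Finset.sum_range_succ', smul_smul,
      Finset.sum_range_succ' (fun i => y i • F^[i] x), hy0, ← add_assoc, ← Finset.sum_add_distrib,
      mul_comm (t ^ q)]
    congr 1
    refine Finset.sum_congr rfl fun i _ => ?_
    rw [smul_smul, ← add_smul, hy1, mul_comm (t ^ q)]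

theorem exists_sub_pow_eq (c : κ) : ∃ x : κ, x - x ^ q = c := by
  obtain ⟨x, hx⟩ := IsAlgClosed.exists_root (X ^ q - (X - C c)) (by
    rw [degree_sub_eq_left_of_degree_lt]
    · rw [degree_X_pow]
      norm_cast
      lia
    · rw [degree_X_sub_C, degree_X_pow]
      exact_mod_cast hq)
  refine ⟨x, ?_⟩
  simp only [IsRoot.def, eval_sub, eval_pow, eval_X, eval_C] at hx
  linear_combination -hx

/-- Divide by the line of a fixed vector `v` and induct. A lift of a fixed vector of the quotient is
fixed up to a multiple of `v`, which is removed by solving an Artin–Schreier equation. -/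
theorem exists_fixed_basis (n : ℕ) : ∀ {U : Type w} [AddCommGroup U] [Module κ U]
    [FiniteDimensional κ U] (F : U →ₛₗ[φ] U), Function.Injective F → Module.finrank κ U = n →
    ∃ e : Fin n → U, LinearIndependent κ e ∧ ∀ i, F (e i) = e i := by
  induction n with
  | zero => exact fun F _ _ => ⟨Fin.elim0, linearIndependent_empty_type, fun i => i.elim0⟩
  | succ n ih =>
    intro U _ _ _ F hF hn
    have : Nontrivial U := Module.nontrivial_of_finrank_pos (R := κ) (by lia)
    obtain ⟨v, hv0, hv⟩ := exists_fixed_vector hq hφ F hF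
    let W := Submodule.span κ {v}
    have hW : ∀ x ∈ W, F x ∈ W := fun x hx => by
      obtain ⟨c, rfl⟩ := Submodule.mem_span_singleton.1 hx
      rw [map_smulₛₗ, hv]
      exact W.smul_mem _ (Submodule.mem_span_singleton_self v)
    let F' : (U ⧸ W) →ₛₗ[φ] (U ⧸ W) := Submodule.mapQ _ _ F hW
    have hF' : Function.Injective F' := by
      rw [injective_iff_map_eq_zero]
      intro y hy
      obtain ⟨x, rfl⟩ := W.mkQ_surjective y
      have hx : F x ∈ W := (Submodule.Quotient.mk_eq_zero W).1 hy
      obtain ⟨c, hc⟩ := Submodule.mem_span_singleton.1 hx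
      obtain ⟨c', rfl⟩ := IsAlgClosed.exists_pow_nat_eq c (by lia : 0 < q)
      have h1 : F (c' • v) = F x := by rw [map_smulₛₗ, hφ, hv, hc]
      refine (Submodule.Quotient.mk_eq_zero W).2 ?_
      rw [← hF h1]
      exact W.smul_mem _ (Submodule.mem_span_singleton_self v)
    have hrank : Module.finrank κ (U ⧸ W) = n := by
      have h1 := W.finrank_quotient_add_finrank
      rw [finrank_span_singleton hv0] at h1
      lia
    obtain ⟨e, he, hfix⟩ := ih F' hF' hrank
    choose u hu using fun i => W.mkQ_surjective (e i)
    have hc : ∀ i, ∃ c : κ, c • v = F (u i) - u i := fun i => by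
      refine Submodule.mem_span_singleton.1 ((Submodule.Quotient.mk_eq_zero W).1 ?_)
      rw [Submodule.Quotient.mk_sub, sub_eq_zero]
      change F' (W.mkQ (u i)) = W.mkQ (u i)
      rw [hu, hfix]
    choose c hc using hc
    choose x hx using fun i => exists_sub_pow_eq hq hφ (c i)
    refine ⟨Fin.cons v fun i => u i + x i • v, ?_, fun i => ?_⟩
    · rw [Fintype.linearIndependent_iff]
      intro g hg
      rw [Fin.sum_univ_succ] at hg
      simp only [Fin.cons_zero, Fin.cons_succ] at hg
      have hvW : W.mkQ v = 0 :=
        (Submodule.Quotient.mk_eq_zero W).2 (Submodule.mem_span_singleton_self v)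
      have h1 := congrArg W.mkQ hg
      simp only [map_add, map_sum, map_smul, hvW, smul_zero, zero_add, hu, add_zero, map_zero] at h1
      have h2 := Fintype.linearIndependent_iff.1 he _ h1
      intro i
      cases i using Fin.cases with
      | zero =>
        rw [Finset.sum_eq_zero fun i _ => by rw [h2 i, zero_smul], add_zero] at hg
        exact (smul_eq_zero.1 hg).resolve_right hv0
      | succ i => exact h2 i
    · cases i using Fin.cases with
      | zero => exact hv
      | succ i =>
        rw [Fin.cons_succ, map_add, map_smulₛₗ, hv, hφ]
        have h1 : F (u i) = u i + c i • v := by rw [hc]; abel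
        rw [h1, ← hx, add_assoc, ← add_smul, sub_add_cancel]

/-- In coordinates along a basis of fixed vectors the equation decouples into Artin–Schreier
equations. -/
theorem exists_sub_semilinear_eq {U : Type*} [AddCommGroup U] [Module κ U]
    [FiniteDimensional κ U] (F : U →ₛₗ[φ] U) (hF : Function.Injective F) (y : U) :
    ∃ x, x - F x = y := by
  obtain ⟨e, he, hfix⟩ := exists_fixed_basis hq hφ _ F hF rfl
  have hy : y ∈ Submodule.span κ (Set.range e) := by
    rw [he.span_eq_top_of_card_eq_finrank' (by simp)]
    trivial
  obtain ⟨c, rfl⟩ := (Submodule.mem_span_range_iff_exists_fun κ).1 hy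
  choose x hx using fun i => exists_sub_pow_eq hq hφ (c i)
  refine ⟨∑ i, x i • e i, ?_⟩
  rw [map_sum, ← Finset.sum_sub_distrib]
  exact Finset.sum_congr rfl fun i _ => by rw [map_smulₛₗ, hfix, hφ, ← sub_smul, hx]

end LangField

/-! ### Lang's theorem by successive approximation -/

section LangComplete

theorem exists_limit_of_isAdicComplete {A : Type*} [CommRing A] {π : A}
    (hc : IsAdicComplete (Ideal.span {π}) A) (x : ℕ → A) (hx : ∀ n, π ^ n ∣ x (n + 1) - x n) :
    ∃ y, ∀ n, π ^ n ∣ y - x n := by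
  have hmem : ∀ n (z : A), z ∈ ((Ideal.span {π}) ^ n • ⊤ : Submodule A A) ↔ π ^ n ∣ z := fun n z => by
    rw [smul_eq_mul, Ideal.mul_top, Ideal.span_singleton_pow, Ideal.mem_span_singleton]
  have hcau : ∀ {m n}, m ≤ n → x m ≡ x n [SMOD ((Ideal.span {π}) ^ m • ⊤ : Submodule A A)] := by
    intro m n hmn
    induction n, hmn using Nat.le_induction with
    | base => rfl
    | succ n hn ih =>
      refine ih.trans (SModEq.symm ?_)
      rw [SModEq.sub_mem, hmem]
      exact (pow_dvd_pow π hn).trans (hx n)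
  obtain ⟨y, hy⟩ := IsPrecomplete.prec hc.toIsPrecomplete hcau
  refine ⟨y, fun n => ?_⟩
  have := hy n
  rw [SModEq.sub_mem, hmem] at this
  rw [← neg_sub, dvd_neg]
  exact this

/-- The semilinear map given by a matrix. -/
def matSemi {κ : Type*} [Field κ] (φ : κ →+* κ) {n : ℕ} (B : Matrix (Fin n) (Fin n) κ) :
    (Fin n → κ) →ₛₗ[φ] (Fin n → κ) where
  toFun y := B.mulVec fun i => φ (y i)
  map_add' x y := by
    rw [← Matrix.mulVec_add]
    congr 1
    funext i
    exact map_add φ _ _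
  map_smul' c y := by
    rw [← Matrix.mulVec_smul]
    congr 1
    funext i
    exact map_mul φ _ _

theorem matSemi_injective {κ : Type*} [Field κ] (φ : κ →+* κ) {n : ℕ}
    {B : Matrix (Fin n) (Fin n) κ} (hB : B.det ≠ 0) : Function.Injective (matSemi φ B) := by
  rw [injective_iff_map_eq_zero]
  intro y hy
  by_contra hy0
  exact hB (Matrix.exists_mulVec_eq_zero_iff.1
    ⟨fun i => φ (y i), fun h => hy0 (funext fun i => (map_eq_zero φ).1 (congrFun h i)), hy⟩)

variable {A : Type*} [CommRing A] [IsDomain A] [IsDiscreteValuationRing A] {π : A}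
  (hπ : Irreducible π)
  (hc : ∀ x : ℕ → A, (∀ n, π ^ n ∣ x (n + 1) - x n) → ∃ y, ∀ n, π ^ n ∣ y - x n)
  {κ : Type*} [Field κ] [IsAlgClosed κ] (r : A →+* κ) (hr : Function.Surjective r)
  (hr0 : ∀ x, r x = 0 ↔ π ∣ x) {τ : A →+* A} {φ : κ →+* κ} {q : ℕ} (hq : 1 < q)
  (hφ : ∀ x, φ x = x ^ q) (hτ : ∀ x, r (τ x) = r x ^ q) {u : A} (hu : IsUnit u)
  (hτπ : τ π = u * π)
include hπ hc hr hr0 hq hφ hτ hu hτπ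

/-- A Hensel argument. Replacing `v` by `v + π ^ k * y` changes the error `π ^ k * z` into `π ^ k *
(z + u ^ k * C τ(y) - y)`, the factor `u ^ k` coming from `τ (π ^ k)`. Modulo `π` the bracket can be
made zero by `exists_sub_semilinear_eq`. -/
theorem exists_fixed_lift {n : ℕ} (C : Matrix (Fin n) (Fin n) A) (hC : IsUnit C.det)
    (v₀ : Fin n → κ) (hv₀ : (C.map r).mulVec (fun i => φ (v₀ i)) = v₀) :
    ∃ v : Fin n → A, C.mulVec (fun i => τ (v i)) = v ∧ ∀ i, r (v i) = v₀ i := by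
  let T : (Fin n → A) → Fin n → A := fun v => C.mulVec (fun i => τ (v i)) - v
  have hτk : ∀ k, τ (π ^ k) = u ^ k * π ^ k := fun k => by rw [map_pow, hτπ, mul_pow]
  have hstep : ∀ (k : ℕ) (v : Fin n → A), (∀ i, π ^ k ∣ T v i) →
      ∃ v' : Fin n → A, (∀ i, π ^ k ∣ v' i - v i) ∧ ∀ i, π ^ (k + 1) ∣ T v' i := by
    intro k v hv
    choose z hz using hv
    let B : Matrix (Fin n) (Fin n) κ := (r u ^ k) • C.map r
    let G := matSemi φ B
    have hG : Function.Injective G := matSemi_injective φ (by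
      rw [Matrix.det_smul, ← RingHom.mapMatrix_apply, ← RingHom.map_det]
      exact mul_ne_zero (pow_ne_zero _ (pow_ne_zero _ (hu.map r).ne_zero)) (hC.map r).ne_zero)
    obtain ⟨y₀, hy₀⟩ := exists_sub_semilinear_eq hq hφ G hG fun i => r (z i)
    choose y hy using fun i => hr (y₀ i)
    refine ⟨fun i => v i + π ^ k * y i, fun i => by rw [add_sub_cancel_left]; exact dvd_mul_right _ _,
      fun i => ?_⟩
    have e : T (fun i => v i + π ^ k * y i) i =
        π ^ k * (z i + u ^ k * C.mulVec (fun i => τ (y i)) i - y i) := by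
      have e1 : (fun i => τ (v i + π ^ k * y i)) = (fun i => τ (v i)) +
          (u ^ k * π ^ k) • fun i => τ (y i) := by
        funext i
        rw [map_add, map_mul, hτk]; rfl
      have hz' := hz i
      simp only [T, Pi.sub_apply] at hz' ⊢
      rw [e1, Matrix.mulVec_add, Matrix.mulVec_smul, Pi.add_apply, Pi.smul_apply, smul_eq_mul]
      linear_combination hz'
    rw [e, pow_succ]
    refine mul_dvd_mul_left _ ((hr0 _).1 ?_)
    have h1 := congrFun hy₀ i
    have h2 : r (C.mulVec (fun i => τ (y i)) i) = (C.map r).mulVec (fun i => φ (y₀ i)) i := by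
      simp only [Matrix.mulVec, dotProduct, map_sum, map_mul, hτ, hφ, hy, Matrix.map_apply]
    have h3 : G y₀ i = r u ^ k * (C.map r).mulVec (fun i => φ (y₀ i)) i := by
      change B.mulVec (fun i => φ (y₀ i)) i = _
      rw [Matrix.smul_mulVec]; rfl
    rw [Pi.sub_apply, h3] at h1
    rw [map_sub, map_add, map_mul, map_pow, h2, hy]
    linear_combination -h1
  choose! step hs1 hs2 using hstep
  choose v₁ hv₁ using fun i => hr (v₀ i)
  -- The sequence starts from a lift of `v₀`, which already solves the equation modulo `π`, so `x k`
  -- solves it modulo `π ^ (k + 1)`.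
  let x : ℕ → Fin n → A := fun k => Nat.rec v₁ (fun k v => step (k + 1) v) k
  have hx1 : ∀ k, x (k + 1) = step (k + 1) (x k) := fun k => rfl
  have hxT : ∀ k i, π ^ (k + 1) ∣ T (x k) i := by
    intro k
    induction k with
    | zero =>
      intro i
      rw [zero_add, pow_one, ← hr0]
      have h1 := congrFun hv₀ i
      change r (C.mulVec (fun i => τ (v₁ i)) i - v₁ i) = 0
      rw [map_sub, hv₁, sub_eq_zero, ← h1]
      simp only [Matrix.mulVec, dotProduct, map_sum, map_mul, hτ, hφ, hv₁, Matrix.map_apply]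
    | succ k ih => rw [hx1]; exact hs2 _ _ ih
  have hxc : ∀ i k, π ^ k ∣ x (k + 1) i - x k i := fun i k =>
    (pow_dvd_pow π (Nat.le_succ k)).trans (hx1 k ▸ hs1 _ _ (hxT k) i)
  choose v hv using fun i => hc (fun k => x k i) (hxc i)
  refine ⟨v, ?_, fun i => ?_⟩
  · funext i
    rw [← sub_eq_zero]
    refine eq_zero_of_forall_pow_dvd hπ fun k => ?_
    have h1 : π ^ k ∣ C.mulVec (fun i => τ (v i)) i - C.mulVec (fun i => τ (x k i)) i := by
      rw [Matrix.mulVec, Matrix.mulVec, dotProduct, dotProduct, ← Finset.sum_sub_distrib]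
      refine Finset.dvd_sum fun j _ => ?_
      rw [← mul_sub, ← map_sub]
      refine Dvd.dvd.mul_left ?_ _
      have := map_dvd τ (hv j k)
      rw [hτk] at this
      exact (dvd_mul_left _ _).trans this
    have h2 := (pow_dvd_pow π (Nat.le_succ k)).trans (hxT k i)
    have h3 := dvd_sub (dvd_add h1 h2) (hv i k)
    have e : C.mulVec (fun i => τ (v i)) i - v i =
        C.mulVec (fun i => τ (v i)) i - C.mulVec (fun i => τ (x k i)) i + T (x k) i -
          (v i - x k i) := by
      simp only [T, Pi.sub_apply]; ring
    rw [e]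
    exact h3
  · have h1 := hv i 1
    rw [pow_one, ← hr0, map_sub, sub_eq_zero] at h1
    have h2 : π ∣ x 1 i - x 0 i := by
      have := hs1 1 (x 0) (by simpa using hxT 0) i
      rwa [pow_one] at this
    rw [← hr0, map_sub, sub_eq_zero] at h2
    rw [h1, h2]
    exact hv₁ i

/-- Lang's theorem over a complete discrete valuation ring with algebraically closed residue
field. -/
theorem exists_isUnit_det_fixed {n : ℕ} (C : Matrix (Fin n) (Fin n) A) (hC : IsUnit C.det) :
    ∃ P : Matrix (Fin n) (Fin n) A, IsUnit P.det ∧ C * P.map τ = P := by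
  let G := matSemi φ (C.map r)
  have hG : Function.Injective G := matSemi_injective φ (by
    rw [← RingHom.mapMatrix_apply, ← RingHom.map_det]
    exact (hC.map r).ne_zero)
  obtain ⟨e, he, hfix⟩ := exists_fixed_basis hq hφ n G hG (by simp)
  choose v hv hvr using fun j =>
    exists_fixed_lift hπ hc r hr hr0 hq hφ hτ hu hτπ C hC (e j) (hfix j)
  refine ⟨Matrix.of fun i j => v j i, ?_, ?_⟩
  · by_contra hnu
    have h0 : r (Matrix.of fun i j => v j i).det = 0 := by
      rw [hr0, ← Ideal.mem_span_singleton, ← hπ.maximalIdeal_eq, mem_maximalIdeal]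
      exact hnu
    rw [RingHom.map_det] at h0
    obtain ⟨y, hy, hy0⟩ := Matrix.exists_mulVec_eq_zero_iff.2 h0
    refine hy (funext fun j => Fintype.linearIndependent_iff.1 he y ?_ j)
    funext i
    have h1 := congrFun hy0 i
    simp only [Matrix.mulVec, dotProduct, RingHom.mapMatrix_apply, Matrix.map_apply,
      Matrix.of_apply, hvr] at h1
    rw [Finset.sum_apply, ← h1]
    exact Finset.sum_congr rfl fun j _ => mul_comm _ _
  · ext i j
    exact congrFun (hv j) i

end LangComplete

/-! ### Unit-root lattices in pure modules -/

section Lattice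

variable {p : ℕ} {A : Type u} [CommRing A] [IsDomain A] [IsDiscreteValuationRing A]
  (hA : IsMixed p A) {τ : A →+* A}

include hA in
-- The bound, applied to the columns of the adjugate, says that `γ` times the inverse of `D` is
-- integral. So `D * E = γ` for some matrix `E`, and the determinants give the claim.
theorem det_dvd_pow_of_le {n : ℕ} (D : Matrix (Fin n) (Fin n) A) {γ : A} (hγ : γ ≠ 0)
    (h : ∀ (v : Fin n → A) (d : ℝ), 0 ≤ d → (∀ i, av p (D.mulVec v i) ≤ d) →
      ∀ i, av p γ * av p (v i) ≤ d) : D.det ∣ γ ^ n := by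
  have hdet : D.det ≠ 0 := by
    intro h0
    obtain ⟨v, hv, hv0⟩ := Matrix.exists_mulVec_eq_zero_iff.2 h0
    refine hv (funext fun i => ?_)
    have h1 := h v 0 le_rfl (fun i => by rw [hv0]; exact (av_zero p).le) i
    have h2 : av p γ * av p (v i) = 0 :=
      le_antisymm h1 (mul_nonneg (av_nonneg p _) (av_nonneg p _))
    exact (av_eq_zero p).1 ((mul_eq_zero.1 h2).resolve_left (av_pos p hγ).ne')
  have hadj : ∀ i j, D.det ∣ γ * D.adjugate i j := fun i j => by
    rw [← av_le_iff hA, av_mul]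
    refine h (fun i => D.adjugate i j) (av p D.det) (av_nonneg p _) (fun l => ?_) i
    have e : D.mulVec (fun i => D.adjugate i j) l = (D * D.adjugate) l j := rfl
    rw [e, Matrix.mul_adjugate, Matrix.smul_apply, smul_eq_mul, av_mul]
    exact mul_le_of_le_one_right (av_nonneg p _) (av_le_one p _)
  choose E hE using hadj
  have h1 : D.det • (D * Matrix.of E) = D.det • (γ • (1 : Matrix (Fin n) (Fin n) A)) := by
    have h2 : γ • D.adjugate = D.det • Matrix.of E := by
      ext i j
      exact hE i j
    rw [← Matrix.mul_smul, ← h2, Matrix.mul_smul, Matrix.mul_adjugate, smul_comm]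
  have h2 : D * Matrix.of E = γ • (1 : Matrix (Fin n) (Fin n) A) :=
    smul_right_injective _ hdet h1
  have h3 := congrArg Matrix.det h2
  rw [Matrix.det_mul, Matrix.det_smul, Matrix.det_one, mul_one, Fintype.card_fin] at h3
  exact ⟨_, h3.symm⟩

include hA in
theorem av_det_iterate {L : Type*} [AddCommGroup L] [Module A L] (G : L →ₛₗ[τ] L) {n : ℕ}
    (b : Module.Basis (Fin n) A L) (k : ℕ) :
    av p (Matrix.of fun i j => b.repr (G^[k] (b j)) i).det =
      av p (Matrix.of fun i j => b.repr (G (b j)) i).det ^ k := by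
  induction k with
  | zero =>
    have : (Matrix.of fun i j => b.repr (G^[0] (b j)) i) = 1 := by
      ext i j
      change b.repr (b j) i = _
      rw [b.repr_self, Finsupp.single_apply, Matrix.one_apply]
      simp only [eq_comm]
    rw [this, Matrix.det_one, av_one, pow_zero]
  | succ k ih =>
    have : (Matrix.of fun i j => b.repr (G^[k + 1] (b j)) i) =
        (Matrix.of fun i j => b.repr (G (b j)) i) *
          (Matrix.of fun i j => b.repr (G^[k] (b j)) i).map τ := by
      ext i j
      change b.repr (G^[k + 1] (b j)) i = _
      rw [Function.iterate_succ_apply', repr_semilinear]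
      rfl
    rw [this, Matrix.det_mul, av_mul, ← RingHom.mapMatrix_apply, ← RingHom.map_det, av_map hA hA,
      ih, pow_succ']

include hA in
-- The determinant of `G^[k]` has absolute value `|det G| ^ k`, yet by the uniform lower bound it
-- divides a fixed nonzero element for all `k`. Hence `|det G| = 1`.
theorem isUnit_det_of_le_nm_iterate (hτ : Function.Bijective τ) {L : Type*} [AddCommGroup L]
    [Module A L] [Module.Free A L] [Module.Finite A L] (G : L →ₛₗ[τ] L) {c : ℝ} (hc : 0 < c)
    (h : ∀ (k : ℕ) (x : L), c * nm (A := A) p x ≤ nm (A := A) p (G^[k] x)) {n : ℕ}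
    (b : Module.Basis (Fin n) A L) : IsUnit (Matrix.of fun i j => b.repr (G (b j)) i).det := by
  let D : ℕ → Matrix (Fin n) (Fin n) A := fun k => Matrix.of fun i j => b.repr (G^[k] (b j)) i
  have hdet : ∀ k, av p (D k).det = av p (Matrix.of fun i j => b.repr (G (b j)) i).det ^ k :=
    av_det_iterate hA G b
  obtain ⟨m, hm⟩ := exists_pow_lt_of_lt_one hc (one_half_lt_one (α := ℝ))
  have hγ : (p : A) ^ m ≠ 0 := pow_ne_zero _ hA.ne_zero
  have hγc : av p ((p : A) ^ m) ≤ c := by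
    rw [av_pow, av_natCast hA]; exact hm.le
  have hdvd : ∀ k, (D k).det ∣ ((p : A) ^ m) ^ n := by
    intro k
    refine det_dvd_pow_of_le hA (D k) hγ fun v d hd hv i => ?_
    choose w hw using fun i => (GammaRing.bijective_ringHom_pow hτ k).2 (v i)
    have h1 := h k (∑ i, w i • b i)
    have h2 : ∀ i, b.repr (G^[k] (∑ i, w i • b i)) i = (D k).mulVec v i := fun i => by
      rw [← siter_apply, repr_semilinear]
      simp only [Module.Basis.repr_sum_self, hw]
      rfl
    rw [nm_eq_bnorm b hA, nm_eq_bnorm b hA] at h1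
    have h3 : bnorm p b (G^[k] (∑ i, w i • b i)) ≤ d := bnorm_le b hd fun i => by
      rw [h2]; exact hv i
    have h4 := av_repr_le_bnorm (p := p) b (∑ i, w i • b i) i
    rw [Module.Basis.repr_sum_self] at h4
    rw [← hw i, av_map hA hA]
    calc _ ≤ c * bnorm p b (∑ i, w i • b i) := mul_le_mul hγc h4 (av_nonneg p _) hc.le
      _ ≤ d := h1.trans h3
  by_contra hnu
  have hlt := av_lt_one hA hnu
  obtain ⟨k, hk⟩ := exists_pow_lt_of_lt_one (av_pos p (pow_ne_zero n hγ)) hlt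
  have := av_le_of_dvd p (hdvd k)
  rw [hdet] at this
  exact absurd hk this.not_gt

include hA in
/-- A pure module contains a lattice on which `F`, divided by a fixed scalar, is invertible. -/
theorem exists_unit_lattice (hτ : Function.Bijective τ) {ϖ : A} (hϖ0 : ϖ ≠ 0) (hϖ : τ ϖ = ϖ)
    {N : Type*} [AddCommGroup N] [Module A N] {F : N →ₛₗ[τ] N} {s : ℚ} (hF : IsPure p F s) {a : ℕ}
    (ha : rho s = av p ϖ ^ a) :
    ∃ (e : Fin (Module.finrank A N) → N)
      (C : Matrix (Fin (Module.finrank A N)) (Fin (Module.finrank A N)) A),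
      LinearIndependent A e ∧ IsUnit C.det ∧ ∀ j, F (e j) = ϖ ^ a • ∑ i, C i j • e i := by
  classical
  obtain ⟨_, _, C, hC, hF⟩ := hF
  have hρ := rho_pos s
  have hρk : ∀ k, rho s ^ k = av p ((ϖ ^ a) ^ k) := fun k => by rw [av_pow, av_pow, ha]
  set t := ϖ ^ a with ht
  have ht0 : t ≠ 0 := pow_ne_zero _ hϖ0
  have hτt : τ t = t := by rw [ht, map_pow, hϖ]
  -- The vectors whose whole orbit obeys the bound with constant `1`. Both `F` and division by `t`
  -- can be carried out inside: `F x = t • y` with `y` again in `L`.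
  let L : Submodule A N :=
    { carrier := {x | ∀ k : ℕ, nm (A := A) p (F^[k] x) ≤ rho s ^ k}
      zero_mem' := fun k => by
        rw [← siter_apply, map_zero, (nm_eq_zero hA).2 rfl]
        positivity
      add_mem' := fun {x y} hx hy k => by
        rw [iterate_map_add]
        exact (nm_add_le _ _).trans (max_le (hx k) (hy k))
      smul_mem' := fun c x hx k => by
        rw [nm_iterate_smul hA]
        exact (mul_le_of_le_one_left (nm_nonneg _) (av_le_one p c)).trans (hx k) }
  have hLex : ∀ x : L, ∃ y : L, F x = t • (y : N) := by
    rintro ⟨x, hx⟩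
    obtain ⟨y, hy⟩ := (nm_le_iff (x := F x) hA t).1 (by simpa [ht, ← ha, av_pow] using hx 1)
    refine ⟨⟨y, fun k => ?_⟩, hy⟩
    have h1 := hx (k + 1)
    rw [Function.iterate_succ_apply, hy, nm_iterate_smul hA, pow_succ',
      show av p t = rho s by rw [ht, av_pow, ha]] at h1
    exact le_of_mul_le_mul_left h1 hρ
  choose g hg using hLex
  have hcancel : ∀ x y : L, t • (x : N) = t • (y : N) → x = y := fun x y h =>
    Subtype.ext (smul_right_injective N ht0 h)
  let F₁ : L →ₛₗ[τ] L :=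
    { toFun := g
      map_add' := fun x y => hcancel _ _ (by
        rw [← hg, Submodule.coe_add, Submodule.coe_add, map_add, smul_add, ← hg, ← hg])
      map_smul' := fun c x => hcancel _ _ (by
        rw [← hg, Submodule.coe_smul, Submodule.coe_smul, map_smulₛₗ, smul_comm, ← hg]) }
  have hF₁ : ∀ x : L, F x = t • (F₁ x : N) := hg
  have hF₁k : ∀ (k : ℕ) (x : L), F^[k] (x : N) = t ^ k • (F₁^[k] x : N) := by
    intro k x
    induction k with
    | zero => simp
    | succ k ih =>
      rw [Function.iterate_succ_apply', ih, map_smulₛₗ, map_pow, hτt, hF₁, smul_smul,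
        Function.iterate_succ_apply', pow_succ]
  -- `γ` is small enough to absorb the constant of purity, so `γ • N` is contained in `L`. Therefore
  -- `L` has full rank and its own norm is comparable with the one induced from `N`.
  obtain ⟨m, hm⟩ := exists_pow_lt_of_lt_one (inv_pos.2 hC) (one_half_lt_one (α := ℝ))
  set γ := (p : A) ^ m
  have hγ : γ ≠ 0 := pow_ne_zero _ hA.ne_zero
  have hγC : av p γ * C ≤ 1 := by
    rw [av_pow, av_natCast hA]
    calc _ ≤ C⁻¹ * C := by gcongr
      _ = 1 := inv_mul_cancel₀ hC.ne'
  have hγL : ∀ x : N, γ • x ∈ L := fun x k => by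
    rw [nm_iterate_smul hA]
    have h0 := av_nonneg p γ
    have h1 := nm_le_one (p := p) (A := A) hA x
    calc _ ≤ av p γ * (C * rho s ^ k * nm (A := A) p x) := by gcongr; exact (hF k x).1
      _ ≤ av p γ * (C * rho s ^ k * 1) := by gcongr
      _ = (av p γ * C) * rho s ^ k := by ring
      _ ≤ 1 * rho s ^ k := by gcongr
      _ = _ := one_mul _
  have hnmL : ∀ x : L, av p γ * nm (A := A) p x ≤ nm (A := A) p (x : N) := fun x => by
    obtain ⟨r, hr⟩ := exists_nm_eq (p := p) (A := A) (x : N)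
    obtain ⟨y, hy⟩ := (nm_le_iff hA r).1 hr.le
    rw [← nm_smul, hr, nm_le_iff hA]
    refine ⟨⟨γ • y, hγL y⟩, Subtype.ext ?_⟩
    rw [Submodule.coe_smul, Submodule.coe_smul, hy, smul_comm]
  have hlow : ∀ (k : ℕ) (x : L), C⁻¹ * av p γ * nm (A := A) p x ≤ nm (A := A) p (F₁^[k] x) := by
    intro k x
    have h1 := (hF k (x : N)).2
    rw [hF₁k, nm_smul, hρk, mul_left_comm] at h1
    have h2 := le_of_mul_le_mul_left h1 (av_pos p (pow_ne_zero k ht0))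
    rw [mul_assoc, ← div_eq_inv_mul, div_le_iff₀ hC, mul_comm _ C]
    refine (hnmL x).trans (h2.trans (mul_le_mul_of_nonneg_left ?_ hC.le))
    exact nm_map_le hA L.subtype _
  have hfin : Module.finrank A L = Module.finrank A N := by
    refine le_antisymm (Submodule.finrank_le L) ?_
    refine LinearMap.finrank_le_finrank_of_injective
      (f := (LinearMap.lsmul A N γ).codRestrict L hγL) fun x y hxy => ?_
    exact smul_right_injective N hγ (congrArg Subtype.val hxy)
  let b := (Module.finBasis A L).reindex (finCongr hfin)
  refine ⟨fun j => (b j : N), Matrix.of fun i j => b.repr (F₁ (b j)) i, ?_,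
    isUnit_det_of_le_nm_iterate hA hτ F₁ (by have := av_pos p hγ; positivity) hlow b, fun j => ?_⟩
  · exact b.linearIndependent.map' L.subtype L.ker_subtype
  · rw [hF₁]
    congr 1
    have h := congrArg L.subtype (b.sum_repr (F₁ (b j)))
    rw [map_sum] at h
    simp only [map_smul] at h
    exact h.symm

/-- A solution of `C τ(P) = P` turns a basis of matrix `C` into a basis of eigenvectors. -/
theorem exists_eigenvectors_of_fixed {n : ℕ} {N : Type*} [AddCommGroup N] [Module A N]
    {F : N →ₛₗ[τ] N} {e : Fin n → N} (he : LinearIndependent A e) {C P : Matrix (Fin n) (Fin n) A}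
    {t : A} (hF : ∀ j, F (e j) = t • ∑ i, C i j • e i) (hP : P.det ≠ 0) (hCP : C * P.map τ = P) :
    ∃ e' : Fin n → N, LinearIndependent A e' ∧ ∀ j, F (e' j) = t • e' j := by
  refine ⟨fun j => ∑ i, P i j • e i, ?_, fun j => ?_⟩
  · rw [Fintype.linearIndependent_iff]
    intro y hy
    have h1 : ∑ i, (P.mulVec y i) • e i = 0 := by
      rw [← hy]
      simp only [Matrix.mulVec, dotProduct, Finset.sum_smul, Finset.smul_sum, smul_smul]
      rw [Finset.sum_comm]
      exact Finset.sum_congr rfl fun j _ => Finset.sum_congr rfl fun i _ => by rw [mul_comm]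
    have h2 : P.mulVec y = 0 := funext (Fintype.linearIndependent_iff.1 he _ h1)
    by_contra! hcon
    obtain ⟨i, hi⟩ := hcon
    exact hP (Matrix.exists_mulVec_eq_zero_iff.1 ⟨y, fun h => hi (congrFun h i), h2⟩)
  · rw [map_sum]
    conv_rhs => rw [← hCP]
    simp only [map_smulₛₗ, hF, Matrix.mul_apply, Matrix.map_apply, Finset.sum_smul]
    rw [Finset.sum_comm, Finset.smul_sum]
    refine Finset.sum_congr rfl fun i _ => ?_
    rw [smul_comm]
    congr 1
    rw [Finset.smul_sum]
    exact Finset.sum_congr rfl fun l _ => by rw [smul_smul, mul_comm]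

end Lattice

/-! ### Completeness with respect to one element -/

section Complete

/-- `A` is separated and complete for the powers of the ideal generated by `a`. -/
structure IsCompleteAt {A : Type*} [CommRing A] (a : A) : Prop where
  haus : ∀ x : A, (∀ n, a ^ n ∣ x) → x = 0
  lim : ∀ x : ℕ → A, (∀ n, a ^ n ∣ x (n + 1) - x n) → ∃ y, ∀ n, a ^ n ∣ y - x n

theorem pow_dvd_sub_of_le {A : Type*} [CommRing A] {a : A} {x : ℕ → A}
    (hx : ∀ n, a ^ n ∣ x (n + 1) - x n) {m n : ℕ} (h : m ≤ n) : a ^ m ∣ x n - x m := by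
  induction n, h using Nat.le_induction with
  | base => simp
  | succ n hn ih =>
    rw [← sub_add_sub_cancel _ (x n)]
    exact dvd_add ((pow_dvd_pow a hn).trans (hx n)) ih

theorem isCompleteAt_iff {A : Type*} [CommRing A] (a : A) :
    IsCompleteAt a ↔ IsAdicComplete (Ideal.span {a}) A := by
  have hmem : ∀ n (z : A), z ∈ ((Ideal.span {a}) ^ n • ⊤ : Submodule A A) ↔ a ^ n ∣ z := fun n z => by
    rw [smul_eq_mul, Ideal.mul_top, Ideal.span_singleton_pow, Ideal.mem_span_singleton]
  constructor
  · intro h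
    refine { haus' := fun x hx => h.haus x fun n => ?_, prec' := fun x hx => ?_ }
    · have := hx n
      rwa [SModEq.sub_mem, hmem, sub_zero] at this
    · obtain ⟨y, hy⟩ := h.lim x fun n => by
        have := hx (Nat.le_succ n)
        rw [SModEq.sub_mem, hmem] at this
        rwa [← neg_sub, dvd_neg]
      refine ⟨y, fun n => ?_⟩
      rw [SModEq.sub_mem, hmem, ← neg_sub, dvd_neg]
      exact hy n
  · intro h
    refine ⟨fun x hx => IsHausdorff.haus h.toIsHausdorff x fun n => ?_,
      exists_limit_of_isAdicComplete h⟩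
    rw [SModEq.sub_mem, hmem, sub_zero]
    exact hx n

/-- The powers of `a` and of `b` define the same topology. A sequence that is Cauchy for `b` has a
subsequence that is Cauchy for `a` at the rate required. -/
theorem IsCompleteAt.of_dvd_pow {A : Type*} [CommRing A] {a b : A} (h : IsCompleteAt a) {m n : ℕ}
    (hm : 0 < m) (hn : 0 < n) (hab : a ∣ b ^ m) (hba : b ∣ a ^ n) : IsCompleteAt b := by
  have h1 : ∀ k, a ^ k ∣ b ^ (m * k) := fun k => by rw [pow_mul]; exact pow_dvd_pow_of_dvd hab k
  have h2 : ∀ k, b ^ k ∣ a ^ (n * k) := fun k => by rw [pow_mul]; exact pow_dvd_pow_of_dvd hba k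
  refine ⟨fun x hx => h.haus x fun k => (h1 k).trans (hx _), fun x hx => ?_⟩
  obtain ⟨y, hy⟩ := h.lim (fun k => x (m * k)) fun k =>
    (h1 k).trans (pow_dvd_sub_of_le hx (Nat.mul_le_mul_left m k.le_succ))
  refine ⟨y, fun j => ?_⟩
  rw [← sub_add_sub_cancel y (x (m * (n * j)))]
  refine dvd_add ((h2 j).trans (hy _)) (pow_dvd_sub_of_le hx ?_)
  rw [← mul_assoc]
  exact Nat.le_mul_of_pos_left j (Nat.mul_pos hm hn)

theorem IsCompleteAt.map_algebraMap {A B : Type*} [CommRing A] [CommRing B] [Algebra A B]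
    [Module.Free A B] [Module.Finite A B] {a : A} (h : IsCompleteAt a) :
    IsCompleteAt (algebraMap A B a) := by
  let b := Module.Free.chooseBasis A B
  have hdvd : ∀ n (x : B), algebraMap A B a ^ n ∣ x ↔ ∀ i, a ^ n ∣ b.repr x i := fun n x => by
    constructor
    · rintro ⟨y, rfl⟩ i
      rw [← map_pow, ← Algebra.smul_def, map_smul, Finsupp.smul_apply, smul_eq_mul]
      exact dvd_mul_right _ _
    · intro hx
      choose c hc using hx
      refine ⟨∑ i, c i • b i, ?_⟩
      rw [← map_pow, ← Algebra.smul_def, Finset.smul_sum, ← b.sum_repr x]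
      exact Finset.sum_congr rfl fun i _ => by rw [smul_smul, ← hc]
  constructor
  · intro x hx
    refine b.ext_elem fun i => ?_
    rw [map_zero, Finsupp.zero_apply]
    exact h.haus _ fun n => (hdvd n x).1 (hx n) i
  · intro x hx
    have : ∀ i, ∃ y, ∀ n, a ^ n ∣ y - b.repr (x n) i := fun i =>
      h.lim (fun n => b.repr (x n) i) fun n => by
        have := (hdvd n _).1 (hx n) i
        rwa [map_sub, Finsupp.sub_apply] at this
    choose y hy using this
    refine ⟨∑ i, y i • b i, fun n => (hdvd n _).2 fun i => ?_⟩
    rw [map_sub, Finsupp.sub_apply, b.repr_sum_self]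
    exact hy i n

theorem IsCompleteAt.isUnit {A : Type*} [CommRing A] {a : A} (h : IsCompleteAt a) {κ : Type*}
    [Field κ] {r : A →+* κ} (hr : Function.Surjective r) (hr0 : ∀ x, r x = 0 ↔ a ∣ x) {x : A}
    (hx : r x ≠ 0) : IsUnit x := by
  have := (isCompleteAt_iff a).1 h
  obtain ⟨y, hy⟩ := hr (r x)⁻¹
  have h1 : x * y - 1 ∈ Ideal.span {a} := by
    rw [Ideal.mem_span_singleton, ← hr0, map_sub, map_mul, hy, mul_inv_cancel₀ hx, map_one, sub_self]
  have h2 := IsAdicComplete.le_jacobson_bot (Ideal.span {a}) h1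
  rw [Ideal.mem_jacobson_bot] at h2
  have := h2 1
  rw [mul_one, sub_add_cancel] at this
  exact isUnit_of_mul_isUnit_left this

end Complete

/-- `A` is a complete discrete valuation ring with uniformizer `ϖ` and residue map `r`, and `τ` lifts
the `q`-power map of its residue field. -/
structure IsFrobRing (q : ℕ) {A κ : Type*} [CommRing A] [Field κ] (r : A →+* κ) (ϖ : A)
    (τ : A →+* A) : Prop where
  surjective : Function.Surjective r
  eq_zero_iff : ∀ x, r x = 0 ↔ ϖ ∣ x
  pow_ne_zero : ∀ n, ϖ ^ n ≠ 0
  complete : IsCompleteAt ϖ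
  frob : ∀ x, r (τ x) = r x ^ q

/-! ### Complete discrete valuation rings with a Frobenius lift -/

namespace IsFrobRing

section Basic

variable {q : ℕ} {A κ : Type*} [CommRing A] [Field κ] {r : A →+* κ} {ϖ : A} {τ : A →+* A}

theorem isUnit_iff (h : IsFrobRing q r ϖ τ) (x : A) : IsUnit x ↔ r x ≠ 0 :=
  ⟨fun hx => (hx.map r).ne_zero, h.complete.isUnit h.surjective h.eq_zero_iff⟩

theorem exists_eq_mul_pow (h : IsFrobRing q r ϖ τ) {x : A} (hx : x ≠ 0) :
    ∃ (n : ℕ) (u : A), IsUnit u ∧ x = ϖ ^ n * u := by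
  have : ∃ n, ¬ ϖ ^ n ∣ x := by
    by_contra! hc
    exact hx (h.complete.haus x hc)
  classical
  obtain ⟨n, hn⟩ : ∃ n, Nat.find this = n + 1 := Nat.exists_eq_succ_of_ne_zero fun h0 => by
    have := Nat.find_spec this
    rw [h0, pow_zero] at this
    exact this (one_dvd x)
  have h1 : ϖ ^ n ∣ x := not_not.1 (Nat.find_min this (by lia))
  have h2 := Nat.find_spec this
  obtain ⟨u, rfl⟩ := h1
  refine ⟨n, u, (h.isUnit_iff u).2 fun hu => h2 ?_, rfl⟩
  obtain ⟨v, rfl⟩ := (h.eq_zero_iff u).1 hu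
  rw [hn, pow_succ, ← mul_assoc]
  exact dvd_mul_right _ _

theorem isDomain (h : IsFrobRing q r ϖ τ) : IsDomain A := by
  have : Nontrivial A := ⟨1, 0, by simpa using h.pow_ne_zero 0⟩
  have : NoZeroDivisors A := ⟨fun {x y} hxy => by
    by_contra! hc
    obtain ⟨n, u, hu, hx⟩ := h.exists_eq_mul_pow hc.1
    obtain ⟨m, v, hv, hy⟩ := h.exists_eq_mul_pow hc.2
    refine h.pow_ne_zero (n + m) ?_
    have h1 : ϖ ^ (n + m) * (u * v) = 0 := by rw [← hxy, hx, hy]; ring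
    exact (hu.mul hv).mul_left_eq_zero.1 h1⟩
  exact NoZeroDivisors.to_isDomain A

theorem irreducible [IsDomain A] (h : IsFrobRing q r ϖ τ) : Irreducible ϖ := by
  have h0 : r ϖ = 0 := (h.eq_zero_iff ϖ).2 dvd_rfl
  have hne : ϖ ≠ 0 := by simpa using h.pow_ne_zero 1
  refine ⟨fun hu => (h.isUnit_iff ϖ).1 hu h0, fun a b hab => ?_⟩
  rw [h.isUnit_iff, h.isUnit_iff]
  by_contra! hc
  obtain ⟨a', rfl⟩ := (h.eq_zero_iff a).1 hc.1
  obtain ⟨b', rfl⟩ := (h.eq_zero_iff b).1 hc.2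
  have h1 : ϖ * (a' * ϖ * b') = ϖ * 1 := by rw [mul_one]; nth_rewrite 3 [hab]; ring
  have h2 := congrArg r (mul_left_cancel₀ hne h1)
  simp [h0] at h2

theorem isDiscreteValuationRing [IsDomain A] (h : IsFrobRing q r ϖ τ) :
    IsDiscreteValuationRing A :=
  IsDiscreteValuationRing.ofHasUnitMulPowIrreducibleFactorization
    ⟨ϖ, h.irreducible, fun {x} hx => by
      obtain ⟨n, u, hu, rfl⟩ := h.exists_eq_mul_pow hx
      exact ⟨n, hu.unit, rfl⟩⟩

theorem pow (h : IsFrobRing q r ϖ τ) (f : ℕ) : IsFrobRing (q ^ f) r ϖ (τ ^ f) where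
  surjective := h.surjective
  eq_zero_iff := h.eq_zero_iff
  pow_ne_zero := h.pow_ne_zero
  complete := h.complete
  frob x := by
    induction f with
    | zero => simp
    | succ f ih => rw [pow_succ', RingHom.mul_def, RingHom.comp_apply, h.frob, ih, ← pow_mul, pow_succ]

end Basic

section Dvr

variable {p q : ℕ} {A : Type u} {κ : Type*} [CommRing A] [Field κ] {r : A →+* κ} {ϖ : A} {τ : A →+* A}
  [IsDomain A] [IsDiscreteValuationRing A]

theorem maximalIdeal_eq (h : IsFrobRing q r ϖ τ) : maximalIdeal A = Ideal.span {ϖ} :=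
  h.irreducible.maximalIdeal_eq

theorem isAdicComplete (h : IsFrobRing q r ϖ τ) : IsAdicComplete (maximalIdeal A) A := by
  rw [h.maximalIdeal_eq]; exact (isCompleteAt_iff ϖ).1 h.complete

theorem isFrobLift (h : IsFrobRing q r ϖ τ) : IsFrobLift q τ := fun x => by
  rw [h.maximalIdeal_eq, Ideal.mem_span_singleton, ← h.eq_zero_iff, map_sub, h.frob, map_pow, sub_self]

theorem exists_frob_unif (h : IsFrobRing q r ϖ τ) (hA : IsMixed p A) :
    ∃ u, IsUnit u ∧ τ ϖ = u * ϖ := by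
  have h1 := av_map hA hA τ ϖ
  obtain ⟨u, hu⟩ := (av_le_iff hA).1 h1.le
  obtain ⟨v, hv⟩ := (av_le_iff hA).1 h1.ge
  refine ⟨u, ?_, by rw [hu, mul_comm]⟩
  rw [hu, mul_assoc] at hv
  have h2 : ϖ * (u * v) = ϖ * 1 := by rw [← hv, mul_one]
  exact IsUnit.of_mul_eq_one v (mul_left_cancel₀ h.irreducible.ne_zero h2)

theorem bijective (h : IsFrobRing q r ϖ τ) (hA : IsMixed p A)
    (hq : ∀ x : κ, ∃ y, y ^ q = x) : Function.Bijective τ := by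
  refine ⟨map_injective_of_isMixed hA hA _, ?_⟩
  obtain ⟨u, hu, hτ⟩ := h.exists_frob_unif hA
  have := (isCompleteAt_iff ϖ).1 h.complete
  have hI : (Ideal.span {ϖ}).map τ = Ideal.span {ϖ} := by
    rw [Ideal.map_span, Set.image_singleton, hτ]
    exact Ideal.span_singleton_mul_left_unit hu _
  have : IsHausdorff ((Ideal.span {ϖ}).map τ) A := by rw [hI]; infer_instance
  refine surjective_of_mk_map_comp_surjective (I := Ideal.span {ϖ}) τ fun y => ?_
  obtain ⟨y, rfl⟩ := Ideal.Quotient.mk_surjective y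
  obtain ⟨z, hz⟩ := hq (r y)
  obtain ⟨x, hx⟩ := h.surjective z
  refine ⟨x, ?_⟩
  rw [RingHom.comp_apply, Ideal.Quotient.eq, hI, Ideal.mem_span_singleton, ← h.eq_zero_iff, map_sub,
    h.frob, hx, hz, sub_self]

theorem exists_isUnit_det_fixed [IsAlgClosed κ] (h : IsFrobRing q r ϖ τ) (hA : IsMixed p A)
    (hq : 1 < q) {φ : κ →+* κ} (hφ : ∀ x, φ x = x ^ q) {n : ℕ} (C : Matrix (Fin n) (Fin n) A)
    (hC : IsUnit C.det) : ∃ P : Matrix (Fin n) (Fin n) A, IsUnit P.det ∧ C * P.map τ = P := by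
  obtain ⟨u, hu, hτ⟩ := h.exists_frob_unif hA
  exact SlopeFiltration.exists_isUnit_det_fixed h.irreducible h.complete.lim r h.surjective
    h.eq_zero_iff hq hφ h.frob hu hτ C hC

/-- Write `τ ϖ = u * ϖ` with `u` a unit. Lang's theorem for `1 × 1` matrices gives a unit `c` with
`u * τ c = c`, and then `c * ϖ` is fixed. -/
theorem exists_fixed_unif [IsAlgClosed κ] (h : IsFrobRing q r ϖ τ) (hA : IsMixed p A)
    (hq : 1 < q) {φ : κ →+* κ} (hφ : ∀ x, φ x = x ^ q) :
    ∃ ϖ', τ ϖ' = ϖ' ∧ IsFrobRing q r ϖ' τ := by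
  obtain ⟨u, hu, hτ⟩ := h.exists_frob_unif hA
  obtain ⟨P, hP, hC⟩ := h.exists_isUnit_det_fixed hA hq hφ (n := 1) (Matrix.of fun _ _ => u)
    (by simpa using hu)
  have hc : IsUnit (P 0 0) := by simpa using hP
  have h1 := congrFun (congrFun hC 0) 0
  rw [Matrix.mul_apply] at h1
  simp only [Finset.univ_unique, Fin.default_eq_zero, Fin.isValue, Matrix.of_apply, Matrix.map_apply,
    Finset.sum_singleton] at h1
  have ha : Associated ϖ (P 0 0 * ϖ) := ⟨hc.unit, by simp [mul_comm]⟩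
  refine ⟨P 0 0 * ϖ, ?_, h.surjective, fun x => ?_, fun n => ?_, ?_, h.frob⟩
  · rw [map_mul, hτ, ← mul_assoc, mul_comm _ u, h1]
  · rw [h.eq_zero_iff, ha.dvd_iff_dvd_left]
  · rw [mul_pow]; exact mul_ne_zero (_root_.pow_ne_zero n hc.ne_zero) (h.pow_ne_zero n)
  · exact h.complete.of_dvd_pow one_pos one_pos (by rw [pow_one]; exact ha.dvd)
      (by rw [pow_one]; exact ha.symm.dvd)

end Dvr

section AdjoinRoot

open Polynomial in
/-- Adjoining a root of a uniformizer fixed by Frobenius. -/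
theorem adjoinRoot {q : ℕ} {A : Type u} {κ : Type*} [CommRing A] [Field κ] {r : A →+* κ} {ϖ : A}
    {τ : A →+* A} (h : IsFrobRing q r ϖ τ) (hτ : τ ϖ = ϖ) {b : ℕ} (hb : 0 < b) :
    ∃ (r' : AdjoinRoot (X ^ b - C ϖ) →+* κ) (τ' : AdjoinRoot (X ^ b - C ϖ) →+* _),
      IsFrobRing q r' (AdjoinRoot.root (X ^ b - C ϖ)) τ' ∧
      τ' (AdjoinRoot.root _) = AdjoinRoot.root _ ∧
      AdjoinRoot.root (X ^ b - C ϖ) ^ b = AdjoinRoot.of _ ϖ ∧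
      ∀ a, τ' (AdjoinRoot.of _ a) = AdjoinRoot.of _ (τ a) := by
  have hmon : (X ^ b - C ϖ).Monic := monic_X_pow_sub_C ϖ hb.ne'
  set g : A[X] := X ^ b - C ϖ with hg
  have hroot : AdjoinRoot.root g ^ b = AdjoinRoot.of g ϖ := by
    have := AdjoinRoot.eval₂_root g
    rwa [hg, eval₂_sub, eval₂_X_pow, eval₂_C, ← hg, sub_eq_zero] at this
  have hrϖ : r ϖ = 0 := (h.eq_zero_iff ϖ).2 dvd_rfl
  -- The extension is totally ramified: the new root reduces to `0` and the residue field does not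
  -- change. Since `ϖ` is fixed, Frobenius extends by fixing the root.
  let r' : AdjoinRoot g →+* κ := AdjoinRoot.lift r 0 (by simp [hg, hb.ne', hrϖ])
  let τ' : AdjoinRoot g →+* AdjoinRoot g := AdjoinRoot.lift ((AdjoinRoot.of g).comp τ)
    (AdjoinRoot.root g) (by rw [hg, eval₂_sub, eval₂_X_pow, eval₂_C, ← hg, hroot,
      RingHom.comp_apply, hτ, sub_self])
  have hr'root : r' (AdjoinRoot.root g) = 0 := AdjoinRoot.lift_root _
  have hr'of : ∀ a, r' (AdjoinRoot.of g a) = r a := fun a => AdjoinRoot.lift_of _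
  have hτ'root : τ' (AdjoinRoot.root g) = AdjoinRoot.root g := AdjoinRoot.lift_root _
  have hτ'of : ∀ a, τ' (AdjoinRoot.of g a) = AdjoinRoot.of g (τ a) := fun a => AdjoinRoot.lift_of _
  have hdec : ∀ x, ∃ a y, x = AdjoinRoot.of g a + AdjoinRoot.root g * y := fun x => by
    obtain ⟨P, rfl⟩ := AdjoinRoot.mk_surjective x
    refine ⟨P.coeff 0, AdjoinRoot.mk g P.divX, ?_⟩
    nth_rewrite 1 [← X_mul_divX_add P]
    rw [map_add, map_mul, AdjoinRoot.mk_X, AdjoinRoot.mk_C, add_comm]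
  have : Module.Free A (AdjoinRoot g) := hmon.free_adjoinRoot
  have : Module.Finite A (AdjoinRoot g) := hmon.finite_adjoinRoot
  have : Nontrivial (AdjoinRoot g) := r'.domain_nontrivial
  have hinj : Function.Injective (AdjoinRoot.of g) := FaithfulSMul.algebraMap_injective A (AdjoinRoot g)
  have hcomp : IsCompleteAt (AdjoinRoot.of g ϖ) := h.complete.map_algebraMap (B := AdjoinRoot g)
  refine ⟨r', τ', ⟨fun z => ?_, fun x => ⟨fun hx => ?_, ?_⟩, fun n hn => ?_, ?_, fun x => ?_⟩,
    hτ'root, hroot, hτ'of⟩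
  · obtain ⟨a, rfl⟩ := h.surjective z
    exact ⟨_, hr'of a⟩
  · obtain ⟨a, y, rfl⟩ := hdec x
    rw [map_add, map_mul, hr'root, zero_mul, add_zero, hr'of, h.eq_zero_iff] at hx
    obtain ⟨c, rfl⟩ := hx
    rw [map_mul, ← hroot]
    exact dvd_add (dvd_mul_of_dvd_left (dvd_pow_self _ hb.ne') _) (dvd_mul_right _ _)
  · rintro ⟨y, rfl⟩
    rw [map_mul, hr'root, zero_mul]
  · refine h.pow_ne_zero n (hinj ?_)
    rw [map_pow, ← hroot, ← pow_mul, mul_comm, pow_mul, hn, zero_pow hb.ne', map_zero]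
  · refine hcomp.of_dvd_pow hb one_pos ?_ ?_
    · rw [hroot]
    · rw [pow_one, ← hroot]; exact dvd_pow_self _ hb.ne'
  · obtain ⟨a, y, rfl⟩ := hdec x
    simp only [map_add, map_mul, hτ'root, hτ'of, hr'root, hr'of, zero_mul, add_zero, h.frob]

end AdjoinRoot

end IsFrobRing

/-! ### Teichmüller lifts and the map from Witt vectors to `Γ` -/

namespace GammaRing

variable {p : ℕ} {O : Type u} [CommRing O] [IsDomain O] [IsDiscreteValuationRing O]
  {σ₀ : O →+* O} {K : Type u} [Field K] [Algebra (LaurentSeries (ResidueField O)) K]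
  {Γ : Type u} [CommRing Γ] [IsDomain Γ] [IsDiscreteValuationRing Γ] [Algebra O Γ]
  [hp : Fact p.Prime] [CharP (ResidueField O) p] [CharZero O] [PerfectField K]

theorem isFrobRing (G : GammaRing p σ₀ K Γ) {π : O} (hπ : Irreducible π) :
    IsFrobRing p G.residue (algebraMap O Γ π) G.frob where
  surjective := G.residue_surjective
  eq_zero_iff x := by rw [← G.mem_max_iff, G.max_eq hπ, Ideal.mem_span_singleton]
  pow_ne_zero n := pow_ne_zero n (G.unif_ne_zero hπ)
  complete := by
    rw [isCompleteAt_iff, ← G.max_eq hπ]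
    exact G.complete
  frob := G.residue_frob

theorem exists_natCast_eq (G : GammaRing p σ₀ K Γ) {π : O} (hπ : Irreducible π) :
    ∃ (e : ℕ) (u : Γ), 0 < e ∧ IsUnit u ∧ (p : Γ) = algebraMap O Γ π ^ e * u := by
  obtain ⟨e, u, hu, h⟩ := (G.isFrobRing hπ).exists_eq_mul_pow G.isMixed.ne_zero
  refine ⟨e, u, Nat.pos_of_ne_zero fun h0 => ?_, hu, h⟩
  rw [h0, pow_zero, one_mul] at h
  exact (IsLocalRing.mem_maximalIdeal _).1 G.isMixed.mem (h ▸ hu)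

theorem isCompleteAt_natCast (G : GammaRing p σ₀ K Γ) : IsCompleteAt (p : Γ) := by
  obtain ⟨π, hπ⟩ := IsDiscreteValuationRing.exists_irreducible O
  obtain ⟨e, u, he, hu, h⟩ := G.exists_natCast_eq hπ
  refine (G.isFrobRing hπ).complete.of_dvd_pow one_pos he ?_ ?_
  · rw [pow_one, h]
    exact dvd_mul_of_dvd_left (dvd_pow_self _ he.ne') _
  · rw [h]
    exact hu.mul_right_dvd.2 dvd_rfl



/-- The Teichmüller lift. -/
def teich (G : GammaRing p σ₀ K Γ) (x : K) : Γ := (G.exists_teich x).choose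

theorem isTeichmuller_teich (G : GammaRing p σ₀ K Γ) (x : K) : IsTeichmuller p (G.teich x) :=
  (G.exists_teich x).choose_spec.1

theorem residue_teich (G : GammaRing p σ₀ K Γ) (x : K) : G.residue (G.teich x) = x :=
  (G.exists_teich x).choose_spec.2

theorem teich_eq (G : GammaRing p σ₀ K Γ) {t : Γ} (ht : IsTeichmuller p t) :
    G.teich (G.residue t) = t :=
  G.teich_unique (G.isTeichmuller_teich _) ht (G.residue_teich _)

theorem isTeichmuller_one : IsTeichmuller p (1 : Γ) := fun _ => ⟨1, one_pow _⟩

theorem isTeichmuller_pow {t : Γ} (ht : IsTeichmuller p t) (m : ℕ) : IsTeichmuller p (t ^ m) :=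
  fun n => by
  obtain ⟨y, rfl⟩ := ht n
  exact ⟨y ^ m, by rw [← pow_mul, ← pow_mul, mul_comm]⟩

theorem teich_map_one (G : GammaRing p σ₀ K Γ) : G.teich 1 = 1 := by
  rw [← map_one G.residue]; exact G.teich_eq isTeichmuller_one

theorem teich_map_zero (G : GammaRing p σ₀ K Γ) : G.teich 0 = 0 := by
  rw [← map_zero G.residue]
  exact G.teich_eq fun n => ⟨0, zero_pow (pow_ne_zero n hp.out.ne_zero)⟩

theorem teich_map_mul (G : GammaRing p σ₀ K Γ) (x y : K) :
    G.teich (x * y) = G.teich x * G.teich y := by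
  conv_lhs => rw [← G.residue_teich x, ← G.residue_teich y, ← map_mul]
  exact G.teich_eq (teich_mul (G.isTeichmuller_teich x) (G.isTeichmuller_teich y))

theorem teich_map_pow (G : GammaRing p σ₀ K Γ) (x : K) (m : ℕ) :
    G.teich (x ^ m) = G.teich x ^ m := by
  conv_lhs => rw [← G.residue_teich x, ← map_pow]
  exact G.teich_eq (isTeichmuller_pow (G.isTeichmuller_teich x) m)

/-- Additivity is clear modulo `π` only. Replace `x` and `y` by their `p ^ e`-th roots, where `p` is
a unit times `π ^ e`, and raise the error to the power `p ^ e ≥ e`: it becomes divisible by `p`.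
This power is the error for `x` and `y` modulo `p`, where Frobenius is additive. -/
theorem dvd_teich_add (G : GammaRing p σ₀ K Γ) (x y : K) :
    (p : Γ) ∣ G.teich (x + y) - (G.teich x + G.teich y) := by
  obtain ⟨π, hπ⟩ := IsDiscreteValuationRing.exists_irreducible O
  obtain ⟨e, u, he, hu, h⟩ := G.exists_natCast_eq hπ
  have := G.charP_K
  have : ExpChar K p := ExpChar.prime hp.out
  obtain ⟨x', rfl⟩ := (iterateFrobeniusEquiv K p e).surjective x
  obtain ⟨y', rfl⟩ := (iterateFrobeniusEquiv K p e).surjective y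
  rw [← map_add]
  simp only [iterateFrobeniusEquiv_apply, iterateFrobenius_def, teich_map_pow]
  have hnu : ¬ IsUnit (p : Γ) := G.isMixed.mem
  have : CharP (Γ ⧸ Ideal.span {(p : Γ)}) p :=
    CharP.quotient Γ p hnu
  have : ExpChar (Γ ⧸ Ideal.span {(p : Γ)}) p := ExpChar.prime hp.out
  rw [← Ideal.mem_span_singleton, ← Ideal.Quotient.eq_zero_iff_mem]
  have h1 : algebraMap O Γ π ∣ G.teich (x' + y') - (G.teich x' + G.teich y') := by
    rw [← (G.isFrobRing hπ).eq_zero_iff, map_sub, map_add, G.residue_teich, G.residue_teich,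
      G.residue_teich, sub_self]
  have h2 : (p : Γ) ∣ (G.teich (x' + y') - (G.teich x' + G.teich y')) ^ p ^ e := by
    rw [h]
    refine hu.mul_right_dvd.2 ?_
    exact (pow_dvd_pow _ (Nat.lt_pow_self hp.out.one_lt).le).trans (pow_dvd_pow_of_dvd h1 _)
  rw [← Ideal.mem_span_singleton, ← Ideal.Quotient.eq_zero_iff_mem] at h2
  rw [map_sub, map_add, map_pow, map_pow, map_pow, ← add_pow_expChar_pow, ← sub_pow_expChar_pow,
    ← map_add, ← map_sub, ← map_pow]
  exact h2

/-- The Teichmüller lift is a ring homomorphism modulo `p`. -/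
def teichMod (G : GammaRing p σ₀ K Γ) : K →+* ModP Γ p where
  toFun x := Ideal.Quotient.mk _ (G.teich x)
  map_one' := by rw [teich_map_one, map_one]
  map_zero' := by rw [teich_map_zero, map_zero]
  map_mul' x y := by rw [teich_map_mul, map_mul]
  map_add' x y := by
    rw [← map_add, Ideal.Quotient.eq, Ideal.mem_span_singleton]
    exact G.dvd_teich_add x y

/-- As `K` is perfect, the homomorphism `K → Γ/p` lifts to the tilt of `Γ`, and Fontaine's map `θ`
goes from the Witt vectors of the tilt to `Γ`. The image of a Teichmüller element has all `p`-power
roots and the right residue, so it is the Teichmüller lift. -/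
theorem exists_theta (G : GammaRing p σ₀ K Γ) :
    ∃ θ : WittVector p K →+* Γ, ∀ x, θ (WittVector.teichmuller p x) = G.teich x := by
  have := G.charP_K
  have : ExpChar K p := ExpChar.prime hp.out
  have hnu : Fact (¬ IsUnit (p : Γ)) := ⟨G.isMixed.mem⟩
  have : IsAdicComplete (Ideal.span {(p : Γ)}) Γ := (isCompleteAt_iff _).1 G.isCompleteAt_natCast
  have : CharP (ModP Γ p) p := CharP.quotient Γ p hnu.out
  let j : K →+* PreTilt Γ p := Perfection.lift p K (ModP Γ p) G.teichMod
  refine ⟨(WittVector.fontaineTheta Γ p).comp (WittVector.map j), fun x => ?_⟩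
  rw [RingHom.comp_apply, WittVector.map_teichmuller, WittVector.fontaineTheta_teichmuller]
  have ht : IsTeichmuller p (PreTilt.untilt (j x)) := fun n => by
    obtain ⟨y, rfl⟩ := (iterateFrobeniusEquiv K p n).surjective x
    exact ⟨PreTilt.untilt (j y), by simp [iterateFrobenius_def]⟩
  rw [← G.teich_eq ht]
  congr 1
  have h1 : Ideal.Quotient.mk (Ideal.span {(p : Γ)}) (PreTilt.untilt (j x)) =
      Ideal.Quotient.mk _ (G.teich x) := by
    rw [PreTilt.mk_untilt_eq_coeff_zero]
    rfl
  rw [Ideal.Quotient.eq, Ideal.mem_span_singleton] at h1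
  obtain ⟨c, hc⟩ := h1
  have := congrArg G.residue hc
  rwa [map_sub, map_mul, map_natCast, G.cast_p_eq_zero, zero_mul, sub_eq_zero, residue_teich] at this

end GammaRing

open WittVector in
theorem ringHom_witt_ext {p : ℕ} [hp : Fact p.Prime] {k : Type*} [CommRing k] [CharP k p]
    [PerfectRing k p] {A : Type*} [CommRing A] (hA : ∀ x : A, (∀ n, (p : A) ^ n ∣ x) → x = 0)
    {f g : WittVector p k →+* A} (h : ∀ x, f (teichmuller p x) = g (teichmuller p x)) : f = g := by
  ext w
  rw [← sub_eq_zero]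
  refine hA _ fun n => ?_
  have := eq_of_apply_teichmuller_eq ((Ideal.Quotient.mk (Ideal.span {(p : A) ^ n})).comp f)
    ((Ideal.Quotient.mk _).comp g) ⟨n, by
      rw [← map_natCast (Ideal.Quotient.mk (Ideal.span {(p : A) ^ n})), ← map_pow,
        Ideal.Quotient.eq_zero_iff_mem]
      exact Ideal.mem_span_singleton_self _⟩ fun x => by
      rw [RingHom.comp_apply, RingHom.comp_apply, h]
  have := congrArg (fun F => F w) this
  rwa [RingHom.comp_apply, RingHom.comp_apply, Ideal.Quotient.eq, Ideal.mem_span_singleton] at this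

theorem exists_tensor_ringHom {R A B C : Type*} [CommRing R] [CommRing A] [CommRing B] [CommRing C]
    [Algebra R A] [Algebra R B] (f : A →+* C) (g : B →+* C)
    (h : ∀ x, f (algebraMap R A x) = g (algebraMap R B x)) :
    ∃ F : A ⊗[R] B →+* C, ∀ a b, F (a ⊗ₜ b) = f a * g b := by
  let : Algebra R C := (f.comp (algebraMap R A)).toAlgebra
  let f' : A →ₐ[R] C := { f with commutes' := fun x => rfl }
  let g' : B →ₐ[R] C := { g with commutes' := fun x => (h x).symm }
  exact ⟨(Algebra.TensorProduct.lift f' g' fun _ _ => Commute.all _ _).toRingHom, fun a b =>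
    Algebra.TensorProduct.lift_tmul _ _ _ _ _⟩

/-! ### An extension of `Γ` with algebraically closed residue field -/

namespace GammaRing

variable {p : ℕ} {O : Type u} [CommRing O] [IsDomain O] [IsDiscreteValuationRing O]
  {σ₀ : O →+* O} {K : Type u} [Field K] [Algebra (LaurentSeries (ResidueField O)) K]
  {Γ : Type u} [CommRing Γ] [IsDomain Γ] [IsDiscreteValuationRing Γ] [Algebra O Γ]
  [hp : Fact p.Prime] [CharP (ResidueField O) p] [CharZero O] [PerfectField K]

open WittVector in
/-- The basic properties of the map from the Witt vectors of `K` to `Γ`. -/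
theorem exists_theta_finite (G : GammaRing p σ₀ K Γ) [CharP K p] [PerfectRing K p] :
    ∃ θ : WittVector p K →+* Γ, (∀ w, G.residue (θ w) = w.coeff 0) ∧
      (∀ w, G.frob (θ w) = θ (frobenius w)) ∧ Function.Injective θ ∧ θ.Finite := by
  obtain ⟨π, hπ⟩ := IsDiscreteValuationRing.exists_irreducible O
  obtain ⟨e, u, he, hu, hpe⟩ := G.exists_natCast_eq hπ
  have hcΓ := G.isCompleteAt_natCast
  have hcW : IsCompleteAt (p : WittVector p K) := (isCompleteAt_iff _).2 inferInstance
  obtain ⟨θ, hθ⟩ := G.exists_theta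
  have hinj : Function.Injective θ := by
    rw [injective_iff_map_eq_zero]
    intro w hw
    by_contra h0
    obtain ⟨m, b, rfl⟩ := exists_eq_pow_p_mul' w h0
    rw [map_mul, map_pow, map_natCast] at hw
    exact mul_ne_zero (pow_ne_zero m G.isMixed.ne_zero) (b.isUnit.map θ).ne_zero hw
  refine ⟨θ, fun w => ?_, fun w => ?_, hinj, ?_⟩
  · have : G.residue.comp θ = constantCoeff := ringHom_witt_ext (p := p) (fun x hx => by
      obtain ⟨c, hc⟩ := hx 1
      rw [hc, CharP.cast_eq_zero, pow_one, zero_mul]) fun x => by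
        rw [RingHom.comp_apply, hθ, residue_teich]; rfl
    exact congrArg (fun F => F w) this
  · have : G.frob.comp θ = θ.comp frobenius := ringHom_witt_ext hcΓ.haus fun x => by
      rw [RingHom.comp_apply, RingHom.comp_apply, hθ, G.teich_frob (G.isTeichmuller_teich x),
        frobenius_eq_map_frobenius, map_teichmuller, hθ, frobenius_def, teich_map_pow]
    exact congrArg (fun F => F w) this
  · let := θ.toAlgebra
    -- The powers `1, π, …, π ^ (e - 1)` generate `Γ` over the Witt vectors: truncated Teichmüller
    -- expansions show this modulo `p`, and completeness of both rings does the rest.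
    let Φ : (Fin e → WittVector p K) →ₗ[WittVector p K] Γ :=
      Fintype.linearCombination _ fun i => algebraMap O Γ π ^ (i : ℕ)
    have hΦ : ∀ w, Φ w = ∑ i, θ (w i) * algebraMap O Γ π ^ (i : ℕ) := fun w => by
      rw [Fintype.linearCombination_apply]
      exact Finset.sum_congr rfl fun i _ => Algebra.smul_def _ _
    have hstep : ∀ x : Γ, ∃ s : (Fin e → WittVector p K) × Γ, x = Φ s.1 + p * s.2 := fun x => by
      obtain ⟨c, hc, hx⟩ := G.exists_expansion hπ x
      obtain ⟨y, hy⟩ := (G.mem_pow_iff hπ e _).1 (hx e)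
      refine ⟨(fun i => teichmuller p (G.residue (c i)), ↑hu.unit⁻¹ * y), ?_⟩
      have h1 : ∑ i ∈ Finset.range e, algebraMap O Γ π ^ i * c i =
          Φ fun i => teichmuller p (G.residue (c i)) := by
        rw [hΦ, ← Fin.sum_univ_eq_sum_range (fun i => algebraMap O Γ π ^ i * c i)]
        exact Finset.sum_congr rfl fun i _ => by rw [hθ, G.teich_eq (hc i), mul_comm]
      rw [sub_eq_iff_eq_add'] at hy
      rw [hy, h1, hpe]
      congr 1
      rw [mul_assoc, ← mul_assoc u, hu.mul_val_inv, one_mul]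
    choose s hs using hstep
    have hsurj : Function.Surjective Φ := fun x => by
      let rem : ℕ → Γ := fun n => Nat.rec x (fun _ y => (s y).2) n
      have hrem : ∀ n, rem n = Φ (s (rem n)).1 + p * rem (n + 1) := fun n => hs (rem n)
      let w : ℕ → Fin e → WittVector p K := fun n =>
        ∑ j ∈ Finset.range n, (p : WittVector p K) ^ j • (s (rem j)).1
      have hw : ∀ n, x - Φ (w n) = p ^ n * rem n := fun n => by
        induction n with
        | zero => simp [w, rem]
        | succ n ih =>
          have h1 : w (n + 1) = w n + (p : WittVector p K) ^ n • (s (rem n)).1 :=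
            Finset.sum_range_succ _ _
          rw [h1, map_add, ← sub_sub, ih, map_smul, Algebra.smul_def, map_pow, map_natCast]
          nth_rewrite 1 [hrem n]
          ring
      have hlim : ∀ i, ∃ y, ∀ n, (p : WittVector p K) ^ n ∣ y - w n i := fun i =>
        hcW.lim (fun n => w n i) fun n => by
          have h1 : w (n + 1) = w n + (p : WittVector p K) ^ n • (s (rem n)).1 :=
            Finset.sum_range_succ _ _
          rw [h1, Pi.add_apply, add_sub_cancel_left]
          exact dvd_mul_right _ _
      choose y hy using hlim
      refine ⟨y, (sub_eq_zero.1 (hcΓ.haus _ fun n => ?_)).symm⟩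
      rw [← sub_sub_sub_cancel_right x _ (Φ (w n)), hw, ← map_sub, hΦ]
      refine dvd_sub (dvd_mul_right _ _) (Finset.dvd_sum fun i _ => dvd_mul_of_dvd_left ?_ _)
      have := map_dvd θ (hy i n)
      rwa [map_pow, map_natCast] at this
    exact Module.Finite.of_surjective Φ hsurj

open WittVector in
/-- `Γ` embeds into a complete discrete valuation ring with algebraically closed residue field, with
the same uniformizer, and with a Frobenius lift extending that of `Γ`. -/
theorem exists_algClosed_extension (G : GammaRing p σ₀ K Γ) {π : O} (hπ : Irreducible π) :
    ∃ (T : Type u) (_ : CommRing T) (j : Γ →+* T) (L : Type u) (_ : Field L) (_ : IsAlgClosed L)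
      (_ : CharP L p) (r : T →+* L) (τ : T →+* T),
      IsFrobRing p r (j (algebraMap O Γ π)) τ ∧ ∀ x, τ (j x) = j (G.frob x) := by
  have := G.charP_K
  have : ExpChar K p := ExpChar.prime hp.out
  obtain ⟨e, u, he, hu, hpe⟩ := G.exists_natCast_eq hπ
  obtain ⟨θ, hres, hfrob, hinj, hfin⟩ := G.exists_theta_finite
  let : Algebra (WittVector p K) Γ := θ.toAlgebra
  let L := AlgebraicClosure K
  have : CharP L p := charP_of_injective_algebraMap (algebraMap K L).injective p
  have : ExpChar L p := ExpChar.prime hp.out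
  let ι : WittVector p K →+* WittVector p L := WittVector.map (algebraMap K L)
  let : Algebra (WittVector p K) (WittVector p L) := ι.toAlgebra
  have : Module.Finite (WittVector p K) Γ := hfin
  have : Module.IsTorsionFree (WittVector p K) Γ := by
    have : FaithfulSMul (WittVector p K) Γ := (faithfulSMul_iff_algebraMap_injective _ _).2 hinj
    infer_instance
  have : Module.Free (WittVector p K) Γ := inferInstance
  -- `Γ` is finite free over the Witt vectors of `K`, so the base change is complete for `p`, and
  -- the residue map and Frobenius can be defined on the two factors.
  let T := WittVector p L ⊗[WittVector p K] Γ
  let j : Γ →+* T := Algebra.TensorProduct.includeRight.toRingHom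
  have hj : ∀ x, j x = 1 ⊗ₜ x := fun x => rfl
  let i : WittVector p L →+* T := algebraMap _ _
  have hi : ∀ x, i x = x ⊗ₜ 1 := fun x => rfl
  have hij : ∀ w, i (ι w) = j (θ w) := fun w => by
    rw [hi, hj]
    have := TensorProduct.smul_tmul (R := WittVector p K) w (1 : WittVector p L) (1 : Γ)
    rwa [Algebra.smul_def, Algebra.smul_def, mul_one, mul_one] at this
  have hιfrob : ∀ w, frobenius (ι w) = ι (frobenius w) := fun w => by
    ext n
    rw [coeff_frobenius_charP, map_coeff, map_coeff, coeff_frobenius_charP, map_pow]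
  obtain ⟨r, hr⟩ := exists_tensor_ringHom (R := WittVector p K) (constantCoeff (p := p) (R := L))
    ((algebraMap K L).comp G.residue) fun w => (congrArg (algebraMap K L) (hres w)).symm
  obtain ⟨τ, hτ⟩ := exists_tensor_ringHom (R := WittVector p K) (i.comp frobenius) (j.comp G.frob)
    fun w => by
      change i (frobenius (ι w)) = j (G.frob (θ w))
      rw [hιfrob, hij, hfrob]
  have hri : ∀ w, r (i w) = constantCoeff w := fun w => by rw [hi, hr, map_one, mul_one]
  have hrj : ∀ x, r (j x) = algebraMap K L (G.residue x) := fun x => by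
    rw [hj, hr, map_one, one_mul]; rfl
  have hrϖ : r (j (algebraMap O Γ π)) = 0 := by rw [hrj, G.residue_unif hπ, map_zero]
  have hpT : (p : T) = j (algebraMap O Γ π) ^ e * j u := by
    rw [← map_natCast j, hpe, map_mul, map_pow]
  -- Modulo the uniformizer every element comes from a Witt vector over `L`. As `p` generates the
  -- kernel of the reduction of Witt vectors, this identifies the kernel of `r`.
  have hdec : ∀ z : T, ∃ w y, z = i w + j (algebraMap O Γ π) * y := fun z => by
    induction z using TensorProduct.induction_on with
    | zero => exact ⟨0, 0, by simp⟩
    | add z z' hz hz' =>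
      obtain ⟨w, y, rfl⟩ := hz
      obtain ⟨w', y', rfl⟩ := hz'
      exact ⟨w + w', y + y', by rw [map_add]; ring⟩
    | tmul w x =>
      have h1 : algebraMap O Γ π ∣ x - θ (teichmuller p (G.residue x)) := by
        rw [← (G.isFrobRing hπ).eq_zero_iff, map_sub, hres, teichmuller_coeff_zero, sub_self]
      obtain ⟨g, hg⟩ := h1
      rw [sub_eq_iff_eq_add'] at hg
      refine ⟨w * ι (teichmuller p (G.residue x)), i w * j g, ?_⟩
      have h2 : w ⊗ₜ[WittVector p K] x = i w * j x := by
        rw [hi, hj, Algebra.TensorProduct.tmul_mul_tmul, mul_one, one_mul]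
      rw [h2, map_mul, hij]
      nth_rewrite 1 [hg]
      rw [map_add, map_mul]
      ring
  have : Nontrivial T := r.domain_nontrivial
  have hiinj : Function.Injective i := FaithfulSMul.algebraMap_injective (WittVector p L) T
  refine ⟨T, inferInstance, j, L, inferInstance, inferInstance, inferInstance, r, τ,
    ⟨fun x => ?_, fun z => ⟨fun hz => ?_, ?_⟩, fun n hn => ?_, ?_, fun z => ?_⟩, fun x => ?_⟩
  · exact ⟨i (teichmuller p x), by rw [hri]; exact teichmuller_coeff_zero p x⟩
  · obtain ⟨w, y, rfl⟩ := hdec z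
    rw [map_add, map_mul, hrϖ, zero_mul, add_zero, hri] at hz
    obtain ⟨w', rfl⟩ := Ideal.mem_span_singleton.1 ((mem_span_p_iff_coeff_zero_eq_zero w).2 hz)
    rw [map_mul, map_natCast, hpT]
    refine dvd_add ?_ (dvd_mul_right _ _)
    exact dvd_mul_of_dvd_left (dvd_mul_of_dvd_left (dvd_pow_self _ he.ne') _) _
  · rintro ⟨y, rfl⟩
    rw [map_mul, hrϖ, zero_mul]
  · have h1 : (p : WittVector p L) ^ n = 0 := hiinj (by
      rw [map_pow, map_natCast, hpT, mul_pow, ← pow_mul, mul_comm e, pow_mul, hn, zero_pow he.ne',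
        zero_mul, map_zero])
    exact pow_ne_zero n (WittVector.p_nonzero p L) h1
  · have h1 : IsCompleteAt (p : WittVector p L) := (isCompleteAt_iff _).2 inferInstance
    have h2 := h1.map_algebraMap (B := T)
    rw [map_natCast, hpT] at h2
    refine h2.of_dvd_pow he one_pos ?_ ?_
    · exact (hu.map j).mul_right_dvd.2 dvd_rfl
    · rw [pow_one]
      exact dvd_mul_of_dvd_left (dvd_pow_self _ he.ne') _
  · induction z using TensorProduct.induction_on with
    | zero => simp [hp.out.ne_zero]
    | add z z' hz hz' => rw [map_add, map_add, hz, hz', map_add, add_pow_char]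
    | tmul w x =>
      rw [hτ, map_mul, RingHom.comp_apply, RingHom.comp_apply, hri, hrj, hr, G.residue_frob, map_pow,
        mul_pow]
      congr 1
      exact coeff_frobenius_charP p w 0
  · rw [hj, hτ, map_one, one_mul]; rfl

end GammaRing

/-! ### Base change of pure modules -/

section BaseChange

variable {p : ℕ} {R : Type u} [CommRing R] [IsDomain R] [IsDiscreteValuationRing R]
  {σ : R →+* R} {M : Type*} [AddCommGroup M] [Module R M] {F : M →ₛₗ[σ] M}

theorem IsPure.injective (hR : IsMixed p R) {s : ℚ} (h : IsPure p F s) : Function.Injective F := by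
  obtain ⟨_, _, C, hC, h⟩ := h
  rw [injective_iff_map_eq_zero]
  intro x hx
  have h1 := (h 1 x).2
  rw [Function.iterate_one, hx, (nm_eq_zero hR).2 rfl, mul_zero, pow_one] at h1
  rw [← nm_eq_zero (A := R) (p := p) hR]
  refine le_antisymm ?_ (nm_nonneg x)
  by_contra! hc
  exact absurd h1 (mul_pos (rho_pos s) hc).not_ge

/-- All norms are at most `1`, so an orbit cannot grow at a rate `rho s > 1`. -/
theorem IsPure.nonneg [Nontrivial M] (hR : IsMixed p R) {s : ℚ} (h : IsPure p F s) : 0 ≤ s := by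
  obtain ⟨_, _, C, hC, h⟩ := h
  obtain ⟨x, hx⟩ := exists_ne (0 : M)
  have hx' : 0 < nm (A := R) p x :=
    lt_of_le_of_ne (nm_nonneg x) fun h0 => hx ((nm_eq_zero hR).1 h0.symm)
  by_contra! hs
  have h1 : 1 < rho s := by
    have := rho_lt_rho.2 hs
    simpa [rho] using this
  obtain ⟨k, hk⟩ := pow_unbounded_of_one_lt (C / nm (A := R) p x) h1
  rw [div_lt_iff₀ hx'] at hk
  refine absurd ((h k x).2.trans ?_) hk.not_ge
  exact mul_le_of_le_one_right hC.le (nm_le_one hR _)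

/-- The upper bound need only be checked on a basis coming from `M`. For the lower bound, Cramer's
rule for `F^[k]` gives vectors `y j` of `M` with `F^[k] (y j) = det • b j`, whose size is controlled
by purity of `M`. Expressing a multiple of `x` through the `1 ⊗ y j`, with coefficients those of the
image of `x`, bounds `x` by that image; the determinant cancels. -/
theorem IsPure.baseChange [Module.Free R M] [Module.Finite R M] (hR : IsMixed p R) {S : Type u}
    [CommRing S] [IsDomain S] [IsDiscreteValuationRing S] (hS : IsMixed p S) [Algebra R S]
    {τ : S →+* S} (hσ : Function.Bijective σ) (hτ : Function.Bijective τ)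
    (hστ : ∀ a, τ (algebraMap R S a) = algebraMap R S (σ a)) {s : ℚ} (h : IsPure p F s) :
    ∃ FS : S ⊗[R] M →ₛₗ[τ] S ⊗[R] M, (∀ m, FS (1 ⊗ₜ m) = 1 ⊗ₜ F m) ∧ IsPure p FS s := by
  have hinj := h.injective hR
  have hRS : Function.Injective (algebraMap R S) := map_injective_of_isMixed hR hS _
  let b := Module.finBasis R M
  let bS := Algebra.TensorProduct.basis S b
  have hbS : ∀ i, bS i = 1 ⊗ₜ b i := fun i => Algebra.TensorProduct.basis_apply b i
  have hrepr : ∀ m i, bS.repr (1 ⊗ₜ m) i = algebraMap R S (b.repr m i) := fun m i => by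
    rw [Algebra.TensorProduct.basis_repr_tmul]
    simp
  have htmul : ∀ m, (1 : S) ⊗ₜ[R] m = ∑ i, algebraMap R S (b.repr m i) • bS i := fun m => by
    conv_lhs => rw [← bS.sum_repr (1 ⊗ₜ m)]
    exact Finset.sum_congr rfl fun i _ => by rw [hrepr]
  let FS : S ⊗[R] M →ₛₗ[τ] S ⊗[R] M := semiConstr bS τ fun i => 1 ⊗ₜ F (b i)
  have hFS : ∀ m, FS (1 ⊗ₜ m) = 1 ⊗ₜ F m := fun m => by
    rw [semilinear_apply b F m, TensorProduct.tmul_sum, htmul, map_sum]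
    refine Finset.sum_congr rfl fun i _ => ?_
    rw [map_smulₛₗ, semiConstr_basis, hστ, TensorProduct.tmul_smul, algebraMap_smul]
  have hFSk : ∀ k m, FS^[k] (1 ⊗ₜ m) = 1 ⊗ₜ F^[k] m := fun k m =>
    (iterate_comm (f := F) (e := fun m => (1 : S) ⊗ₜ[R] m) (fun m => (hFS m).symm) k m).symm
  have hFSinj : Function.Injective FS := by
    rw [injective_iff_det_ne_zero hτ bS]
    have h1 : (Matrix.of fun i j => bS.repr (FS (bS j)) i) =
        (algebraMap R S).mapMatrix (Matrix.of fun i j => b.repr (F (b j)) i) := by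
      ext i j
      rw [Matrix.of_apply, hbS, hFS, hrepr]
      rfl
    rw [h1, ← RingHom.map_det, Ne, map_eq_zero_iff _ hRS]
    exact (injective_iff_det_ne_zero hσ b).1 hinj
  obtain ⟨_, _, C, hC, hF⟩ := h
  refine ⟨FS, hFS, inferInstance, inferInstance, C, hC, fun k x => ⟨?_, ?_⟩⟩
  · have hx0 := nm_nonneg (A := S) (p := p) x
    rw [← siter_apply, semilinear_apply bS (siter FS k) x]
    have hρ := pow_pos (rho_pos s) k
    refine nm_sum_le _ _ (by positivity) fun i _ => ?_
    rw [nm_smul, av_map hS hS, hbS, siter_apply, hFSk, nm_one_tmul hR hS]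
    have h1 : av p (bS.repr x i) ≤ nm (A := S) p x := by
      rw [nm_eq_bnorm bS hS]; exact av_repr_le_bnorm bS x i
    have h2 : nm (A := R) p (F^[k] (b i)) ≤ C * rho s ^ k :=
      ((hF k (b i)).1).trans (mul_le_of_le_one_right (by positivity) (nm_le_one hR _))
    rw [mul_comm]
    exact mul_le_mul h2 h1 (av_nonneg p _) (by positivity)
  · have hσk := GammaRing.bijective_ringHom_pow hσ k
    have hτk := GammaRing.bijective_ringHom_pow hτ k
    let D : Matrix _ _ R := Matrix.of fun i j => b.repr (siter F k (b j)) i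
    have hD : D.det ≠ 0 := (injective_iff_det_ne_zero hσk b (F := siter F k)).1 (hinj.iterate k)
    choose w hw using fun i j => hσk.2 (D.adjugate i j)
    have hy : ∀ j, siter F k (∑ i, w i j • b i) = D.det • b j := fun j => by
      refine b.ext_elem fun l => ?_
      rw [repr_semilinear b]
      simp only [Module.Basis.repr_sum_self, hw]
      have e : D.mulVec (fun i => D.adjugate i j) l = (D * D.adjugate) l j := rfl
      refine e.trans ?_
      rw [Matrix.mul_adjugate, Matrix.smul_apply, map_smul, Finsupp.smul_apply, b.repr_self,
        Finsupp.single_apply, Matrix.one_apply]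
      simp only [eq_comm]
    set y : _ → M := fun j => ∑ i, w i j • b i
    have hny : ∀ j, rho s ^ k * nm (A := R) p (y j) ≤ C * av p D.det := fun j => by
      refine (hF k (y j)).2.trans (mul_le_mul_of_nonneg_left ?_ hC.le)
      rw [← siter_apply, hy, nm_smul]
      exact mul_le_of_le_one_right (av_nonneg p _) (nm_le_one hR _)
    set z := siter FS k x with hz
    choose z' hz' using fun j => hτk.2 (bS.repr z j)
    obtain ⟨d, hd⟩ := hτk.2 (algebraMap R S D.det)
    have hkey : d • x = ∑ j, z' j • ((1 : S) ⊗ₜ[R] y j) := by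
      apply hFSinj.iterate k
      rw [← siter_apply, ← siter_apply, map_smulₛₗ, ← hz, hd, map_sum]
      conv_lhs => rw [← bS.sum_repr z, Finset.smul_sum]
      refine Finset.sum_congr rfl fun j _ => ?_
      rw [map_smulₛₗ, hz', siter_apply, hFSk, ← siter_apply, hy, smul_comm, hbS,
        TensorProduct.tmul_smul, algebraMap_smul]
    have hρ := pow_pos (rho_pos s) k
    have hDpos := av_pos p hD
    have hav : av p d = av p D.det := by
      rw [← av_map hS hS (τ ^ k) d, hd, av_map hR hS]
    have hz0 := nm_nonneg (A := S) (p := p) z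
    have h1 : av p D.det * nm (A := S) p x ≤ nm (A := S) p z * (C * av p D.det / rho s ^ k) := by
      rw [← hav, ← nm_smul, hkey]
      refine nm_sum_le _ _ (mul_nonneg hz0 (by rw [hav]; positivity)) fun j _ => ?_
      rw [nm_smul, nm_one_tmul hR hS, hav]
      refine mul_le_mul ?_ ?_ (nm_nonneg _) hz0
      · rw [← av_map hS hS (τ ^ k), hz', nm_eq_bnorm bS hS]
        exact av_repr_le_bnorm bS z j
      · rw [le_div_iff₀ hρ, mul_comm]; exact hny j
    have h2 : nm (A := S) p z * (C * av p D.det / rho s ^ k) =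
        av p D.det * (C * nm (A := S) p z / rho s ^ k) := by ring
    rw [h2] at h1
    have h3 := le_of_mul_le_mul_left h1 hDpos
    rwa [le_div_iff₀ hρ, mul_comm] at h3

end BaseChange

namespace IsFrobRing

theorem isMixed {p q : ℕ} {A : Type u} {κ : Type*} [CommRing A] [Field κ] {r : A →+* κ} {ϖ : A}
    {τ : A →+* A} [IsDomain A] [IsDiscreteValuationRing A] [CharP κ p] (h : IsFrobRing q r ϖ τ)
    (hp : (p : A) ≠ 0) : IsMixed p A where
  ne_zero := hp
  mem := by
    rw [h.maximalIdeal_eq, Ideal.mem_span_singleton, ← h.eq_zero_iff, map_natCast,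
      CharP.cast_eq_zero]

end IsFrobRing

theorem rho_eq_av_pow {p : ℕ} {A : Type u} [CommRing A] [IsDomain A] [IsDiscreteValuationRing A]
    (hA : IsMixed p A) {ϖ u : A} (hu : IsUnit u) {m : ℕ} (hm : (p : A) = ϖ ^ m * u) {s : ℚ} {a : ℕ}
    (ha : s * m = a) : rho s = av p ϖ ^ a := by
  have hm0 : m ≠ 0 := by
    rintro rfl
    rw [pow_zero, one_mul] at hm
    exact (IsLocalRing.mem_maximalIdeal _).1 hA.mem (hm ▸ hu)
  have hϖ : ϖ ≠ 0 := by
    rintro rfl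
    rw [zero_pow hm0, zero_mul] at hm
    exact hA.ne_zero hm
  have h1 := congrArg (av p) hm
  rw [av_natCast hA, av_mul, av_pow, av_isUnit p hu, mul_one, av_eq_rho p hϖ, ← rho_nsmul] at h1
  have h2 : rho 1 = 1 / 2 := by norm_num [rho, Real.rpow_neg_one]
  have h3 := rho_injective (h2.trans h1)
  rw [av_eq_rho p hϖ, ← rho_nsmul, ← ha]
  congr 1
  rw [mul_assoc, ← h3, mul_one]

/-! ### From purity to generic slopes -/

namespace GammaRing

variable {p : ℕ} {O : Type u} [CommRing O] [IsDomain O] [IsDiscreteValuationRing O]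
  {σ₀ : O →+* O} {K : Type u} [Field K] [Algebra (LaurentSeries (ResidueField O)) K]
  {Γ : Type u} [CommRing Γ] [IsDomain Γ] [IsDiscreteValuationRing Γ] [Algebra O Γ]
  [hp : Fact p.Prime] [CharP (ResidueField O) p] [CharZero O] [PerfectField K]

theorem conFrob_pow_bijective (G : GammaRing p σ₀ K Γ) {π : O} (hπ : Irreducible π) (f : ℕ) :
    Function.Bijective (G.conFrob hπ ^ f) :=
  bijective_ringHom_pow (G.conFrob_bijective hπ) f

open Polynomial in
-- Extend `Γ` to a ring with algebraically closed residue field, choose a uniformizer fixed by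
-- Frobenius and adjoin its root `ω` of order `s.den`. Then `v_p(ω) = 1 / (s.den * e)`, so `s` is
-- the valuation of a power of `ω`, which is fixed. On a lattice of the extended module `F` is this
-- power times a unit matrix, and Lang's theorem provides eigenvectors.
theorem hasGenericSlopes_of_isPure (G : GammaRing p σ₀ K Γ) {π : O} (hπ : Irreducible π) {f : ℕ}
    (hf : 0 < f) {M : Type*} [AddCommGroup M] [Module (G.con hπ) M] [Nontrivial M]
    [Module.Free (G.con hπ) M] [Module.Finite (G.con hπ) M] {F : M →ₛₗ[G.conFrob hπ ^ f] M} {s : ℚ}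
    (h : IsPure p F s) :
    HasGenericSlopes p (p ^ f) F (fun _ : Fin (Module.finrank (G.con hπ) M) => s) := by
  have hR := G.con_isMixed hπ
  have hs := h.nonneg hR
  obtain ⟨e, u, he, hu, hpe⟩ := G.exists_natCast_eq hπ
  obtain ⟨T, _, j, L, _, _, _, r, τ, hT, hτ⟩ := G.exists_algClosed_extension hπ
  have : ExpChar L p := ExpChar.prime hp.out
  have := hT.isDomain
  have := hT.isDiscreteValuationRing
  have hpT : (p : T) = j (algebraMap O Γ π) ^ e * j u := by
    rw [← map_natCast j, hpe, map_mul, map_pow]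
  have hmT : IsMixed p T := hT.isMixed (by
    rw [hpT]; exact mul_ne_zero (hT.pow_ne_zero e) (hu.map j).ne_zero)
  have hq : 1 < p ^ f := Nat.one_lt_pow hf.ne' hp.out.one_lt
  have hφ : ∀ x : L, iterateFrobenius L p f x = x ^ p ^ f := fun x => iterateFrobenius_def _ _ _
  obtain ⟨ϖ, hϖ, hϖT⟩ := (hT.pow f).exists_fixed_unif hmT hq hφ
  have hass : Associated (j (algebraMap O Γ π)) ϖ := by
    refine associated_of_dvd_dvd ?_ ?_
    · rw [← hT.eq_zero_iff, hϖT.eq_zero_iff]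
    · rw [← hϖT.eq_zero_iff, hT.eq_zero_iff]
  obtain ⟨v, hv⟩ := hass.symm
  obtain ⟨r', τ', hS, hroot, hrootb, hτ'⟩ := hϖT.adjoinRoot hϖ s.den_pos
  set S := AdjoinRoot (X ^ s.den - C ϖ)
  set ω := AdjoinRoot.root (X ^ s.den - C ϖ)
  have := hS.isDomain
  have := hS.isDiscreteValuationRing
  have hpS : (p : S) = ω ^ (s.den * e) * AdjoinRoot.of _ ((v : T) ^ e * j u) := by
    rw [pow_mul, hrootb, ← map_pow, ← map_mul, ← mul_assoc, ← mul_pow, hv, ← hpT, map_natCast]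
  have hunit : IsUnit (AdjoinRoot.of (X ^ s.den - C ϖ) ((v : T) ^ e * j u)) :=
    ((v.isUnit.pow e).mul (hu.map j)).map _
  have hmS : IsMixed p S := hS.isMixed (by
    rw [hpS]; exact mul_ne_zero (hS.pow_ne_zero _) hunit.ne_zero)
  have hτ'b : Function.Bijective τ' := hS.bijective hmS fun x =>
    IsAlgClosed.exists_pow_nat_eq x (by positivity)
  let : Algebra (G.con hπ) S :=
    ((AdjoinRoot.of (X ^ s.den - C ϖ)).comp (j.comp (G.con hπ).subtype)).toAlgebra
  have halg : ∀ a, algebraMap (G.con hπ) S a = AdjoinRoot.of (X ^ s.den - C ϖ) (j a) := fun a => rfl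
  have hjf : ∀ (n : ℕ) (x : Γ), (τ ^ n) (j x) = j ((G.frob ^ n) x) := fun n x => by
    induction n with
    | zero => simp
    | succ n ih => rw [pow_succ', pow_succ', RingHom.mul_def, RingHom.mul_def, RingHom.comp_apply,
        RingHom.comp_apply, ih, hτ]
  have hcomp : ∀ a, τ' (algebraMap (G.con hπ) S a) =
      algebraMap (G.con hπ) S ((G.conFrob hπ ^ f) a) := fun a => by
    rw [halg, halg, hτ', hjf, coe_conFrob_pow]
  obtain ⟨FS, hFS, hpure⟩ := h.baseChange hR hmS (G.conFrob_pow_bijective hπ f) hτ'b hcomp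
  have hω0 : ω ≠ 0 := by simpa using hS.pow_ne_zero 1
  have hrho : rho s = av p ω ^ (s.num.toNat * e) := by
    refine rho_eq_av_pow hmS hunit hpS ?_
    have h1 : ((s.num.toNat : ℤ) : ℚ) = s.num := by rw [Int.toNat_of_nonneg (Rat.num_nonneg.2 hs)]
    have h2 := Rat.mul_den_eq_num s
    push_cast at h1 ⊢
    rw [← mul_assoc, h2, h1]
  obtain ⟨e₀, C₀, he₀, hC₀, hFe⟩ := exists_unit_lattice hmS hτ'b hω0 hroot hpure hrho
  obtain ⟨P, hP, hCP⟩ := hS.exists_isUnit_det_fixed hmS hq hφ C₀ hC₀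
  obtain ⟨e₁, he₁, hFe₁⟩ := exists_eigenvectors_of_fixed he₀ hFe hP.ne_zero hCP
  have hrk : Module.finrank S (S ⊗[G.con hπ] M) = Module.finrank (G.con hπ) M :=
    Module.finrank_baseChange
  refine ⟨rfl, S, inferInstance, inferInstance, inferInstance, inferInstance, τ', FS,
    hS.isAdicComplete, hmS.mem, map_injective_of_isMixed hR hmS _, hS.isFrobLift, hcomp, hFS,
    fun i => e₁ (Fin.cast hrk.symm i), fun _ => ω ^ (s.num.toNat * e),
    he₁.comp _ (Fin.cast_injective _), fun i => ⟨hFe₁ _, pow_ne_zero _ hω0, ?_⟩⟩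
  refine rho_injective ?_
  rw [← av_eq_rho p (pow_ne_zero _ hω0), av_pow, hrho]

end GammaRing

/-! ### Saturation -/

section Saturation

variable {R : Type*} [CommRing R] [IsDomain R] {M : Type*} [AddCommGroup M] [Module R M]

/-- The saturation of a submodule. -/
def satur (W : Submodule R M) : Submodule R M where
  carrier := {x | ∃ c : R, c ≠ 0 ∧ c • x ∈ W}
  zero_mem' := ⟨1, one_ne_zero, by simp⟩
  add_mem' := by
    rintro x y ⟨c, hc, hx⟩ ⟨d, hd, hy⟩
    refine ⟨c * d, mul_ne_zero hc hd, ?_⟩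
    rw [smul_add]
    refine W.add_mem ?_ ?_
    · rw [mul_comm, mul_smul]; exact W.smul_mem _ hx
    · rw [mul_smul]; exact W.smul_mem _ hy
  smul_mem' := by
    rintro a x ⟨c, hc, hx⟩
    exact ⟨c, hc, by rw [smul_comm]; exact W.smul_mem _ hx⟩

theorem le_satur (W : Submodule R M) : W ≤ satur W := fun x hx => ⟨1, one_ne_zero, by rwa [one_smul]⟩

theorem satur_saturated {W : Submodule R M} {a : R} {x : M} (ha : a ≠ 0) (h : a • x ∈ satur W) :
    x ∈ satur W := by
  obtain ⟨c, hc, h⟩ := h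
  exact ⟨c * a, mul_ne_zero hc ha, by rwa [mul_smul]⟩

theorem satur_stable {σ : R →+* R} (hσ : Function.Injective σ) {F : M →ₛₗ[σ] M} {W : Submodule R M}
    (hW : ∀ x ∈ W, F x ∈ W) : ∀ x ∈ satur W, F x ∈ satur W := by
  rintro x ⟨c, hc, h⟩
  exact ⟨σ c, (map_ne_zero_iff σ hσ).2 hc, by rw [← map_smulₛₗ]; exact hW _ h⟩

theorem exists_smul_mem_of_fg {W N : Submodule R M} (hN : N.FG) (h : N ≤ satur W) :
    ∃ c : R, c ≠ 0 ∧ ∀ x ∈ N, c • x ∈ W := by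
  classical
  obtain ⟨S, rfl⟩ := hN
  choose! c hc hcW using fun x (hx : x ∈ S) => h (Submodule.subset_span hx)
  refine ⟨∏ x ∈ S, c x, Finset.prod_ne_zero_iff.2 hc, fun x hx => ?_⟩
  induction hx using Submodule.span_induction with
  | mem x hx =>
    rw [← Finset.prod_erase_mul S c hx, mul_smul]
    exact W.smul_mem _ (hcW x hx)
  | zero => simp
  | add x y _ _ hx hy => rw [smul_add]; exact W.add_mem hx hy
  | smul a x _ hx => rw [smul_comm]; exact W.smul_mem _ hx

theorem finrank_satur_le [IsNoetherianRing R] [Module.Finite R M] [Module.IsTorsionFree R M]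
    (W : Submodule R M) : Module.finrank R (satur W) ≤ Module.finrank R W := by
  obtain ⟨c, hc, h⟩ := exists_smul_mem_of_fg (IsNoetherian.noetherian (satur W)) (le_refl _)
  let g : satur W →ₗ[R] W := (c • (satur W).subtype).codRestrict W fun x => h x x.2
  refine LinearMap.finrank_le_finrank_of_injective (f := g) fun x y hxy => Subtype.ext ?_
  have h1 : c • (x : M) = c • (y : M) := congrArg Subtype.val hxy
  exact smul_right_injective M hc h1

end Saturation

/-! ### Cyclic decomposition of pure modules -/

section Cyclic

variable {p : ℕ} {R : Type u} [CommRing R] [IsDomain R] [IsDiscreteValuationRing R]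
  (hR : IsMixed p R) {σ : R →+* R} {M : Type*} [AddCommGroup M] [Module R M] {F : M →ₛₗ[σ] M}

theorem IsPure.iterate {s : ℚ} (h : IsPure p F s) (b : ℕ) : IsPure p (siter F b) (b * s) := by
  obtain ⟨h1, h2, C, hC, h⟩ := h
  refine ⟨h1, h2, C, hC, fun k x => ?_⟩
  have h3 : (siter F b)^[k] x = F^[b * k] x := by rw [Function.iterate_mul]; rfl
  rw [h3, rho_nsmul, ← pow_mul]
  exact h (b * k) x

include hR in
theorem IsPure.restrict [Module.Free R M] [Module.Finite R M] {s : ℚ} (h : IsPure p F s)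
    {N : Submodule R M} (hN : IsSaturated N) (hF : ∀ x ∈ N, F x ∈ N) :
    IsPure p (F.restrict hF) s := by
  obtain ⟨_, _, C, hC, h⟩ := h
  refine ⟨inferInstance, inferInstance, C, hC, fun k x => ?_⟩
  rw [← nm_coe hR hN, ← nm_coe hR hN,
    iterate_comm (f := F.restrict hF) (e := fun y : N => (y : M)) (fun _ => rfl)]
  exact h k x

include hR in
-- Compare determinants. On a lattice `F^[b]` is `ϖ ^ a` times a unit matrix, so `|det F| ^ b = |ϖ|
-- ^ (a * rank)`. As `det F` is a unit times a power of `ϖ` and `a` is prime to `b`, the rank is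
-- divisible by `b`.
theorem IsPure.dvd_finrank (hσ : Function.Bijective σ) {s : ℚ} (h : IsPure p F s) {ϖ : R}
    (hϖ : Irreducible ϖ) (hϖσ : σ ϖ = ϖ) {a b : ℕ} (hab : b.Coprime a)
    (hs : rho (b * s) = av p ϖ ^ a) : b ∣ Module.finrank R M := by
  have hpure := h.iterate b
  have hinj := h.injective hR
  obtain ⟨_, _, -⟩ := h
  have hσb := GammaRing.bijective_ringHom_pow hσ b
  have hϖb : (σ ^ b) ϖ = ϖ := by
    rw [RingHom.coe_pow]; exact Function.iterate_fixed hϖσ b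
  obtain ⟨e, C, he, hC, hF⟩ := exists_unit_lattice hR hσb hϖ.ne_zero hϖb hpure hs
  let β := Module.finBasis R M
  let A : Matrix (Fin _) (Fin _) R := Matrix.of fun i j => β.repr (F (β j)) i
  let D : Matrix (Fin _) (Fin _) R := Matrix.of fun i j => β.repr (siter F b (β j)) i
  have hA : A.det ≠ 0 := (injective_iff_det_ne_zero hσ β).1 hinj
  have hD : av p D.det = av p A.det ^ b := av_det_iterate hR F β b
  let P : Matrix (Fin _) (Fin _) R := Matrix.of fun i j => β.repr (e j) i
  have hP : P.det ≠ 0 := by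
    intro h0
    obtain ⟨v, hv, hv0⟩ := Matrix.exists_mulVec_eq_zero_iff.2 h0
    refine hv (funext (Fintype.linearIndependent_iff.1 he v ?_))
    refine β.ext_elem fun i => ?_
    rw [map_sum, Finsupp.finsetSum_apply, map_zero, Finsupp.zero_apply]
    refine Eq.trans ?_ (congrFun hv0 i)
    exact Finset.sum_congr rfl fun j _ => by
      rw [map_smul, Finsupp.smul_apply, smul_eq_mul, mul_comm]; rfl
  have hDP : D * P.map (σ ^ b) = ϖ ^ a • (P * C) := by
    ext i j
    have h1 := repr_semilinear (F := siter F b) β (e j) i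
    rw [hF, map_smul, Finsupp.smul_apply, map_sum, Finsupp.finsetSum_apply] at h1
    rw [Matrix.smul_apply, Matrix.mul_apply, Matrix.mul_apply]
    refine h1.symm.trans (congrArg (ϖ ^ a • ·) (Finset.sum_congr rfl fun l _ => ?_))
    rw [map_smul, Finsupp.smul_apply, smul_eq_mul, mul_comm]
    rfl
  have hdet := congrArg (fun X => av p (Matrix.det X)) hDP
  simp only [Matrix.det_mul, Matrix.det_smul, av_mul, av_pow, av_isUnit p hC, mul_one, hD,
    Fintype.card_fin] at hdet
  rw [← RingHom.mapMatrix_apply, ← RingHom.map_det, av_map hR hR] at hdet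
  have hdet' := mul_right_cancel₀ (av_pos p hP).ne' hdet
  obtain ⟨m, u, hm⟩ := IsDiscreteValuationRing.eq_unit_mul_pow_irreducible hA hϖ
  rw [hm, av_mul, av_isUnit p u.isUnit, one_mul, av_pow, ← pow_mul, ← pow_mul] at hdet'
  have h1 : m * b = a * Module.finrank R M :=
    pow_right_injective₀ (av_pos p hϖ.ne_zero) (av_irreducible_lt_one hR hϖ).ne hdet'
  exact hab.dvd_of_dvd_mul_left (h1 ▸ dvd_mul_left b m)

include hR in
/-- A pure module that has enough eigenvectors for the `b`-th power of `F` is up to isogeny a direct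
sum of cyclic modules of rank `b`. -/
theorem IsPure.exists_cyclic_family [Module.Free R M] [Module.Finite R M]
    (hσ : Function.Bijective σ) {s : ℚ} (h : IsPure p F s) {ϖ : R}
    (hϖ : Irreducible ϖ) (hϖσ : σ ϖ = ϖ) {a b : ℕ} (hb : 0 < b) (hab : b.Coprime a)
    (hs : rho (b * s) = av p ϖ ^ a) {v : Fin (Module.finrank R M) → M} (hv : LinearIndependent R v)
    (hFv : ∀ j, F^[b] (v j) = ϖ ^ a • v j) :
    ∃ (l : ℕ) (u : Fin l → M), (∀ k, F^[b] (u k) = ϖ ^ a • u k) ∧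
      LinearIndependent R (fun x : Fin l × Fin b => F^[x.2] (u x.1)) ∧
      satur (Submodule.span R (Set.range fun x : Fin l × Fin b => F^[x.2] (u x.1))) = ⊤ := by
  classical
  -- Take as many eigenvectors of `F^[b]` as possible whose first `b` iterates are jointly
  -- independent. Suppose that another eigenvector is outside the saturation of their span. The
  -- stable submodule generated by all of them has a pure saturation, of rank divisible by `b`,
  -- greater than `l * b` and at most `(l + 1) * b`. The rank is then `(l + 1) * b`, so the enlarged
  -- family is independent, against maximality.
  let P : ℕ → Prop := fun l => ∃ u : Fin l → M, (∀ k, F^[b] (u k) = ϖ ^ a • u k) ∧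
    LinearIndependent R (fun x : Fin l × Fin b => F^[x.2] (u x.1))
  have hbound : ∀ l, P l → l ≤ Module.finrank R M := by
    rintro l ⟨u, -, hu⟩
    have h1 := hu.fintype_card_le_finrank
    rw [Fintype.card_prod, Fintype.card_fin, Fintype.card_fin] at h1
    exact (Nat.le_mul_of_pos_right l hb).trans h1
  have hP0 : P 0 := ⟨Fin.elim0, fun k => k.elim0, linearIndependent_empty_type⟩
  obtain ⟨u, hu, hli⟩ := Nat.findGreatest_spec (Nat.zero_le (Module.finrank R M)) hP0
  have hmax : ¬ P (Nat.findGreatest P (Module.finrank R M) + 1) := fun hP =>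
    Nat.findGreatest_is_greatest (Nat.lt_succ_self _) (hbound _ hP) hP
  generalize Nat.findGreatest P (Module.finrank R M) = l at u hu hli hmax
  refine ⟨l, u, hu, hli, ?_⟩
  have hkey : ∀ w : M, F^[b] w = ϖ ^ a • w →
      w ∈ satur (Submodule.span R (Set.range fun x : Fin l × Fin b => F^[x.2] (u x.1))) := by
    intro w hw
    by_contra hnot
    let u' : Fin (l + 1) → M := Fin.snoc u w
    let g : Fin (l + 1) × Fin b → M := fun x => F^[x.2] (u' x.1)
    have hu' : ∀ k, F^[b] (u' k) = ϖ ^ a • u' k := fun k => by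
      refine Fin.lastCases ?_ (fun k => ?_) k
      · simpa only [u', Fin.snoc_last] using hw
      · simpa only [u', Fin.snoc_castSucc] using hu k
    have hstab : ∀ x ∈ Submodule.span R (Set.range g), F x ∈ Submodule.span R (Set.range g) := by
      intro x hx
      induction hx using Submodule.span_induction with
      | mem x hx =>
        obtain ⟨⟨k, i⟩, rfl⟩ := hx
        change F (F^[i] (u' k)) ∈ _
        rw [← Function.iterate_succ_apply' F]
        rcases Nat.lt_or_ge (i + 1) b with hi | hi
        · exact Submodule.subset_span ⟨(k, ⟨i + 1, hi⟩), rfl⟩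
        · have hib : (i : ℕ) + 1 = b := le_antisymm i.2 hi
          rw [Nat.succ_eq_add_one, hib, hu']
          exact Submodule.smul_mem _ _ (Submodule.subset_span ⟨(k, ⟨0, hb⟩), rfl⟩)
      | zero => rw [map_zero]; exact zero_mem _
      | add x y _ _ hx hy => rw [map_add]; exact add_mem hx hy
      | smul c x _ hx => rw [map_smulₛₗ]; exact Submodule.smul_mem _ _ hx
    have hpure := h.restrict hR (N := satur (Submodule.span R (Set.range g)))
      (fun c x hc hx => satur_saturated hc hx) (satur_stable hσ.1 hstab)
    obtain ⟨m, hm⟩ := hpure.dvd_finrank hR hσ hϖ hϖσ hab hs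
    have hle := finrank_satur_le (Submodule.span R (Set.range g))
    have hcard : Module.finrank R (Submodule.span R (Set.range g)) ≤ (l + 1) * b := by
      refine (finrank_range_le_card g).trans ?_
      rw [Fintype.card_prod, Fintype.card_fin, Fintype.card_fin]
    have hli' : LinearIndependent R (fun o : Option (Fin l × Fin b) =>
        o.elim w fun x => F^[x.2] (u x.1)) := by
      rw [Fintype.linearIndependent_iff] at hli ⊢
      intro c hc
      rw [Fintype.sum_option] at hc
      simp only [Option.elim_none, Option.elim_some] at hc
      have hc0 : c none = 0 := by
        by_contra hne
        refine hnot ⟨c none, hne, ?_⟩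
        rw [eq_neg_of_add_eq_zero_left hc]
        exact neg_mem (sum_mem fun x _ => Submodule.smul_mem _ _ (Submodule.subset_span ⟨x, rfl⟩))
      rw [hc0, zero_smul, zero_add] at hc
      rintro (_ | x)
      · exact hc0
      · exact hli (fun x => c (some x)) hc x
    have hmem : ∀ o : Option (Fin l × Fin b), (o.elim w fun x => F^[x.2] (u x.1)) ∈
        satur (Submodule.span R (Set.range g)) := by
      rintro (_ | x)
      · refine le_satur _ (Submodule.subset_span ⟨(Fin.last l, ⟨0, hb⟩), ?_⟩)
        simp [g, u']
      · refine le_satur _ (Submodule.subset_span ⟨(x.1.castSucc, x.2), ?_⟩)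
        simp [g, u']
    have hge : l * b + 1 ≤ Module.finrank R (satur (Submodule.span R (Set.range g))) := by
      have h1 : LinearIndependent R fun o : Option (Fin l × Fin b) =>
          (⟨_, hmem o⟩ : satur (Submodule.span R (Set.range g))) :=
        LinearIndependent.of_comp (satur (Submodule.span R (Set.range g))).subtype hli'
      have h2 := h1.fintype_card_le_finrank
      rwa [Fintype.card_option, Fintype.card_prod, Fintype.card_fin, Fintype.card_fin] at h2
    refine hmax ⟨u', hu', (linearIndependent_iff_card_eq_finrank_span (b := g)).2 ?_⟩
    rw [Fintype.card_prod, Fintype.card_fin, Fintype.card_fin, Set.finrank]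
    refine le_antisymm (le_trans ?_ hle) hcard
    rw [hm] at hge ⊢
    have h1 : l < m := by
      by_contra! hml
      have := Nat.mul_le_mul_left b hml
      rw [mul_comm l b] at hge
      lia
    rw [mul_comm]
    exact Nat.mul_le_mul_left b h1
  rw [eq_top_iff]
  have hspan : Submodule.span R (Set.range v) ≤
      satur (Submodule.span R (Set.range fun x : Fin l × Fin b => F^[x.2] (u x.1))) := by
    rw [Submodule.span_le]
    rintro _ ⟨j, rfl⟩
    exact hkey _ (hFv j)
  intro x _
  by_contra hx
  have hli' : LinearIndependent R (fun o : Option (Fin (Module.finrank R M)) => o.elim x v) := by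
    rw [Fintype.linearIndependent_iff] at hv ⊢
    intro c hc
    rw [Fintype.sum_option] at hc
    simp only [Option.elim_none, Option.elim_some] at hc
    have hc0 : c none = 0 := by
      by_contra hne
      refine hx (satur_saturated hne (hspan ?_))
      rw [eq_neg_of_add_eq_zero_left hc]
      exact neg_mem (sum_mem fun x _ => Submodule.smul_mem _ _ (Submodule.subset_span ⟨x, rfl⟩))
    rw [hc0, zero_smul, zero_add] at hc
    rintro (_ | x)
    · exact hc0
    · exact hv (fun x => c (some x)) hc x
  have h2 := hli'.fintype_card_le_finrank
  rw [Fintype.card_option, Fintype.card_fin] at h2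
  lia

end Cyclic

/-! ### Isogenies and standard modules -/

section Isogeny

variable {p : ℕ} {R : Type u} [CommRing R] {σ : R →+* R} {M : Type w} [AddCommGroup M] [Module R M]
  {F : M →ₛₗ[σ] M} {N : Type*} [AddCommGroup N] [Module R N] {F' : N →ₛₗ[σ] N}

theorem bijective_natCast_pow_smul (p c : ℕ) (A : Type*) [AddCommGroup A] [Module R A] :
    Function.Bijective fun x : LocalizedModule (Submonoid.powers (p : R)) A => (p : R) ^ c • x :=
  (Module.End.isUnit_iff _).1 (IsLocalizedModule.map_units
    (LocalizedModule.mkLinearMap (Submonoid.powers (p : R)) A)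
    (⟨(p : R) ^ c, c, rfl⟩ : Submonoid.powers (p : R)))

theorem bijective_localized_of_comp {g : M →ₗ[R] N} {h : N →ₗ[R] M} {c : ℕ}
    (hg : h ∘ₗ g = (p : R) ^ c • LinearMap.id) (hh : g ∘ₗ h = (p : R) ^ c • LinearMap.id) :
    Function.Bijective (IsLocalizedModule.map (Submonoid.powers (p : R))
      (LocalizedModule.mkLinearMap (Submonoid.powers (p : R)) M)
      (LocalizedModule.mkLinearMap (Submonoid.powers (p : R)) N) g) := by
  set S := Submonoid.powers (p : R)
  have h1 := congrArg (IsLocalizedModule.map S (LocalizedModule.mkLinearMap S M)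
    (LocalizedModule.mkLinearMap S M)) hg
  have h2 := congrArg (IsLocalizedModule.map S (LocalizedModule.mkLinearMap S N)
    (LocalizedModule.mkLinearMap S N)) hh
  rw [IsLocalizedModule.map_comp' S _ (LocalizedModule.mkLinearMap S N), map_smul,
    IsLocalizedModule.map_id] at h1
  rw [IsLocalizedModule.map_comp' S _ (LocalizedModule.mkLinearMap S M), map_smul,
    IsLocalizedModule.map_id] at h2
  constructor
  · refine Function.Injective.of_comp (f := IsLocalizedModule.map S (LocalizedModule.mkLinearMap S N)
      (LocalizedModule.mkLinearMap S M) h) ?_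
    rw [← LinearMap.coe_comp, h1]
    exact (bijective_natCast_pow_smul p c M).1
  · refine Function.Surjective.of_comp (g := IsLocalizedModule.map S (LocalizedModule.mkLinearMap S N)
      (LocalizedModule.mkLinearMap S M) h) ?_
    rw [← LinearMap.coe_comp, h2]
    exact (bijective_natCast_pow_smul p c N).2

theorem Isogenous.refl (F : M →ₛₗ[σ] M) : Isogenous p F F :=
  ⟨LinearMap.id, fun _ => rfl, bijective_localized_of_comp (h := LinearMap.id) (c := 0)
    (by simp) (by simp)⟩

/-- The given map goes from `N` to `M`, while the isogeny sought goes from `M` to `N`. A power of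
`p` carries `M` into the image, so `p ^ c` times the inverse of `h` is integral; it commutes with
Frobenius because `p` is fixed. -/
theorem Isogenous.of_injective [IsDomain R] [IsDiscreteValuationRing R] (hR : IsMixed p R)
    [Module.Finite R M] (h : N →ₗ[R] M)
    (hinj : Function.Injective h) (hF : ∀ y, h (F' y) = F (h y))
    (hsat : satur (LinearMap.range h) = ⊤) : Isogenous p F F' := by
  obtain ⟨d, hd, hd'⟩ := exists_smul_mem_of_fg (W := LinearMap.range h) (N := ⊤)
    Module.Finite.fg_top hsat.ge
  obtain ⟨c, e, hc⟩ := exists_dvd_natCast_pow hR hd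
  have hmem : ∀ x, ((p : R) ^ c • (LinearMap.id : M →ₗ[R] M)) x ∈ LinearMap.range h := fun x => by
    rw [hc, mul_comm, LinearMap.smul_apply, mul_smul]
    exact Submodule.smul_mem _ _ (hd' x trivial)
  let g : M →ₗ[R] N := (LinearEquiv.ofInjective h hinj).symm.toLinearMap ∘ₗ
    ((p : R) ^ c • LinearMap.id).codRestrict (LinearMap.range h) hmem
  have hg : ∀ x, h (g x) = (p : R) ^ c • x := fun x => by
    have h1 := (LinearEquiv.ofInjective h hinj).apply_symm_apply
      (((p : R) ^ c • LinearMap.id).codRestrict (LinearMap.range h) hmem x)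
    exact congrArg Subtype.val h1
  refine ⟨g, fun m => hinj ?_, bijective_localized_of_comp (h := h) (c := c) (LinearMap.ext hg)
    (LinearMap.ext fun y => hinj ?_)⟩
  · rw [hg, hF, hg, map_smulₛₗ, map_pow, map_natCast]
  · change h (g (h y)) = h ((p : R) ^ c • y)
    rw [hg, map_smul]

/-- The `σ`-linear map with `F v_i = v_{i+1}` for `i < n` and `F v_n = a • v_0`. -/
def standardFrob (σ : R →+* R) (n : ℕ) (a : R) : (Fin (n + 1) → R) →ₛₗ[σ] (Fin (n + 1) → R) :=
  semiConstr (Pi.basisFun R (Fin (n + 1))) σ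
    (Fin.snoc (α := fun _ => Fin (n + 1) → R) (fun i : Fin n => Pi.basisFun R _ i.succ)
      (a • Pi.basisFun R _ 0))

theorem standardFrob_castSucc (n : ℕ) (a : R) (i : Fin n) :
    standardFrob σ n a (Pi.basisFun R _ i.castSucc) = Pi.basisFun R _ i.succ := by
  rw [standardFrob, semiConstr_basis, Fin.snoc_castSucc (α := fun _ => Fin (n + 1) → R)]

theorem standardFrob_last (n : ℕ) (a : R) :
    standardFrob σ n a (Pi.basisFun R _ (Fin.last n)) = a • Pi.basisFun R _ 0 := by
  rw [standardFrob, semiConstr_basis, Fin.snoc_last (α := fun _ => Fin (n + 1) → R)]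

/-- Each `u k` is the image of the first basis vector of a standard module. The sum of these maps is
injective by independence, and every vector has a nonzero multiple in its image by `hsat`. -/
theorem isogenousToSumOfStandard_of_cyclic_family [IsDomain R] [IsDiscreteValuationRing R]
    (hR : IsMixed p R) [Module.Finite R M] (hσ : Function.Bijective σ) (hF : Function.Injective F)
    {n l : ℕ} {a : R} (ha : σ a = a) {u : Fin l → M} (hu : ∀ k, F^[n + 1] (u k) = a • u k)
    (hli : LinearIndependent R (fun x : Fin l × Fin (n + 1) => F^[x.2] (u x.1)))
    (hsat : satur (Submodule.span R (Set.range fun x : Fin l × Fin (n + 1) => F^[x.2] (u x.1))) = ⊤) :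
    IsogenousToSumOfStandard p F := by
  let hj : Fin l → (Fin (n + 1) → R) →ₗ[R] M := fun j =>
    Fintype.linearCombination R fun i : Fin (n + 1) => F^[i] (u j)
  have hjb : ∀ j i, hj j (Pi.basisFun R _ i) = F^[i] (u j) := fun j i => by
    rw [Pi.basisFun_apply, Fintype.linearCombination_apply_single, one_smul]
  have hjF : ∀ j y, hj j (standardFrob σ n a y) = F (hj j y) := fun j y => by
    refine semilinear_ext (Pi.basisFun R (Fin (n + 1))) (F := (hj j).comp (standardFrob σ n a))
      (F' := F.comp (hj j)) (fun i => ?_) y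
    rw [LinearMap.comp_apply, LinearMap.comp_apply, hjb]
    refine Fin.lastCases ?_ (fun i => ?_) i
    · rw [standardFrob_last, map_smul, hjb, Fin.val_zero, Function.iterate_zero, id, ← hu,
        Function.iterate_succ_apply']
      rfl
    · rw [standardFrob_castSucc, hjb, Fin.val_succ, Function.iterate_succ_apply', Fin.val_castSucc]
  let h : (Fin l → Fin (n + 1) → R) →ₗ[R] M :=
    (Fintype.linearCombination R fun x : Fin l × Fin (n + 1) => F^[x.2] (u x.1)) ∘ₗ
      (LinearEquiv.curry R R (Fin l) (Fin (n + 1))).symm.toLinearMap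
  have hh : ∀ x, h x = ∑ j, hj j (x j) := fun x => by
    change Fintype.linearCombination R _ _ = _
    rw [Fintype.linearCombination_apply, Fintype.sum_prod_type]
    rfl
  have hinj : Function.Injective h :=
    (linearIndependent_iff_injective_fintypeLinearCombination.1 hli).comp (LinearEquiv.injective _)
  have hjinj : ∀ j, Function.Injective (hj j) := fun j => by
    refine linearIndependent_iff_injective_fintypeLinearCombination.1 ?_
    exact hli.comp (fun i => (j, i)) (Prod.mk_right_injective j)
  have hsigma : ∀ _ : Fin l, IsSigmaModule p (standardFrob σ n a) := fun j =>
    (isSigmaModule_iff hR hσ).2 ⟨inferInstance, inferInstance, fun x y hxy => hjinj j (hF (by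
      rw [← hjF, ← hjF, hxy]))⟩
  refine ⟨l, fun _ => Fin (n + 1) → R, fun _ => inferInstance, fun _ => inferInstance,
    fun _ => standardFrob σ n a, fun j => ⟨hsigma j, ?_⟩, ?_⟩
  · exact ⟨Fin (n + 1) → R, inferInstance, inferInstance, standardFrob σ n a, n, Pi.basisFun R _, a,
      hsigma j, ha, standardFrob_castSucc n a, standardFrob_last n a, Isogenous.refl _⟩
  · refine Isogenous.of_injective hR h hinj (fun y => ?_) ?_
    · rw [hh, hh, map_sum]
      exact Finset.sum_congr rfl fun j _ => hjF j (y j)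
    · rw [← hsat]
      congr 1
      change LinearMap.range (_ ∘ₗ _) = _
      rw [LinearMap.range_comp, LinearEquiv.range, Submodule.map_top, Fintype.range_linearCombination]

end Isogeny

/-! ### Standard modules when `K` is algebraically closed -/

namespace GammaRing

variable {p : ℕ} {O : Type u} [CommRing O] [IsDomain O] [IsDiscreteValuationRing O]
  {σ₀ : O →+* O} {K : Type u} [Field K] [Algebra (LaurentSeries (ResidueField O)) K]
  {Γ : Type u} [CommRing Γ] [IsDomain Γ] [IsDiscreteValuationRing Γ] [Algebra O Γ]
  [hp : Fact p.Prime] [CharP (ResidueField O) p] [CharZero O] [PerfectField K]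

/-- Lang's theorem over `Γ_con`. -/
theorem exists_det_ne_zero_fixed [IsAlgClosed K] (G : GammaRing p σ₀ K Γ) {π : O}
    (hπ : Irreducible π) {m : ℕ} (hm : 0 < m) {n : ℕ} (C : Matrix (Fin n) (Fin n) (G.con hπ))
    (hC : IsUnit C.det) : ∃ P : Matrix (Fin n) (Fin n) (G.con hπ),
      P.det ≠ 0 ∧ C * P.map (G.conFrob hπ ^ m) = P := by
  have := G.charP_K
  have : ExpChar K p := ExpChar.prime hp.out
  obtain ⟨P, hP, hCP⟩ := ((G.isFrobRing hπ).pow m).exists_isUnit_det_fixed G.isMixed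
    (Nat.one_lt_pow hm.ne' hp.out.one_lt) (φ := iterateFrobenius K p m)
    (fun x => iterateFrobenius_def _ _ _) ((G.con hπ).subtype.mapMatrix C)
    (by rw [← RingHom.map_det]; exact hC.map _)
  have hinv : (G.con hπ).subtype.mapMatrix C⁻¹ * (G.con hπ).subtype.mapMatrix C = 1 := by
    rw [← map_mul, Matrix.nonsing_inv_mul C hC, map_one]
  -- `P` is found over the complete ring `Γ`. In this form its columns solve a Frobenius equation
  -- with overconvergent matrix, so they are themselves overconvergent.
  have hP' : P.map (G.frob ^ m) = (G.con hπ).subtype.mapMatrix C⁻¹ * P := by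
    nth_rewrite 2 [← hCP]
    rw [← Matrix.mul_assoc, hinv, Matrix.one_mul]
  have hmem : ∀ i j, P i j ∈ G.con hπ := fun i j =>
    G.mem_con_of_frob_eq hπ hm (fun i j => (G.con hπ).subtype.mapMatrix C⁻¹ i j)
      (fun i j => (C⁻¹ i j).2) (fun i => P i j)
      (fun i => congrFun (congrFun hP' i) j) i
  let Q : Matrix (Fin n) (Fin n) (G.con hπ) := Matrix.of fun i j => ⟨P i j, hmem i j⟩
  have hQ : (G.con hπ).subtype.mapMatrix Q = P := rfl
  have hinj : Function.Injective (G.con hπ).subtype := Subtype.val_injective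
  refine ⟨Q, fun h0 => hP.ne_zero ?_, ?_⟩
  · rw [← hQ, ← RingHom.map_det, h0, map_zero]
  · refine Matrix.map_injective hinj ?_
    change (G.con hπ).subtype.mapMatrix (C * Q.map (G.conFrob hπ ^ m)) =
      (G.con hπ).subtype.mapMatrix Q
    rw [map_mul, hQ]
    refine Eq.trans ?_ hCP
    congr 1
    ext i j
    exact G.coe_conFrob_pow hπ m (Q i j)

/-- `Γ_con` has a uniformizer fixed by Frobenius if `K` is algebraically closed. -/
theorem exists_fixed_unif_con [IsAlgClosed K] (G : GammaRing p σ₀ K Γ) {π : O}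
    (hπ : Irreducible π) {m : ℕ} (hm : 0 < m) :
    ∃ ϖ : G.con hπ, Irreducible ϖ ∧ (G.conFrob hπ ^ m) ϖ = ϖ := by
  have := G.charP_K
  have : ExpChar K p := ExpChar.prime hp.out
  obtain ⟨ϖ, hϖ, hϖG⟩ := ((G.isFrobRing hπ).pow m).exists_fixed_unif G.isMixed
    (Nat.one_lt_pow hm.ne' hp.out.one_lt) (φ := iterateFrobenius K p m)
    (fun x => iterateFrobenius_def _ _ _)
  have hmem : ϖ ∈ G.con hπ := G.mem_con_of_frob_eq hπ hm (fun _ _ : Fin 1 => 1)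
    (fun _ _ => one_mem _) (fun _ => ϖ) (fun _ => by simpa using hϖ) 0
  refine ⟨⟨ϖ, hmem⟩, ?_, Subtype.ext ?_⟩
  · refine ⟨?_, fun a b hab => ?_⟩
    · rw [G.con_isUnit_iff hπ]
      exact hϖG.irreducible.not_isUnit
    · rw [G.con_isUnit_iff hπ, G.con_isUnit_iff hπ]
      exact hϖG.irreducible.isUnit_or_isUnit (congrArg Subtype.val hab)
  · rw [coe_conFrob_pow]; exact hϖ

/-- Let `t` be the slope measured by a fixed uniformizer `ϖ`, with denominator `n + 1`. Then `F^[n +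
1]` has the slope of an integral power of `ϖ`. Lang's theorem over `Γ_con` gives a maximal
independent family of eigenvectors for it, from which `exists_cyclic_family` extracts the cyclic
summands. -/
theorem isogenousToSumOfStandard_of_isPure [IsAlgClosed K] (G : GammaRing p σ₀ K Γ) {π : O}
    (hπ : Irreducible π) {f : ℕ} (hf : 0 < f) {M : Type w} [AddCommGroup M] [Module (G.con hπ) M]
    [Nontrivial M] [Module.Free (G.con hπ) M] [Module.Finite (G.con hπ) M]
    {F : M →ₛₗ[G.conFrob hπ ^ f] M} {s : ℚ} (h : IsPure p F s) :
    IsogenousToSumOfStandard p F := by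
  have hR := G.con_isMixed hπ
  have hs := h.nonneg hR
  have hσ := G.conFrob_pow_bijective hπ f
  obtain ⟨ϖ, hϖ, hϖσ⟩ := G.exists_fixed_unif_con hπ hf
  obtain ⟨e, v, hpe⟩ := IsDiscreteValuationRing.eq_unit_mul_pow_irreducible hR.ne_zero hϖ
  set t : ℚ := s * e
  have ht : 0 ≤ t := mul_nonneg hs (Nat.cast_nonneg e)
  obtain ⟨n, hn⟩ : ∃ n, t.den = n + 1 := Nat.exists_eq_succ_of_ne_zero t.den_ne_zero
  have hrho : rho ((n + 1 : ℕ) * s) = av p ϖ ^ t.num.toNat := by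
    refine rho_eq_av_pow hR v.isUnit (hpe.trans (mul_comm _ _)) ?_
    have h1 : ((t.num.toNat : ℤ) : ℚ) = t.num := by rw [Int.toNat_of_nonneg (Rat.num_nonneg.2 ht)]
    have h2 := Rat.mul_den_eq_num t
    rw [← hn, ← Int.cast_natCast t.num.toNat, h1, ← h2, mul_comm _ s, mul_right_comm]
  have hcop : (n + 1).Coprime t.num.toNat := by
    have h1 := t.reduced
    rw [← hn, Nat.coprime_comm]
    have h2 : t.num.natAbs = t.num.toNat := by have := Rat.num_nonneg.2 ht; lia
    rwa [h2] at h1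
  obtain ⟨e₀, C₀, he₀, hC₀, hFe⟩ := exists_unit_lattice hR (bijective_ringHom_pow hσ (n + 1))
    hϖ.ne_zero (by rw [RingHom.coe_pow]; exact Function.iterate_fixed hϖσ _) (h.iterate (n + 1)) hrho
  obtain ⟨P, hP, hCP⟩ := G.exists_det_ne_zero_fixed hπ (Nat.mul_pos hf n.succ_pos) C₀ hC₀
  rw [pow_mul] at hCP
  obtain ⟨e₁, he₁, hFe₁⟩ := exists_eigenvectors_of_fixed he₀ hFe hP hCP
  obtain ⟨l, u, hu, hli, hsat⟩ := h.exists_cyclic_family hR hσ hϖ hϖσ n.succ_pos hcop hrho he₁ hFe₁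
  exact isogenousToSumOfStandard_of_cyclic_family hR hσ (h.injective hR)
    (by rw [map_pow, hϖσ]) hu hli hsat

end GammaRing

theorem HasClosedSubrings.pow {R : Type*} [CommRing R] {σ : R →+* R} {π : R}
    (h : HasClosedSubrings σ π) (f : ℕ) : HasClosedSubrings (σ ^ f) π := by
  intro T
  obtain ⟨A, hT, hA, hlim⟩ := h T
  refine ⟨A, hT, fun x hx => ?_, hlim⟩
  induction f with
  | zero => simpa using hx
  | succ f ih =>
    rw [pow_succ', RingHom.mul_def, RingHom.comp_apply] at hx
    exact ih (hA _ hx)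

/-! ### Generic filtrations are pure filtrations -/

namespace GammaRing

variable {p : ℕ} {O : Type u} [CommRing O] [IsDomain O] [IsDiscreteValuationRing O]
  {σ₀ : O →+* O} {K : Type u} [Field K] [Algebra (LaurentSeries (ResidueField O)) K]
  {Γ : Type u} [CommRing Γ] [IsDomain Γ] [IsDiscreteValuationRing Γ] [Algebra O Γ]
  [hp : Fact p.Prime] [CharP (ResidueField O) p] [CharZero O] [PerfectField K]

section

variable (G : GammaRing p σ₀ K Γ) {π : O} (hπ : Irreducible π) {f : ℕ} (hf : 0 < f)
  {M : Type w} [AddCommGroup M] [Module (G.con hπ) M] [Module.Free (G.con hπ) M]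
  [Module.Finite (G.con hπ) M] {F : M →ₛₗ[G.conFrob hπ ^ f] M} {D : SigmaFiltration F}

theorem nontrivial_gr (hlt : ∀ i : Fin D.length, D.step i.castSucc < D.step i.succ)
    (i : Fin D.length) : Nontrivial (D.Gr i) := by
  rw [Submodule.Quotient.nontrivial_iff]
  intro h
  refine (hlt i).not_ge fun x hx => ?_
  have : (⟨x, hx⟩ : D.step i.succ) ∈ (D.step i.castSucc).submoduleOf (D.step i.succ) :=
    h ▸ Submodule.mem_top
  exact this

theorem free_gr (hsat : ∀ (i : Fin D.length) (a : G.con hπ) (x : M), a ≠ 0 → x ∈ D.step i.succ →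
    a • x ∈ D.step i.castSucc → x ∈ D.step i.castSucc) (i : Fin D.length) :
    Module.Free (G.con hπ) (D.Gr i) :=
  free_quotient_of_isSaturated fun a x ha hx => hsat i a x ha x.2 hx

/-- The graded pieces are free by saturation and nonzero by strictness, so generic slopes and purity
can be exchanged piece by piece; the steps are `σ`-modules because `F` is injective on them. -/
theorem isDescendingGeneric_iff (hF : Function.Injective F) (hf : 0 < f) :
    D.IsDescendingGeneric p (p ^ f) ↔ D.IsPureFiltration p := by
  have hR := G.con_isMixed hπ
  constructor
  · intro h
    refine ⟨h.bot, h.top, h.lt, h.saturated, fun i => ?_, h.strictAnti⟩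
    have := G.free_gr hπ h.saturated i
    exact isPure_of_hasGenericSlopes hR (h.slopes i)
  · intro h
    refine ⟨fun i => ?_, h.bot, h.top, h.lt, h.saturated, fun i => ?_, h.strictAnti⟩
    · refine (isSigmaModule_iff hR (G.conFrob_pow_bijective hπ f)).2
        ⟨inferInstance, inferInstance, fun x y hxy => Subtype.ext (hF ?_)⟩
      exact congrArg Subtype.val hxy
    · have := G.free_gr hπ h.saturated i
      have := G.nontrivial_gr hπ h.lt i
      exact G.hasGenericSlopes_of_isPure hπ hf (h.isPure i)

end

end GammaRing

end SlopeFiltration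

end

theorem mainTheorem10 (p : ℕ) [Fact p.Prime]
    (O : Type u) [CommRing O] [IsDomain O] [IsDiscreteValuationRing O] [CharZero O]
    [IsAdicComplete (IsLocalRing.maximalIdeal O) O] [CharP (IsLocalRing.ResidueField O) p]
    (π : O) (hπ : Irreducible π)
    (σ₀ : O →+* O) (hσ₀ : SlopeFiltration.IsFrobLift p σ₀)
    (f : ℕ) (hf : 0 < f)
    (K : Type u) [Field K] [Algebra (LaurentSeries (IsLocalRing.ResidueField O)) K]
    [Algebra.IsAlgebraic (LaurentSeries (IsLocalRing.ResidueField O)) K] [PerfectField K]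
    (Γ : Type u) [CommRing Γ] [IsDomain Γ] [IsDiscreteValuationRing Γ] [Algebra O Γ]
    (G : SlopeFiltration.GammaRing p σ₀ K Γ)
    (M : Type w) [AddCommGroup M] [Module (G.con hπ) M]
    (F : M →ₛₗ[G.conFrob hπ ^ f] M) (hF : SlopeFiltration.IsSigmaModule p F) :
    (∃! D : SlopeFiltration.SigmaFiltration F, D.IsDescendingGeneric p (p ^ f)) ∧
    (IsAlgClosed K → ∀ D : SlopeFiltration.SigmaFiltration F, D.IsDescendingGeneric p (p ^ f) →
      ∀ i : Fin D.length, SlopeFiltration.IsogenousToSumOfStandard p (D.grFrob i)) := by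
  have hR := G.con_isMixed hπ
  have hσ := G.conFrob_pow_bijective hπ f
  obtain ⟨_, _, hinj⟩ := (SlopeFiltration.isSigmaModule_iff hR hσ).1 hF
  have hiff : ∀ D : SlopeFiltration.SigmaFiltration F,
      D.IsDescendingGeneric p (p ^ f) ↔ D.IsPureFiltration p := fun D =>
    G.isDescendingGeneric_iff hπ hinj hf
  refine ⟨?_, fun _ D hD i => ?_⟩
  · obtain ⟨D, hD⟩ := SlopeFiltration.exists_isPureFiltration hR (G.conUnif_irreducible hπ) hσ
      ((G.con_hasClosedSubrings hπ).pow f) _ M F hinj rfl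
    exact ⟨D, (hiff D).2 hD, fun D' hD' =>
      SlopeFiltration.SigmaFiltration.IsPureFiltration.unique hR ((hiff D').1 hD') hD⟩
  · have := G.free_gr hπ hD.saturated i
    have := G.nontrivial_gr hπ hD.lt i
    exact G.isogenousToSumOfStandard_of_isPure hπ hf (((hiff D).1 hD).isPure i)
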